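/- **Setting.** $\mathcal{AX}_{\mathtt{diff}}$ is the three-sorted theory (sorts ARRAY, INDEX, ELEM) with symbols $rd$, $wr$, $\mathtt{diff}$ and the axioms $rd(wr(y,i,e),i)=e$; $i\neq j\to rd(wr(y,i,e),j)=rd(y,j)$; $x\neq y\to rd(x,\mathtt{diff}(x,y))\neq rd(y,\mathtt{diff}(x,y))$. A constraint is a finite set of ground literals with free constants ($a,b,c$ of sort ARRAY; $i,j,k$ of sort INDEX; $d,e$ of sort ELEM). $wr(a,I,E)$ is a nested write with constant indexes and elements. Flat literals are $a=wr(b,I,E)$ (including $a=b$), $rd(a,i)=e$, $\mathtt{diff}(a,b)=i$, $\alpha=\beta$, $\alpha\neq\beta$. A pair $(A,B)$ comes with signatures $\Sigma^A,\Sigma^B$ of free constants (at the start: those occurring in $A$, resp. $B$). Common means over $\Sigma^A\cap\Sigma^B$; $A$-strict means over $\Sigma^A$ but not common; dually for $B$. The $A$-relevant constants are those occurring in $A$ and the common ones occurring in $B$. There is a total precedence on the constants, extended whenever fresh constants are introduced, in which common constants are smaller than strict ones of the same sort. Flat literals are oriented as rules $a\to wr(b,I,E)$ (if $a>b$), $rd(a,i)\to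 e$, $e\to d$ (if $e>d$). Rewriting with respect to a constraint uses its rules and the rules $rd(wr(x,i,e),j)\to rd(x,j)$ ($i\not\equiv j$), $rd(wr(x,i,e),i)\to e$, $wr(wr(x,i,e),j,d)\to wr(wr(x,j,d),i,e)$ ($i>j$), $wr(wr(x,i,e),i,d)\to wr(x,i,d)$; $\downarrow$ is joinability. **The solver.** All instructions are stated for $A$; they apply symmetrically to $B$. Fresh constants in pre-processing may be $A$-strict, or common (with their definitions put into both components) if the term they define is common. *Pre-processing*, each step done exhaustively, in this order: (1) flatten by naming subterms of non-flat literals with fresh constants; (2) replace $a\neq b$ by $\mathtt{diff}(a,b)=i$, $rd(b,i)=e$, $rd(a,i)=d$, $d\neq e$ with $i,e,d$ fresh; (3) for every pair of $A$-relevant index constants guess $i\neq j$ (added) or $i=j$ (the greater one is replaced by the smaller one; in both components if it is common); given literals $i=j$ are eliminated in the same way and $i\neq i$ yields $\bot$; (4) for $A$-relevant $a,i$ such that no literal $rd(a,i)=e$ is present, add one with fresh $e$. *Completion*: (ι) (first priority) restore the invariants: repeat (3), and repeat (4) for those $rd(a,i)$ that do not reduce to a constant. (β) (second priority, together with γ)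 copy a common literal that is missing in the other component. (γ) Term Sharing: in the presence of $rd(c,i)\to d$, $\mathtt{diff}(a,b)=k$ or $a\to wr(c,I,E)$, where $d$, $k$, respectively the last $a$, is strict and all other constants are common, rename the strict constant to a fresh common one and put the renamed literal into both components (in the last case the new constant is greater than $c$). Splitting: given $c\to wr(c',I,E)$ with $c$ common and a non-common right-hand side, sort and deduplicate the writes and split them into the common ones $(I_1,E_1)$ and the others $(I_2,E_2)$. One successor replaces the literal by $c=wr(c',I_1,E_1)$ and $rd(c',I_2)=E_2$. For the others, introduce fresh common constants $c'',i,d,d''$ with $c''=wr(c',I_1,E_1)$, $c>c''>c'$ (or take $c''\equiv c'$ if $I_1$ is empty), $\mathtt{diff}(c,c'')=i$, $rd(c,i)=d$, $rd(c'',i)=d''$ in both components, add $d\neq d''$ to $A$ and replace the literal by $c=wr(c'',I_2,E_2)$; there is one successor for each pair $(i_k,e_k)$ of $(I_2,E_2)$, in which $i_k,e_k$ are replaced by $i,d$ (in both components if they are common). (α) (last priority) one of the following instructions; if it deletes common literals it is performed simultaneously in both components. – Orientation: $a=wr(b,I,E)$ with $a<b$ and non-empty $I$ becomes (after sorting and deduplicating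 the writes) $b=wr(a,I,D)$, $rd(a,I)=E$, where $rd(b,I)$ reduces to $D$; $a=wr(a,I,E)$ becomes $rd(a,I)=E$. – Rules $a\to t_1$, $a\to t_2$, $t_1\not\equiv t_2$, with normal forms $wr(b_1,I_1,E_1)$, $wr(b_2,I_2,E_2)$: if $b_1>b_2$, replace both by $a=wr(b_2,I_2,E_2)$, $b_1=wr(b_2,J,D)$ and the element equalities between the normal forms of $rd(wr(b_2,I_2,E_2),I_1)$ and $E_1$, where $rd(b_1,I_1)$ reduces to $F$ and $wr(b_2,J,D)$ is $wr(b_2,I_2\cdot I_1,E_2\cdot F)$ sorted and deduplicated. If $b_1\equiv b_2\equiv b$, replace both by $a=wr(b,I,E)$, with $I$ the indexes common to $I_1$ and $I_2$ and $E$ their elements in $E_1$, the equalities between the elements of $E_1$ and $E_2$ at the indexes in $I$, and $rd(b,j)=e$ for the remaining writes $(j,e)$. – Other critical pairs (between $rd(a,i)\to e'$ and $a\to t$, between two rules for $rd(a,i)$, between two rules for $e$): remove one parent rule (in the first case $rd(a,i)\to e'$) and add the equality of normal forms of the two sides, unless it is trivial. – Replace the right-hand side of a rule by a normal form; remove $t=t$;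 after sorting and deduplicating the writes of $a\to wr(b,I,E)$, drop a write $(i_k,e_k)$ with $rd(b,i_k)\downarrow e_k$. – If $\mathtt{diff}(a,b)=i$ is present, $a\not\equiv b$ and $rd(a,i)\downarrow rd(b,i)$: add $a=b$ and replace the greater of $a,b$ by the smaller one in this $\mathtt{diff}$-literal. – Failure: add $\bot$ if $e\neq d$ is present and $e\downarrow d$, or if $\mathtt{diff}(a,b)=i$, $\mathtt{diff}(a',b')=i'$ are present with $a\downarrow a'$, $b\downarrow b'$ and $i\not\equiv i'$. An *interpolating tree* for $(A,B)$ is a (possibly infinite) tree with root label $(A,B)$, with the signatures of the symbols occurring in $A$ and $B$, in which the successors of each node are the results of some applicable instruction, and whose leaves are exactly the nodes that contain $\bot$ or to which no instruction applies. **Metarules** $A\mid B\ \Leftarrow\ \text{premises}$, with their interpolants $\phi'$ ($\phi,\phi_k$ being those of the premises; $\vdash$ modulo $\mathcal{AX}_{\mathtt{diff}}$; signatures change only where said): Close1: no premise, $\bot\in A$, $\phi'=\bot$. Close2: $\bot\in B$, $\phi'=\top$. Propagate1: $A\mid B\cup\{\psi\}$, if $A\vdash\psi$, $\psi$ common; $\phi'=\phi\wedge\psi$.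 Propagate2: $A\cup\{\psi\}\mid B$, if $B\vdash\psi$, $\psi$ common; $\phi'=\psi\to\phi$. Define0: $A\cup\{a=t\}\mid B\cup\{a=t\}$, $t$ common, $a$ fresh and added to both signatures; $\phi'=\phi(t/a)$. Define1 (Define2): $a=t$ added to $A$ (to $B$), $t$ over $\Sigma^A$ ($\Sigma^B$), $a$ fresh and added to that signature; $\phi'=\phi$. Disjunction1: premises $A\cup\{\psi_k\}\mid B$ for $1\le k\le n$, $n\ge1$, if $A\vdash\bigvee_k\psi_k$, over $\Sigma^A$; $\phi'=\bigvee_k\phi_k$. Disjunction2: dually, $\phi'=\bigwedge_k\phi_k$. Redplus1,2 (Redminus1,2): add (delete) a sentence entailed by (the rest of) $A$, resp. $B$, over its signature; $\phi'=\phi$. ConstElim1,2: delete $a=t$ from $A$ (from $B$), $a$ an $A$-strict ($B$-strict) constant not occurring in $t$ or in the rest of that component; ConstElim0: delete $c=t$ from both components, $c$ and $t$ common, $c$ not occurring elsewhere; $\phi'=\phi$. An *interpolating metarules refutation* of $(A,B)$ is a tree of metarules with root $(A,B)$ all of whose leaves are instances of Close1 or Close2. An interpolating tree *is* an interpolating metarules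 refutation if it is finite, all its leaves contain $\bot$, and each inner node is derived from its successors by metarules; replacing every instruction by such a derivation gives a refutation in the literal sense, called an expansion of the tree. **Theorem 6.1.** Let $A,B$ be finite sets of ground literals, and fix any total precedence on their free constants in which common constants are smaller than strict ones of the same sort. Then there is an interpolating tree for $(A,B)$. Moreover, for every interpolating tree $T$ for $(A,B)$: 1. $T$ is finite; 2. $T$ is an interpolating metarules refutation if and only if $A\wedge B$ is $\mathcal{AX}_{\mathtt{diff}}$-unsatisfiable; 3. if $T$ is an interpolating metarules refutation, it has an expansion; and for every expansion of $T$ the formula $\theta$ computed recursively by the instructions $\phi'$ is a quantifier-free interpolant for $(A,B)$: $\theta$ is ground, its free constants occur both in $A$ and in $B$, $A\vdash\theta$, and $\theta\wedge B$ is $\mathcal{AX}_{\mathtt{diff}}$-unsatisfiable. -/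

import Mathlib

namespace AXdiff

/-! # Syntax: the three-sorted signature with `rd`, `wr`, `diff` and free constants -/

/-- The sorts ARRAY, INDEX, ELEM. -/
inductive Srt where
  | array
  | index
  | elem
deriving DecidableEq

/-- Ground terms; every sort has countably many free constants `const s n`. -/
inductive Term : Srt → Type where
  | const (s : Srt) (n : ℕ) : Term s
  | rd (x : Term Srt.array) (i : Term Srt.index) : Term Srt.elem
  | wr (x : Term Srt.array) (i : Term Srt.index) (e : Term Srt.elem) : Term Srt.array
  | diff (x y : Term Srt.array) : Term Srt.index
deriving DecidableEq

/-- Ground (hence quantifier-free) sentences. -/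
inductive Form : Type where
  | eq {s : Srt} (t u : Term s) : Form
  | bot : Form
  | top : Form
  | neg (φ : Form) : Form
  | and (φ ψ : Form) : Form
  | or (φ ψ : Form) : Form
  | imp (φ ψ : Form) : Form
deriving DecidableEq

/-- A free constant: its sort and its name. -/
abbrev Const : Type := Srt × ℕ

abbrev arr (a : ℕ) : Term Srt.array := Term.const Srt.array a
abbrev idx (i : ℕ) : Term Srt.index := Term.const Srt.index i
abbrev el (e : ℕ) : Term Srt.elem := Term.const Srt.elem e

/-- The free constants occurring in a term. -/
def Term.consts : {s : Srt} → Term s → Finset Const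
  | _, .const s n => {(s, n)}
  | _, .rd x i => x.consts ∪ i.consts
  | _, .wr x i e => x.consts ∪ i.consts ∪ e.consts
  | _, .diff x y => x.consts ∪ y.consts

/-- The free constants occurring in a formula. -/
def Form.consts : Form → Finset Const
  | .eq t u => t.consts ∪ u.consts
  | .bot => ∅
  | .top => ∅
  | .neg φ => φ.consts
  | .and φ ψ => φ.consts ∪ ψ.consts
  | .or φ ψ => φ.consts ∪ ψ.consts
  | .imp φ ψ => φ.consts ∪ ψ.consts

/-- The free constants occurring in a finite set of formulas. -/
def constsOf (A : Finset Form) : Finset Const := A.biUnion Form.consts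

/-- `x.subst s₀ n₀ u` is `x` with the constant `n₀` of sort `s₀` replaced by the term `u`. -/
def Term.subst (s₀ : Srt) (n₀ : ℕ) (u : Term s₀) : {s : Srt} → Term s → Term s
  | _, .const s n => if h : s₀ = s ∧ n₀ = n then h.1 ▸ u else .const s n
  | _, .rd x i => .rd (Term.subst s₀ n₀ u x) (Term.subst s₀ n₀ u i)
  | _, .wr x i e => .wr (Term.subst s₀ n₀ u x) (Term.subst s₀ n₀ u i) (Term.subst s₀ n₀ u e)
  | _, .diff x y => .diff (Term.subst s₀ n₀ u x) (Term.subst s₀ n₀ u y)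

def Form.subst (s₀ : Srt) (n₀ : ℕ) (u : Term s₀) : Form → Form
  | .eq t v => .eq (Term.subst s₀ n₀ u t) (Term.subst s₀ n₀ u v)
  | .bot => .bot
  | .top => .top
  | .neg φ => .neg (Form.subst s₀ n₀ u φ)
  | .and φ ψ => .and (Form.subst s₀ n₀ u φ) (Form.subst s₀ n₀ u ψ)
  | .or φ ψ => .or (Form.subst s₀ n₀ u φ) (Form.subst s₀ n₀ u ψ)
  | .imp φ ψ => .imp (Form.subst s₀ n₀ u φ) (Form.subst s₀ n₀ u ψ)

/-- The constant `m` replaces the constant `n` (of the same sort `s`). -/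
def Form.rename (s : Srt) (n m : ℕ) (φ : Form) : Form := φ.subst s n (.const s m)

def Form.bigOr : List Form → Form
  | [] => .bot
  | φ :: l => .or φ (bigOr l)

def Form.bigAnd : List Form → Form
  | [] => .top
  | φ :: l => .and φ (bigAnd l)

/-- Literals: equalities and negated equalities. -/
inductive IsLit : Form → Prop
  | pos {s : Srt} (t u : Term s) : IsLit (.eq t u)
  | neg {s : Srt} (t u : Term s) : IsLit (.neg (.eq t u))

/-- A finite constraint is a finite set of ground literals. -/
def IsConstraint (A : Finset Form) : Prop := ∀ φ ∈ A, IsLit φ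

/-! # Semantics -/

/-- A model of the theory of arrays with `diff`, together with an interpretation of the free
constants. -/
structure Model where
  carrier : Srt → Type
  rd : carrier .array → carrier .index → carrier .elem
  wr : carrier .array → carrier .index → carrier .elem → carrier .array
  diff : carrier .array → carrier .array → carrier .index
  const : (s : Srt) → ℕ → carrier s
  rd_wr_same : ∀ y i e, rd (wr y i e) i = e
  rd_wr_other : ∀ y i j e, i ≠ j → rd (wr y i e) j = rd y j
  rd_diff : ∀ x y, x ≠ y → rd x (diff x y) ≠ rd y (diff x y)

def Model.eval (M : Model) : {s : Srt} → Term s → M.carrier s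
  | _, .const s n => M.const s n
  | _, .rd x i => M.rd (M.eval x) (M.eval i)
  | _, .wr x i e => M.wr (M.eval x) (M.eval i) (M.eval e)
  | _, .diff x y => M.diff (M.eval x) (M.eval y)

def Model.Holds (M : Model) : Form → Prop
  | .eq t u => M.eval t = M.eval u
  | .bot => False
  | .top => True
  | .neg φ => ¬ M.Holds φ
  | .and φ ψ => M.Holds φ ∧ M.Holds ψ
  | .or φ ψ => M.Holds φ ∨ M.Holds ψ
  | .imp φ ψ => M.Holds φ → M.Holds ψ

/-- Satisfiability modulo the theory of (the conjunction of) a finite set of sentences. -/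
def Sat (A : Finset Form) : Prop := ∃ M : Model, ∀ φ ∈ A, M.Holds φ

/-- Entailment modulo the theory. -/
def Entails (A : Finset Form) (ψ : Form) : Prop :=
  ∀ M : Model, (∀ φ ∈ A, M.Holds φ) → M.Holds ψ

/-- `θ` is a (quantifier-free) interpolant for the pair `A`, `B`. -/
def IsInterpolant (A B : Finset Form) (θ : Form) : Prop :=
  θ.consts ⊆ constsOf A ∩ constsOf B ∧ Entails A θ ∧ ¬ Sat (insert θ B)

/-! # Interpolating metarules -/

/-- The label of a node in a metarules derivation: a pair of finite sets of sentences, with the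
two signatures they live in. -/
structure MNode where
  sigA : Finset Const
  sigB : Finset Const
  A : Finset Form
  B : Finset Form

/-- Trees built from the interpolating metarules (conclusion = root). Open leaves `hyp` are allowed
at the labels `n` with `H n`; the other leaves have `⊥` in one of the components. -/
inductive MDeriv (H : MNode → Type) : MNode → Type
  | hyp {n : MNode} (h : H n) : MDeriv H n
  | close1 {n : MNode} (h : Form.bot ∈ n.A) : MDeriv H n
  | close2 {n : MNode} (h : Form.bot ∈ n.B) : MDeriv H n
  | propagate1 {SA SB A B} (ψ : Form) (hent : Entails A ψ) (hψ : ψ.consts ⊆ SA ∩ SB)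
      (d : MDeriv H ⟨SA, SB, A, insert ψ B⟩) : MDeriv H ⟨SA, SB, A, B⟩
  | propagate2 {SA SB A B} (ψ : Form) (hent : Entails B ψ) (hψ : ψ.consts ⊆ SA ∩ SB)
      (d : MDeriv H ⟨SA, SB, insert ψ A, B⟩) : MDeriv H ⟨SA, SB, A, B⟩
  | define0 {SA SB A B} (s : Srt) (a : ℕ) (t : Term s) (ht : t.consts ⊆ SA ∩ SB)
      (ha : (s, a) ∉ SA ∪ SB)
      (d : MDeriv H ⟨insert (s, a) SA, insert (s, a) SB,
        insert (.eq (.const s a) t) A, insert (.eq (.const s a) t) B⟩) : MDeriv H ⟨SA, SB, A, B⟩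
  | define1 {SA SB A B} (s : Srt) (a : ℕ) (t : Term s) (ht : t.consts ⊆ SA)
      (ha : (s, a) ∉ SA ∪ SB)
      (d : MDeriv H ⟨insert (s, a) SA, SB, insert (.eq (.const s a) t) A, B⟩) :
      MDeriv H ⟨SA, SB, A, B⟩
  | define2 {SA SB A B} (s : Srt) (a : ℕ) (t : Term s) (ht : t.consts ⊆ SB)
      (ha : (s, a) ∉ SA ∪ SB)
      (d : MDeriv H ⟨SA, insert (s, a) SB, A, insert (.eq (.const s a) t) B⟩) :
      MDeriv H ⟨SA, SB, A, B⟩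
  | disjunction1 {SA SB A B} (n : ℕ) (ψ : Fin (n + 1) → Form)
      (hloc : (Form.bigOr (List.ofFn ψ)).consts ⊆ SA)
      (hent : Entails A (Form.bigOr (List.ofFn ψ)))
      (d : ∀ k, MDeriv H ⟨SA, SB, insert (ψ k) A, B⟩) : MDeriv H ⟨SA, SB, A, B⟩
  | disjunction2 {SA SB A B} (n : ℕ) (ψ : Fin (n + 1) → Form)
      (hloc : (Form.bigOr (List.ofFn ψ)).consts ⊆ SB)
      (hent : Entails B (Form.bigOr (List.ofFn ψ)))
      (d : ∀ k, MDeriv H ⟨SA, SB, A, insert (ψ k) B⟩) : MDeriv H ⟨SA, SB, A, B⟩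
  | redplus1 {SA SB A B} (ψ : Form) (hent : Entails A ψ) (hψ : ψ.consts ⊆ SA)
      (d : MDeriv H ⟨SA, SB, insert ψ A, B⟩) : MDeriv H ⟨SA, SB, A, B⟩
  | redplus2 {SA SB A B} (ψ : Form) (hent : Entails B ψ) (hψ : ψ.consts ⊆ SB)
      (d : MDeriv H ⟨SA, SB, A, insert ψ B⟩) : MDeriv H ⟨SA, SB, A, B⟩
  | redminus1 {SA SB A B} (ψ : Form) (hent : Entails A ψ) (hψ : ψ.consts ⊆ SA)
      (d : MDeriv H ⟨SA, SB, A, B⟩) : MDeriv H ⟨SA, SB, insert ψ A, B⟩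
  | redminus2 {SA SB A B} (ψ : Form) (hent : Entails B ψ) (hψ : ψ.consts ⊆ SB)
      (d : MDeriv H ⟨SA, SB, A, B⟩) : MDeriv H ⟨SA, SB, A, insert ψ B⟩
  | constElim1 {SA SB A B} (s : Srt) (a : ℕ) (t : Term s) (hstrict : (s, a) ∈ SA \ SB)
      (hA : (s, a) ∉ constsOf A) (ht : (s, a) ∉ t.consts)
      (d : MDeriv H ⟨SA, SB, A, B⟩) : MDeriv H ⟨SA, SB, insert (.eq (.const s a) t) A, B⟩
  | constElim2 {SA SB A B} (s : Srt) (b : ℕ) (t : Term s) (hstrict : (s, b) ∈ SB \ SA)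
      (hB : (s, b) ∉ constsOf B) (ht : (s, b) ∉ t.consts)
      (d : MDeriv H ⟨SA, SB, A, B⟩) : MDeriv H ⟨SA, SB, A, insert (.eq (.const s b) t) B⟩
  | constElim0 {SA SB A B} (s : Srt) (c : ℕ) (t : Term s) (hc : (s, c) ∈ SA ∩ SB)
      (hcommon : t.consts ⊆ SA ∩ SB) (hA : (s, c) ∉ constsOf A) (hB : (s, c) ∉ constsOf B)
      (ht : (s, c) ∉ t.consts) (d : MDeriv H ⟨SA, SB, A, B⟩) :
      MDeriv H ⟨SA, SB, insert (.eq (.const s c) t) A, insert (.eq (.const s c) t) B⟩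

/-- An interpolating metarules refutation of a label: a tree without open leaves. -/
abbrev Refutation (n : MNode) : Type := MDeriv (fun _ => Empty) n

/-- The interpolating instructions, applied recursively from the leaves to the root; `f` supplies
the formulas at the open leaves. -/
def MDeriv.interp {H : MNode → Type} (f : ∀ m, H m → Form) : {n : MNode} → MDeriv H n → Form
  | n, .hyp h => f n h
  | _, .close1 _ => .bot
  | _, .close2 _ => .top
  | _, .propagate1 ψ _ _ d => .and (d.interp f) ψ
  | _, .propagate2 ψ _ _ d => .imp ψ (d.interp f)
  | _, .define0 s a t _ _ d => (d.interp f).subst s a t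
  | _, .define1 _ _ _ _ _ d => d.interp f
  | _, .define2 _ _ _ _ _ d => d.interp f
  | _, .disjunction1 _ _ _ _ d => Form.bigOr (List.ofFn fun k => (d k).interp f)
  | _, .disjunction2 _ _ _ _ d => Form.bigAnd (List.ofFn fun k => (d k).interp f)
  | _, .redplus1 _ _ _ d => d.interp f
  | _, .redplus2 _ _ _ d => d.interp f
  | _, .redminus1 _ _ _ d => d.interp f
  | _, .redminus2 _ _ _ d => d.interp f
  | _, .constElim1 _ _ _ _ _ _ d => d.interp f
  | _, .constElim2 _ _ _ _ _ _ d => d.interp f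
  | _, .constElim0 _ _ _ _ _ _ _ _ d => d.interp f

/-- The interpolant computed from a refutation. -/
def Refutation.interpolant {n : MNode} (R : Refutation n) : Form :=
  MDeriv.interp (fun _ h => h.elim) R

/-- Grafting derivations on the open leaves. -/
def MDeriv.graft {H K : MNode → Type} (g : ∀ m, H m → MDeriv K m) :
    {n : MNode} → MDeriv H n → MDeriv K n
  | n, .hyp h => g n h
  | _, .close1 h => .close1 h
  | _, .close2 h => .close2 h
  | _, .propagate1 ψ h₁ h₂ d => .propagate1 ψ h₁ h₂ (d.graft g)
  | _, .propagate2 ψ h₁ h₂ d => .propagate2 ψ h₁ h₂ (d.graft g)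
  | _, .define0 s a t h₁ h₂ d => .define0 s a t h₁ h₂ (d.graft g)
  | _, .define1 s a t h₁ h₂ d => .define1 s a t h₁ h₂ (d.graft g)
  | _, .define2 s a t h₁ h₂ d => .define2 s a t h₁ h₂ (d.graft g)
  | _, .disjunction1 n ψ h₁ h₂ d => .disjunction1 n ψ h₁ h₂ fun k => (d k).graft g
  | _, .disjunction2 n ψ h₁ h₂ d => .disjunction2 n ψ h₁ h₂ fun k => (d k).graft g
  | _, .redplus1 ψ h₁ h₂ d => .redplus1 ψ h₁ h₂ (d.graft g)
  | _, .redplus2 ψ h₁ h₂ d => .redplus2 ψ h₁ h₂ (d.graft g)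
  | _, .redminus1 ψ h₁ h₂ d => .redminus1 ψ h₁ h₂ (d.graft g)
  | _, .redminus2 ψ h₁ h₂ d => .redminus2 ψ h₁ h₂ (d.graft g)
  | _, .constElim1 s a t h₁ h₂ h₃ d => .constElim1 s a t h₁ h₂ h₃ (d.graft g)
  | _, .constElim2 s b t h₁ h₂ h₃ d => .constElim2 s b t h₁ h₂ h₃ (d.graft g)
  | _, .constElim0 s c t h₁ h₂ h₃ h₄ h₅ d => .constElim0 s c t h₁ h₂ h₃ h₄ h₅ (d.graft g)

/-! # Flat literals, precedence and rewriting -/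

/-- The nested write `wr(wr(⋯wr(x, i₁, e₁)⋯), iₙ, eₙ)` for `W = [(i₁, e₁), …, (iₙ, eₙ)]`. -/
def wrs (x : Term .array) (W : List (ℕ × ℕ)) : Term .array :=
  W.foldl (fun t p => .wr t (idx p.1) (el p.2)) x

/-- The literals `rd(a, i) = e` for `(i, e)` in `W`. -/
def reads (a : ℕ) (W : List (ℕ × ℕ)) : Finset Form :=
  (W.map fun p => Form.eq (.rd (arr a) (idx p.1)) (el p.2)).toFinset

/-- The literals `e = d` for `(e, d)` in `l` with `e`, `d` different constants. -/
def elemEqs (l : List (ℕ × ℕ)) : Finset Form :=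
  ((l.filter fun p => p.1 ≠ p.2).map fun p => Form.eq (el p.1) (el p.2)).toFinset

/-- Flat literals. (`a = b` is the case `W = []` of `wr`.) -/
inductive Flat : Form → Prop
  | wr (a b : ℕ) (W : List (ℕ × ℕ)) : Flat (.eq (arr a) (wrs (arr b) W))
  | rd (a i e : ℕ) : Flat (.eq (.rd (arr a) (idx i)) (el e))
  | diff (a b i : ℕ) : Flat (.eq (.diff (arr a) (arr b)) (idx i))
  | idxEq (i j : ℕ) : Flat (.eq (idx i) (idx j))
  | elemEq (e d : ℕ) : Flat (.eq (el e) (el d))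
  | ne (s : Srt) (m n : ℕ) : Flat (.neg (.eq (.const s m) (.const s n)))

/-- `DefLit s α t D`: the flat literal `D` is the explicit definition of the non-constant term `t`
by the constant `α` of sort `s`. -/
inductive DefLit : (s : Srt) → ℕ → Term s → Form → Prop
  | wr (α b : ℕ) (W : List (ℕ × ℕ)) (hW : W ≠ []) :
      DefLit .array α (wrs (arr b) W) (.eq (arr α) (wrs (arr b) W))
  | rd (α a i : ℕ) : DefLit .elem α (.rd (arr a) (idx i)) (.eq (.rd (arr a) (idx i)) (el α))
  | diff (α a b : ℕ) :
      DefLit .index α (.diff (arr a) (arr b)) (.eq (.diff (arr a) (arr b)) (idx α))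

/-- The precedence is a duplicate-free list of the constants in increasing order.
`Prec ord s x y`: the constant `x` of sort `s` is smaller than the constant `y` of sort `s`. -/
def Prec (ord : List Const) (s : Srt) (x y : ℕ) : Prop := List.Sublist [(s, x), (s, y)] ord

/-- `ord` is a total precedence on the constants of the two signatures, and it makes common
constants smaller than strict constants of the same sort. -/
def Admissible (sigA sigB : Finset Const) (ord : List Const) : Prop :=
  ord.Nodup ∧ (∀ c, c ∈ ord ↔ c ∈ sigA ∪ sigB) ∧
    ∀ s x y, (s, x) ∈ sigA ∩ sigB → (s, y) ∈ (sigA ∪ sigB) \ (sigA ∩ sigB) → Prec ord s x y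

/-- `LitRule ord L l r`: the positive flat literal `L` of the main part is oriented by the
precedence as the ground rewrite rule `l → r`. -/
inductive LitRule (ord : List Const) : Form → {s : Srt} → Term s → Term s → Prop
  | arr (a b : ℕ) (W : List (ℕ × ℕ)) (h : Prec ord .array b a) :
      LitRule ord (.eq (arr a) (wrs (arr b) W)) (arr a) (wrs (arr b) W)
  | arrSymm (a b : ℕ) (h : Prec ord .array b a) :
      LitRule ord (.eq (arr b) (arr a)) (arr a) (arr b)
  | rd (a i e : ℕ) :
      LitRule ord (.eq (.rd (arr a) (idx i)) (el e)) (.rd (arr a) (idx i)) (el e)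
  | elem (e d : ℕ) (h : Prec ord .elem d e) : LitRule ord (.eq (el e) (el d)) (el e) (el d)
  | elemSymm (e d : ℕ) (h : Prec ord .elem d e) : LitRule ord (.eq (el d) (el e)) (el e) (el d)

/-- One-step rewriting of ground terms with the oriented positive literals of `A` and the four
non-ground rules. `Rew ord ∅` is rewriting with the non-ground rules alone. -/
inductive Rew (ord : List Const) (A : Finset Form) : {s : Srt} → Term s → Term s → Prop
  | ground {s : Srt} {l r : Term s} (L : Form) (hL : L ∈ A) (h : LitRule ord L l r) : Rew ord A l r
  | readOther (x : Term .array) (i j e : ℕ) (h : i ≠ j) :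
      Rew ord A (.rd (.wr x (idx i) (el e)) (idx j)) (.rd x (idx j))
  | readSame (x : Term .array) (i e : ℕ) :
      Rew ord A (.rd (.wr x (idx i) (el e)) (idx i)) (el e)
  | sort (x : Term .array) (i j e d : ℕ) (h : Prec ord .index j i) :
      Rew ord A (.wr (.wr x (idx i) (el e)) (idx j) (el d))
        (.wr (.wr x (idx j) (el d)) (idx i) (el e))
  | overwrite (x : Term .array) (i e d : ℕ) :
      Rew ord A (.wr (.wr x (idx i) (el e)) (idx i) (el d)) (.wr x (idx i) (el d))
  | rd₁ {x x' : Term .array} (i : Term .index) (h : Rew ord A x x') :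
      Rew ord A (.rd x i) (.rd x' i)
  | rd₂ (x : Term .array) {i i' : Term .index} (h : Rew ord A i i') :
      Rew ord A (.rd x i) (.rd x i')
  | wr₁ {x x' : Term .array} (i : Term .index) (e : Term .elem) (h : Rew ord A x x') :
      Rew ord A (.wr x i e) (.wr x' i e)
  | wr₂ (x : Term .array) {i i' : Term .index} (e : Term .elem) (h : Rew ord A i i') :
      Rew ord A (.wr x i e) (.wr x i' e)
  | wr₃ (x : Term .array) (i : Term .index) {e e' : Term .elem} (h : Rew ord A e e') :
      Rew ord A (.wr x i e) (.wr x i e')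
  | diff₁ {x x' : Term .array} (y : Term .array) (h : Rew ord A x x') :
      Rew ord A (.diff x y) (.diff x' y)
  | diff₂ (x : Term .array) {y y' : Term .array} (h : Rew ord A y y') :
      Rew ord A (.diff x y) (.diff x y')

/-- Reflexive and transitive closure. -/
def Rews (ord : List Const) (A : Finset Form) {s : Srt} (t u : Term s) : Prop :=
  Relation.ReflTransGen (Rew ord A) t u

/-- `u` is a normal form of `t`. -/
def NF (ord : List Const) (A : Finset Form) {s : Srt} (t u : Term s) : Prop :=
  Rews ord A t u ∧ ∀ v, ¬ Rew ord A u v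

def Joinable (ord : List Const) (A : Finset Form) {s : Srt} (t u : Term s) : Prop :=
  ∃ v, Rews ord A t v ∧ Rews ord A u v

/-! # Completion instructions on a single constraint -/

/-- `Compl ord A del add`: a completion instruction applied to the constraint `A` removes the
literals `del` and adds the literals `add`. -/
inductive Compl (ord : List Const) (A : Finset Form) : Finset Form → Finset Form → Prop
  /-- Orientation of `a = wr(b, I, E)` with `a < b`. -/
  | orient (a b : ℕ) (V W : List (ℕ × ℕ)) (F : List ℕ)
      (hL : Form.eq (arr a) (wrs (arr b) V) ∈ A) (hab : Prec ord .array a b) (hV : V ≠ [])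
      (hW : NF ord ∅ (wrs (arr b) V) (wrs (arr b) W))
      (hF : List.Forall₂ (fun p f => Rews ord A (.rd (arr b) (idx p.1)) (el f)) W F) :
      Compl ord A {Form.eq (arr a) (wrs (arr b) V)}
        (insert (Form.eq (arr b) (wrs (arr a) ((W.map Prod.fst).zip F))) (reads a W))
  /-- Orientation of `a = wr(a, I, E)`. -/
  | orientSelf (a : ℕ) (V W : List (ℕ × ℕ))
      (hL : Form.eq (arr a) (wrs (arr a) V) ∈ A)
      (hW : NF ord ∅ (wrs (arr a) V) (wrs (arr a) W)) :
      Compl ord A {Form.eq (arr a) (wrs (arr a) V)} (reads a W)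
  /-- Gaussian completion: the normalized critical pair has different array constants. -/
  | gaussSymmTrans (L₁ L₂ : Form) (a b₁ b₂ : ℕ) (r₁ r₂ : Term .array)
      (W₁ W₂ U : List (ℕ × ℕ)) (F G : List ℕ)
      (hL₁ : L₁ ∈ A) (hr₁ : LitRule ord L₁ (arr a) r₁)
      (hL₂ : L₂ ∈ A) (hr₂ : LitRule ord L₂ (arr a) r₂) (hne : r₁ ≠ r₂)
      (hn₁ : NF ord A r₁ (wrs (arr b₁) W₁)) (hn₂ : NF ord A r₂ (wrs (arr b₂) W₂))
      (hb : Prec ord .array b₂ b₁)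
      (hF : List.Forall₂ (fun p f => Rews ord A (.rd (arr b₁) (idx p.1)) (el f)) W₁ F)
      (hU : NF ord ∅ (wrs (arr b₂) (W₂ ++ (W₁.map Prod.fst).zip F)) (wrs (arr b₂) U))
      (hG : List.Forall₂ (fun p g => NF ord A (.rd (wrs (arr b₂) W₂) (idx p.1)) (el g)) W₁ G) :
      Compl ord A {L₁, L₂}
        ({Form.eq (arr b₁) (wrs (arr b₂) U), Form.eq (arr a) (wrs (arr b₂) W₂)} ∪
          elemEqs (G.zip (W₁.map Prod.snd)))
  /-- Gaussian completion: the normalized critical pair has the same array constant. -/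
  | gaussConfl (L₁ L₂ : Form) (a b : ℕ) (r₁ r₂ : Term .array) (W₁ W₂ : List (ℕ × ℕ))
      (hL₁ : L₁ ∈ A) (hr₁ : LitRule ord L₁ (arr a) r₁)
      (hL₂ : L₂ ∈ A) (hr₂ : LitRule ord L₂ (arr a) r₂) (hne : r₁ ≠ r₂)
      (hn₁ : NF ord A r₁ (wrs (arr b) W₁)) (hn₂ : NF ord A r₂ (wrs (arr b) W₂)) :
      Compl ord A {L₁, L₂}
        (insert (Form.eq (arr a) (wrs (arr b) (W₁.filter fun p => p.1 ∈ W₂.map Prod.fst)))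
          (elemEqs (((W₁.product W₂).filter fun q => q.1.1 = q.2.1).map fun q => (q.1.2, q.2.2)) ∪
            reads b (W₁.filter fun p => p.1 ∉ W₂.map Prod.fst) ∪
            reads b (W₂.filter fun p => p.1 ∉ W₁.map Prod.fst)))
  /-- Critical pair `d ← rd(wr(b, I, E), i) ← rd(a, i) → e' → e`. -/
  | critReadWrite (L₁ L₂ : Form) (a i e' d e : ℕ) (r : Term .array)
      (hL₁ : L₁ ∈ A) (hr₁ : LitRule ord L₁ (.rd (arr a) (idx i)) (el e'))
      (hL₂ : L₂ ∈ A) (hr₂ : LitRule ord L₂ (arr a) r)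
      (hd : NF ord A (.rd r (idx i)) (el d)) (he : NF ord A (el e') (el e)) :
      Compl ord A {L₁} (elemEqs [(d, e)])
  /-- Critical pair between two rules with left-hand side `rd(a, i)`. -/
  | critRead (L₁ L₂ : Form) (a i e' d' e d : ℕ)
      (hL₁ : L₁ ∈ A) (hr₁ : LitRule ord L₁ (.rd (arr a) (idx i)) (el e'))
      (hL₂ : L₂ ∈ A) (hr₂ : LitRule ord L₂ (.rd (arr a) (idx i)) (el d')) (hne : e' ≠ d')
      (he : NF ord A (el e') (el e)) (hd : NF ord A (el d') (el d)) :
      Compl ord A {L₁} (elemEqs [(e, d)])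
  /-- Critical pair between two rules with the same element constant on the left. -/
  | critElem (L₁ L₂ : Form) (c e' d' e d : ℕ)
      (hL₁ : L₁ ∈ A) (hr₁ : LitRule ord L₁ (el c) (el e'))
      (hL₂ : L₂ ∈ A) (hr₂ : LitRule ord L₂ (el c) (el d')) (hne : e' ≠ d')
      (he : NF ord A (el e') (el e)) (hd : NF ord A (el d') (el d)) :
      Compl ord A {L₁} (elemEqs [(e, d)])
  /-- Reduction of a right-hand side to normal form. -/
  | reduceRhs {s : Srt} (L : Form) (l r r' : Term s) (hL : L ∈ A) (hr : LitRule ord L l r)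
      (hn : NF ord A r r') (hne : r ≠ r') : Compl ord A {L} {Form.eq l r'}
  /-- Removal of `t = t`. -/
  | removeRefl {s : Srt} (t : Term s) (hL : Form.eq t t ∈ A) : Compl ord A {Form.eq t t} ∅
  /-- Removal of a redundant write. -/
  | redundantWrite (L : Form) (a b : ℕ) (V U U' : List (ℕ × ℕ)) (p : ℕ × ℕ)
      (hL : L ∈ A) (hr : LitRule ord L (arr a) (wrs (arr b) V))
      (hn : NF ord ∅ (wrs (arr b) V) (wrs (arr b) (U ++ p :: U')))
      (hj : Joinable ord A (.rd (arr b) (idx p.1)) (el p.2)) :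
      Compl ord A {L} {Form.eq (arr a) (wrs (arr b) (U ++ U'))}
  /-- `diff(a, b) = i` with `rd(a, i)`, `rd(b, i)` joinable and `a > b`. -/
  | diffJoin (a b i : ℕ) (hL : Form.eq (.diff (arr a) (arr b)) (idx i) ∈ A)
      (hj : Joinable ord A (.rd (arr a) (idx i)) (.rd (arr b) (idx i)))
      (hab : Prec ord .array b a) :
      Compl ord A {Form.eq (.diff (arr a) (arr b)) (idx i)}
        {Form.eq (arr a) (arr b), Form.eq (.diff (arr b) (arr b)) (idx i)}
  /-- `diff(a, b) = i` with `rd(a, i)`, `rd(b, i)` joinable and `a < b`. -/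
  | diffJoinSymm (a b i : ℕ) (hL : Form.eq (.diff (arr a) (arr b)) (idx i) ∈ A)
      (hj : Joinable ord A (.rd (arr a) (idx i)) (.rd (arr b) (idx i)))
      (hab : Prec ord .array a b) :
      Compl ord A {Form.eq (.diff (arr a) (arr b)) (idx i)}
        {Form.eq (arr b) (arr a), Form.eq (.diff (arr a) (arr a)) (idx i)}

/-- The failure instructions. -/
inductive Failure (ord : List Const) (A : Finset Form) : Prop
  | elem (e d : ℕ) (hL : Form.neg (.eq (el e) (el d)) ∈ A) (hj : Joinable ord A (el e) (el d))
  | diff (a b a' b' i i' : ℕ) (h : Form.eq (.diff (arr a) (arr b)) (idx i) ∈ A)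
      (h' : Form.eq (.diff (arr a') (arr b')) (idx i') ∈ A)
      (ha : Joinable ord A (arr a) (arr a')) (hb : Joinable ord A (arr b) (arr b')) (hi : i ≠ i')

/-! # The interpolating solver -/

/-- The four pre-processing steps (flattening, replacing array inequalities, guessing the index
partition, adding read literals) and the completion phase. -/
inductive Phase where
  | flatten
  | arrayNe
  | guess
  | reads
  | completion
deriving DecidableEq

/-- The state of the solver: the two signatures, the two constraints, the precedence, the phase. -/
structure Node where
  sigA : Finset Const
  sigB : Finset Const
  A : Finset Form
  B : Finset Form
  ord : List Const
  phase : Phase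

namespace Node

/-- The underlying label. -/
def toM (n : Node) : MNode := ⟨n.sigA, n.sigB, n.A, n.B⟩

/-- Exchange of the two components. -/
def swap (n : Node) : Node := ⟨n.sigB, n.sigA, n.B, n.A, n.ord, n.phase⟩

/-- The `AB`-common constants. -/
def common (n : Node) : Finset Const := n.sigA ∩ n.sigB

/-- The constants in use that are `A`-local: those occurring in `A`, and the common ones
occurring in `B`. -/
def localA (n : Node) : Finset Const := constsOf n.A ∪ constsOf n.B ∩ n.common

/-- An explicitly inconsistent pair. -/
def Closed (n : Node) : Prop := Form.bot ∈ n.A ∪ n.B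

/-- `A` is replaced by `A'` and fresh constants `X` are introduced through the literals `D`: as
common constants, with `D` added to both components, if `sh = true`; as `A`-strict constants, with
`D` added to the `A`-component only, if `sh = false`. -/
def extend (n : Node) (sh : Bool) (X : Finset Const) (ord' : List Const) (A' D : Finset Form) :
    Node where
  sigA := n.sigA ∪ X
  sigB := if sh then n.sigB ∪ X else n.sigB
  A := A' ∪ D
  B := if sh then n.B ∪ D else n.B
  ord := ord'
  phase := n.phase

/-- The constants `X` are fresh, `ord'` extends the precedence to them, and `D` is common if it is
to be shared. -/
def CanExtend (n : Node) (sh : Bool) (X : Finset Const) (ord' : List Const) (D : Finset Form) :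
    Prop :=
  Disjoint X (n.sigA ∪ n.sigB) ∧ List.Sublist n.ord ord' ∧
    Admissible (n.sigA ∪ X) (if sh then n.sigB ∪ X else n.sigB) ord' ∧
    (sh = true → constsOf D ⊆ n.common ∪ X)

/-- Replacement of the constant `old` by the constant `new` of the same sort `s`, everywhere in the
`A`-component, and everywhere in the `B`-component too if `old` is common. -/
def identify (n : Node) (s : Srt) (old new : ℕ) : Node :=
  { n with
    A := n.A.image (Form.rename s old new)
    B := if (s, old) ∈ n.common then n.B.image (Form.rename s old new) else n.B }

def withA (n : Node) (A' : Finset Form) : Node := { n with A := A' }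

end Node

/-- Symmetric closure of an instruction under exchange of the two components. -/
def Sym (P : Node → List Node → Prop) (n : Node) (cs : List Node) : Prop :=
  P n cs ∨ ∃ ds, P n.swap ds ∧ cs = ds.map Node.swap

/-- Flattening: in a non-flat literal `L`, occurrences of a subterm `t` are replaced by a fresh
constant `α` (so `L` is the result of substituting `t` for `α` in the new literal `L'`), and the
definition of `α` is added. -/
inductive FlattenA (n : Node) : List Node → Prop
  | mk (sh : Bool) (L L' : Form) (s : Srt) (α : ℕ) (t : Term s) (D : Form) (ord' : List Const)
      (hL : L ∈ n.A) (hflat : ¬ Flat L) (hD : DefLit s α t D)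
      (hL' : L'.subst s α t = L) (hocc : (s, α) ∈ L'.consts)
      (hext : n.CanExtend sh {(s, α)} ord' {D}) :
      FlattenA n [n.extend sh {(s, α)} ord' (insert L' (n.A.erase L)) {D}]

/-- Replacement of `a ≠ b` by `diff(a, b) = i`, `rd(b, i) = e`, `rd(a, i) = d`, `d ≠ e`. -/
inductive ArrayNeA (n : Node) : List Node → Prop
  | mk (sh : Bool) (a b i e d : ℕ) (ord' : List Const)
      (hL : Form.neg (.eq (arr a) (arr b)) ∈ n.A) (hed : e ≠ d)
      (hext : n.CanExtend sh {(.index, i), (.elem, e), (.elem, d)} ord'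
        {.eq (.diff (arr a) (arr b)) (idx i), .eq (.rd (arr b) (idx i)) (el e),
          .eq (.rd (arr a) (idx i)) (el d)}) :
      ArrayNeA n [n.extend sh {(.index, i), (.elem, e), (.elem, d)} ord'
        (insert (.neg (.eq (el d) (el e))) (n.A.erase (.neg (.eq (arr a) (arr b)))))
        {.eq (.diff (arr a) (arr b)) (idx i), .eq (.rd (arr b) (idx i)) (el e),
          .eq (.rd (arr a) (idx i)) (el d)}]

/-- Guessing the index partition. -/
inductive GuessA (n : Node) : List Node → Prop
  /-- A trivial literal `i = i` is removed. -/
  | refl (i : ℕ) (hL : Form.eq (idx i) (idx i) ∈ n.A) :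
      GuessA n [n.withA (n.A.erase (.eq (idx i) (idx i)))]
  /-- A literal `i = j` is removed, the greater constant being replaced by the smaller one. -/
  | merge (L : Form) (big small : ℕ) (hL : L ∈ n.A)
      (hform : L = .eq (idx big) (idx small) ∨ L = .eq (idx small) (idx big))
      (hlt : Prec n.ord .index small big) :
      GuessA n [(n.withA (n.A.erase L)).identify .index big small]
  /-- For a pair of index constants, `i ≠ j` is added or they are identified. -/
  | guess (big small : ℕ) (hbig : (.index, big) ∈ n.localA) (hsmall : (.index, small) ∈ n.localA)
      (hlt : Prec n.ord .index small big)
      (h₁ : Form.neg (.eq (idx big) (idx small)) ∉ n.A)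
      (h₂ : Form.neg (.eq (idx small) (idx big)) ∉ n.A) :
      GuessA n
        [{ n with
            A := insert (.neg (.eq (idx big) (idx small))) n.A
            B := if (.index, big) ∈ n.common ∧ (.index, small) ∈ n.common then
              insert (.neg (.eq (idx big) (idx small))) n.B else n.B },
          n.identify .index big small]
  /-- The guess is inconsistent. -/
  | clash (i : ℕ) (hL : Form.neg (.eq (idx i) (idx i)) ∈ n.A) :
      GuessA n [n.withA (insert .bot n.A)]

/-- Adding a literal `rd(a, i) = e` with fresh `e`, in the pre-processing phase. -/
inductive ReadA (n : Node) : List Node → Prop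
  | mk (sh : Bool) (a i e : ℕ) (ord' : List Const)
      (ha : (.array, a) ∈ n.localA) (hi : (.index, i) ∈ n.localA)
      (hmiss : ∀ e', Form.eq (.rd (arr a) (idx i)) (el e') ∉ n.A)
      (hext : n.CanExtend sh {(.elem, e)} ord' {.eq (.rd (arr a) (idx i)) (el e)}) :
      ReadA n [n.extend sh {(.elem, e)} ord' n.A {.eq (.rd (arr a) (idx i)) (el e)}]

/-- Restoring, in the completion phase, the invariant that every `rd(a, i)` reduces to a
constant. -/
inductive RepairA (n : Node) : List Node → Prop
  | mk (sh : Bool) (a i e : ℕ) (ord' : List Const)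
      (ha : (.array, a) ∈ n.localA) (hi : (.index, i) ∈ n.localA)
      (hmiss : ∀ e', ¬ Rews n.ord n.A (.rd (arr a) (idx i)) (el e'))
      (hext : n.CanExtend sh {(.elem, e)} ord' {.eq (.rd (arr a) (idx i)) (el e)}) :
      RepairA n [n.extend sh {(.elem, e)} ord' n.A {.eq (.rd (arr a) (idx i)) (el e)}]

/-- Restoring the invariants in the completion phase. -/
def InvA (n : Node) (cs : List Node) : Prop := GuessA n cs ∨ RepairA n cs

/-- Copying a common literal to the other component. -/
inductive CopyA (n : Node) : List Node → Prop
  | mk (L : Form) (hA : L ∈ n.A) (hB : L ∉ n.B) (hL : L.consts ⊆ n.common) :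
      CopyA n [{ n with B := insert L n.B }]

/-- Term Sharing: the `A`-strict constant `old`, defined by the literal `L`, is renamed to the fresh
common constant `new`. -/
def Node.share (n : Node) (s : Srt) (old new : ℕ) (ord' : List Const) (L : Form) : Node :=
  n.extend true {(s, new)} ord' (n.A.image (Form.rename s old new)) {L.rename s old new}

/-- Elimination of undesired literals from the `A`-component. -/
inductive UndesiredA (n : Node) : List Node → Prop
  /-- `rd(c, i) → d` with common left-hand side and `A`-strict `d`. -/
  | shareRead (c i d m : ℕ) (ord' : List Const)
      (hL : Form.eq (.rd (arr c) (idx i)) (el d) ∈ n.A)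
      (hc : (.array, c) ∈ n.common) (hi : (.index, i) ∈ n.common) (hd : (.elem, d) ∉ n.common)
      (hext : n.CanExtend true {(.elem, m)} ord' {.eq (.rd (arr c) (idx i)) (el m)}) :
      UndesiredA n [n.share .elem d m ord' (.eq (.rd (arr c) (idx i)) (el d))]
  /-- `a → wr(c, I, E)` with common right-hand side and `A`-strict `a`. -/
  | shareArray (L : Form) (a c m : ℕ) (W : List (ℕ × ℕ)) (ord' : List Const)
      (hL : L ∈ n.A) (hr : LitRule n.ord L (arr a) (wrs (arr c) W))
      (hW : (wrs (arr c) W).consts ⊆ n.common) (ha : (.array, a) ∉ n.common)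
      (hext : n.CanExtend true {(.array, m)} ord' {.eq (arr m) (wrs (arr c) W)})
      (hm : Prec ord' .array c m) :
      UndesiredA n [n.share .array a m ord' L]
  /-- `diff(a, b) = k` with common left-hand side and `A`-strict `k`. -/
  | shareDiff (a b k m : ℕ) (ord' : List Const)
      (hL : Form.eq (.diff (arr a) (arr b)) (idx k) ∈ n.A)
      (ha : (.array, a) ∈ n.common) (hb : (.array, b) ∈ n.common) (hk : (.index, k) ∉ n.common)
      (hext : n.CanExtend true {(.index, m)} ord' {.eq (.diff (arr a) (arr b)) (idx m)}) :
      UndesiredA n [n.share .index k m ord' (.eq (.diff (arr a) (arr b)) (idx k))]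
  /-- `c → wr(c', I, E)` with common left-hand side and a right-hand side that is not common. The
  normalized list of writes `W` is split into its common part `W₁` and the rest `W₂`. The guess that
  `c = wr(c', I₁, E₁)` gives the first successor. Under the guess that `c ≠ wr(c', I₁, E₁)` the term
  `wr(c', I₁, E₁)` is named by `c₂` (a fresh common constant, or `c'` itself if `I₁` is empty), and
  common constants `i`, `d`, `d₂` with `diff(c, c₂) = i`, `rd(c, i) = d`, `rd(c₂, i) = d₂` and
  `d ≠ d₂` are introduced; there is one further successor for every pair `(iₖ, eₖ)` in `W₂`, in
  which `iₖ`, `eₖ` are replaced by `i`, `d`. -/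
  | split (L : Form) (c c' c₂ i d d₂ : ℕ) (V W W₁ W₂ : List (ℕ × ℕ)) (ord' : List Const)
      (X : Finset Const) (D : Finset Form) (M : Node)
      (hL : L ∈ n.A) (hr : LitRule n.ord L (arr c) (wrs (arr c') V))
      (hc : (.array, c) ∈ n.common) (hrhs : ¬ (wrs (arr c') V).consts ⊆ n.common)
      (hW : NF n.ord ∅ (wrs (arr c') V) (wrs (arr c') W))
      (hW₁ : W₁ = W.filter fun p => (.index, p.1) ∈ n.common ∧ (.elem, p.2) ∈ n.common)
      (hW₂ : W₂ = W.filter fun p => ¬ ((.index, p.1) ∈ n.common ∧ (.elem, p.2) ∈ n.common))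
      (hdd : d ≠ d₂)
      (hc₂ : (X = {(.array, c₂), (.index, i), (.elem, d), (.elem, d₂)} ∧
            D = {.eq (arr c₂) (wrs (arr c') W₁), .eq (.diff (arr c) (arr c₂)) (idx i),
              .eq (.rd (arr c) (idx i)) (el d), .eq (.rd (arr c₂) (idx i)) (el d₂)} ∧
            Prec ord' .array c' c₂ ∧ Prec ord' .array c₂ c) ∨
          (W₁ = [] ∧ c₂ = c' ∧ X = {(.index, i), (.elem, d), (.elem, d₂)} ∧
            D = {.eq (.diff (arr c) (arr c₂)) (idx i),
              .eq (.rd (arr c) (idx i)) (el d), .eq (.rd (arr c₂) (idx i)) (el d₂)}))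
      (hext : n.CanExtend true X ord' D)
      (hM : M = n.extend true X ord'
        (insert (.neg (.eq (el d) (el d₂)))
          (insert (.eq (arr c) (wrs (arr c₂) W₂)) (n.A.erase L))) D) :
      UndesiredA n
        (n.withA (insert (.eq (arr c) (wrs (arr c') W₁)) (n.A.erase L) ∪ reads c' W₂) ::
          W₂.map fun p => (M.identify .index p.1 i).identify .elem p.2 d)

/-- The completion instructions of highest priority. -/
def CopyOrUndesiredA (n : Node) (cs : List Node) : Prop := CopyA n cs ∨ UndesiredA n cs

/-- Completion instructions on the `A`-component. An instruction deleting common literals is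
performed simultaneously in both components. -/
inductive ComplA (n : Node) : List Node → Prop
  | single (del add : Finset Form) (h : Compl n.ord n.A del add)
      (hdel : ∀ L ∈ del, ¬ L.consts ⊆ n.common) : ComplA n [n.withA ((n.A \ del) ∪ add)]
  | both (del add : Finset Form) (hA : Compl n.ord n.A del add) (hB : Compl n.ord n.B del add)
      (hdel : ∀ L ∈ del, L.consts ⊆ n.common) :
      ComplA n [{ n with A := (n.A \ del) ∪ add, B := (n.B \ del) ∪ add }]
  | fail (h : Failure n.ord n.A) : ComplA n [n.withA (insert .bot n.A)]

/-- No instruction of the kind `P` applies to `n`. -/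
def Exhausted (P : Node → List Node → Prop) (n : Node) : Prop := ∀ cs, ¬ P n cs

/-- The pre-processing steps are performed exhaustively one after the other. -/
def PhaseStep (P : Node → List Node → Prop) (next : Phase) (n : Node) (cs : List Node) : Prop :=
  Sym P n cs ∨ Exhausted (Sym P) n ∧ cs = [{ n with phase := next }]

/-- In the completion phase, restoring the invariants has the highest priority; copying common
literals and eliminating undesired literals have priority over the remaining instructions. -/
def CompletionStep (n : Node) (cs : List Node) : Prop :=
  Sym InvA n cs ∨
    Exhausted (Sym InvA) n ∧
      (Sym CopyOrUndesiredA n cs ∨ Exhausted (Sym CopyOrUndesiredA) n ∧ Sym ComplA n cs)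

/-- `Step n cs`: an instruction of the interpolating solver applies to the pair at `n`, and `cs` are
the resulting alternatives. -/
def Step (n : Node) (cs : List Node) : Prop :=
  ¬ n.Closed ∧
    match n.phase with
    | .flatten => PhaseStep FlattenA .arrayNe n cs
    | .arrayNe => PhaseStep ArrayNeA .guess n cs
    | .guess => PhaseStep GuessA .reads n cs
    | .reads => PhaseStep ReadA .completion n cs
    | .completion => CompletionStep n cs

/-! # Interpolating trees -/

/-- A possibly infinite labelled tree: `T p` is the label at the position `p`, `none` if there is no
such position; the `k`-th successor of `p` is `p ++ [k]`. -/
abbrev Tree : Type := List ℕ → Option Node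

/-- The labels of the successors of `p` are, in this order, `cs`. -/
def Tree.Succs (T : Tree) (p : List ℕ) (cs : List Node) : Prop := ∀ k, T (p ++ [k]) = cs[k]?

/-- The initial node; its signatures are those of the symbols occurring in the constraints. -/
def root (A B : Finset Form) (ord : List Const) : Node :=
  ⟨constsOf A, constsOf B, A, B, ord, .flatten⟩

/-- `T` is an interpolating tree with root label `n₀`: every inner node is expanded by some
instruction, and only nodes to which no instruction applies are leaves. -/
def IsInterpolatingTree (n₀ : Node) (T : Tree) : Prop :=
  T [] = some n₀ ∧ (∀ p k, T p = none → T (p ++ [k]) = none) ∧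
    ∀ p n, T p = some n → (∃ cs, Step n cs ∧ T.Succs p cs) ∨ (Exhausted Step n ∧ T.Succs p [])

def Tree.Finite (T : Tree) : Prop := {p | T p ≠ none}.Finite

/-- The open leaves allowed when the passage from a node to its successors `cs` is derived from
metarules. -/
def SuccHyp (cs : List Node) (m : MNode) : Type := {k : Fin cs.length // (cs.get k).toM = m}

/-- `T` is an interpolating metarules refutation: it is finite, its leaves have `⊥` in one of their
components, and every inner node is obtained from its successors by metarules. -/
def IsRefutation (T : Tree) : Prop :=
  T.Finite ∧
    (∀ p n, T p = some n → T.Succs p [] → n.Closed) ∧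
    ∀ p n cs, T p = some n → T.Succs p cs → cs ≠ [] → Nonempty (MDeriv (SuccHyp cs) n.toM)

/-- `Expansion T p n R`: the metarules refutation `R` of the label `n` at the position `p` arises
from the subtree of `T` above `p` when every instruction is replaced by a justification of it by
metarules. -/
inductive Expansion (T : Tree) : List ℕ → (n : MNode) → Refutation n → Prop
  | leaf1 (p : List ℕ) (n : Node) (hp : T p = some n) (hs : T.Succs p []) (h : Form.bot ∈ n.toM.A) :
      Expansion T p n.toM (.close1 h)
  | leaf2 (p : List ℕ) (n : Node) (hp : T p = some n) (hs : T.Succs p []) (h : Form.bot ∈ n.toM.B) :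
      Expansion T p n.toM (.close2 h)
  | inner (p : List ℕ) (n : Node) (cs : List Node) (hp : T p = some n) (hs : T.Succs p cs)
      (hcs : cs ≠ []) (J : MDeriv (SuccHyp cs) n.toM)
      (R : ∀ k : Fin cs.length, Refutation (cs.get k).toM)
      (hR : ∀ k : Fin cs.length, Expansion T (p ++ [k.val]) (cs.get k).toM (R k)) :
      Expansion T p n.toM (J.graft fun _ h => h.2 ▸ R h.1)

end AXdiff

namespace AXdiff

open Finset

variable {ord ord' : List Const} {n : Node} {cs : List Node} {A A' B D del add : Finset Form}
  {S S' C X : Finset Const} {s : Srt} {t u l r : Term s} {V W : List (ℕ × ℕ)} {L φ : Form} {M : Model}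

/-! # Semantics: reinterpretation of a constant -/

open Classical in
/-- The model obtained by reinterpreting one free constant. -/
noncomputable abbrev Model.update (M : Model) (s : Srt) (n : ℕ) (v : M.carrier s) : Model where
  carrier := M.carrier
  rd := M.rd
  wr := M.wr
  diff := M.diff
  const := fun s' n' => if h : s = s' ∧ n = n' then h.1 ▸ v else M.const s' n'
  rd_wr_same := M.rd_wr_same
  rd_wr_other := M.rd_wr_other
  rd_diff := M.rd_diff

theorem Model.eval_update_subst (M : Model) (s : Srt) (n : ℕ) (u : Term s) :
    ∀ {s' : Srt} (t : Term s'), (M.update s n (M.eval u)).eval t = M.eval (Term.subst s n u t)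
  | _, .const s' n' => by
    by_cases h : s = s' ∧ n = n'
    · obtain ⟨rfl, rfl⟩ := h
      simp [Model.eval, Term.subst]
    · simp [Model.eval, Term.subst, h]
  | _, .rd x i => by
    simp only [Model.eval, Term.subst, ← eval_update_subst M s n u x,
      ← eval_update_subst M s n u i]
  | _, .wr x i e => by
    simp only [Model.eval, Term.subst, ← eval_update_subst M s n u x,
      ← eval_update_subst M s n u i, ← eval_update_subst M s n u e]
  | _, .diff x y => by
    simp only [Model.eval, Term.subst, ← eval_update_subst M s n u x,
      ← eval_update_subst M s n u y]

theorem Model.holds_update_subst (M : Model) (s : Srt) (n : ℕ) (u : Term s) (φ : Form) :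
    (M.update s n (M.eval u)).Holds φ ↔ M.Holds (φ.subst s n u) := by
  induction φ with
  | eq t v => simp only [Model.Holds, Form.subst, ← M.eval_update_subst]
  | bot => rfl
  | top => rfl
  | neg φ ih => simp only [Model.Holds, Form.subst, ih]
  | and φ ψ ih1 ih2 => simp only [Model.Holds, Form.subst, ih1, ih2]
  | or φ ψ ih1 ih2 => simp only [Model.Holds, Form.subst, ih1, ih2]
  | imp φ ψ ih1 ih2 => simp only [Model.Holds, Form.subst, ih1, ih2]

theorem Model.eval_update_of_notMem (M : Model) (s : Srt) (n : ℕ) (v : M.carrier s) :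
    ∀ {s' : Srt} (t : Term s'), (s, n) ∉ t.consts → (M.update s n v).eval t = M.eval t
  | _, .const s' n', h => by
    have : ¬ (s = s' ∧ n = n') := by simpa [Term.consts] using h
    simp [Model.eval, this]
  | _, .rd x i, h => by
    simp only [Term.consts, mem_union, not_or] at h
    simp only [Model.eval, eval_update_of_notMem M s n v x h.1,
      eval_update_of_notMem M s n v i h.2]
  | _, .wr x i e, h => by
    simp only [Term.consts, mem_union, not_or] at h
    simp only [Model.eval, eval_update_of_notMem M s n v x h.1.1,
      eval_update_of_notMem M s n v i h.1.2, eval_update_of_notMem M s n v e h.2]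
  | _, .diff x y, h => by
    simp only [Term.consts, mem_union, not_or] at h
    simp only [Model.eval, eval_update_of_notMem M s n v x h.1,
      eval_update_of_notMem M s n v y h.2]

theorem Model.holds_update_of_notMem (M : Model) (s : Srt) (n : ℕ) (v : M.carrier s) (φ : Form)
    (h : (s, n) ∉ φ.consts) : (M.update s n v).Holds φ ↔ M.Holds φ := by
  induction φ with
  | eq t u =>
    simp only [Form.consts, mem_union, not_or] at h
    simp only [Model.Holds, M.eval_update_of_notMem s n v _ h.1,
      M.eval_update_of_notMem s n v _ h.2]
  | bot => rfl
  | top => rfl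
  | neg φ ih => simp only [Model.Holds, ih h]
  | and φ ψ ih1 ih2 =>
    simp only [Form.consts, mem_union, not_or] at h
    simp only [Model.Holds, ih1 h.1, ih2 h.2]
  | or φ ψ ih1 ih2 =>
    simp only [Form.consts, mem_union, not_or] at h
    simp only [Model.Holds, ih1 h.1, ih2 h.2]
  | imp φ ψ ih1 ih2 =>
    simp only [Form.consts, mem_union, not_or] at h
    simp only [Model.Holds, ih1 h.1, ih2 h.2]

theorem Model.eval_update_self (M : Model) (s : Srt) (n : ℕ) (v : M.carrier s) :
    (M.update s n v).eval (.const s n) = v := by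
  simp [Model.eval]

/-! # Constants of substituted terms and formulas -/

theorem Term.subst_of_notMem (s : Srt) (n : ℕ) (u : Term s) :
    ∀ {s' : Srt} (t : Term s'), (s, n) ∉ t.consts → Term.subst s n u t = t
  | _, .const s' n', h => by
    have : ¬ (s = s' ∧ n = n') := by simpa [Term.consts] using h
    simp [Term.subst, this]
  | _, .rd x i, h => by
    simp only [Term.consts, mem_union, not_or] at h
    simp only [Term.subst, subst_of_notMem s n u x h.1, subst_of_notMem s n u i h.2]
  | _, .wr x i e, h => by
    simp only [Term.consts, mem_union, not_or] at h
    simp only [Term.subst, subst_of_notMem s n u x h.1.1, subst_of_notMem s n u i h.1.2,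
      subst_of_notMem s n u e h.2]
  | _, .diff x y, h => by
    simp only [Term.consts, mem_union, not_or] at h
    simp only [Term.subst, subst_of_notMem s n u x h.1, subst_of_notMem s n u y h.2]

theorem Form.subst_of_notMem (s : Srt) (n : ℕ) (u : Term s) (φ : Form) (h : (s, n) ∉ φ.consts) :
    φ.subst s n u = φ := by
  induction φ with
  | eq t v =>
    simp only [Form.consts, mem_union, not_or] at h
    simp only [Form.subst, Term.subst_of_notMem s n u _ h.1, Term.subst_of_notMem s n u _ h.2]
  | bot => rfl
  | top => rfl
  | neg φ ih => simp only [Form.subst, ih h]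
  | and φ ψ ih1 ih2 =>
    simp only [Form.consts, mem_union, not_or] at h
    simp only [Form.subst, ih1 h.1, ih2 h.2]
  | or φ ψ ih1 ih2 =>
    simp only [Form.consts, mem_union, not_or] at h
    simp only [Form.subst, ih1 h.1, ih2 h.2]
  | imp φ ψ ih1 ih2 =>
    simp only [Form.consts, mem_union, not_or] at h
    simp only [Form.subst, ih1 h.1, ih2 h.2]

theorem Term.consts_subst_subset (s : Srt) (n : ℕ) (u : Term s) :
    ∀ {s' : Srt} (t : Term s'), (Term.subst s n u t).consts ⊆ t.consts.erase (s, n) ∪ u.consts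
  | _, .const s' n' => by
    by_cases h : s = s' ∧ n = n'
    · obtain ⟨rfl, rfl⟩ := h
      simp [Term.subst]
    · have h' : (s', n') ≠ (s, n) := fun e => h (by simpa [eq_comm] using e)
      simp [Term.subst, h, Term.consts, h'.symm]
  | _, .rd x i => by
    have h1 := consts_subst_subset s n u x
    have h2 := consts_subst_subset s n u i
    intro c
    have := @h1 c
    have := @h2 c
    simp only [Term.subst, Term.consts, mem_union, mem_erase] at *
    tauto
  | _, .wr x i e => by
    have h1 := consts_subst_subset s n u x
    have h2 := consts_subst_subset s n u i
    have h3 := consts_subst_subset s n u e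
    intro c
    have := @h1 c
    have := @h2 c
    have := @h3 c
    simp only [Term.subst, Term.consts, mem_union, mem_erase] at *
    tauto
  | _, .diff x y => by
    have h1 := consts_subst_subset s n u x
    have h2 := consts_subst_subset s n u y
    intro c
    have := @h1 c
    have := @h2 c
    simp only [Term.subst, Term.consts, mem_union, mem_erase] at *
    tauto

theorem Form.consts_subst_subset (s : Srt) (n : ℕ) (u : Term s) (φ : Form) :
    (φ.subst s n u).consts ⊆ φ.consts.erase (s, n) ∪ u.consts := by
  induction φ with
  | eq t v =>
    have h1 := Term.consts_subst_subset s n u t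
    have h2 := Term.consts_subst_subset s n u v
    intro c
    have := @h1 c
    have := @h2 c
    simp only [Form.subst, Form.consts, mem_union, mem_erase] at *
    tauto
  | bot => simp [Form.subst, Form.consts]
  | top => simp [Form.subst, Form.consts]
  | neg φ ih => exact ih
  | and φ ψ ih1 ih2 | or φ ψ ih1 ih2 | imp φ ψ ih1 ih2 =>
    intro c
    have := @ih1 c
    have := @ih2 c
    simp only [Form.subst, Form.consts, mem_union, mem_erase] at *
    tauto

theorem Term.subset_consts_subst (s : Srt) (n : ℕ) (u : Term s) :
    ∀ {s' : Srt} (t : Term s'), t.consts ⊆ insert (s, n) (Term.subst s n u t).consts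
  | _, .const s' n' => by
    by_cases h : s = s' ∧ n = n'
    · obtain ⟨rfl, rfl⟩ := h
      simp [Term.consts]
    · simp [Term.subst, h, Term.consts]
  | _, .rd x i => by
    have h1 := subset_consts_subst s n u x
    have h2 := subset_consts_subst s n u i
    intro c
    have := @h1 c
    have := @h2 c
    simp only [Term.subst, Term.consts, mem_union, mem_insert] at *
    tauto
  | _, .wr x i e => by
    have h1 := subset_consts_subst s n u x
    have h2 := subset_consts_subst s n u i
    have h3 := subset_consts_subst s n u e
    intro c
    have := @h1 c
    have := @h2 c
    have := @h3 c
    simp only [Term.subst, Term.consts, mem_union, mem_insert] at *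
    tauto
  | _, .diff x y => by
    have h1 := subset_consts_subst s n u x
    have h2 := subset_consts_subst s n u y
    intro c
    have := @h1 c
    have := @h2 c
    simp only [Term.subst, Term.consts, mem_union, mem_insert] at *
    tauto

theorem Form.subset_consts_subst (s : Srt) (n : ℕ) (u : Term s) (φ : Form) :
    φ.consts ⊆ insert (s, n) (φ.subst s n u).consts := by
  induction φ with
  | eq t v =>
    have h1 := Term.subset_consts_subst s n u t
    have h2 := Term.subset_consts_subst s n u v
    intro c
    have := @h1 c
    have := @h2 c
    simp only [Form.subst, Form.consts, mem_union, mem_insert] at *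
    tauto
  | bot => simp [Form.consts]
  | top => simp [Form.consts]
  | neg φ ih => exact ih
  | and φ ψ ih1 ih2 | or φ ψ ih1 ih2 | imp φ ψ ih1 ih2 =>
    intro c
    have := @ih1 c
    have := @ih2 c
    simp only [Form.subst, Form.consts, mem_union, mem_insert] at *
    tauto

/-! # Sets of formulas -/

theorem mem_constsOf {c : Const} : c ∈ constsOf A ↔ ∃ φ ∈ A, c ∈ φ.consts := by
  simp [constsOf]

theorem subset_constsOf (h : φ ∈ A) :
    φ.consts ⊆ constsOf A := fun _ hc => mem_constsOf.2 ⟨φ, h, hc⟩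

theorem constsOf_subset_iff :
    constsOf A ⊆ S ↔ ∀ φ ∈ A, φ.consts ⊆ S := by
  simp [constsOf]

theorem constsOf_insert (φ : Form) (A : Finset Form) :
    constsOf (insert φ A) = φ.consts ∪ constsOf A := by simp [constsOf]

theorem constsOf_union (A B : Finset Form) : constsOf (A ∪ B) = constsOf A ∪ constsOf B := by
  ext c
  simp only [mem_constsOf, mem_union]
  grind

theorem constsOf_mono (h : A ⊆ B) : constsOf A ⊆ constsOf B :=
  biUnion_subset_biUnion_of_subset_left _ h

theorem constsOf_singleton (φ : Form) : constsOf {φ} = φ.consts := by simp [constsOf]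

/-- All formulas of a finite set hold. -/
def Model.HoldsAll (M : Model) (A : Finset Form) : Prop := ∀ φ ∈ A, M.Holds φ

theorem Model.holds_insert :
    M.HoldsAll (insert φ A) ↔ M.Holds φ ∧ M.HoldsAll A := by
  simp [Model.HoldsAll]

theorem Model.holds_singleton : M.HoldsAll {φ} ↔ M.Holds φ := by
  simp [Model.HoldsAll]

theorem Model.holds_union :
    M.HoldsAll (A ∪ B) ↔ M.HoldsAll A ∧ M.HoldsAll B := by
  simp only [Model.HoldsAll, mem_union]
  grind

theorem Model.HoldsAll.mono (h : M.HoldsAll B) (hAB : A ⊆ B) :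
    M.HoldsAll A := fun φ hφ => h φ (hAB hφ)

theorem Model.holdsAll_update_of_notMem (M : Model) (s : Srt) (n : ℕ) (v : M.carrier s)
    (A : Finset Form) (h : (s, n) ∉ constsOf A) :
    (M.update s n v).HoldsAll A ↔ M.HoldsAll A := by
  refine forall₂_congr fun φ hφ => M.holds_update_of_notMem s n v φ fun hc => h ?_
  exact subset_constsOf hφ hc

theorem holds_bigOr {l : List Form} :
    M.Holds (Form.bigOr l) ↔ ∃ φ ∈ l, M.Holds φ := by
  induction l with
  | nil => simp [Form.bigOr, Model.Holds]
  | cons φ l ih => simp [Form.bigOr, Model.Holds, ih]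

theorem holds_bigAnd {l : List Form} :
    M.Holds (Form.bigAnd l) ↔ ∀ φ ∈ l, M.Holds φ := by
  induction l with
  | nil => simp [Form.bigAnd, Model.Holds]
  | cons φ l ih => simp [Form.bigAnd, Model.Holds, ih]

theorem mem_consts_bigOr {c : Const} {l : List Form} :
    c ∈ (Form.bigOr l).consts ↔ ∃ φ ∈ l, c ∈ φ.consts := by
  induction l with
  | nil => simp [Form.bigOr, Form.consts]
  | cons φ l ih => simp [Form.bigOr, Form.consts, ih]

theorem mem_consts_bigAnd {c : Const} {l : List Form} :
    c ∈ (Form.bigAnd l).consts ↔ ∃ φ ∈ l, c ∈ φ.consts := by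
  induction l with
  | nil => simp [Form.bigAnd, Form.consts]
  | cons φ l ih => simp [Form.bigAnd, Form.consts, ih]

/-! # Correctness of the interpolating instructions -/

theorem entails_define {a : ℕ} {θ : Form} (haA : (s, a) ∉ constsOf A) (hat : (s, a) ∉ t.consts)
    (h : Entails (insert (.eq (.const s a) t) A) θ) : Entails A (θ.subst s a t) := by
  intro M hM
  rw [← M.holds_update_subst]
  refine h _ (Model.holds_insert.2 ⟨?_, (M.holdsAll_update_of_notMem s a _ A haA).2 hM⟩)
  simp only [Model.Holds, M.eval_update_self, M.eval_update_of_notMem s a _ t hat]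

/-- The formula computed by the interpolating instructions is an interpolant, over the common
signature, of the label of the root. -/
theorem MDeriv.interp_spec {n : MNode} (R : Refutation n) (hA : constsOf n.A ⊆ n.sigA)
    (hB : constsOf n.B ⊆ n.sigB) :
    R.interpolant.consts ⊆ n.sigA ∩ n.sigB ∧ Entails n.A R.interpolant ∧
      Entails n.B (.neg R.interpolant) := by
  unfold Refutation.interpolant
  unfold Refutation at R
  induction R with
  | hyp h => exact h.elim
  | close1 h =>
    exact ⟨by simp [interp, Form.consts], fun M hM => hM _ h, fun M _ => id⟩
  | close2 h =>
    exact ⟨by simp [interp, Form.consts], fun M _ => trivial, fun M hM => (hM _ h).elim⟩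
  | propagate1 ψ hent hψ d ih =>
    obtain ⟨h1, h2, h3⟩ := ih hA (by
      rw [constsOf_insert]
      exact union_subset (hψ.trans inter_subset_right) hB)
    refine ⟨union_subset h1 hψ, fun M hM => ⟨h2 M hM, hent M hM⟩, fun M hM h => ?_⟩
    exact h3 M (Model.holds_insert.2 ⟨h.2, hM⟩) h.1
  | propagate2 ψ hent hψ d ih =>
    obtain ⟨h1, h2, h3⟩ := ih (by
      rw [constsOf_insert]
      exact union_subset (hψ.trans inter_subset_left) hA) hB
    refine ⟨union_subset hψ h1, fun M hM h => ?_, fun M hM h => ?_⟩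
    · exact h2 M (Model.holds_insert.2 ⟨h, hM⟩)
    · exact h3 M hM (h (hent M hM))
  | @define0 SA SB A B s a t ht ha d ih =>
    have ht' := fun h => mem_inter.1 (@ht (s, a) h)
    simp only [mem_union, not_or] at ha
    obtain ⟨h1, h2, h3⟩ := ih
      (by
        simp only [constsOf_insert, Form.consts, Term.consts]
        grind)
      (by
        simp only [constsOf_insert, Form.consts, Term.consts]
        grind)
    refine ⟨(Form.consts_subst_subset s a t _).trans ?_, ?_, ?_⟩
    · intro c hc
      have := @h1 c
      have := @ht c
      grind
    · exact entails_define (fun h => ha.1 (hA h)) (fun h => ha.1 (ht' h).1) h2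
    · exact entails_define (fun h => ha.2 (hB h)) (fun h => ha.1 (ht' h).1) h3
  | @define1 SA SB A B s a t ht ha d ih =>
    simp only [mem_union, not_or] at ha
    obtain ⟨h1, h2, h3⟩ := ih
      (by
        simp only [constsOf_insert, Form.consts, Term.consts]
        grind) hB
    have hθ : (s, a) ∉ (d.interp fun _ h => h.elim).consts := fun h => by
      have := h1 h
      grind
    refine ⟨fun c (hc : c ∈ (d.interp fun _ h => h.elim).consts) => ?_, ?_, h3⟩
    · have := h1 hc
      have : c ≠ (s, a) := fun e => hθ (e ▸ hc)
      grind
    · have := entails_define (fun h => ha.1 (hA h)) (fun h => ha.1 (ht h)) h2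
      rwa [Form.subst_of_notMem s a t _ hθ] at this
  | @define2 SA SB A B s a t ht ha d ih =>
    simp only [mem_union, not_or] at ha
    obtain ⟨h1, h2, h3⟩ := ih hA
      (by
        simp only [constsOf_insert, Form.consts, Term.consts]
        grind)
    have hθ : (s, a) ∉ (d.interp fun _ h => h.elim).consts := fun h => by
      have := h1 h
      grind
    refine ⟨fun c (hc : c ∈ (d.interp fun _ h => h.elim).consts) => ?_, h2, ?_⟩
    · have := h1 hc
      have : c ≠ (s, a) := fun e => hθ (e ▸ hc)
      grind
    · have := entails_define (fun h => ha.2 (hB h)) (fun h => ha.2 (ht h)) h3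
      rwa [Form.subst_of_notMem s a t (.neg _) hθ] at this
  | @disjunction1 SA SB A B n ψ hloc hent d ih =>
    have ih' := fun k => ih k
      (by
        rw [constsOf_insert]
        refine union_subset (fun c hc => hloc (mem_consts_bigOr.2 ⟨ψ k, ?_, hc⟩)) hA
        exact List.mem_ofFn.2 ⟨k, rfl⟩) hB
    refine ⟨fun c hc => ?_, fun M hM => ?_, fun M hM h => ?_⟩
    · obtain ⟨φ, hφ, hc⟩ := mem_consts_bigOr.1 hc
      obtain ⟨k, rfl⟩ := List.mem_ofFn.1 hφ
      exact (ih' k).1 hc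
    · obtain ⟨φ, hφ, h⟩ := holds_bigOr.1 (hent M hM)
      obtain ⟨k, rfl⟩ := List.mem_ofFn.1 hφ
      exact holds_bigOr.2 ⟨_, List.mem_ofFn.2 ⟨k, rfl⟩,
        (ih' k).2.1 M (Model.holds_insert.2 ⟨h, hM⟩)⟩
    · obtain ⟨φ, hφ, h⟩ := holds_bigOr.1 h
      obtain ⟨k, rfl⟩ := List.mem_ofFn.1 hφ
      exact (ih' k).2.2 M hM h
  | @disjunction2 SA SB A B n ψ hloc hent d ih =>
    have ih' := fun k => ih k hA
      (by
        rw [constsOf_insert]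
        refine union_subset (fun c hc => hloc (mem_consts_bigOr.2 ⟨ψ k, ?_, hc⟩)) hB
        exact List.mem_ofFn.2 ⟨k, rfl⟩)
    refine ⟨fun c hc => ?_, fun M hM => ?_, fun M hM h => ?_⟩
    · obtain ⟨φ, hφ, hc⟩ := mem_consts_bigAnd.1 hc
      obtain ⟨k, rfl⟩ := List.mem_ofFn.1 hφ
      exact (ih' k).1 hc
    · refine holds_bigAnd.2 fun φ hφ => ?_
      obtain ⟨k, rfl⟩ := List.mem_ofFn.1 hφ
      exact (ih' k).2.1 M hM
    · obtain ⟨φ, hφ, h'⟩ := holds_bigOr.1 (hent M hM)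
      obtain ⟨k, rfl⟩ := List.mem_ofFn.1 hφ
      exact (ih' k).2.2 M (Model.holds_insert.2 ⟨h', hM⟩)
        (holds_bigAnd.1 h _ (List.mem_ofFn.2 ⟨k, rfl⟩))
  | redplus1 ψ hent hψ d ih =>
    obtain ⟨h1, h2, h3⟩ := ih
      (by
        rw [constsOf_insert]
        exact union_subset hψ hA) hB
    exact ⟨h1, fun M hM => h2 M (Model.holds_insert.2 ⟨hent M hM, hM⟩), h3⟩
  | redplus2 ψ hent hψ d ih =>
    obtain ⟨h1, h2, h3⟩ := ih hA
      (by
        rw [constsOf_insert]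
        exact union_subset hψ hB)
    exact ⟨h1, h2, fun M hM => h3 M (Model.holds_insert.2 ⟨hent M hM, hM⟩)⟩
  | redminus1 ψ hent hψ d ih =>
    obtain ⟨h1, h2, h3⟩ := ih ((constsOf_mono (subset_insert _ _)).trans hA) hB
    exact ⟨h1, fun M hM => h2 M (Model.holds_insert.1 hM).2, h3⟩
  | redminus2 ψ hent hψ d ih =>
    obtain ⟨h1, h2, h3⟩ := ih hA ((constsOf_mono (subset_insert _ _)).trans hB)
    exact ⟨h1, h2, fun M hM => h3 M (Model.holds_insert.1 hM).2⟩
  | constElim1 s a t _ _ _ d ih =>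
    obtain ⟨h1, h2, h3⟩ := ih ((constsOf_mono (subset_insert _ _)).trans hA) hB
    exact ⟨h1, fun M hM => h2 M (Model.holds_insert.1 hM).2, h3⟩
  | constElim2 s a t _ _ _ d ih =>
    obtain ⟨h1, h2, h3⟩ := ih hA ((constsOf_mono (subset_insert _ _)).trans hB)
    exact ⟨h1, h2, fun M hM => h3 M (Model.holds_insert.1 hM).2⟩
  | constElim0 s c t _ _ _ _ _ d ih =>
    obtain ⟨h1, h2, h3⟩ := ih ((constsOf_mono (subset_insert _ _)).trans hA)
      ((constsOf_mono (subset_insert _ _)).trans hB)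
    exact ⟨h1, fun M hM => h2 M (Model.holds_insert.1 hM).2,
      fun M hM => h3 M (Model.holds_insert.1 hM).2⟩

theorem isInterpolant_of_refutation (R : Refutation (root A B ord).toM) : IsInterpolant A B R.interpolant := by
  obtain ⟨h1, h2, h3⟩ := MDeriv.interp_spec R (Finset.Subset.refl _) (Finset.Subset.refl _)
  exact ⟨h1, h2, fun ⟨M, hM⟩ =>
    h3 M (Model.holds_insert.1 hM).2 (Model.holds_insert.1 hM).1⟩

/-! # Derivability by metarules -/

/-- The label `n` can be derived by metarules from open leaves in `H`. -/
abbrev Dv (H : MNode → Type) (n : MNode) : Prop := Nonempty (MDeriv H n)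

/-- Exchange of the two components of a label. -/
abbrev MNode.swap (n : MNode) : MNode := ⟨n.sigB, n.sigA, n.B, n.A⟩

theorem Dv.swap {H : MNode → Type} {n : MNode} (h : Dv H n) : Dv (fun m => H m.swap) n.swap := by
  obtain ⟨d⟩ := h
  induction d with
  | hyp h => exact ⟨.hyp h⟩
  | close1 h => exact ⟨.close2 h⟩
  | close2 h => exact ⟨.close1 h⟩
  | propagate1 ψ h1 h2 _ ih =>
    obtain ⟨d⟩ := ih
    exact ⟨.propagate2 ψ h1 (h2.trans (inter_comm _ _).subset) d⟩
  | propagate2 ψ h1 h2 _ ih =>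
    obtain ⟨d⟩ := ih
    exact ⟨.propagate1 ψ h1 (h2.trans (inter_comm _ _).subset) d⟩
  | define0 s a t h1 h2 _ ih =>
    obtain ⟨d⟩ := ih
    exact ⟨.define0 s a t (h1.trans (inter_comm _ _).subset)
      (fun h => h2 ((union_comm _ _).subset h)) d⟩
  | define1 s a t h1 h2 _ ih =>
    obtain ⟨d⟩ := ih
    exact ⟨.define2 s a t h1 (fun h => h2 ((union_comm _ _).subset h)) d⟩
  | define2 s a t h1 h2 _ ih =>
    obtain ⟨d⟩ := ih
    exact ⟨.define1 s a t h1 (fun h => h2 ((union_comm _ _).subset h)) d⟩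
  | disjunction1 n ψ h1 h2 _ ih => exact ⟨.disjunction2 n ψ h1 h2 fun k => (ih k).some⟩
  | disjunction2 n ψ h1 h2 _ ih => exact ⟨.disjunction1 n ψ h1 h2 fun k => (ih k).some⟩
  | redplus1 ψ h1 h2 _ ih =>
    obtain ⟨d⟩ := ih
    exact ⟨.redplus2 ψ h1 h2 d⟩
  | redplus2 ψ h1 h2 _ ih =>
    obtain ⟨d⟩ := ih
    exact ⟨.redplus1 ψ h1 h2 d⟩
  | redminus1 ψ h1 h2 _ ih =>
    obtain ⟨d⟩ := ih
    exact ⟨.redminus2 ψ h1 h2 d⟩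
  | redminus2 ψ h1 h2 _ ih =>
    obtain ⟨d⟩ := ih
    exact ⟨.redminus1 ψ h1 h2 d⟩
  | constElim1 s a t h1 h2 h3 _ ih =>
    obtain ⟨d⟩ := ih
    exact ⟨.constElim2 s a t h1 h2 h3 d⟩
  | constElim2 s a t h1 h2 h3 _ ih =>
    obtain ⟨d⟩ := ih
    exact ⟨.constElim1 s a t h1 h2 h3 d⟩
  | constElim0 s a t h1 h2 h3 h4 h5 _ ih =>
    obtain ⟨d⟩ := ih
    exact ⟨.constElim0 s a t ((inter_comm _ _).subset h1)
      (h2.trans (inter_comm _ _).subset) h4 h3 h5 d⟩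

/-- Case distinction in the first component. -/
theorem Dv.cases {H : MNode → Type} {SA SB : Finset Const} (l : List Form)
    (hl : ∀ ψ ∈ l, ψ.consts ⊆ SA) (hent : Entails A (.bigOr l))
    (h : ∀ ψ ∈ l, Dv H ⟨SA, SB, insert ψ A, B⟩) : Dv H ⟨SA, SB, A, B⟩ := by
  have hloc : (Form.bigOr l).consts ⊆ SA := fun c hc => by
    obtain ⟨ψ, hψ, hc⟩ := mem_consts_bigOr.1 hc
    exact hl ψ hψ hc
  match l with
  | [] => exact ⟨.redplus1 .bot hent (by simp [Form.consts]) (.close1 (mem_insert_self _ _))⟩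
  | φ :: l =>
    have e : List.ofFn (fun k : Fin (l.length + 1) => (φ :: l).get k) = φ :: l :=
      List.ofFn_get (φ :: l)
    exact ⟨.disjunction1 l.length (fun k => (φ :: l).get k) (e.symm ▸ hloc) (e.symm ▸ hent) fun k =>
      (h _ (List.get_mem _ _)).some⟩

/-- The pair of constraints is satisfiable. -/
def SatP (m : MNode) : Prop := ∃ M : Model, M.HoldsAll m.A ∧ M.HoldsAll m.B

theorem SatP.swap {m : MNode} (h : SatP m) : SatP m.swap :=
  let ⟨M, h1, h2⟩ := h
  ⟨M, h2, h1⟩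

/-- The label `m` is derivable from the label `m'`, and satisfiable if `m'` is. -/
structure Link (m m' : MNode) : Prop where
  der : ∀ H, Dv H m' → Dv H m
  sat : SatP m' → SatP m

theorem Link.refl (m : MNode) : Link m m := ⟨fun _ => id, id⟩

theorem Link.trans {m1 m2 m3 : MNode} (h : Link m1 m2) (h' : Link m2 m3) : Link m1 m3 :=
  ⟨fun H d => h.der H (h'.der H d), fun d => h.sat (h'.sat d)⟩

theorem Link.swap {m m' : MNode} (h : Link m m') : Link m.swap m'.swap :=
  ⟨fun _ d => (h.der _ d.swap).swap, fun d => (h.sat d.swap).swap⟩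

variable {SA SB : Finset Const} {A A' B B' : Finset Form}

theorem Link.union (D : Finset Form) (hD : ∀ ψ ∈ D, Entails A ψ) (hc : constsOf D ⊆ SA) :
    Link ⟨SA, SB, A, B⟩ ⟨SA, SB, D ∪ A, B⟩ := by
  refine ⟨fun H => ?_, fun ⟨M, h1, h2⟩ => ⟨M, h1.mono subset_union_right, h2⟩⟩
  induction D using Finset.induction_on with
  | empty => simp
  | insert ψ D _ ih =>
    rw [constsOf_insert] at hc
    rintro ⟨d⟩
    refine ih (fun φ hφ => hD φ (mem_insert_of_mem hφ))
      (union_subset_right hc) ⟨.redplus1 ψ (fun M hM => ?_) (union_subset_left hc)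
        (insert_union ψ D A ▸ d)⟩
    exact hD ψ (mem_insert_self _ _) M fun φ hφ => hM φ (mem_union_right _ hφ)

theorem Link.remove (D : Finset Form) (hD : ∀ ψ ∈ D, Entails A ψ) (hc : constsOf D ⊆ SA) :
    Link ⟨SA, SB, D ∪ A, B⟩ ⟨SA, SB, A, B⟩ := by
  refine ⟨fun H => ?_, fun ⟨M, h1, h2⟩ =>
    ⟨M, Model.holds_union.2 ⟨fun φ hφ => hD φ hφ M h1, h1⟩, h2⟩⟩
  induction D using Finset.induction_on with
  | empty => simp
  | insert ψ D _ ih =>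
    rw [constsOf_insert] at hc
    intro d
    obtain ⟨d⟩ := ih (fun φ hφ => hD φ (mem_insert_of_mem hφ)) (union_subset_right hc) d
    rw [insert_union]
    refine ⟨.redminus1 ψ (fun M hM => ?_) (union_subset_left hc) d⟩
    exact hD ψ (mem_insert_self _ _) M fun φ hφ => hM φ (mem_union_right _ hφ)

/-- Replacement of the first component by an equivalent one. -/
theorem Link.replace (h : ∀ M : Model, M.HoldsAll A ↔ M.HoldsAll A') (hA : constsOf A ⊆ SA)
    (hA' : constsOf A' ⊆ SA) : Link ⟨SA, SB, A, B⟩ ⟨SA, SB, A', B⟩ :=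
  .trans (.union A' (fun ψ hψ M hM => (h M).1 hM ψ hψ) hA') <| by
    rw [union_comm]
    exact .remove A (fun ψ hψ M hM => (h M).2 hM ψ hψ) hA

theorem Link.replace₂ (h : ∀ M : Model, M.HoldsAll B ↔ M.HoldsAll B') (hB : constsOf B ⊆ SB)
    (hB' : constsOf B' ⊆ SB) : Link ⟨SA, SB, A, B⟩ ⟨SA, SB, A, B'⟩ :=
  (Link.replace (SA := SB) (SB := SA) (B := A) h hB hB').swap

theorem Link.propagate (ψ : Form) (h : Entails A ψ) (hψ : ψ.consts ⊆ SA ∩ SB) :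
    Link ⟨SA, SB, A, B⟩ ⟨SA, SB, A, insert ψ B⟩ :=
  ⟨fun _ ⟨d⟩ => ⟨.propagate1 ψ h hψ d⟩,
    fun ⟨M, h1, h2⟩ => ⟨M, h1, h2.mono (subset_insert _ _)⟩⟩

/-- Introduction of a fresh constant `α` by a formula `D` equivalent to `α = t`. -/
theorem Link.define (sh : Bool) (s : Srt) (α : ℕ) (t : Term s) (D : Form) (hα : (s, α) ∉ SA ∪ SB)
    (ht : t.consts ⊆ SA) (ht' : sh = true → t.consts ⊆ SB)
    (hD : ∀ M : Model, M.Holds D ↔ M.Holds (.eq (.const s α) t))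
    (hDc : D.consts ⊆ insert (s, α) t.consts) (hA : constsOf A ⊆ SA) (hB : constsOf B ⊆ SB) :
    Link ⟨SA, SB, A, B⟩ ⟨insert (s, α) SA, if sh then insert (s, α) SB else SB, insert D A,
      if sh then insert D B else B⟩ := by
  have key : ∀ {S : Finset Const} {C : Finset Form}, constsOf C ⊆ S → t.consts ⊆ S →
      constsOf (insert (.eq (.const s α) t) C) ⊆ insert (s, α) S ∧
      constsOf (insert D C) ⊆ insert (s, α) S ∧ ∀ M : Model,
      M.HoldsAll (insert (.eq (.const s α) t) C) ↔ M.HoldsAll (insert D C) := by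
    intro S C hC hS
    refine ⟨?_, ?_, fun M => ?_⟩
    · rw [constsOf_insert]
      simp only [Form.consts, Term.consts]
      grind
    · rw [constsOf_insert]
      grind
    · rw [Model.holds_insert, Model.holds_insert, hD]
  obtain ⟨a1, a2, a3⟩ := key hA ht
  cases sh with
  | false =>
    refine .trans ⟨fun H ⟨d⟩ => ⟨.define1 s α t ht hα d⟩, fun ⟨M, h1, h2⟩ =>
      ⟨M, h1.mono (subset_insert _ _), h2⟩⟩ (.replace a3 a1 a2)
  | true =>
    obtain ⟨b1, b2, b3⟩ := key hB (ht' rfl)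
    refine .trans ⟨fun H ⟨d⟩ => ⟨.define0 s α t (subset_inter ht (ht' rfl)) hα d⟩,
      fun ⟨M, h1, h2⟩ => ⟨M, h1.mono (subset_insert _ _),
        h2.mono (subset_insert _ _)⟩⟩ ((Link.replace a3 a1 a2).trans (.replace₂ b3 b1 b2))

theorem Model.update_const_self (M : Model) (s : Srt) (n : ℕ) : M.update s n (M.const s n) = M := by
  have : (M.update s n (M.const s n)).const = M.const := by
    funext s' n'
    by_cases h : s = s' ∧ n = n'
    · obtain ⟨rfl, rfl⟩ := h
      simp
    · simp [h]
  cases M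
  simp only [Model.update] at this ⊢
  rw [this]

theorem holds_rename_iff {n m : ℕ} (h : M.const s n = M.const s m) (φ : Form) : M.Holds (φ.rename s n m) ↔ M.Holds φ := by
  have := M.holds_update_subst s n (.const s m) φ
  rw [show M.eval (.const s m) = M.const s n from h.symm, M.update_const_self] at this
  exact this.symm

theorem holdsAll_image_rename_iff {n m : ℕ} (h : M.const s n = M.const s m) (A : Finset Form) :
    M.HoldsAll (A.image (Form.rename s n m)) ↔ M.HoldsAll A := by
  simp [Model.HoldsAll, holds_rename_iff h]

theorem consts_rename_subset (s : Srt) (n m : ℕ) (φ : Form) :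
    (φ.rename s n m).consts ⊆ insert (s, m) (φ.consts.erase (s, n)) := by
  have := Form.consts_subst_subset s n (.const s m) φ
  simp only [Term.consts] at this
  intro c hc
  have := this hc
  grind

theorem constsOf_image_rename_subset (s : Srt) (n m : ℕ) (A : Finset Form) :
    constsOf (A.image (Form.rename s n m)) ⊆ insert (s, m) ((constsOf A).erase (s, n)) := by
  intro c hc
  obtain ⟨φ', hφ', hc⟩ := mem_constsOf.1 hc
  obtain ⟨φ, hφ, rfl⟩ := mem_image.1 hφ'
  have := consts_rename_subset s n m φ hc
  have := @subset_constsOf A φ hφ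
  grind

theorem notMem_constsOf_image_rename {n m : ℕ} (h : n ≠ m) (A : Finset Form) :
    (s, n) ∉ constsOf (A.image (Form.rename s n m)) := fun hc => by
  have := constsOf_image_rename_subset s n m A hc
  simp [h] at this

theorem Form.rename_of_notMem {n m : ℕ} (h : (s, n) ∉ φ.consts) :
    φ.rename s n m = φ := φ.subst_of_notMem s n _ h

theorem image_rename_of_notMem {n m : ℕ} (h : (s, n) ∉ constsOf A) :
    A.image (Form.rename s n m) = A := by
  ext ψ
  simp only [mem_image]
  constructor
  · rintro ⟨φ, hφ, rfl⟩
    rwa [Form.rename_of_notMem fun hc => h (subset_constsOf hφ hc)]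
  · exact fun hψ => ⟨ψ, hψ, Form.rename_of_notMem fun hc => h (subset_constsOf hψ hc)⟩

/-- Elimination of a constant that is equal to another constant. -/
theorem Link.identify {n m : ℕ} (hnm : n ≠ m) (hA : constsOf A ⊆ SA) (hB : constsOf B ⊆ SB)
    (hn : (s, n) ∈ SA) (hm : (s, m) ∈ SA) (hm' : (s, n) ∈ SB → (s, m) ∈ SB)
    (h : Entails A (.eq (.const s n) (.const s m))) :
    Link ⟨SA, SB, A, B⟩ ⟨SA, SB, A.image (Form.rename s n m),
      if (s, n) ∈ SA ∩ SB then B.image (Form.rename s n m) else B⟩ := by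
  have key : ∀ {S : Finset Const} {C : Finset Form}, constsOf C ⊆ S → (s, n) ∈ S → (s, m) ∈ S →
      (∀ M : Model, M.HoldsAll (insert (.eq (.const s n) (.const s m)) C) ↔
        M.HoldsAll (insert (.eq (.const s n) (.const s m)) (C.image (Form.rename s n m)))) ∧
      constsOf (insert (.eq (.const s n) (.const s m)) C) ⊆ S ∧
      constsOf (insert (.eq (.const s n) (.const s m)) (C.image (Form.rename s n m))) ⊆ S := by
    intro S C hC hn hm
    have := constsOf_image_rename_subset s n m C
    refine ⟨fun M => ?_, ?_, ?_⟩
    · rw [Model.holds_insert, Model.holds_insert]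
      exact and_congr_right fun h => (holdsAll_image_rename_iff h C).symm
    · rw [constsOf_insert]
      simp only [Form.consts, Term.consts]
      grind
    · rw [constsOf_insert]
      simp only [Form.consts, Term.consts]
      grind
  have hself : ∀ M : Model, M.HoldsAll A ↔
      M.HoldsAll (insert (.eq (.const s n) (.const s m)) A) := fun M => by
    rw [Model.holds_insert]
    exact ⟨fun hM => ⟨h M hM, hM⟩, fun hM => hM.2⟩
  obtain ⟨a1, a2, a3⟩ := key hA hn hm
  have hL := Link.replace (SB := SB) (B := B) (fun M => (hself M).trans (a1 M)) hA a3
  have hnt : (s, n) ∉ (Term.const s m).consts := by simp [Term.consts, hnm]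
  by_cases hc : (s, n) ∈ SA ∩ SB
  · rw [if_pos hc]
    have hn' := (mem_inter.1 hc).2
    obtain ⟨b1, b2, b3⟩ := key hB hn' (hm' hn')
    have hcm : (s, m) ∈ SA ∩ SB := mem_inter.2 ⟨hm, hm' hn'⟩
    have hL' := hL.trans ((Link.propagate (.eq (.const s n) (.const s m))
      (fun M hM => hM _ (mem_insert_self _ _)) (by
        simp only [Form.consts, Term.consts]
        grind)).trans (.replace₂ b1 b2 b3))
    refine hL'.trans ⟨fun H ⟨d⟩ => ⟨.constElim0 s n (.const s m) hc (by simpa [Term.consts] using hcm)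
      (notMem_constsOf_image_rename hnm A) (notMem_constsOf_image_rename hnm B) hnt d⟩, ?_⟩
    rintro ⟨M, h1, h2⟩
    refine ⟨M.update s n (M.const s m), ?_⟩
    have he : (M.update s n (M.const s m)).Holds (.eq (.const s n) (.const s m)) := by
      simp only [Model.Holds]
      rw [M.eval_update_self, M.eval_update_of_notMem _ _ _ _ hnt]
      rfl
    rw [Model.holds_insert, Model.holds_insert,
      M.holdsAll_update_of_notMem _ _ _ _ (notMem_constsOf_image_rename hnm A),
      M.holdsAll_update_of_notMem _ _ _ _ (notMem_constsOf_image_rename hnm B)]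
    exact ⟨⟨he, h1⟩, ⟨he, h2⟩⟩
  · rw [if_neg hc]
    have hnB : (s, n) ∉ SB := fun h => hc (mem_inter.2 ⟨hn, h⟩)
    refine hL.trans ⟨fun H ⟨d⟩ => ⟨.constElim1 s n (.const s m) (mem_sdiff.2 ⟨hn, hnB⟩)
      (notMem_constsOf_image_rename hnm A) hnt d⟩, ?_⟩
    rintro ⟨M, h1, h2⟩
    refine ⟨M.update s n (M.const s m), ?_⟩
    have he : (M.update s n (M.const s m)).Holds (.eq (.const s n) (.const s m)) := by
      simp only [Model.Holds]
      rw [M.eval_update_self, M.eval_update_of_notMem _ _ _ _ hnt]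
      rfl
    rw [Model.holds_insert,
      M.holdsAll_update_of_notMem _ _ _ _ (notMem_constsOf_image_rename hnm A),
      M.holdsAll_update_of_notMem _ _ _ _ (fun h => hnB (hB h))]
    exact ⟨⟨he, h1⟩, h2⟩

/-! # Sound instructions -/

/-- The passage from `n` to its successors `cs` is justified by metarules, and `n` is satisfiable if
one of its successors is. -/
structure Sound (n : Node) (cs : List Node) : Prop where
  der : ∀ H, (∀ c ∈ cs, Dv H c.toM) → Dv H n.toM
  sat : ∀ c ∈ cs, SatP c.toM → SatP n.toM

theorem Sound.of_link {n c : Node} (h : Link n.toM c.toM) : Sound n [c] :=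
  ⟨fun H hc => h.der H (hc c (by simp)), by simpa using h.sat⟩

theorem Sound.swap (h : Sound n.swap cs) :
    Sound n (cs.map Node.swap) := by
  refine ⟨fun H hc => ?_, fun c hc hs => ?_⟩
  · exact (h.der (fun m => H m.swap) fun c hcs => (hc c.swap (List.mem_map.2 ⟨c, hcs, rfl⟩)).swap).swap
  · obtain ⟨d, hd, rfl⟩ := List.mem_map.1 hc
    exact (h.sat d hd hs.swap).swap

theorem Sound.nonempty_deriv (h : Sound n cs) :
    Nonempty (MDeriv (SuccHyp cs) n.toM) :=
  h.der _ fun c hc => by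
    obtain ⟨k, hk, rfl⟩ := List.mem_iff_getElem.1 hc
    exact ⟨.hyp ⟨⟨k, hk⟩, rfl⟩⟩

/-! # Interpolating trees -/

theorem Tree.Succs.unique {T : Tree} {p : List ℕ} {cs ds : List Node} (h : T.Succs p cs)
    (h' : T.Succs p ds) : cs = ds := by
  refine List.ext_getElem? fun k => ?_
  rw [← h k, ← h' k]

theorem exists_isInterpolatingTree (n₀ : Node) : ∃ T, IsInterpolatingTree n₀ T := by
  classical
  let next : Node → List Node := fun n => if h : ∃ cs, Step n cs then h.choose else []
  let T : Tree := fun p => p.foldl (fun o k => o.bind fun n => (next n)[k]?) (some n₀)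
  have hT : ∀ p k, T (p ++ [k]) = (T p).bind fun n => (next n)[k]? := fun p k => by
    simp only [T, List.foldl_append, List.foldl_cons, List.foldl_nil]
  refine ⟨T, rfl, fun p k h => by rw [hT, h]; rfl, fun p n h => ?_⟩
  have hs : T.Succs p (next n) := fun k => by rw [hT, h]; rfl
  by_cases hn : ∃ cs, Step n cs
  · refine .inl ⟨next n, ?_, hs⟩
    simp only [next, dif_pos hn]
    exact hn.choose_spec
  · refine .inr ⟨fun cs h => hn ⟨cs, h⟩, ?_⟩
    simpa [next, hn] using hs

/-- `c` is a successor of `n` by some instruction. -/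
def Child (c n : Node) : Prop := ∃ cs, Step n cs ∧ c ∈ cs

theorem finite_above_of_acc {n₀ : Node} {T : Tree} (hT : IsInterpolatingTree n₀ T)
    (hn : Acc Child n) : ∀ p, T p = some n → {q | T (p ++ q) ≠ none}.Finite := by
  induction hn with
  | intro n _ ih =>
    intro p hp
    obtain ⟨cs, hcs, hsucc⟩ : ∃ cs, (∀ c ∈ cs, Child c n) ∧ T.Succs p cs := by
      rcases hT.2.2 p n hp with ⟨cs, h, h'⟩ | ⟨_, h'⟩
      · exact ⟨cs, fun c hc => ⟨cs, h, hc⟩, h'⟩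
      · exact ⟨[], by simp, h'⟩
    have hnone : ∀ q k, T (p ++ [k]) = none → T (p ++ k :: q) = none := by
      intro q k h
      induction q using List.reverseRecOn with
      | nil => exact h
      | append_singleton q j ih => 
        have := hT.2.1 _ j ih
        simpa using this
    have hfin : ∀ k : Fin cs.length, {q | T (p ++ k.val :: q) ≠ none}.Finite := fun k => by
      have := ih (cs.get k) (hcs _ (List.get_mem _ _)) (p ++ [k.val]) (by simp [hsucc k.val])
      simpa using this
    refine ((Set.finite_singleton []).union
      (Set.finite_iUnion fun k : Fin cs.length => (hfin k).image (List.cons k.val))).subset ?_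
    intro q hq
    match q with
    | [] => exact .inl rfl
    | k :: q =>
      have hk : k < cs.length := by
        by_contra hk
        exact hq (hnone q k (by rw [hsucc k, List.getElem?_eq_none (not_lt.1 hk)]))
      exact .inr (Set.mem_iUnion.2 ⟨⟨k, hk⟩, q, hq, rfl⟩)

theorem exists_expansion {n₀ : Node} {T : Tree} (hT : IsInterpolatingTree n₀ T)
    (hR : IsRefutation T) (hn : Acc Child n) :
    ∀ p, T p = some n → ∃ R, Expansion T p n.toM R := by
  induction hn with
  | intro n _ ih =>
    intro p hp
    obtain ⟨cs, hcs, hsucc⟩ : ∃ cs, (∀ c ∈ cs, Child c n) ∧ T.Succs p cs := by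
      rcases hT.2.2 p n hp with ⟨cs, h, h'⟩ | ⟨_, h'⟩
      · exact ⟨cs, fun c hc => ⟨cs, h, hc⟩, h'⟩
      · exact ⟨[], by simp, h'⟩
    by_cases hnil : cs = []
    · subst hnil
      rcases mem_union.1 (hR.2.1 p n hp hsucc) with h | h
      · exact ⟨_, .leaf1 p n hp hsucc h⟩
      · exact ⟨_, .leaf2 p n hp hsucc h⟩
    · obtain ⟨J⟩ := hR.2.2 p n cs hp hsucc hnil
      choose R hR using fun k : Fin cs.length =>
        ih (cs.get k) (hcs _ (List.get_mem _ _)) (p ++ [k.val]) (by simp [hsucc k.val])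
      exact ⟨_, .inner p n cs hp hsucc hnil J R hR⟩

/-! # Nested writes -/

theorem wrs_append (x : Term .array) (V W : List (ℕ × ℕ)) : wrs x (V ++ W) = wrs (wrs x V) W := by
  simp [wrs, List.foldl_append]

theorem wrs_snoc (x : Term .array) (W : List (ℕ × ℕ)) (p : ℕ × ℕ) :
    wrs x (W ++ [p]) = .wr (wrs x W) (idx p.1) (el p.2) := by
  simp [wrs, List.foldl_append]

theorem wrs_inj {a b : ℕ} :
    wrs (arr a) V = wrs (arr b) W ↔ a = b ∧ V = W := by
  refine ⟨fun h => ?_, by rintro ⟨rfl, rfl⟩; rfl⟩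
  induction V using List.reverseRecOn generalizing W with
  | nil =>
    induction W using List.reverseRecOn with
    | nil => simpa [wrs] using h
    | append_singleton W q _ => simp [wrs] at h
  | append_singleton V p ih =>
    induction W using List.reverseRecOn with
    | nil => simp [wrs] at h
    | append_singleton W q _ =>
      simp only [wrs_snoc, Term.wr.injEq, Term.const.injEq] at h
      obtain ⟨h1, h2, h3⟩ := h
      obtain ⟨rfl, rfl⟩ := ih h1
      exact ⟨rfl, by rw [Prod.ext h2 h3]⟩

theorem wrs_eq_arr {a b : ℕ} : wrs (arr a) V = arr b ↔ a = b ∧ V = [] :=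
  wrs_inj (W := [])

theorem mem_consts_wrs {x : Term .array} {c : Const} :
    c ∈ (wrs x W).consts ↔
      c ∈ x.consts ∨ ∃ p ∈ W, c = (.index, p.1) ∨ c = (.elem, p.2) := by
  induction W using List.reverseRecOn with
  | nil => simp [wrs]
  | append_singleton W q ih =>
    simp only [wrs_snoc, Term.consts, mem_union, ih, mem_singleton, List.mem_append,
      List.mem_singleton]
    grind

theorem consts_wrs_subset {x : Term .array} :
    (wrs x W).consts ⊆ S ↔
      x.consts ⊆ S ∧ ∀ p ∈ W, (.index, p.1) ∈ S ∧ (.elem, p.2) ∈ S := by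
  simp only [subset_iff, mem_consts_wrs]
  constructor
  · intro h
    exact ⟨fun c hc => h (.inl hc), fun p hp => ⟨h (.inr ⟨p, hp, .inl rfl⟩), h (.inr ⟨p, hp, .inr rfl⟩)⟩⟩
  · rintro ⟨h1, h2⟩ c (hc | ⟨p, hp, rfl | rfl⟩)
    exacts [h1 hc, (h2 p hp).1, (h2 p hp).2]

/-! # The precedence -/

theorem prec_iff (hn : ord.Nodup) {x y : ℕ} :
    Prec ord s x y ↔
      (s, x) ∈ ord ∧ (s, y) ∈ ord ∧ ord.idxOf (s, x) < ord.idxOf (s, y) := by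
  unfold Prec
  induction ord with
  | nil => simp
  | cons c ord ih =>
    rw [List.nodup_cons] at hn
    by_cases hx : (s, x) = c
    · subst hx
      rw [List.cons_sublist_cons, List.singleton_sublist]
      by_cases hy : (s, y) = (s, x)
      · rw [hy]
        simp [hn.1]
      · simp [List.idxOf_cons_ne _ (Ne.symm hy), hy]
    · rw [List.sublist_cons_iff]
      have hx' : c ≠ (s, x) := Ne.symm hx
      have : ¬ ∃ r, [(s, x), (s, y)] = c :: r ∧ r.Sublist ord := by
        rintro ⟨r, h, _⟩
        simp only [List.cons.injEq] at h
        exact hx h.1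
      rw [or_iff_left this, ih hn.2, List.idxOf_cons_ne _ hx']
      by_cases hy : (s, y) = c
      · subst hy
        simp [hn.1]
      · have hy' : c ≠ (s, y) := Ne.symm hy
        simp [List.idxOf_cons_ne _ hy', hx, hy]

theorem Prec.lt (hn : ord.Nodup) {x y : ℕ} (h : Prec ord s x y) :
    ord.idxOf (s, x) < ord.idxOf (s, y) := ((prec_iff hn).1 h).2.2

theorem Prec.irrefl (hn : ord.Nodup) {x : ℕ} : ¬ Prec ord s x x :=
  fun h => lt_irrefl _ (h.lt hn)

theorem Prec.asymm (hn : ord.Nodup) {x y : ℕ} (h : Prec ord s x y) :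
    ¬ Prec ord s y x := fun h' => lt_asymm (h.lt hn) (h'.lt hn)

theorem Prec.trans (hn : ord.Nodup) {x y z : ℕ} (h : Prec ord s x y) (h' : Prec ord s y z) : Prec ord s x z := by
  rw [prec_iff hn] at *
  exact ⟨h.1, h'.2.1, h.2.2.trans h'.2.2⟩

theorem Prec.mem_left {x y : ℕ} (h : Prec ord s x y) : (s, x) ∈ ord :=
  h.subset (by simp)

theorem Prec.mem_right {x y : ℕ} (h : Prec ord s x y) :
    (s, y) ∈ ord := h.subset (by simp)

theorem prec_total (hn : ord.Nodup) {x y : ℕ} (hx : (s, x) ∈ ord) (hy : (s, y) ∈ ord)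
    (hxy : x ≠ y) : Prec ord s x y ∨ Prec ord s y x := by
  rw [prec_iff hn, prec_iff hn]
  have : ord.idxOf (s, x) ≠ ord.idxOf (s, y) := fun h => by
    have := (List.idxOf_inj hx).1 h
    simp [hxy] at this
  rcases lt_or_gt_of_ne this with h | h
  · exact .inl ⟨hx, hy, h⟩
  · exact .inr ⟨hy, hx, h⟩

theorem Prec.mono (h : ord.Sublist ord') {x y : ℕ} (hp : Prec ord s x y) : Prec ord' s x y := List.Sublist.trans hp h

/-! # Rules -/

theorem LitRule.eq_or (h : LitRule ord L l r) : L = .eq l r ∨ L = .eq r l := by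
  cases h <;> simp

theorem LitRule.mono (hs : ord.Sublist ord') (h : LitRule ord L l r) : LitRule ord' L l r := by
  cases h with
  | arr a b W h => exact .arr a b W (h.mono hs)
  | arrSymm a b h => exact .arrSymm a b (h.mono hs)
  | rd a i e => exact .rd a i e
  | elem e d h => exact .elem e d (h.mono hs)
  | elemSymm e d h => exact .elemSymm e d (h.mono hs)

theorem LitRule.consts_subset (h : LitRule ord L l r) : l.consts ⊆ L.consts ∧ r.consts ⊆ L.consts ∧
      L.consts ⊆ l.consts ∪ r.consts := by
  rcases h.eq_or with rfl | rfl <;> simp only [Form.consts] <;> grind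

theorem litRule_arr {a : ℕ} {r : Term .array} :
    LitRule ord L (arr a) r ↔ ∃ b W, r = wrs (arr b) W ∧ Prec ord .array b a ∧
      (L = .eq (arr a) r ∨ W = [] ∧ L = .eq (arr b) (arr a)) := by
  constructor
  · intro h
    cases h with
    | arr _ b W h => exact ⟨b, W, rfl, h, .inl rfl⟩
    | arrSymm _ b h => exact ⟨b, [], rfl, h, .inr ⟨rfl, rfl⟩⟩
  · rintro ⟨b, W, rfl, h, rfl | ⟨rfl, rfl⟩⟩
    · exact .arr a b W h
    · exact .arrSymm a b h

theorem litRule_rd {a i : ℕ} {r : Term .elem} :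
    LitRule ord L (.rd (arr a) (idx i)) r ↔ ∃ e, r = el e ∧ L = .eq (.rd (arr a) (idx i)) (el e) := by
  constructor
  · intro h
    cases h with
    | rd _ _ e => exact ⟨e, rfl, rfl⟩
  · rintro ⟨e, rfl, rfl⟩
    exact .rd a i e

theorem litRule_elem {e : ℕ} {r : Term .elem} :
    LitRule ord L (el e) r ↔ ∃ d, r = el d ∧ Prec ord .elem d e ∧
      (L = .eq (el e) (el d) ∨ L = .eq (el d) (el e)) := by
  constructor
  · intro h
    cases h with
    | elem _ d h => exact ⟨d, rfl, h, .inl rfl⟩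
    | elemSymm _ d h => exact ⟨d, rfl, h, .inr rfl⟩
  · rintro ⟨d, rfl, h, rfl | rfl⟩
    exacts [.elem e d h, .elemSymm e d h]

theorem litRule_lhs_cases (h : LitRule ord L l r) : (∃ a b W, s = .array ∧ l ≍ arr a ∧ r ≍ wrs (arr b) W) ∨
      (∃ a i e, s = .elem ∧ l ≍ Term.rd (arr a) (idx i) ∧ r ≍ el e) ∨
      (∃ e d, s = .elem ∧ l ≍ el e ∧ r ≍ el d) := by
  cases h with
  | arr a b W h => exact .inl ⟨a, b, W, rfl, .rfl, .rfl⟩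
  | arrSymm a b h => exact .inl ⟨a, b, [], rfl, .rfl, .rfl⟩
  | rd a i e => exact .inr (.inl ⟨a, i, e, rfl, .rfl, .rfl⟩)
  | elem e d h => exact .inr (.inr ⟨e, d, rfl, .rfl, .rfl⟩)
  | elemSymm e d h => exact .inr (.inr ⟨e, d, rfl, .rfl, .rfl⟩)

/-! # Weights of terms -/

/-- The sum of the ranks of the array constants. -/
def Term.wtA (ord : List Const) : {s : Srt} → Term s → ℕ
  | _, .const .array n => ord.idxOf (.array, n) + 1
  | _, .const .index _ => 0
  | _, .const .elem _ => 0
  | _, .rd x i => x.wtA ord + i.wtA ord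
  | _, .wr x i e => x.wtA ord + i.wtA ord + e.wtA ord
  | _, .diff x y => x.wtA ord + y.wtA ord

/-- The number of writes. -/
def Term.wtW : {s : Srt} → Term s → ℕ
  | _, .const _ _ => 0
  | _, .rd x i => x.wtW + i.wtW
  | _, .wr x i e => x.wtW + i.wtW + e.wtW + 1
  | _, .diff x y => x.wtW + y.wtW

/-- The rank of an index constant. -/
def Term.wtI (ord : List Const) : Term .index → ℕ
  | .const _ n => ord.idxOf (.index, n)
  | .diff _ _ => 0

/-- The sum of the ranks of the index constants at which an array term is written. -/
def Term.wtR (ord : List Const) : {s : Srt} → Term s → ℕ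
  | _, .wr x i _ => x.wtR ord + i.wtI ord
  | _, .const _ _ => 0
  | _, .rd _ _ => 0
  | _, .diff _ _ => 0

/-- A measure for the ranks of the elements and the order of the writes. -/
def Term.wtE (ord : List Const) : {s : Srt} → Term s → ℕ
  | _, .const .array _ => 0
  | _, .const .index n => ord.idxOf (.index, n) + 1
  | _, .const .elem n => ord.idxOf (.elem, n) + 1
  | _, .rd x i => x.wtE ord + i.wtE ord
  | _, .wr x i e => x.wtE ord + x.wtR ord + i.wtE ord + e.wtE ord
  | _, .diff x y => x.wtE ord + y.wtE ord

/-- The strict lexicographic order on weights. -/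
def Term.Lt (ord : List Const) {s s' : Srt} (t : Term s) (u : Term s') : Prop :=
  t.wtA ord < u.wtA ord ∨ t.wtA ord = u.wtA ord ∧
    (t.wtW < u.wtW ∨ t.wtW = u.wtW ∧ t.wtE ord < u.wtE ord)

/-- The lexicographic order on weights. -/
def Term.Le (ord : List Const) {s s' : Srt} (t : Term s) (u : Term s') : Prop :=
  t.wtA ord < u.wtA ord ∨ t.wtA ord = u.wtA ord ∧
    (t.wtW < u.wtW ∨ t.wtW = u.wtW ∧ t.wtE ord ≤ u.wtE ord)

theorem wtA_wrs (ord : List Const) (x : Term .array) (W : List (ℕ × ℕ)) :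
    (wrs x W).wtA ord = x.wtA ord := by
  induction W using List.reverseRecOn with
  | nil => rfl
  | append_singleton W p ih => simp [wrs_snoc, Term.wtA, ih]

theorem wtW_wrs (x : Term .array) (W : List (ℕ × ℕ)) : (wrs x W).wtW = x.wtW + W.length := by
  induction W using List.reverseRecOn with
  | nil => rfl
  | append_singleton W p ih =>
    simp [wrs_snoc, Term.wtW, ih]
    omega

theorem litRule_lt (hn : ord.Nodup) (h : LitRule ord L l r) : r.Lt ord l ∧ (s = .array → r.wtA ord < l.wtA ord) := by
  cases h with
  | arr a b W h =>
    have := h.lt hn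
    have : (wrs (arr b) W).wtA ord < (arr a).wtA ord := by
      rw [wtA_wrs]
      simpa [Term.wtA] using this
    exact ⟨.inl this, fun _ => this⟩
  | arrSymm a b h =>
    have := h.lt hn
    have : (arr b).wtA ord < (arr a).wtA ord := by simpa [Term.wtA] using this
    exact ⟨.inl this, fun _ => this⟩
  | rd a i e => exact ⟨.inl (by simp [Term.wtA]), by simp⟩
  | elem e d h | elemSymm e d h =>
    have := h.lt hn
    exact ⟨.inr ⟨rfl, .inr ⟨rfl, by simpa [Term.wtE] using this⟩⟩, by simp⟩

theorem wtA_pos (ord : List Const) (x : Term .array) : 0 < x.wtA ord := by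
  cases x with
  | const _ n => simp [Term.wtA]
  | wr x i e =>
    have := wtA_pos ord x
    simp only [Term.wtA]
    omega

theorem Rew.wt (hn : ord.Nodup) (h : Rew ord A t u) : u.wtA ord < t.wtA ord ∨ u.wtA ord = t.wtA ord ∧
      (u.wtW < t.wtW ∨ u.wtW = t.wtW ∧ u.wtE ord < t.wtE ord ∧ u.wtR ord = t.wtR ord) := by
  induction h with
  | @ground s l r L hL h =>
    have h1 := litRule_lt hn h
    rcases litRule_lhs_cases h with ⟨a, b, W, rfl, h2, h3⟩ | ⟨a, i, e, rfl, h2, h3⟩ | ⟨e, d, rfl, h2, h3⟩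
    · exact .inl (h1.2 rfl)
    · cases h2
      cases h3
      exact .inl (by simp [Term.wtA])
    · cases h2
      cases h3
      rcases h1.1 with h | ⟨h, h' | ⟨h', h''⟩⟩
      · exact .inl h
      · exact .inr ⟨h, .inl h'⟩
      · exact .inr ⟨h, .inr ⟨h', h'', rfl⟩⟩
  | readOther x i j e h =>
    refine .inr ⟨by simp [Term.wtA], .inl ?_⟩
    simp only [Term.wtW]
    omega
  | readSame x i e =>
    have := wtA_pos ord x
    refine .inl ?_
    simp only [Term.wtA]
    omega
  | sort x i j e d h =>
    have := h.lt hn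
    refine .inr ⟨by simp only [Term.wtA], .inr ⟨by simp only [Term.wtW], ?_, ?_⟩⟩ <;>
    simp only [Term.wtE, Term.wtR, Term.wtI] <;> omega
  | overwrite x i e d =>
    refine .inr ⟨by simp only [Term.wtA], .inl ?_⟩
    simp only [Term.wtW]
    omega
  | rd₁ i h ih | rd₂ x h ih | wr₁ i e h ih | wr₃ x i h ih | diff₁ y h ih | diff₂ x h ih =>
    simp only [Term.wtA, Term.wtW, Term.wtE, Term.wtR, and_true]
    omega
  | wr₂ x e h ih =>
    have : ∀ {i i' : Term .index}, Rew ord A i i' → i.wtI ord = i'.wtI ord := by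
      intro i i' h
      cases h with
      | ground L hL h => rcases litRule_lhs_cases h with ⟨_, _, _, h, _⟩ | ⟨_, _, _, h, _⟩ | ⟨_, _, h, _⟩ <;> cases h
      | diff₁ y h => rfl
      | diff₂ x h => rfl
    have := this h
    simp only [Term.wtA, Term.wtW, Term.wtE, Term.wtR]
    omega

theorem Rew.lt (hn : ord.Nodup) (h : Rew ord A t u) : u.Lt ord t := by
  have := h.wt hn
  unfold Term.Lt
  omega

theorem Rews.eq_or_lt (hn : ord.Nodup) (h : Rews ord A t u) : u = t ∨ u.Lt ord t := by
  induction h with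
  | refl => exact .inl rfl
  | tail _ h ih =>
    have := h.lt hn
    rcases ih with rfl | ih
    · exact .inr this
    · unfold Term.Lt at *
      omega

theorem wellFounded_termLt (ord : List Const) (s : Srt) :
    WellFounded fun t u : Term s => t.Lt ord u := by
  refine Subrelation.wf (r := InvImage (Prod.Lex (· < ·) (Prod.Lex (· < ·) (· < ·)))
    fun t : Term s => (t.wtA ord, t.wtW, t.wtE ord)) ?_
    (InvImage.wf _ (WellFounded.prod_lex wellFounded_lt (WellFounded.prod_lex wellFounded_lt
      wellFounded_lt)))
  intro t u h
  simpa [InvImage, Prod.lex_def, Term.Lt] using h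

theorem exists_NF (hn : ord.Nodup) (A : Finset Form) (t : Term s) :
    ∃ u, NF ord A t u := by
  induction t using (wellFounded_termLt ord s).induction with
  | _ t ih =>
    by_cases h : ∃ u, Rew ord A t u
    · obtain ⟨u, hu⟩ := h
      obtain ⟨v, hv, hv'⟩ := ih u (hu.lt hn)
      exact ⟨v, .head hu hv, hv'⟩
    · exact ⟨t, .refl, fun u hu => h ⟨u, hu⟩⟩

/-! # The shape of rewriting steps on flat terms -/

theorem Rew.wrs {x x' : Term .array} (h : Rew ord A x x') (W : List (ℕ × ℕ)) : Rew ord A (wrs x W) (wrs x' W) := by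
  induction W using List.reverseRecOn with
  | nil => exact h
  | append_singleton W p ih =>
    rw [wrs_snoc, wrs_snoc]
    exact .wr₁ _ _ ih

theorem Rew.mono (hs : ord.Sublist ord') (hA : A ⊆ A') (h : Rew ord A t u) : Rew ord' A' t u := by
  induction h with
  | ground L hL h => exact .ground L (hA hL) (h.mono hs)
  | readOther x i j e h => exact .readOther x i j e h
  | readSame x i e => exact .readSame x i e
  | sort x i j e d h => exact .sort x i j e d (h.mono hs)
  | overwrite x i e d => exact .overwrite x i e d
  | rd₁ i _ ih => exact .rd₁ i ih
  | rd₂ x _ ih => exact .rd₂ x ih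
  | wr₁ i e _ ih => exact .wr₁ i e ih
  | wr₂ x e _ ih => exact .wr₂ x e ih
  | wr₃ x i _ ih => exact .wr₃ x i ih
  | diff₁ y _ ih => exact .diff₁ y ih
  | diff₂ x _ ih => exact .diff₂ x ih

theorem Rews.mono (hs : ord.Sublist ord') (hA : A ⊆ A') (h : Rews ord A t u) : Rews ord' A' t u :=
  Relation.ReflTransGen.mono (fun _ _ => Rew.mono hs hA) _ _ h

theorem not_rew_idx {i : ℕ} {u : Term .index} :
    ¬ Rew ord A (idx i) u := by
  intro h
  cases h with
  | ground L hL h => rcases litRule_lhs_cases h with ⟨_, _, _, h, _⟩ | ⟨_, _, _, h, _⟩ | ⟨_, _, h, _⟩ <;> cases h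

theorem rew_arr {a : ℕ} {u : Term .array} :
    Rew ord A (arr a) u ↔ ∃ L ∈ A, LitRule ord L (arr a) u := by
  constructor
  · intro h
    cases h with
    | ground L hL h => exact ⟨L, hL, h⟩
  · rintro ⟨L, hL, h⟩
    exact .ground L hL h

theorem rew_el {e : ℕ} {u : Term .elem} :
    Rew ord A (el e) u ↔ ∃ L ∈ A, LitRule ord L (el e) u := by
  constructor
  · intro h
    cases h with
    | ground L hL h => exact ⟨L, hL, h⟩
  · rintro ⟨L, hL, h⟩
    exact .ground L hL h

theorem Rew.wrs_shape {b : ℕ} {u : Term .array} (h : Rew ord A (AXdiff.wrs (arr b) W) u) : ∃ b' W',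
      u = AXdiff.wrs (arr b') W' ∧
      ((∃ L ∈ A, ∃ V, LitRule ord L (arr b) (AXdiff.wrs (arr b') V) ∧ W' = V ++ W) ∨
        b' = b ∧ ∀ i, i ∈ W'.map Prod.fst ↔ i ∈ W.map Prod.fst) := by
  induction W using List.reverseRecOn generalizing u with
  | nil =>
    obtain ⟨L, hL, h⟩ := rew_arr.1 h
    obtain ⟨b', V, rfl, _⟩ := litRule_arr.1 h
    exact ⟨b', V, rfl, .inl ⟨L, hL, V, h, by simp⟩⟩
  | append_singleton W p ih =>
    rw [wrs_snoc] at h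
    generalize hx : AXdiff.wrs (arr b) W = x at h
    cases h with
    | ground L hL h => rcases litRule_lhs_cases h with ⟨_, _, _, _, h, _⟩ | ⟨_, _, _, h, _⟩ | ⟨_, _, h, _⟩ <;> cases h
    | sort x i j e d h =>
      induction W using List.reverseRecOn with
      | nil => simp [AXdiff.wrs] at hx
      | append_singleton W q _ =>
        rw [wrs_snoc] at hx
        simp only [Term.wr.injEq, Term.const.injEq] at hx
        obtain ⟨rfl, rfl, rfl⟩ := hx
        refine ⟨b, W ++ [p, q], ?_, .inr ⟨rfl, fun i => ?_⟩⟩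
        · rw [show W ++ [p, q] = (W ++ [p]) ++ [q] by simp, wrs_snoc, wrs_snoc]
        · simp only [List.map_append, List.mem_append, List.map_cons, List.mem_cons, List.map_nil]
          grind
    | overwrite x i e d =>
      induction W using List.reverseRecOn with
      | nil => simp [AXdiff.wrs] at hx
      | append_singleton W q _ =>
        rw [wrs_snoc] at hx
        simp only [Term.wr.injEq, Term.const.injEq] at hx
        obtain ⟨rfl, hq, rfl⟩ := hx
        refine ⟨b, W ++ [p], ?_, .inr ⟨rfl, fun i => ?_⟩⟩
        · rw [wrs_snoc]
        · simp only [List.map_append, List.mem_append, List.map_cons, List.mem_cons, List.map_nil]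
          grind
    | wr₁ i e h =>
      subst hx
      obtain ⟨b', W', rfl, h'⟩ := ih h
      refine ⟨b', W' ++ [p], (wrs_snoc _ _ _).symm, ?_⟩
      rcases h' with ⟨L, hL, V, h', rfl⟩ | ⟨rfl, h'⟩
      · exact .inl ⟨L, hL, V, h', by simp⟩
      · exact .inr ⟨rfl, fun i => by simp only [List.map_append, List.mem_append, h' i]⟩
    | wr₂ x e h => exact (not_rew_idx h).elim
    | wr₃ x i h =>
      obtain ⟨L, hL, h⟩ := rew_el.1 h
      obtain ⟨d, rfl, _⟩ := litRule_elem.1 h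
      subst hx
      refine ⟨b, W ++ [(p.1, d)], (wrs_snoc _ _ (p.1, d)).symm, .inr ⟨rfl, fun i => ?_⟩⟩
      simp

theorem Rew.rd_shape {b i : ℕ} {u : Term .elem}
    (h : Rew ord A (.rd (AXdiff.wrs (arr b) W) (idx i)) u) :
    (∃ x, u = .rd x (idx i) ∧ Rew ord A (AXdiff.wrs (arr b) W) x) ∨
    (∃ W₀ p, W = W₀ ++ [p] ∧
      (p.1 ≠ i ∧ u = .rd (AXdiff.wrs (arr b) W₀) (idx i) ∨ p.1 = i ∧ u = el p.2)) ∨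
    W = [] ∧ ∃ e, u = el e ∧ Form.eq (.rd (arr b) (idx i)) (el e) ∈ A := by
  generalize hx : AXdiff.wrs (arr b) W = x at h
  cases h with
  | ground L hL h =>
    have h' := litRule_lhs_cases h
    rcases h' with ⟨_, _, _, h', _⟩ | ⟨a, j, e, _, h', h''⟩ | ⟨_, _, _, h', _⟩
    · cases h'
    · cases h'
      cases h''
      obtain ⟨rfl, rfl⟩ := wrs_eq_arr.1 hx
      obtain ⟨e, h, rfl⟩ := litRule_rd.1 h
      cases h
      exact .inr (.inr ⟨rfl, e, rfl, hL⟩)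
    · cases h'
  | readOther x j i e h =>
    induction W using List.reverseRecOn with
    | nil => simp [AXdiff.wrs] at hx
    | append_singleton W q _ =>
      rw [wrs_snoc] at hx
      simp only [Term.wr.injEq, Term.const.injEq] at hx
      obtain ⟨rfl, rfl, rfl⟩ := hx
      exact .inr (.inl ⟨W, q, rfl, .inl ⟨h, rfl⟩⟩)
  | readSame x i e =>
    induction W using List.reverseRecOn with
    | nil => simp [AXdiff.wrs] at hx
    | append_singleton W q _ =>
      rw [wrs_snoc] at hx
      simp only [Term.wr.injEq, Term.const.injEq] at hx
      obtain ⟨rfl, rfl, rfl⟩ := hx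
      exact .inr (.inl ⟨W, q, rfl, .inr ⟨rfl, rfl⟩⟩)
  | rd₁ i h => exact .inl ⟨_, rfl, h⟩
  | rd₂ x h => exact (not_rew_idx h).elim

theorem Rews.wrs_shape {b : ℕ} {u : Term .array} (h : Rews ord A (wrs (arr b) W) u) : ∃ b' W', u = wrs (arr b') W' := by
  generalize hx : wrs (arr b) W = x at h
  induction h with
  | refl => exact ⟨b, W, hx.symm⟩
  | tail _ h ih =>
    obtain ⟨b', W', rfl⟩ := ih
    obtain ⟨b'', W'', rfl, _⟩ := h.wrs_shape
    exact ⟨b'', W'', rfl⟩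

theorem Rews.el_shape {e : ℕ} {u : Term .elem} (h : Rews ord A (el e) u) : ∃ d, u = el d := by
  generalize hx : el e = x at h
  induction h with
  | refl => exact ⟨e, hx.symm⟩
  | tail _ h ih =>
    obtain ⟨d, rfl⟩ := ih
    obtain ⟨L, _, h⟩ := rew_el.1 h
    obtain ⟨d', rfl, _⟩ := litRule_elem.1 h
    exact ⟨d', rfl⟩

theorem Rew.consts_subset (h : Rew ord A t u) : u.consts ⊆ t.consts ∪ constsOf A := by
  induction h with
  | ground L hL h =>
    exact h.consts_subset.2.1.trans ((subset_constsOf hL).trans subset_union_right)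
  | readOther x i j e h | readSame x i e | sort x i j e d h | overwrite x i e d =>
    simp only [Term.consts]
    grind
  | rd₁ i h ih | rd₂ x h ih | wr₁ i e h ih | wr₂ x e h ih | wr₃ x i h ih | diff₁ y h ih
  | diff₂ x h ih =>
    simp only [Term.consts]
    grind

theorem Rews.consts_subset (h : Rews ord A t u) : u.consts ⊆ t.consts ∪ constsOf A := by
  induction h with
  | refl => exact subset_union_left
  | tail _ h ih =>
    have := h.consts_subset
    grind

/-- Nested writes in normal form are strictly sorted by their indexes. -/
theorem sorted_of_irreducible (hn : ord.Nodup) {x : Term .array}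
    (hW : ∀ p ∈ W, (.index, p.1) ∈ ord) (h : ∀ u, ¬ Rew ord A (wrs x W) u) : (W.map Prod.fst).Pairwise (Prec ord .index) := by
  induction W using List.reverseRecOn with
  | nil => simp
  | append_singleton W q ih =>
    have ih := ih (fun p hp => hW p (by simp [hp])) fun u hu => h _ (by
      rw [wrs_snoc]
      exact .wr₁ _ _ hu)
    rw [List.map_append, List.pairwise_append]
    refine ⟨ih, by simp, ?_⟩
    induction W using List.reverseRecOn with
    | nil => simp
    | append_singleton W p _ =>
      rw [wrs_snoc, wrs_snoc] at h
      have hpq : Prec ord .index p.1 q.1 := by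
        by_cases e : p.1 = q.1
        · exact (h _ (by rw [← e]; exact .overwrite _ _ _ _)).elim
        · exact (prec_total hn (hW p (by simp)) (hW q (by simp)) e).resolve_right fun h' =>
            h _ (.sort _ _ _ _ _ h')
      rw [List.map_append, List.pairwise_append] at ih
      intro i hi j hj
      simp only [List.map_cons, List.map_nil, List.mem_singleton, List.map_append,
        List.mem_append] at hi hj
      subst hj
      rcases hi with hi | rfl
      · exact (ih.2.2 i hi p.1 (by simp)).trans hn hpq
      · exact hpq

theorem nodup_of_pairwise_prec (hn : ord.Nodup) {l : List ℕ} (h : l.Pairwise (Prec ord s)) : l.Nodup :=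
  h.imp fun h e => (e ▸ h).irrefl hn

/-! # Reads that reduce to constants -/

/-- `rd(a, i)` reduces to a constant. -/
inductive Reach (ord : List Const) (A : Finset Form) : ℕ → ℕ → Prop
  | lit {a i e : ℕ} (h : Form.eq (.rd (arr a) (idx i)) (el e) ∈ A) : Reach ord A a i
  | write {a b i : ℕ} {V : List (ℕ × ℕ)} {L : Form} (hL : L ∈ A)
      (hr : LitRule ord L (arr a) (wrs (arr b) V)) (h : i ∈ V.map Prod.fst) : Reach ord A a i
  | base {a b i : ℕ} {V : List (ℕ × ℕ)} {L : Form} (hL : L ∈ A)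
      (hr : LitRule ord L (arr a) (wrs (arr b) V)) (h : Reach ord A b i) : Reach ord A a i

theorem rews_rd_wrs_of_mem {x : Term .array} {i : ℕ} (h : i ∈ W.map Prod.fst) :
    ∃ e, Rews ord A (.rd (wrs x W) (idx i)) (el e) := by
  induction W using List.reverseRecOn with
  | nil => simp at h
  | append_singleton W q ih =>
    rw [wrs_snoc]
    by_cases hq : q.1 = i
    · exact ⟨q.2, .single (hq ▸ .readSame _ _ _)⟩
    · obtain ⟨e, he⟩ := ih (by
        simp only [List.map_append, List.map_cons, List.map_nil, List.mem_append,
          List.mem_singleton] at h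
        grind)
      exact ⟨e, .head (.readOther _ _ _ _ hq) he⟩

theorem rews_rd_wrs_of_notMem {x : Term .array} {i : ℕ} (h : i ∉ W.map Prod.fst) :
    Rews ord A (.rd (wrs x W) (idx i)) (.rd x (idx i)) := by
  induction W using List.reverseRecOn with
  | nil => exact .refl
  | append_singleton W q ih =>
    rw [wrs_snoc]
    simp only [List.map_append, List.map_cons, List.map_nil, List.mem_append, List.mem_singleton,
      not_or] at h
    exact .head (.readOther _ _ _ _ (Ne.symm h.2)) (ih h.1)

theorem Reach.rews {a i : ℕ} (h : Reach ord A a i) :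
    ∃ e, Rews ord A (.rd (arr a) (idx i)) (el e) := by
  induction h with
  | lit h => exact ⟨_, .single (.ground _ h (.rd _ _ _))⟩
  | write hL hr h =>
    obtain ⟨e, he⟩ := rews_rd_wrs_of_mem (ord := ord) (A := A) h
    exact ⟨e, .head (.rd₁ _ (.ground _ hL hr)) he⟩
  | @base a b i V L hL hr _ ih =>
    obtain ⟨e, he⟩ := ih
    by_cases h : i ∈ V.map Prod.fst
    · obtain ⟨e, he⟩ := rews_rd_wrs_of_mem (ord := ord) (A := A) h
      exact ⟨e, .head (.rd₁ _ (.ground _ hL hr)) he⟩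
    · exact ⟨e, .head (.rd₁ _ (.ground _ hL hr)) ((rews_rd_wrs_of_notMem h).trans he)⟩

theorem reach_of_rews {b i e : ℕ} (h : Rews ord A (.rd (wrs (arr b) W) (idx i)) (el e)) :
    i ∈ W.map Prod.fst ∨ Reach ord A b i := by
  generalize ht : Term.rd (wrs (arr b) W) (idx i) = t at h
  induction h using Relation.ReflTransGen.head_induction_on generalizing b W with
  | refl => cases ht
  | head h _ ih =>
    subst ht
    rcases h.rd_shape with ⟨x, rfl, h'⟩ | ⟨W₀, p, rfl, ⟨hp, rfl⟩ | ⟨hp, rfl⟩⟩ | ⟨rfl, e, rfl, h'⟩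
    · obtain ⟨b', W', rfl, h''⟩ := h'.wrs_shape
      have := ih rfl
      rcases h'' with ⟨L, hL, V, hr, rfl⟩ | ⟨rfl, h''⟩
      · rw [List.map_append, List.mem_append] at this
        rcases this with (h | h) | h
        · exact .inr (.write hL hr h)
        · exact .inl h
        · exact .inr (.base hL hr h)
      · rwa [h''] at this
    · rcases ih rfl with h | h
      · exact .inl (by simp only [List.map_append, List.mem_append, h, true_or])
      · exact .inr h
    · exact .inl (by simp [hp])
    · exact .inr (.lit h')

theorem reach_iff {a i : ℕ} :
    Reach ord A a i ↔ ∃ e, Rews ord A (.rd (arr a) (idx i)) (el e) :=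
  ⟨Reach.rews, fun ⟨_, h⟩ => (reach_of_rews (W := []) h).resolve_left (by simp)⟩

/-- The array constant `a` is the left-hand side of a rule. -/
def Red (ord : List Const) (A : Finset Form) (a : ℕ) : Prop := ∃ L ∈ A, ∃ r, LitRule ord L (arr a) r

/-- If irreducible arrays have all reads at `i`, then all reads at `i` reduce to constants. -/
theorem reach_of_irreducible (hn : ord.Nodup) {i : ℕ} (P : ℕ → Prop)
    (hP : ∀ a b V L, P a → L ∈ A → LitRule ord L (arr a) (wrs (arr b) V) → P b)
    (h : ∀ a, P a → ¬ Red ord A a → ∃ e, Form.eq (.rd (arr a) (idx i)) (el e) ∈ A) :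
    ∀ a, P a → Reach ord A a i := by
  intro a
  induction hk : ord.idxOf (Srt.array, a) using Nat.strong_induction_on generalizing a with
  | _ k ih =>
    intro ha
    by_cases hr : Red ord A a
    · obtain ⟨L, hL, r, hr⟩ := hr
      obtain ⟨b, V, rfl, hb, _⟩ := litRule_arr.1 hr
      exact .base hL hr (ih _ (hk ▸ hb.lt hn) b rfl (hP a b V L ha hL hr))
    · obtain ⟨e, he⟩ := h a ha hr
      exact .lit he

theorem Reach.lit_of_irreducible {a i : ℕ} (h : Reach ord A a i) (hr : ¬ Red ord A a) :
    ∃ e, Form.eq (.rd (arr a) (idx i)) (el e) ∈ A := by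
  cases h with
  | lit h => exact ⟨_, h⟩
  | write hL h => exact (hr ⟨_, hL, _, h⟩).elim
  | base hL h => exact (hr ⟨_, hL, _, h⟩).elim

theorem rew_rd_of_reach {a i : ℕ} (h : Reach ord A a i) :
    ∃ u, Rew ord A (.rd (arr a) (idx i)) u := by
  cases h with
  | lit h => exact ⟨_, .ground _ h (.rd _ _ _)⟩
  | write hL h => exact ⟨_, .rd₁ _ (.ground _ hL h)⟩
  | base hL h => exact ⟨_, .rd₁ _ (.ground _ hL h)⟩

theorem Rews.rd_shape {b i : ℕ} {u : Term .elem} (h : Rews ord A (.rd (wrs (arr b) W) (idx i)) u) :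
    (∃ b' W', u = .rd (wrs (arr b') W') (idx i)) ∨ ∃ e, u = el e := by
  generalize hx : Term.rd (wrs (arr b) W) (idx i) = x at h
  induction h with
  | refl => exact .inl ⟨b, W, hx.symm⟩
  | tail _ h ih =>
    rcases ih with ⟨b', W', rfl⟩ | ⟨e, rfl⟩
    · rcases h.rd_shape with ⟨x, rfl, h'⟩ | ⟨W₀, p, rfl, ⟨hp, rfl⟩ | ⟨hp, rfl⟩⟩ | ⟨rfl, e, rfl, _⟩
      · obtain ⟨b'', W'', rfl, _⟩ := h'.wrs_shape
        exact .inl ⟨b'', W'', rfl⟩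
      · exact .inl ⟨_, _, rfl⟩
      · exact .inr ⟨_, rfl⟩
      · exact .inr ⟨_, rfl⟩
    · obtain ⟨L, _, h⟩ := rew_el.1 h
      obtain ⟨d', rfl, _⟩ := litRule_elem.1 h
      exact .inr ⟨d', rfl⟩

/-- If all reads at `i` reduce to constants, their normal forms are constants. -/
theorem exists_NF_rd (hn : ord.Nodup) {i : ℕ}
    (h : ∀ a, (.array, a) ∈ constsOf A → Reach ord A a i) {b : ℕ} (hb : Reach ord A b i) :
    ∃ e, NF ord A (.rd (wrs (arr b) W) (idx i)) (el e) := by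
  obtain ⟨u, hu, hu'⟩ := exists_NF hn A (.rd (wrs (arr b) W) (idx i))
  rcases hu.rd_shape with ⟨b', W', rfl⟩ | ⟨e, rfl⟩
  · exfalso
    induction W' using List.reverseRecOn with
    | nil =>
      have hb' : Reach ord A b' i := by
        by_cases e : b' = b
        · exact e ▸ hb
        · refine h b' ?_
          have key : ∀ {x : Term .elem}, Rews ord A (.rd (wrs (arr b) W) (idx i)) x →
              ∀ b' W', x = .rd (wrs (arr b') W') (idx i) → b' = b ∨ (.array, b') ∈ constsOf A := by
            intro x hx
            induction hx with
            | refl =>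
              intro b' W' h
              simp only [Term.rd.injEq, wrs_inj] at h
              exact .inl h.1.1.symm
            | tail h1 h2 ih =>
              rintro b' W' rfl
              rcases Rews.rd_shape h1 with ⟨b1, W1, rfl⟩ | ⟨e, rfl⟩
              · have ih1 := ih b1 W1 rfl
                rcases h2.rd_shape with ⟨x, hx, h'⟩ | ⟨W₀, p, rfl, ⟨hp, h⟩ | ⟨hp, h⟩⟩ | ⟨_, e, h, _⟩
                · obtain ⟨b2, W2, rfl, h''⟩ := h'.wrs_shape
                  simp only [Term.rd.injEq, wrs_inj] at hx
                  obtain ⟨⟨rfl, rfl⟩, _⟩ := hx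
                  rcases h'' with ⟨L, hL, V, hr, _⟩ | ⟨rfl, _⟩
                  · refine .inr (subset_constsOf hL (hr.consts_subset.2.1 ?_))
                    exact mem_consts_wrs.2 (.inl (by simp [Term.consts]))
                  · exact ih1
                · simp only [Term.rd.injEq, wrs_inj] at h
                  obtain ⟨⟨rfl, rfl⟩, _⟩ := h
                  exact ih1
                · cases h
                · cases h
              · obtain ⟨L, _, h⟩ := rew_el.1 h2
                obtain ⟨d', h, _⟩ := litRule_elem.1 h
                cases h
          exact (key hu b' [] rfl).resolve_left e
      obtain ⟨u, h⟩ := rew_rd_of_reach hb'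
      exact hu' u h
    | append_singleton W' q _ =>
      rw [wrs_snoc] at hu'
      by_cases hq : q.1 = i
      · subst hq
        exact hu' _ (.readSame _ _ _)
      · exact hu' _ (.readOther _ _ _ _ hq)
  · exact ⟨e, hu, hu'⟩

/-! # Semantics of nested writes -/

theorem Model.array_ext (M : Model) {x y : M.carrier .array} (h : ∀ k, M.rd x k = M.rd y k) :
    x = y := by
  by_contra hxy
  exact M.rd_diff x y hxy (h _)

theorem Model.eval_wrs_congr (M : Model) {x y : Term .array} (h : M.eval x = M.eval y)
    (W : List (ℕ × ℕ)) : M.eval (wrs x W) = M.eval (wrs y W) := by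
  induction W using List.reverseRecOn with
  | nil => exact h
  | append_singleton W p ih =>
    rw [wrs_snoc, wrs_snoc]
    simp only [Model.eval, ih]

theorem Model.rd_wrs_of_ne (M : Model) (x : Term .array) {k : M.carrier .index}
    (h : ∀ p ∈ W, M.const .index p.1 ≠ k) : M.rd (M.eval (wrs x W)) k = M.rd (M.eval x) k := by
  induction W using List.reverseRecOn with
  | nil => rfl
  | append_singleton W p ih =>
    rw [wrs_snoc]
    simp only [Model.eval]
    rw [M.rd_wr_other _ _ _ _ (h p (by simp)), ih fun q hq => h q (by simp [hq])]

/-- Different index constants in `S` have different values. -/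
def Model.Inj (M : Model) (S : Finset Const) : Prop :=
  ∀ i j, (.index, i) ∈ S → (.index, j) ∈ S → M.const .index i = M.const .index j → i = j

theorem Model.Inj.rd_wrs_of_mem (hM : M.Inj S) (x : Term .array)
    (hW : ∀ p ∈ W, (.index, p.1) ∈ S) (hn : (W.map Prod.fst).Nodup) {p : ℕ × ℕ} (hp : p ∈ W) :
    M.rd (M.eval (wrs x W)) (M.const .index p.1) = M.const .elem p.2 := by
  induction W using List.reverseRecOn with
  | nil => simp at hp
  | append_singleton W q ih =>
    rw [wrs_snoc]
    simp only [Model.eval]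
    rcases List.mem_append.1 hp with h | h
    · rw [M.rd_wr_other, ih (fun p hp => hW p (by simp [hp])) (by simp at hn; grind) h]
      intro e
      have := hM _ _ (hW q (by simp)) (hW p hp) e
      simp only [List.map_append, List.map_cons, List.map_nil, List.nodup_append] at hn
      exact hn.2.2 _ (List.mem_map.2 ⟨p, h, rfl⟩) _ (List.mem_singleton.2 rfl) this.symm
    · obtain rfl := List.mem_singleton.1 h
      exact M.rd_wr_same _ _ _

theorem Model.exists_write_or (M : Model) (W : List (ℕ × ℕ)) (k : M.carrier .index) :
    (∃ p ∈ W, M.const .index p.1 = k) ∨ ∀ p ∈ W, M.const .index p.1 ≠ k := by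
  by_cases h : ∃ p ∈ W, M.const .index p.1 = k
  · exact .inl h
  · push Not at h
    exact .inr h

/-! # Soundness of rewriting -/

theorem LitRule.holds_iff (h : LitRule ord L l r) (M : Model) : M.Holds L ↔ M.eval l = M.eval r := by
  rcases h.eq_or with rfl | rfl
  · rfl
  · exact eq_comm

theorem LitRule.lhs_unique (hn : ord.Nodup) {s s' : Srt} {l r : Term s} {l' r' : Term s'}
    (h : LitRule ord L l r) (h' : LitRule ord L l' r') :
    s = s' ∧ l ≍ l' ∧ r ≍ r' := by
  have h1 := (litRule_lt hn h).1
  have h2 := (litRule_lt hn h').1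
  rcases h.eq_or with rfl | rfl <;> rcases h'.eq_or with e | e
  · cases e
    exact ⟨rfl, .rfl, .rfl⟩
  · cases e
    unfold Term.Lt at h1 h2
    omega
  · cases e
    unfold Term.Lt at h1 h2
    omega
  · cases e
    exact ⟨rfl, .rfl, .rfl⟩

theorem Rew.sound (h : Rew ord A t u) (hn : ord.Nodup) (hM : M.Inj S) (ht : t.consts ⊆ S)
    (hA : ∀ L ∈ A, ∀ (s' : Srt) (l r : Term s'), LitRule ord L l r → l.Le ord t → M.Holds L) :
    M.eval t = M.eval u := by
  induction h with
  | @ground s l r L hL h =>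
    exact (h.holds_iff M).1 (hA L hL s l r h (by unfold Term.Le; omega))
  | readOther x i j e h =>
    exact M.rd_wr_other _ _ _ _ fun e => h (hM i j (ht (by simp [Term.consts]))
      (ht (by simp [Term.consts])) e)
  | readSame x i e => exact M.rd_wr_same _ _ _
  | sort x i j e d h =>
    have hij : M.const .index i ≠ M.const .index j := fun e => by
      have := hM i j (ht (by simp [Term.consts])) (ht (by simp [Term.consts])) e
      exact (this ▸ h).irrefl hn
    refine M.array_ext fun k => ?_
    simp only [Model.eval]
    by_cases hi : M.const .index i = k
    · subst hi
      rw [M.rd_wr_other _ _ _ _ hij.symm, M.rd_wr_same, M.rd_wr_same]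
    · by_cases hj : M.const .index j = k
      · subst hj
        rw [M.rd_wr_same, M.rd_wr_other _ _ _ _ hi, M.rd_wr_same]
      · rw [M.rd_wr_other _ _ _ _ hj, M.rd_wr_other _ _ _ _ hi, M.rd_wr_other _ _ _ _ hi,
          M.rd_wr_other _ _ _ _ hj]
  | overwrite x i e d =>
    refine M.array_ext fun k => ?_
    simp only [Model.eval]
    by_cases hi : M.const .index i = k
    · subst hi
      rw [M.rd_wr_same, M.rd_wr_same]
    · rw [M.rd_wr_other _ _ _ _ hi, M.rd_wr_other _ _ _ _ hi, M.rd_wr_other _ _ _ _ hi]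
  | rd₁ i h ih | rd₂ x h ih | wr₁ i e h ih | wr₂ x e h ih | wr₃ x i h ih | diff₁ y h ih
  | diff₂ x h ih =>
    simp only [Model.eval]
    rw [ih]
    · simp only [Term.consts] at ht
      grind
    · intro L hL s' l r hr hle
      refine hA L hL s' l r hr ?_
      simp only [Term.Le, Term.wtA, Term.wtW, Term.wtE] at hle ⊢
      omega

theorem Rews.sound (h : Rews ord A t u) (hn : ord.Nodup) (hM : M.Inj S) (ht : t.consts ⊆ S)
    (hS : constsOf A ⊆ S)
    (hA : ∀ L ∈ A, ∀ (s' : Srt) (l r : Term s'), LitRule ord L l r → l.Le ord t → M.Holds L) :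
    M.eval t = M.eval u := by
  induction h with
  | refl => rfl
  | tail h1 h2 ih =>
    rw [ih]
    refine h2.sound hn hM ((Rews.consts_subset h1).trans (union_subset ht hS)) ?_
    intro L hL s' l r hr hle
    refine hA L hL s' l r hr ?_
    rcases Rews.eq_or_lt hn h1 with rfl | h
    · exact hle
    · unfold Term.Le Term.Lt at *
      omega

/-- Rewriting below the left-hand sides of the rules `del` does not use these rules. -/
theorem Rews.sound_of_lt {A del : Finset Form} (h : Rews ord A t u) (hn : ord.Nodup)
    (hM : M.Inj (constsOf A)) (ht : t.consts ⊆ constsOf A) (hA : M.HoldsAll (A \ del))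
    (hdel : ∀ L ∈ del, ∃ (s' : Srt) (l r : Term s'), LitRule ord L l r ∧ t.Lt ord l) :
    M.eval t = M.eval u := by
  refine h.sound hn hM ht (Finset.Subset.refl _) fun L hL s' l r hr hle => ?_
  refine hA L (mem_sdiff.2 ⟨hL, fun hd => ?_⟩)
  obtain ⟨s'', l', r', hr', hlt⟩ := hdel L hd
  obtain ⟨rfl, h, _⟩ := hr.lhs_unique hn hr'
  cases h
  unfold Term.Le Term.Lt at *
  omega

theorem Rews.sound_all (h : Rews ord A t u) (hn : ord.Nodup) (hM : M.Inj (constsOf A))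
    (ht : t.consts ⊆ constsOf A) (hA : M.HoldsAll A) : M.eval t = M.eval u :=
  h.sound hn hM ht (Finset.Subset.refl _) fun L hL _ _ _ _ _ => hA L hL

theorem Joinable.sound_all (h : Joinable ord A t u) (hn : ord.Nodup) (hM : M.Inj (constsOf A))
    (ht : t.consts ⊆ constsOf A) (hu : u.consts ⊆ constsOf A) (hA : M.HoldsAll A) :
    M.eval t = M.eval u :=
  let ⟨_, h1, h2⟩ := h
  (h1.sound_all hn hM ht hA).trans (h2.sound_all hn hM hu hA).symm

/-- The sorted and deduplicated form of a nested write. -/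
theorem NF.sound_wrs {b : ℕ} (h : NF ord ∅ (wrs (arr b) V) (wrs (arr b) W)) (hn : ord.Nodup)
    (hV : (wrs (arr b) V).consts ⊆ S) (hS : ∀ c ∈ S, c ∈ ord) :
    (wrs (arr b) W).consts ⊆ S ∧ (∀ p ∈ W, (.index, p.1) ∈ S) ∧ (W.map Prod.fst).Nodup ∧
      ∀ M : Model, M.Inj S → M.eval (wrs (arr b) V) = M.eval (wrs (arr b) W) := by
  have hW : (wrs (arr b) W).consts ⊆ S := by
    have := Rews.consts_subset h.1
    have h' : constsOf (∅ : Finset Form) = ∅ := by simp [constsOf]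
    rw [h', union_empty] at this
    exact this.trans hV
  have hW' := fun p hp => ((consts_wrs_subset.1 hW).2 p hp).1
  refine ⟨hW, hW', ?_, fun M hM => ?_⟩
  · exact nodup_of_pairwise_prec hn (sorted_of_irreducible hn (fun p hp => hS _ (hW' p hp)) h.2)
  · refine Rews.sound h.1 hn hM hV ?_ ?_
    · simp [constsOf]
    · intro L hL
      simp at hL

theorem NF.sorted {b : ℕ} {t : Term .array} (h : NF ord A t (wrs (arr b) W)) (hn : ord.Nodup)
    (ht : t.consts ⊆ constsOf A) (hS : ∀ c ∈ constsOf A, c ∈ ord) :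
    (∀ p ∈ W, (.index, p.1) ∈ constsOf A) ∧ (W.map Prod.fst).Nodup := by
  have hW : (wrs (arr b) W).consts ⊆ constsOf A :=
    (Rews.consts_subset h.1).trans (union_subset ht (Finset.Subset.refl _))
  have hW' := fun p hp => ((consts_wrs_subset.1 hW).2 p hp).1
  exact ⟨hW', nodup_of_pairwise_prec hn
    (sorted_of_irreducible hn (fun p hp => hS _ (hW' p hp)) h.2)⟩

/-! # Semantics of auxiliary literals -/

theorem holdsAll_reads {a : ℕ} : M.HoldsAll (reads a W) ↔
    ∀ p ∈ W, M.rd (M.const .array a) (M.const .index p.1) = M.const .elem p.2 := by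
  simp only [Model.HoldsAll, reads, List.mem_toFinset, List.mem_map]
  constructor
  · intro h p hp
    exact h _ ⟨p, hp, rfl⟩
  · rintro h _ ⟨p, hp, rfl⟩
    exact h p hp

theorem holdsAll_elemEqs {l : List (ℕ × ℕ)} : M.HoldsAll (elemEqs l) ↔
    ∀ p ∈ l, M.const .elem p.1 = M.const .elem p.2 := by
  simp only [Model.HoldsAll, elemEqs, List.mem_toFinset, List.mem_map, List.mem_filter]
  constructor
  · intro h p hp
    by_cases e : p.1 = p.2
    · rw [e]
    · exact h _ ⟨p, ⟨hp, by simpa using e⟩, rfl⟩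
  · rintro h _ ⟨p, ⟨hp, _⟩, rfl⟩
    exact h p hp

theorem forall₂_zip {R : ℕ × ℕ → ℕ → Prop} {F : List ℕ} (h : List.Forall₂ R W F) : ((W.map Prod.fst).zip F).map Prod.fst = W.map Prod.fst ∧
      (∀ z ∈ (W.map Prod.fst).zip F, ∃ p ∈ W, p.1 = z.1 ∧ R p z.2) ∧
      (∀ p ∈ W, ∃ z ∈ (W.map Prod.fst).zip F, z.1 = p.1) ∧
      (∀ z ∈ F.zip (W.map Prod.snd), ∃ p ∈ W, p.2 = z.2 ∧ R p z.1) ∧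
      (∀ p ∈ W, ∃ z ∈ F.zip (W.map Prod.snd), p.2 = z.2 ∧ R p z.1) := by
  induction h with
  | nil => simp
  | cons h _ ih =>
    obtain ⟨h1, h2, h3, h4, h5⟩ := ih
    simp only [List.map_cons, List.zip_cons_cons, List.forall_mem_cons, List.exists_mem_cons_iff]
    exact ⟨by rw [h1], ⟨.inl ⟨trivial, h⟩, fun z hz => .inr (h2 z hz)⟩,
      ⟨.inl trivial, fun p hp => .inr (h3 p hp)⟩, ⟨.inl ⟨trivial, h⟩, fun z hz => .inr (h4 z hz)⟩,
      ⟨.inl ⟨trivial, h⟩, fun p hp => .inr (h5 p hp)⟩⟩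

theorem Model.not_ne_of_subset {k : M.carrier .index} (h : ∀ p ∈ W, M.const .index p.1 ≠ k)
    (hV : V.map Prod.fst = W.map Prod.fst) :
    ∀ p ∈ V, M.const .index p.1 ≠ k := fun p hp => by
  have : p.1 ∈ W.map Prod.fst := hV ▸ List.mem_map.2 ⟨p, hp, rfl⟩
  obtain ⟨q, hq, e⟩ := List.mem_map.1 this
  exact e ▸ h q hq

/-! # Completion instructions are equivalences -/

theorem Compl.del_subset (h : Compl ord A del add) :
    del ⊆ A := by
  cases h <;> simp [*, insert_subset_iff]

theorem mem_consts_el (e : ℕ) : (Srt.elem, e) ∈ (el e).consts := by simp [Term.consts]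

theorem mem_consts_arr (a : ℕ) : (Srt.array, a) ∈ (arr a).consts := by simp [Term.consts]

theorem Model.Inj.eval_eq_wrs_iff (hM : M.Inj S) {x y : Term .array}
    (hW : ∀ p ∈ W, (.index, p.1) ∈ S) (hn : (W.map Prod.fst).Nodup) :
    M.eval x = M.eval (wrs y W) ↔
      (∀ p ∈ W, M.rd (M.eval x) (M.const .index p.1) = M.const .elem p.2) ∧
        ∀ k, (∀ p ∈ W, M.const .index p.1 ≠ k) → M.rd (M.eval x) k = M.rd (M.eval y) k := by
  constructor
  · intro h
    rw [h]
    exact ⟨fun p hp => hM.rd_wrs_of_mem y hW hn hp, fun k hk => M.rd_wrs_of_ne y hk⟩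
  · rintro ⟨h1, h2⟩
    refine M.array_ext fun k => ?_
    rcases M.exists_write_or W k with ⟨p, hp, rfl⟩ | hk
    · rw [h1 p hp, hM.rd_wrs_of_mem y hW hn hp]
    · rw [h2 k hk, M.rd_wrs_of_ne y hk]

theorem Compl.holds_iff (h : Compl ord A del add) (hn : ord.Nodup)
    (hS : ∀ c ∈ constsOf A, c ∈ ord) (hM : M.Inj (constsOf A)) (hR : M.HoldsAll (A \ del)) :
    M.HoldsAll del ↔ M.HoldsAll add := by
  have hall : M.HoldsAll del → M.HoldsAll A := fun hd φ hφ => by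
    by_cases h' : φ ∈ del
    · exact hd φ h'
    · exact hR φ (mem_sdiff.2 ⟨hφ, h'⟩)
  have hrd : ∀ {x : Term .array} {i : ℕ}, x.consts ⊆ constsOf A → (.index, i) ∈ constsOf A →
      (Term.rd x (idx i)).consts ⊆ constsOf A := fun hx hi =>
    union_subset hx (singleton_subset_iff.2 hi)
  have hone : ∀ {L : Form} {s s' : Srt} {l r : Term s} {t u : Term s'}, LitRule ord L l r →
      del = {L} → Rews ord A t u → t.consts ⊆ constsOf A → t.Lt ord l →
      M.eval t = M.eval u := fun hr hd h ht hlt =>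
    h.sound_of_lt hn hM ht hR fun L' hL' => ⟨_, _, _, mem_singleton.1 (hd ▸ hL') ▸ hr, hlt⟩
  have htwo : ∀ {L1 L2 : Form} {a : ℕ} {r1 r2 : Term .array} {s : Srt} {t u : Term s},
      LitRule ord L1 (arr a) r1 → LitRule ord L2 (arr a) r2 → del = {L1, L2} → Rews ord A t u →
      t.consts ⊆ constsOf A → t.wtA ord ≤ r1.wtA ord ∨ t.wtA ord ≤ r2.wtA ord →
      M.eval t = M.eval u := by
    intro L1 L2 a r1 r2 s t u hr1 hr2 hd h ht hle
    refine h.sound_of_lt hn hM ht hR fun L hL => ?_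
    have h1 := (litRule_lt hn hr1).2 rfl
    have h2 := (litRule_lt hn hr2).2 rfl
    rw [hd, mem_insert, mem_singleton] at hL
    rcases hL with rfl | rfl
    · exact ⟨_, _, _, hr1, .inl (by omega)⟩
    · exact ⟨_, _, _, hr2, .inl (by omega)⟩
  have hcrit : ∀ {L1 L2 : Form} {l : Term .elem} {e' d' e d : ℕ}, L1 ∈ A → L2 ∈ A →
      LitRule ord L1 l (el e') → LitRule ord L2 l (el d') → e' ≠ d' → NF ord A (el e') (el e) →
      NF ord A (el d') (el d) → del = {L1} →
      (M.HoldsAll {L1} ↔ M.HoldsAll (elemEqs [(e, d)])) := by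
    intro L1 L2 l e' d' e d hL1 hL2 hr1 hr2 hne he hd hdel
    have hE1 := hone hr1 hdel he.1 (hr1.consts_subset.2.1.trans (subset_constsOf hL1))
      (litRule_lt hn hr1).1
    have hE2 := hone hr1 hdel hd.1 (hr2.consts_subset.2.1.trans (subset_constsOf hL2))
      (litRule_lt hn hr2).1
    have hL2' : M.Holds L2 := hR L2 (mem_sdiff.2 ⟨hL2, fun h => by
      rw [hdel, mem_singleton] at h
      have := eq_of_heq (hr1.lhs_unique hn (h ▸ hr2)).2.2
      simp only [Term.const.injEq] at this
      exact hne this⟩)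
    rw [hr2.holds_iff] at hL2'
    rw [Model.holds_singleton, hr1.holds_iff, holdsAll_elemEqs, hL2', hE1, hE2]
    simp only [List.mem_singleton, forall_eq]
    exact eq_comm
  have hread : ∀ {b : ℕ} {W : List (ℕ × ℕ)} {F : List ℕ},
      List.Forall₂ (fun p f => Rews ord A (.rd (arr b) (idx p.1)) (el f)) W F →
      (.array, b) ∈ constsOf A → (∀ p ∈ W, (.index, p.1) ∈ constsOf A) → M.HoldsAll A →
      ∀ z ∈ (W.map Prod.fst).zip F,
        M.rd (M.const .array b) (M.const .index z.1) = M.const .elem z.2 := by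
    intro b W F hF hb hW hA z hz
    obtain ⟨q, hq, e, hf⟩ := (forall₂_zip hF).2.1 z hz
    rw [← e]
    exact hf.sound_all hn hM (hrd (singleton_subset_iff.2 hb) (hW q hq)) hA
  have hzip : ∀ {R : ℕ × ℕ → ℕ → Prop} {W : List (ℕ × ℕ)} {F : List ℕ}, List.Forall₂ R W F →
      (∀ p ∈ W, (.index, p.1) ∈ constsOf A) → (W.map Prod.fst).Nodup →
      (∀ z ∈ (W.map Prod.fst).zip F, (.index, z.1) ∈ constsOf A) ∧
        (((W.map Prod.fst).zip F).map Prod.fst).Nodup ∧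
        ∀ k, (∀ z ∈ (W.map Prod.fst).zip F, M.const .index z.1 ≠ k) ↔
          ∀ p ∈ W, M.const .index p.1 ≠ k := by
    intro R W F hF hW hWn
    obtain ⟨z1, z2, -, -, -⟩ := forall₂_zip hF
    refine ⟨fun z hz => ?_, by rwa [z1], fun k => ⟨fun h => Model.not_ne_of_subset h z1.symm,
      fun h => Model.not_ne_of_subset h z1⟩⟩
    obtain ⟨p, hp, e, _⟩ := z2 z hz
    exact e ▸ hW p hp
  cases h with
  | orient a b V W F hL hab hV hW hF =>
    have hc := subset_constsOf hL
    simp only [Form.consts, union_subset_iff] at hc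
    obtain ⟨hWc, hWi, hWn, hE⟩ := hW.sound_wrs hn hc.2 hS
    obtain ⟨hZi, hZn, hZ⟩ := hzip hF hWi hWn
    rw [Model.holds_insert, holdsAll_reads, Model.holds_singleton, Model.Holds, Model.Holds,
      hE M hM, hM.eval_eq_wrs_iff hWi hWn, hM.eval_eq_wrs_iff hZi hZn]
    refine ⟨fun h => ⟨⟨?_, fun k hk => (h.2 k ((hZ k).1 hk)).symm⟩, h.1⟩, fun h =>
      ⟨h.2, fun k hk => (h.1.2 k ((hZ k).2 hk)).symm⟩⟩
    refine hread hF ((consts_wrs_subset.1 hWc).1 (mem_consts_arr b)) hWi (hall ?_)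
    rw [Model.holds_singleton, Model.Holds, hE M hM]
    exact (hM.eval_eq_wrs_iff hWi hWn).2 h
  | orientSelf a V W hL hW =>
    have hc := subset_constsOf hL
    simp only [Form.consts, union_subset_iff] at hc
    obtain ⟨-, hWi, hWn, hE⟩ := hW.sound_wrs hn hc.2 hS
    rw [holdsAll_reads, Model.holds_singleton, Model.Holds, hE M hM,
      hM.eval_eq_wrs_iff hWi hWn]
    exact and_iff_left fun _ _ => rfl
  | gaussSymmTrans L1 L2 a b1 b2 r1 r2 W1 W2 U F G hL1 hr1 hL2 hr2 hne hn1 hn2 hb hF hU hG =>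
    have hc1 := hr1.consts_subset.2.1.trans (subset_constsOf hL1)
    have hc2 := hr2.consts_subset.2.1.trans (subset_constsOf hL2)
    have hWc1 := hn1.1.consts_subset.trans (union_subset hc1 subset_rfl)
    have hWc2 := hn2.1.consts_subset.trans (union_subset hc2 subset_rfl)
    obtain ⟨hWi, hWn⟩ := hn1.sorted hn hc1 hS
    have hb1 := (consts_wrs_subset.1 hWc1).1
    have hE1 := htwo hr1 hr2 rfl hn1.1 hc1 (.inl le_rfl)
    have hE2 := htwo hr1 hr2 rfl hn2.1 hc2 (.inr le_rfl)
    obtain ⟨hZi, hZn, hZ⟩ := hzip hF hWi hWn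
    obtain ⟨-, -, -, g1, g2⟩ := forall₂_zip hG
    have hUE := (hU.sound_wrs hn (consts_wrs_subset.2 ⟨(consts_wrs_subset.1 hWc2).1, fun p hp => by
      rcases List.mem_append.1 hp with hp | hp
      · exact (consts_wrs_subset.1 hWc2).2 p hp
      · obtain ⟨q, hq, e, hf⟩ := (forall₂_zip hF).2.1 p hp
        exact ⟨hZi p hp, union_subset (hrd hb1 (hWi q hq)) subset_rfl
          (hf.consts_subset (mem_consts_el p.2))⟩⟩) hS).2.2.2 M hM
    rw [wrs_append] at hUE
    have hGE : ∀ p ∈ W1, ∀ g, NF ord A (.rd (wrs (arr b2) W2) (idx p.1)) (el g) →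
        M.rd (M.eval (wrs (arr b2) W2)) (M.const .index p.1) = M.const .elem g := by
      refine fun p hp g hg => htwo hr1 hr2 rfl hg.1 (hrd hWc2 (hWi p hp)) (.inr ?_)
      rcases hn2.1.eq_or_lt hn with h | h
      · simp [Term.wtA, h]
      · unfold Term.Lt at h
        simp only [Term.wtA]
        omega
    have hd : M.HoldsAll {L1, L2} ↔ M.eval (arr a) = M.eval (wrs (arr b1) W1) ∧
        M.eval (arr a) = M.eval (wrs (arr b2) W2) := by
      rw [Model.holds_insert, Model.holds_singleton, hr1.holds_iff, hr2.holds_iff, hE1, hE2]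
    have hd' := hd.2
    rw [hd, Model.holds_union, Model.holds_insert, Model.holds_singleton,
      holdsAll_elemEqs, Model.Holds, Model.Holds, ← hUE, hM.eval_eq_wrs_iff hWi hWn,
      hM.eval_eq_wrs_iff hZi hZn]
    rw [hM.eval_eq_wrs_iff hWi hWn] at hd'
    constructor
    · rintro ⟨h1, h2⟩
      refine ⟨⟨⟨hread hF (hb1 (mem_consts_arr b1)) hWi (hall (hd' ⟨h1, h2⟩)), fun k hk => ?_⟩, h2⟩,
        fun z hz => ?_⟩
      · rw [← h2, h1.2 k ((hZ k).1 hk)]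
      · obtain ⟨p, hp, e, hg⟩ := g1 z hz
        rw [← hGE p hp _ hg, ← h2, h1.1 p hp, e]
    · rintro ⟨⟨h1, h2⟩, h3⟩
      refine ⟨⟨fun p hp => ?_, fun k hk => ?_⟩, h2⟩
      · obtain ⟨z, hz, e, hg⟩ := g2 p hp
        rw [h2, hGE p hp _ hg, e, h3 z hz]
      · rw [h2, h1.2 k ((hZ k).2 hk)]
  | gaussConfl L1 L2 a b r1 r2 W1 W2 hL1 hr1 hL2 hr2 hne hn1 hn2 =>
    have hc1 := hr1.consts_subset.2.1.trans (subset_constsOf hL1)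
    have hc2 := hr2.consts_subset.2.1.trans (subset_constsOf hL2)
    obtain ⟨hWi1, hWn1⟩ := hn1.sorted hn hc1 hS
    obtain ⟨hWi2, hWn2⟩ := hn2.sorted hn hc2 hS
    have hoff : ∀ {V W : List (ℕ × ℕ)} {p : ℕ × ℕ}, (∀ p ∈ V, (.index, p.1) ∈ constsOf A) →
        (∀ p ∈ W, (.index, p.1) ∈ constsOf A) →
        p ∈ (W.filter fun p => p.1 ∉ V.map Prod.fst) →
        p ∈ W ∧ ∀ q ∈ V, M.const .index q.1 ≠ M.const .index p.1 := by
      intro V W p hV hW hp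
      obtain ⟨hp, hp'⟩ := List.mem_filter.1 hp
      exact ⟨hp, fun q hq e => of_decide_eq_true hp'
        (hM _ _ (hV q hq) (hW p hp) e ▸ List.mem_map_of_mem hq)⟩
    set C := W1.filter fun p => p.1 ∈ W2.map Prod.fst with hC
    have hmC : ∀ {p q}, p ∈ W1 → q ∈ W2 → p.1 = q.1 → p ∈ C := fun hp hq e =>
      List.mem_filter.2 ⟨hp, decide_eq_true (e ▸ List.mem_map_of_mem hq)⟩
    have hsplit : ∀ {V W : List (ℕ × ℕ)} {p : ℕ × ℕ}, p ∈ W →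
        (∃ q ∈ V, q.1 = p.1) ∨ p ∈ W.filter fun p => p.1 ∉ V.map Prod.fst := by
      intro V W p hp
      simp only [List.mem_filter, List.mem_map, decide_eq_true_eq, hp, true_and]
      exact em _
    have hCW : ∀ p ∈ C, p ∈ W1 ∧ ∃ q ∈ W2, q.1 = p.1 := fun p hp => by
      obtain ⟨h, h'⟩ := List.mem_filter.1 hp
      exact ⟨h, List.mem_map.1 (of_decide_eq_true h')⟩
    rw [Model.holds_insert, Model.holds_singleton, Model.holds_insert,
      Model.holds_union, Model.holds_union, holdsAll_elemEqs, holdsAll_reads, holdsAll_reads,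
      hr1.holds_iff, hr2.holds_iff, htwo hr1 hr2 rfl hn1.1 hc1 (.inl le_rfl),
      htwo hr1 hr2 rfl hn2.1 hc2 (.inr le_rfl), Model.Holds, hM.eval_eq_wrs_iff hWi1 hWn1,
      hM.eval_eq_wrs_iff hWi2 hWn2, hM.eval_eq_wrs_iff (fun p hp => hWi1 p (hCW p hp).1)
        (hWn1.sublist (List.filter_sublist.map _))]
    constructor
    · rintro ⟨h1, h2⟩
      refine ⟨⟨fun p hp => h1.1 p (hCW p hp).1, fun k hk => ?_⟩, ⟨fun z hz => ?_, fun p hp => ?_⟩,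
        fun p hp => ?_⟩
      · rcases M.exists_write_or W1 k with ⟨p, hp, rfl⟩ | h
        · rcases hsplit (V := W2) hp with ⟨q, hq, e⟩ | hp'
          · exact (hk p (hmC hp hq e.symm) rfl).elim
          · exact h2.2 _ (hoff hWi2 hWi1 hp').2
        · exact h1.2 k h
      · obtain ⟨q, hq, rfl⟩ := List.mem_map.1 hz
        obtain ⟨hq, e⟩ := List.mem_filter.1 hq
        obtain ⟨hq1, hq2⟩ := List.mem_product.1 hq
        rw [← h1.1 _ hq1, ← h2.1 _ hq2, of_decide_eq_true e]
      · obtain ⟨hp, hp'⟩ := hoff hWi2 hWi1 hp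
        exact (h2.2 _ hp').symm.trans (h1.1 p hp)
      · obtain ⟨hp, hp'⟩ := hoff hWi1 hWi2 hp
        exact (h1.2 _ hp').symm.trans (h2.1 p hp)
    · rintro ⟨h1, ⟨h2, h3⟩, h4⟩
      refine ⟨⟨fun p hp => ?_, fun k hk => h1.2 k fun p hp => hk p (hCW p hp).1⟩,
        fun p hp => ?_, fun k hk => h1.2 k fun p hp => ?_⟩
      · rcases hsplit (V := W2) hp with ⟨q, hq, e⟩ | hp'
        · exact h1.1 p (hmC hp hq e.symm)
        · rw [h1.2 _ fun q hq => (hCW q hq).2.elim fun q' h => h.2 ▸ (hoff hWi2 hWi1 hp').2 q' h.1]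
          exact h3 p hp'
      · rcases hsplit (V := W1) hp with ⟨q, hq, e⟩ | hp'
        · rw [← h2 (q.2, p.2) (List.mem_map.2 ⟨(q, p), List.mem_filter.2
            ⟨List.mem_product.2 ⟨hq, hp⟩, by simpa using e⟩, rfl⟩), ← e]
          exact h1.1 q (hmC hq hp e)
        · rw [h1.2 _ fun q hq => (hoff hWi1 hWi2 hp').2 q (hCW q hq).1]
          exact h4 p hp'
      · obtain ⟨-, q, hq, e⟩ := hCW p hp
        exact e ▸ hk q hq
  | critReadWrite L1 L2 a i e' d e r hL1 hr1 hL2 hr2 hd he =>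
    have hc1 := hr1.consts_subset.1.trans (subset_constsOf hL1)
    have hc2 := hr2.consts_subset.2.1.trans (subset_constsOf hL2)
    have hlt := (litRule_lt hn hr2).2 rfl
    have hE1 := hone hr1 rfl hd.1 (union_subset hc2 (union_subset_right hc1))
      (.inl (by simp only [Term.wtA] at *; omega))
    have hE2 := hone hr1 rfl he.1 (hr1.consts_subset.2.1.trans (subset_constsOf hL1))
      (litRule_lt hn hr1).1
    have hL2' : M.Holds L2 := hR L2 (mem_sdiff.2 ⟨hL2, fun h => by
      rw [mem_singleton] at h
      cases (hr1.lhs_unique hn (h ▸ hr2)).1⟩)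
    rw [hr2.holds_iff] at hL2'
    rw [Model.holds_singleton, hr1.holds_iff, holdsAll_elemEqs, hE2]
    simp only [List.mem_singleton, forall_eq]
    simp only [Model.eval] at hE1 hL2' ⊢
    rw [hL2', hE1]
  | critRead L1 L2 a i e' d' e d hL1 hr1 hL2 hr2 hne he hd =>
    exact hcrit hL1 hL2 hr1 hr2 hne he hd rfl
  | critElem L1 L2 c e' d' e d hL1 hr1 hL2 hr2 hne he hd =>
    exact hcrit hL1 hL2 hr1 hr2 hne he hd rfl
  | @reduceRhs s L l r r' hL hr hnf hne =>
    rw [Model.holds_singleton, hr.holds_iff, Model.holds_singleton, hone hr rfl hnf.1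
      (hr.consts_subset.2.1.trans (subset_constsOf hL)) (litRule_lt hn hr).1]
    rfl
  | removeRefl t hL => simp [Model.HoldsAll, Model.Holds]
  | redundantWrite L a b V U U' p hL hr hnf hj =>
    have hc := hr.consts_subset.2.1.trans (subset_constsOf hL)
    obtain ⟨hUc, hWi, hWn, hE⟩ := hnf.sound_wrs hn hc hS
    have hlt := (litRule_lt hn hr).2 rfl
    rw [wtA_wrs] at hlt
    obtain ⟨hb, hUc⟩ := consts_wrs_subset.1 hUc
    obtain ⟨hpi, hpe⟩ := hUc p (by simp)
    obtain ⟨v, hv1, hv2⟩ := hj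
    have hp : M.rd (M.eval (arr b)) (M.const .index p.1) = M.const .elem p.2 :=
      (hone hr rfl hv1 (hrd hb hpi) (.inl (by simpa only [Term.wtA] using hlt))).trans
        (hone hr rfl hv2 (singleton_subset_iff.2 hpe) (.inl (by
          simp only [Term.wtA] at *
          omega))).symm
    have hsub : (U ++ U').Sublist (U ++ p :: U') :=
      List.Sublist.append (List.Sublist.refl _) (List.sublist_cons_self _ _)
    rw [Model.holds_singleton, hr.holds_iff, Model.holds_singleton, hE M hM, Model.Holds,
      hM.eval_eq_wrs_iff hWi hWn, hM.eval_eq_wrs_iff (fun q hq => hWi q (hsub.subset hq))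
        (hWn.sublist (hsub.map Prod.fst))]
    refine ⟨fun h => ⟨fun q hq => h.1 q (hsub.subset hq), fun k hk => ?_⟩, fun h =>
      ⟨fun q hq => ?_, fun k hk => h.2 k fun q hq => hk q (hsub.subset hq)⟩⟩
    · by_cases hpk : M.const .index p.1 = k
      · rw [← hpk, h.1 p (by simp), hp]
      · refine h.2 k fun q hq => ?_
        simp only [List.mem_append, List.mem_cons] at hq hk
        rcases hq with hq | rfl | hq
        exacts [hk q (.inl hq), hpk, hk q (.inr hq)]
    · by_cases hq' : q ∈ U ++ U'
      · exact h.1 q hq'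
      · obtain rfl : q = p := by
          simp only [List.mem_append, List.mem_cons] at hq hq'
          tauto
        rw [← hp]
        refine h.2 _ fun x hx e => hq' ?_
        rwa [← List.inj_on_of_nodup_map hWn (hsub.subset hx) hq
          (hM _ _ (hWi x (hsub.subset hx)) hpi e)]
  | diffJoin a b i hL hj hab | diffJoinSymm a b i hL hj hab =>
    have hc := subset_constsOf hL
    simp only [Form.consts, union_subset_iff] at hc
    obtain ⟨hc, hi⟩ := hc
    have hi := hi (mem_singleton_self _)
    have key : M.HoldsAll A → M.eval (arr a) = M.eval (arr b) := by
      intro hA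
      by_contra hab
      have h1 := hj.sound_all hn hM (hrd (union_subset_left hc) hi)
        (hrd (union_subset_right hc) hi) hA
      have h2 : M.diff (M.eval (arr a)) (M.eval (arr b)) = M.eval (idx i) := hA _ hL
      exact M.rd_diff _ _ hab (h2 ▸ h1)
    rw [Model.holds_singleton, Model.holds_insert, Model.holds_singleton]
    simp only [Model.Holds]
    constructor
    · intro h
      have he := key (hall (Model.holds_singleton.2 h))
      refine ⟨by rw [he], ?_⟩
      simp only [Model.eval] at h he ⊢
      rw [← h, he]
    · rintro ⟨h1, h2⟩
      simp only [Model.eval] at h1 h2 ⊢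
      rw [← h2, h1]

/-- A completion instruction replaces a constraint by an equivalent one. -/
theorem Compl.holdsAll_iff (h : Compl ord A del add) (hn : ord.Nodup)
    (hS : ∀ c ∈ constsOf A, c ∈ ord) (hM : M.Inj (constsOf A)) :
    M.HoldsAll A ↔ M.HoldsAll (A \ del ∪ add) := by
  rw [Model.holds_union]
  constructor
  · intro hA
    have hR : M.HoldsAll (A \ del) := hA.mono sdiff_subset
    exact ⟨hR, (h.holds_iff hn hS hM hR).1 (hA.mono h.del_subset)⟩
  · rintro ⟨hR, ha⟩ φ hφ
    by_cases hd : φ ∈ del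
    · exact (h.holds_iff hn hS hM hR).2 ha φ hd
    · exact hR φ (mem_sdiff.2 ⟨hφ, hd⟩)

theorem Failure.not_holdsAll (h : Failure ord A) (hn : ord.Nodup) (hM : M.Inj (constsOf A)) : ¬ M.HoldsAll A := by
  intro hA
  cases h with
  | elem e d hL hj =>
    have hc := subset_constsOf hL
    simp only [Form.consts, union_subset_iff] at hc
    exact hA _ hL (hj.sound_all hn hM hc.1 hc.2 hA)
  | diff a b a' b' i i' h h' ha hb hi =>
    have hc := subset_constsOf h
    have hc' := subset_constsOf h'
    simp only [Form.consts, Term.consts] at hc hc'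
    have h1 := ha.sound_all hn hM (by simp only [Term.consts]; grind)
      (by simp only [Term.consts]; grind) hA
    have h2 := hb.sound_all hn hM (by simp only [Term.consts]; grind)
      (by simp only [Term.consts]; grind) hA
    refine hi (hM i i' (hc (by simp)) (hc' (by simp)) ?_)
    have e1 : M.diff (M.eval (arr a)) (M.eval (arr b)) = M.const .index i := hA _ h
    have e2 : M.diff (M.eval (arr a')) (M.eval (arr b')) = M.const .index i' := hA _ h'
    rw [← e1, ← e2, h1, h2]

/-! # Literals added by completion instructions -/

theorem constsOf_reads_subset {a : ℕ} (ha : (.array, a) ∈ S)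
    (hW : ∀ p ∈ W, (.index, p.1) ∈ S ∧ (.elem, p.2) ∈ S) :
    constsOf (reads a W) ⊆ S := by
  rw [constsOf_subset_iff]
  intro φ hφ
  simp only [reads, List.mem_toFinset, List.mem_map] at hφ
  obtain ⟨p, hp, rfl⟩ := hφ
  have := hW p hp
  simp only [Form.consts, Term.consts]
  grind

theorem mem_elemEqs {l : List (ℕ × ℕ)} :
    φ ∈ elemEqs l ↔ ∃ p ∈ l, p.1 ≠ p.2 ∧ φ = .eq (el p.1) (el p.2) := by
  simp only [elemEqs, List.mem_toFinset, List.mem_map, List.mem_filter, decide_eq_true_eq]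
  grind

theorem mem_reads {a : ℕ} :
    φ ∈ reads a W ↔ ∃ p ∈ W, φ = .eq (.rd (arr a) (idx p.1)) (el p.2) := by
  simp only [reads, List.mem_toFinset, List.mem_map]
  grind

theorem constsOf_elemEqs_subset {l : List (ℕ × ℕ)}
    (hl : ∀ p ∈ l, (.elem, p.1) ∈ S ∧ (.elem, p.2) ∈ S) : constsOf (elemEqs l) ⊆ S := by
  rw [constsOf_subset_iff]
  intro φ hφ
  obtain ⟨p, hp, _, rfl⟩ := mem_elemEqs.1 hφ
  have := hl p hp
  simp only [Form.consts, Term.consts]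
  grind

theorem Rews.subset_of_subset (h : Rews ord A t u) (ht : t.consts ⊆ constsOf A) : u.consts ⊆ constsOf A :=
  h.consts_subset.trans (union_subset ht (Finset.Subset.refl _))

theorem NF.empty_subset (h : NF ord ∅ t u) (ht : t.consts ⊆ S) : u.consts ⊆ S := by
  have := Rews.consts_subset h.1
  have h' : constsOf (∅ : Finset Form) = ∅ := by simp [constsOf]
  rw [h', union_empty] at this
  exact this.trans ht

theorem forall₂_zip_consts {R : ℕ × ℕ → ℕ → Prop} {F : List ℕ} (h : List.Forall₂ R W F)
    (hW : ∀ p ∈ W, (.index, p.1) ∈ S ∧ (.elem, p.2) ∈ S)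
    (hR : ∀ p ∈ W, ∀ f, R p f → (Srt.elem, f) ∈ S) :
    (∀ z ∈ (W.map Prod.fst).zip F, (.index, z.1) ∈ S ∧ (.elem, z.2) ∈ S) ∧
      ∀ z ∈ F.zip (W.map Prod.snd), (.elem, z.1) ∈ S ∧ (.elem, z.2) ∈ S := by
  obtain ⟨-, h2, -, h4, -⟩ := forall₂_zip h
  refine ⟨fun z hz => ?_, fun z hz => ?_⟩
  · obtain ⟨p, hp, e, hr⟩ := h2 z hz
    exact ⟨e ▸ (hW p hp).1, hR p hp _ hr⟩
  · obtain ⟨p, hp, e, hr⟩ := h4 z hz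
    exact ⟨hR p hp _ hr, e ▸ (hW p hp).2⟩

theorem Compl.consts_add_subset (h : Compl ord A del add) : constsOf add ⊆ constsOf A := by
  have hrd : ∀ {x : Term .array} {i e : ℕ}, x.consts ⊆ constsOf A → (.index, i) ∈ constsOf A →
      Rews ord A (.rd x (idx i)) (el e) → (.elem, e) ∈ constsOf A := by
    intro x i e hx hi hr
    refine hr.subset_of_subset ?_ (mem_consts_el e)
    simp only [Term.consts]
    grind
  have hel : ∀ {d e : ℕ}, (.elem, d) ∈ constsOf A → NF ord A (el d) (el e) →
      (.elem, e) ∈ constsOf A := by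
    intro d e hd hr
    refine Rews.subset_of_subset hr.1 ?_ (mem_consts_el e)
    simpa [Term.consts] using hd
  cases h with
  | orient a b V W F hL hab hV hW hF =>
    have hc := subset_constsOf hL
    simp only [Form.consts, union_subset_iff] at hc
    obtain ⟨hb, hWc⟩ := consts_wrs_subset.1 (hW.empty_subset hc.2)
    have hz := (forall₂_zip_consts hF hWc fun p hp f hf => hrd hb (hWc p hp).1 hf).1
    rw [constsOf_insert, Form.consts]
    refine union_subset (union_subset hb (consts_wrs_subset.2 ⟨hc.1, hz⟩)) ?_
    exact constsOf_reads_subset (hc.1 (mem_consts_arr a)) hWc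
  | orientSelf a V W hL hW =>
    have hc := subset_constsOf hL
    simp only [Form.consts, union_subset_iff] at hc
    exact constsOf_reads_subset (hc.1 (mem_consts_arr a))
      (consts_wrs_subset.1 (hW.empty_subset hc.2)).2
  | gaussSymmTrans L1 L2 a b1 b2 r1 r2 W1 W2 U F G hL1 hr1 hL2 hr2 hne hn1 hn2 hb hF hU hG =>
    have hc := hr1.consts_subset.1.trans (subset_constsOf hL1)
    have hw1 := Rews.subset_of_subset hn1.1
      (hr1.consts_subset.2.1.trans (subset_constsOf hL1))
    have hw2 := Rews.subset_of_subset hn2.1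
      (hr2.consts_subset.2.1.trans (subset_constsOf hL2))
    obtain ⟨hb1, hW1⟩ := consts_wrs_subset.1 hw1
    obtain ⟨hb2, hW2⟩ := consts_wrs_subset.1 hw2
    have hz := (forall₂_zip_consts hF hW1 fun p hp f hf => hrd hb1 (hW1 p hp).1 hf).1
    have hg := (forall₂_zip_consts hG hW1 fun p hp f hf => hrd hw2 (hW1 p hp).1 hf.1).2
    have hUc := hU.empty_subset (S := constsOf A) (consts_wrs_subset.2 ⟨hb2, fun p hp => by
      rcases List.mem_append.1 hp with hp | hp
      exacts [hW2 p hp, hz p hp]⟩)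
    rw [constsOf_union, constsOf_insert, constsOf_singleton, Form.consts, Form.consts]
    exact union_subset (union_subset (union_subset hb1 hUc)
      (union_subset hc hw2)) (constsOf_elemEqs_subset hg)
  | gaussConfl L1 L2 a b r1 r2 W1 W2 hL1 hr1 hL2 hr2 hne hn1 hn2 =>
    have hc := hr1.consts_subset.1.trans (subset_constsOf hL1)
    have hw1 := Rews.subset_of_subset hn1.1
      (hr1.consts_subset.2.1.trans (subset_constsOf hL1))
    have hw2 := Rews.subset_of_subset hn2.1
      (hr2.consts_subset.2.1.trans (subset_constsOf hL2))
    obtain ⟨hb1, hW1⟩ := consts_wrs_subset.1 hw1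
    obtain ⟨hb2, hW2⟩ := consts_wrs_subset.1 hw2
    rw [constsOf_insert, constsOf_union, constsOf_union, Form.consts]
    refine union_subset (union_subset hc (consts_wrs_subset.2
      ⟨hb1, fun p hp => hW1 p (List.mem_filter.1 hp).1⟩)) (union_subset
      (union_subset (constsOf_elemEqs_subset fun p hp => ?_)
        (constsOf_reads_subset (hb1 (mem_consts_arr b)) fun p hp => hW1 p (List.mem_filter.1 hp).1))
      (constsOf_reads_subset (hb1 (mem_consts_arr b)) fun p hp => hW2 p (List.mem_filter.1 hp).1))
    obtain ⟨q, hq, rfl⟩ := List.mem_map.1 hp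
    obtain ⟨hq1, hq2⟩ := List.mem_product.1 (List.mem_filter.1 hq).1
    exact ⟨(hW1 _ hq1).2, (hW2 _ hq2).2⟩
  | critReadWrite L1 L2 a i e' d e r hL1 hr1 hL2 hr2 hd he =>
    have hc1 := hr1.consts_subset.1.trans (subset_constsOf hL1)
    have hc2 := hr1.consts_subset.2.1.trans (subset_constsOf hL1)
    have hc3 := hr2.consts_subset.2.1.trans (subset_constsOf hL2)
    have hi : (.index, i) ∈ constsOf A := hc1 (by simp [Term.consts])
    refine constsOf_elemEqs_subset fun p hp => ?_
    obtain rfl := List.mem_singleton.1 hp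
    exact ⟨hrd hc3 hi hd.1, hel (hc2 (mem_consts_el e')) he⟩
  | critRead L1 L2 a i e' d' e d hL1 hr1 hL2 hr2 hne he hd
  | critElem L1 L2 a e' d' e d hL1 hr1 hL2 hr2 hne he hd =>
    have hc1 := hr1.consts_subset.2.1.trans (subset_constsOf hL1)
    have hc2 := hr2.consts_subset.2.1.trans (subset_constsOf hL2)
    refine constsOf_elemEqs_subset fun p hp => ?_
    obtain rfl := List.mem_singleton.1 hp
    exact ⟨hel (hc1 (mem_consts_el e')) he, hel (hc2 (mem_consts_el d')) hd⟩
  | @reduceRhs s L l r r' hL hr hnf hne =>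
    have hc1 := hr.consts_subset.1.trans (subset_constsOf hL)
    have hc2 := hr.consts_subset.2.1.trans (subset_constsOf hL)
    rw [constsOf_singleton, Form.consts]
    exact union_subset hc1 (Rews.subset_of_subset hnf.1 hc2)
  | removeRefl t hL => simp [constsOf]
  | redundantWrite L a b V U U' p hL hr hnf hj =>
    have hc1 := hr.consts_subset.1.trans (subset_constsOf hL)
    have hc2 := hr.consts_subset.2.1.trans (subset_constsOf hL)
    obtain ⟨hb, hU⟩ := consts_wrs_subset.1 (hnf.empty_subset hc2)
    rw [constsOf_singleton, Form.consts]
    refine union_subset hc1 (consts_wrs_subset.2 ⟨hb, fun q hq => hU q ?_⟩)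
    simp only [List.mem_append, List.mem_cons] at hq ⊢
    tauto
  | diffJoin a b i hL hj hab | diffJoinSymm a b i hL hj hab =>
    have hc := subset_constsOf hL
    rw [constsOf_insert, constsOf_singleton]
    simp only [Form.consts, Term.consts] at hc ⊢
    grind

/-- A positive literal. -/
def IsEq (φ : Form) : Prop := ∃ (s : Srt) (t u : Term s), φ = .eq t u

theorem NF.wrs_shape {l r r' : Term s} (hr : LitRule ord L l r) (h : NF ord A r r') : Flat (.eq l r') := by
  rcases litRule_lhs_cases hr with ⟨a, b, W, rfl, h1, h2⟩ | ⟨a, i, e, rfl, h1, h2⟩ |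
    ⟨e, d, rfl, h1, h2⟩
  · cases h1
    cases h2
    obtain ⟨b', W', rfl⟩ := Rews.wrs_shape h.1
    exact .wr _ _ _
  · cases h1
    cases h2
    obtain ⟨b', rfl⟩ := Rews.el_shape h.1
    exact .rd _ _ _
  · cases h1
    cases h2
    obtain ⟨b', rfl⟩ := Rews.el_shape h.1
    exact .elemEq _ _

theorem flat_of_mem_reads {a : ℕ} (h : φ ∈ reads a W) :
    Flat φ ∧ IsEq φ := by
  obtain ⟨p, _, rfl⟩ := mem_reads.1 h
  exact ⟨.rd _ _ _, _, _, _, rfl⟩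

theorem flat_of_mem_elemEqs {l : List (ℕ × ℕ)} (h : φ ∈ elemEqs l) :
    Flat φ ∧ IsEq φ := by
  obtain ⟨p, _, _, rfl⟩ := mem_elemEqs.1 h
  exact ⟨.elemEq _ _, _, _, _, rfl⟩

theorem Compl.flat_add (h : Compl ord A del add) :
    ∀ φ ∈ add, Flat φ ∧ IsEq φ := by
  have hwr : ∀ {a b : ℕ} {W : List (ℕ × ℕ)}, Flat (.eq (arr a) (wrs (arr b) W)) ∧
      IsEq (.eq (arr a) (wrs (arr b) W)) := ⟨.wr _ _ _, _, _, _, rfl⟩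
  have harr : ∀ {a b : ℕ}, Flat (.eq (arr a) (arr b)) ∧
      IsEq (.eq (arr a) (arr b)) := ⟨.wr _ _ [], _, _, _, rfl⟩
  have hdf : ∀ {a b i : ℕ}, Flat (.eq (.diff (arr a) (arr b)) (idx i)) ∧
      IsEq (.eq (.diff (arr a) (arr b)) (idx i)) := ⟨.diff _ _ _, _, _, _, rfl⟩
  intro φ hφ
  cases h with
  | orient =>
    rcases mem_insert.1 hφ with rfl | hφ
    exacts [hwr, flat_of_mem_reads hφ]
  | orientSelf => exact flat_of_mem_reads hφ
  | gaussSymmTrans =>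
    simp only [mem_union, mem_insert, mem_singleton] at hφ
    rcases hφ with (rfl | rfl) | hφ
    exacts [hwr, hwr, flat_of_mem_elemEqs hφ]
  | gaussConfl =>
    simp only [mem_union, mem_insert] at hφ
    rcases hφ with rfl | (hφ | hφ) | hφ
    exacts [hwr, flat_of_mem_elemEqs hφ, flat_of_mem_reads hφ, flat_of_mem_reads hφ]
  | critReadWrite | critRead | critElem => exact flat_of_mem_elemEqs hφ
  | reduceRhs L l r r' hL hr hnf hne =>
    rw [mem_singleton] at hφ
    exact hφ ▸ ⟨hnf.wrs_shape hr, _, _, _, rfl⟩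
  | removeRefl => simp at hφ
  | redundantWrite =>
    rw [mem_singleton] at hφ
    exact hφ ▸ hwr
  | diffJoin | diffJoinSymm =>
    simp only [mem_insert, mem_singleton] at hφ
    rcases hφ with rfl | rfl
    exacts [harr, hdf]

theorem LitRule.isEq (h : LitRule ord L l r) : IsEq L := by
  rcases h.eq_or with rfl | rfl
  exacts [⟨_, _, _, rfl⟩, ⟨_, _, _, rfl⟩]

theorem Compl.isEq_del (h : Compl ord A del add) :
    ∀ φ ∈ del, IsEq φ := by
  intro φ hφ
  cases h with
  | gaussSymmTrans L1 L2 a b1 b2 r1 r2 W1 W2 U F G hL1 hr1 hL2 hr2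
  | gaussConfl L1 L2 a b r1 r2 W1 W2 hL1 hr1 hL2 hr2 =>
    simp only [mem_insert, mem_singleton] at hφ
    rcases hφ with rfl | rfl
    exacts [hr1.isEq, hr2.isEq]
  | critReadWrite L1 L2 a i e' d e r hL1 hr1 =>
    exact mem_singleton.1 hφ ▸ hr1.isEq
  | critRead L1 L2 a i e' d' e d hL1 hr1 => exact mem_singleton.1 hφ ▸ hr1.isEq
  | critElem L1 L2 a e' d' e d hL1 hr1 => exact mem_singleton.1 hφ ▸ hr1.isEq
  | reduceRhs L l r r' hL hr => exact mem_singleton.1 hφ ▸ hr.isEq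
  | redundantWrite L a b V U U' p hL hr => exact mem_singleton.1 hφ ▸ hr.isEq
  | orient | orientSelf | removeRefl | diffJoin | diffJoinSymm =>
    exact mem_singleton.1 hφ ▸ ⟨_, _, _, rfl⟩

/-! # Well-formed states -/

/-- The literals allowed in the phases of the solver. -/
def OKForm : Phase → Form → Prop
  | .flatten, φ => IsLit φ
  | .arrayNe, φ => Flat φ
  | _, φ => Flat φ ∧ ∀ a b, φ ≠ .neg (.eq (arr a) (arr b))

theorem Flat.isLit (h : Flat φ) : IsLit φ := by
  cases h
  case ne => exact .neg _ _
  all_goals exact .pos _ _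

theorem okForm_of_flat_isEq (ph : Phase) (h : Flat φ) (h' : IsEq φ) :
    OKForm ph φ := by
  obtain ⟨s, t, u, rfl⟩ := h'
  cases ph
  · exact h.isLit
  · exact h
  all_goals exact ⟨h, by simp⟩

theorem okForm_ne (ph : Phase) (hs : s ≠ .array) (m n : ℕ) :
    OKForm ph (.neg (.eq (.const s m) (.const s n))) := by
  cases ph
  · exact .neg _ _
  · exact .ne _ _ _
  all_goals
    refine ⟨.ne _ _ _, fun a b h => ?_⟩
    cases h
    exact hs rfl

/-- The invariants of the solver. -/
structure Node.Good (n : Node) : Prop where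
  subA : constsOf n.A ⊆ n.sigA
  subB : constsOf n.B ⊆ n.sigB
  adm : Admissible n.sigA n.sigB n.ord
  okA : ∀ φ ∈ n.A, OKForm n.phase φ
  okB : ∀ φ ∈ n.B, OKForm n.phase φ

theorem Admissible.swap {SA SB : Finset Const} (h : Admissible SA SB ord) :
    Admissible SB SA ord := by
  unfold Admissible at *
  rwa [union_comm, inter_comm]

theorem Node.Good.swap (h : n.Good) : n.swap.Good :=
  ⟨h.subB, h.subA, h.adm.swap, h.okB, h.okA⟩

theorem Node.Closed.swap (h : n.Closed) : n.swap.Closed := by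
  unfold Node.Closed at *
  rwa [union_comm] at h

theorem Node.Good.mem_ord (h : n.Good) {c : Const} (hc : c ∈ n.sigA ∪ n.sigB) :
    c ∈ n.ord := (h.adm.2.1 c).2 hc

theorem Node.Good.constsOf_mem_ord (h : n.Good) : ∀ c ∈ constsOf n.A, c ∈ n.ord :=
  fun _ hc => h.mem_ord (mem_union_left _ (h.subA hc))

theorem Node.Good.localA_subset (h : n.Good) : n.localA ⊆ n.sigA := by
  intro c hc
  simp only [Node.localA, Node.common, mem_union, mem_inter] at hc
  rcases hc with hc | hc
  exacts [h.subA hc, hc.2.1]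

theorem Node.Good.extend (h : n.Good) {sh : Bool} {A' D : Finset Form}
    (hext : n.CanExtend sh X ord' D) (hA' : constsOf A' ⊆ n.sigA ∪ X)
    (hD : sh = false → constsOf D ⊆ n.sigA ∪ X) (ok : ∀ φ ∈ A', OKForm n.phase φ)
    (ok' : ∀ φ ∈ D, OKForm n.phase φ) :
    (n.extend sh X ord' A' D).Good := by
  obtain ⟨-, -, hadm, hDc⟩ := hext
  have := h.subB
  cases sh with
  | false =>
    refine ⟨?_, h.subB, hadm, ?_, h.okB⟩
    · simp only [Node.extend, constsOf_union]
      exact union_subset hA' (hD rfl)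
    · simp only [Node.extend, mem_union]
      rintro φ (hφ | hφ)
      exacts [ok φ hφ, ok' φ hφ]
  | true =>
    have hDc := hDc rfl
    simp only [Node.common] at hDc
    refine ⟨?_, ?_, hadm, ?_, ?_⟩
    · simp only [Node.extend, constsOf_union]
      grind
    · simp only [Node.extend, constsOf_union, if_true]
      grind
    · simp only [Node.extend, mem_union]
      rintro φ (hφ | hφ)
      exacts [ok φ hφ, ok' φ hφ]
    · simp only [Node.extend, mem_union, if_true]
      rintro φ (hφ | hφ)
      exacts [h.okB φ hφ, ok' φ hφ]

/-! # Renaming of constants in literals -/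

theorem subst_wrs (s : Srt) (n m : ℕ) (x : Term .array) (W : List (ℕ × ℕ)) :
    ∃ W', Term.subst s n (.const s m) (wrs x W) = wrs (Term.subst s n (.const s m) x) W' ∧
      W' = W.map (fun p => (if s = .index ∧ n = p.1 then m else p.1,
        if s = .elem ∧ n = p.2 then m else p.2)) := by
  refine ⟨_, ?_, rfl⟩
  induction W using List.reverseRecOn with
  | nil => rfl
  | append_singleton W p ih =>
    rw [wrs_snoc, Term.subst, ih, List.map_append, List.map_cons, List.map_nil, wrs_snoc]
    congr 1
    · by_cases h : s = .index ∧ n = p.1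
      · obtain ⟨rfl, rfl⟩ := h
        simp [Term.subst]
      · simp [Term.subst, h]
    · by_cases h : s = .elem ∧ n = p.2
      · obtain ⟨rfl, rfl⟩ := h
        simp [Term.subst]
      · simp [Term.subst, h]

theorem subst_const_const (s : Srt) (n m : ℕ) (s' : Srt) (k : ℕ) :
    Term.subst s n (.const s m) (.const s' k) = .const s' (if s = s' ∧ n = k then m else k) := by
  by_cases h : s = s' ∧ n = k
  · obtain ⟨rfl, rfl⟩ := h
    simp [Term.subst]
  · simp [Term.subst, h]

theorem Flat.rename (h : Flat φ) (s : Srt) (n m : ℕ) : Flat (φ.rename s n m) := by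
  cases h with
  | wr a b W =>
    obtain ⟨W', h, _⟩ := subst_wrs s n m (arr b) W
    simp only [Form.rename, Form.subst, h, subst_const_const]
    exact .wr _ _ _
  | rd a i e =>
    simp only [Form.rename, Form.subst, Term.subst.eq_2, subst_const_const]
    exact .rd _ _ _
  | diff a b i =>
    simp only [Form.rename, Form.subst, Term.subst.eq_4, subst_const_const]
    exact .diff _ _ _
  | idxEq i j =>
    simp only [Form.rename, Form.subst, subst_const_const]
    exact .idxEq _ _
  | elemEq i j =>
    simp only [Form.rename, Form.subst, subst_const_const]
    exact .elemEq _ _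
  | ne s' i j =>
    simp only [Form.rename, Form.subst, subst_const_const]
    exact .ne _ _ _

theorem OKForm.rename {ph : Phase} (h : OKForm ph φ) (s : Srt) (n m : ℕ) :
    OKForm ph (φ.rename s n m) := by
  have key : Flat φ ∧ (∀ a b, φ ≠ .neg (.eq (arr a) (arr b))) →
      Flat (φ.rename s n m) ∧ ∀ a b, φ.rename s n m ≠ .neg (.eq (arr a) (arr b)) := by
    rintro ⟨h, h'⟩
    refine ⟨h.rename s n m, fun a b e => ?_⟩
    cases h with
    | ne s' i j =>
      simp only [Form.rename, Form.subst, subst_const_const] at e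
      cases s' with
      | array => exact h' i j rfl
      | index => cases e
      | elem => cases e
    | _ => simp [Form.rename, Form.subst] at e
  cases ph
  · cases h with
    | pos t u => exact .pos _ _
    | neg t u => exact .neg _ _
  · exact Flat.rename h s n m
  all_goals exact key h

theorem Node.Good.identify (h : n.Good) {old new : ℕ} (hnew : (s, new) ∈ n.sigA)
    (hnew' : (s, old) ∈ n.common → (s, new) ∈ n.sigB) :
    (n.identify s old new).Good := by
  have hA := constsOf_image_rename_subset s old new n.A
  have hB := constsOf_image_rename_subset s old new n.B
  have h1 := h.subA
  have h2 := h.subB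
  have okA : ∀ φ ∈ n.A.image (Form.rename s old new), OKForm n.phase φ := by
    intro φ hφ
    obtain ⟨ψ, hψ, rfl⟩ := mem_image.1 hφ
    exact (h.okA ψ hψ).rename s old new
  have okB : ∀ φ ∈ n.B.image (Form.rename s old new), OKForm n.phase φ := by
    intro φ hφ
    obtain ⟨ψ, hψ, rfl⟩ := mem_image.1 hφ
    exact (h.okB ψ hψ).rename s old new
  refine ⟨?_, ?_, h.adm, okA, ?_⟩
  · simp only [Node.identify]
    grind
  · simp only [Node.identify]
    split_ifs with hc
    · have := hnew' hc
      grind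
    · exact h2
  · simp only [Node.identify]
    split_ifs with hc
    · exact okB
    · exact h.okB

theorem Node.Good.withA (h : n.Good) {A' : Finset Form} (hA : constsOf A' ⊆ n.sigA)
    (ok : ∀ φ ∈ A', OKForm n.phase φ) : (n.withA A').Good :=
  ⟨hA, h.subB, h.adm, ok, h.okB⟩

/-! # Soundness of the pre-processing instructions -/

theorem Term.consts_subst_of_mem (s : Srt) (n : ℕ) (u : Term s) :
    ∀ {s' : Srt} (t : Term s'), (s, n) ∈ t.consts → u.consts ⊆ (Term.subst s n u t).consts
  | _, .const s' m, h => by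
    simp only [Term.consts, mem_singleton, Prod.mk.injEq] at h
    obtain ⟨rfl, rfl⟩ := h
    simp [Term.subst]
  | _, .rd x i, h => by
    simp only [Term.consts, mem_union] at h
    simp only [Term.consts, Term.subst]
    rcases h with h | h
    · exact (consts_subst_of_mem s n u x h).trans subset_union_left
    · exact (consts_subst_of_mem s n u i h).trans subset_union_right
  | _, .wr x i e, h => by
    simp only [Term.consts, mem_union] at h
    simp only [Term.consts, Term.subst]
    rcases h with (h | h) | h
    · exact (consts_subst_of_mem s n u x h).trans
        (subset_union_left.trans subset_union_left)
    · exact (consts_subst_of_mem s n u i h).trans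
        (subset_union_right.trans subset_union_left)
    · exact (consts_subst_of_mem s n u e h).trans subset_union_right
  | _, .diff x y, h => by
    simp only [Term.consts, mem_union] at h
    simp only [Term.consts, Term.subst]
    rcases h with h | h
    · exact (consts_subst_of_mem s n u x h).trans subset_union_left
    · exact (consts_subst_of_mem s n u y h).trans subset_union_right

theorem Form.consts_subst_of_mem (s : Srt) (n : ℕ) (u : Term s) (φ : Form)
    (h : (s, n) ∈ φ.consts) : u.consts ⊆ (φ.subst s n u).consts := by
  induction φ with
  | eq t v =>
    simp only [Form.consts, mem_union] at h
    simp only [Form.consts, Form.subst]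
    rcases h with h | h
    · exact (Term.consts_subst_of_mem s n u t h).trans subset_union_left
    · exact (Term.consts_subst_of_mem s n u v h).trans subset_union_right
  | bot | top => simp [Form.consts] at h
  | neg φ ih => exact ih h
  | and φ ψ ih1 ih2 | or φ ψ ih1 ih2 | imp φ ψ ih1 ih2 =>
    simp only [Form.consts, mem_union] at h
    simp only [Form.consts, Form.subst]
    rcases h with h | h
    · exact (ih1 h).trans subset_union_left
    · exact (ih2 h).trans subset_union_right

theorem holds_subst_iff {n : ℕ} (h : M.const s n = M.eval t) (φ : Form) : M.Holds (φ.subst s n t) ↔ M.Holds φ := by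
  have := M.holds_update_subst s n t φ
  rw [← h, M.update_const_self] at this
  exact this.symm

theorem DefLit.spec {α : ℕ} {D : Form} (h : DefLit s α t D) :
    (∀ M : Model, M.Holds D ↔ M.Holds (.eq (.const s α) t)) ∧
      D.consts = insert (s, α) t.consts ∧ Flat D ∧ IsEq D := by
  cases h with
  | wr b W hW => exact ⟨fun M => Iff.rfl, rfl, .wr _ _ _, _, _, _, rfl⟩
  | rd a i =>
    refine ⟨fun M => eq_comm, ?_, .rd _ _ _, _, _, _, rfl⟩
    simp only [Form.consts, Term.consts]
    grind
  | diff a b =>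
    refine ⟨fun M => eq_comm, ?_, .diff _ _ _, _, _, _, rfl⟩
    simp only [Form.consts, Term.consts]
    grind

theorem union_singleton_eq_insert {α : Type*} [DecidableEq α] (S : Finset α) (a : α) :
    S ∪ {a} = insert a S := by
  rw [union_comm, insert_eq]

/-- Extension by one explicitly defined constant, with an equivalent replacement of the other
literals of the first component. -/
theorem Node.Good.link_extend (hn : n.Good) {sh : Bool} {α : ℕ} {D : Form} {A' : Finset Form}
    (hext : n.CanExtend sh {(s, α)} ord' {D})
    (hD : ∀ M : Model, M.Holds D ↔ M.Holds (.eq (.const s α) t))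
    (hDc : D.consts = insert (s, α) t.consts) (ht : t.consts ⊆ n.sigA)
    (hA' : constsOf A' ⊆ n.sigA ∪ {(s, α)})
    (hiff : ∀ M : Model, M.Holds D → (M.HoldsAll n.A ↔ M.HoldsAll A')) (hα : (s, α) ∉ t.consts) :
    Link n.toM (n.extend sh {(s, α)} ord' A' {D}).toM := by
  obtain ⟨hd, -, -, hDs⟩ := hext
  have hαn : (s, α) ∉ n.sigA ∪ n.sigB := disjoint_singleton_left.1 hd
  have ht' : sh = true → t.consts ⊆ n.sigB := fun h => by
    have h1 := hDs h
    rw [constsOf_singleton, hDc] at h1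
    intro c hc
    have h2 := h1 (mem_insert_of_mem hc)
    simp only [Node.common, mem_union, mem_inter, mem_singleton] at h2
    rcases h2 with h2 | rfl
    exacts [h2.2, (hα hc).elim]
  refine (Link.define sh s α t D hαn ht ht' hD hDc.subset hn.subA hn.subB).trans ?_
  have h1 : constsOf (insert D n.A) ⊆ insert (s, α) n.sigA := by
    rw [constsOf_insert, hDc]
    have := hn.subA
    grind
  have h2 : constsOf (insert D A') ⊆ insert (s, α) n.sigA := by
    rw [constsOf_insert, hDc]
    have := hn.subA
    grind
  have := Link.replace (SB := if sh then insert (s, α) n.sigB else n.sigB)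
    (B := if sh then insert D n.B else n.B) (A := insert D n.A) (A' := insert D A')
    (fun M => by
      rw [Model.holds_insert, Model.holds_insert]
      exact and_congr_right (hiff M)) h1 h2
  simpa only [Node.toM, Node.extend, union_singleton_eq_insert] using this

theorem FlattenA.sound (hn : n.Good) (hph : n.phase = .flatten) (h : FlattenA n cs) : Sound n cs ∧ ∀ c ∈ cs, c.Good := by
  obtain ⟨sh, L, L', s, α, t, D, ord', hL, hflat, hD, hL', hocc, hext⟩ := h
  obtain ⟨hD1, hD2, hD3, hD4⟩ := hD.spec
  have hLc := (subset_constsOf hL).trans hn.subA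
  have ht : t.consts ⊆ n.sigA := by
    refine (Form.consts_subst_of_mem s α t L' hocc).trans ?_
    rwa [hL']
  have hα : (s, α) ∉ n.sigA ∪ n.sigB := disjoint_singleton_left.1 hext.1
  have hA' : constsOf (insert L' (n.A.erase L)) ⊆ n.sigA ∪ {(s, α)} := by
    rw [constsOf_insert]
    have h1 := Form.subset_consts_subst s α t L'
    rw [hL'] at h1
    have h2 := constsOf_mono (erase_subset L n.A)
    have h3 := hn.subA
    grind
  refine ⟨.of_link (hn.link_extend hext hD1 hD2 ht hA' (fun M hM => ?_)
    fun h => hα (mem_union_left _ (ht h))), ?_⟩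
  · conv_lhs => rw [← insert_erase hL]
    rw [Model.holds_insert, Model.holds_insert, ← hL', holds_subst_iff ((hD1 M).1 hM)]
  · simp only [List.mem_singleton, forall_eq]
    refine hn.extend hext hA' (fun _ => ?_) ?_ ?_
    · rw [constsOf_singleton, hD2]
      grind
    · intro φ hφ
      rcases mem_insert.1 hφ with rfl | hφ
      · have hlit := hn.okA L hL
        rw [hph] at hlit ⊢
        change IsLit L at hlit
        rw [← hL'] at hlit
        change IsLit φ
        cases φ with
        | eq t u => exact .pos _ _
        | neg φ =>
          cases φ with
          | eq t u => exact .neg _ _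
          | _ => simp only [Form.subst] at hlit; cases hlit
        | _ => simp only [Form.subst] at hlit; cases hlit
      · exact hn.okA φ (mem_of_mem_erase hφ)
    · intro φ hφ
      rw [mem_singleton] at hφ
      exact hφ ▸ okForm_of_flat_isEq _ hD3 hD4

theorem ReadA.sound_aux (hn : n.Good) {sh : Bool} {a i e : ℕ} (ha : (.array, a) ∈ n.localA)
    (hi : (.index, i) ∈ n.localA)
    (hext : n.CanExtend sh {(.elem, e)} ord' {.eq (.rd (arr a) (idx i)) (el e)}) :
    Sound n [n.extend sh {(.elem, e)} ord' n.A {.eq (.rd (arr a) (idx i)) (el e)}] ∧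
      (n.extend sh {(.elem, e)} ord' n.A {.eq (.rd (arr a) (idx i)) (el e)}).Good := by
  obtain ⟨hD1, hD2, hD3, hD4⟩ := (DefLit.rd e a i).spec
  have ht : (Term.rd (arr a) (idx i)).consts ⊆ n.sigA := by
    simp only [Term.consts]
    have h1 := hn.localA_subset ha
    have h2 := hn.localA_subset hi
    grind
  have hA' : constsOf n.A ⊆ n.sigA ∪ {(.elem, e)} := hn.subA.trans subset_union_left
  refine ⟨.of_link (hn.link_extend hext hD1 hD2 ht hA' (fun M hM => Iff.rfl) (by simp [Term.consts])),
    hn.extend hext hA' (fun _ => ?_) hn.okA ?_⟩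
  · rw [constsOf_singleton, hD2]
    grind
  · intro φ hφ
    rw [mem_singleton] at hφ
    exact hφ ▸ okForm_of_flat_isEq _ hD3 hD4

theorem ReadA.sound (hn : n.Good) (h : ReadA n cs) :
    Sound n cs ∧ ∀ c ∈ cs, c.Good := by
  obtain ⟨sh, a, i, e, ord', ha, hi, -, hext⟩ := h
  simpa using ReadA.sound_aux hn ha hi hext

theorem RepairA.sound (hn : n.Good) (h : RepairA n cs) :
    Sound n cs ∧ ∀ c ∈ cs, c.Good := by
  obtain ⟨sh, a, i, e, ord', ha, hi, -, hext⟩ := h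
  simpa using ReadA.sound_aux hn ha hi hext

/-! # Identification of constants -/

variable {SA SB : Finset Const} {A A' B B' : Finset Form}

theorem Link.identify_insert {n m : ℕ} (hnm : n ≠ m) (hA : constsOf A ⊆ SA)
    (hB : constsOf B ⊆ SB) (hn : (s, n) ∈ SA) (hm : (s, m) ∈ SA)
    (hm' : (s, n) ∈ SB → (s, m) ∈ SB) :
    Link ⟨SA, SB, insert (.eq (.const s n) (.const s m)) A, B⟩ ⟨SA, SB, A.image (Form.rename s n m),
      if (s, n) ∈ SA ∩ SB then B.image (Form.rename s n m) else B⟩ := by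
  have hA' : constsOf (insert (.eq (.const s n) (.const s m)) A) ⊆ SA := by
    rw [constsOf_insert]
    simp only [Form.consts, Term.consts]
    grind
  have hcA := constsOf_image_rename_subset s n m A
  refine (Link.identify hnm hA' hB hn hm hm' fun M hM => hM _ (mem_insert_self _ _)).trans
    (Link.replace (fun M => ?_) ?_ ?_)
  · rw [image_insert, Model.holds_insert, and_iff_right]
    simp [Form.rename, Form.subst, subst_const_const, Model.Holds]
  · have := constsOf_image_rename_subset s n m (insert (.eq (.const s n) (.const s m)) A)
    grind
  · grind

theorem Node.Good.prec_common (h : n.Good) {x y : ℕ} (hxy : Prec n.ord s x y)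
    (hy : (s, y) ∈ n.common) : (s, x) ∈ n.common := by
  by_contra hx
  refine hxy.asymm h.adm.1 (h.adm.2.2 s y x hy (mem_sdiff.2 ⟨?_, hx⟩))
  exact (h.adm.2.1 _).1 hxy.mem_left

theorem Node.Good.link_identify (hn : n.Good) {old new : ℕ} (hne : old ≠ new)
    (hnew : (s, new) ∈ n.sigA) (hold : (s, old) ∈ n.sigA)
    (h : (s, old) ∈ n.common → (s, new) ∈ n.sigB) :
    Link ⟨n.sigA, n.sigB, insert (.eq (.const s old) (.const s new)) n.A, n.B⟩
      (n.identify s old new).toM ∧ (n.identify s old new).Good :=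
  ⟨Link.identify_insert hne hn.subA hn.subB hold hnew
    (fun h' => h (mem_inter.2 ⟨hold, h'⟩)), hn.identify hnew h⟩

theorem Node.Good.link_identify_prec (hn : n.Good) {old new : ℕ} (hnew : (s, new) ∈ n.sigA)
    (hold : (s, old) ∈ n.sigA) (hlt : Prec n.ord s new old) :
    Link ⟨n.sigA, n.sigB, insert (.eq (.const s old) (.const s new)) n.A, n.B⟩
      (n.identify s old new).toM ∧ (n.identify s old new).Good := by
  refine hn.link_identify ?_ hnew hold fun h => (mem_inter.1 (hn.prec_common hlt h)).2
  rintro rfl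
  exact hlt.irrefl hn.adm.1

theorem Node.Closed.of_bot : (n.withA (insert .bot n.A)).Closed :=
  mem_union_left _ (mem_insert_self _ _)

theorem Sound.of_not_holdsAll (h : ∀ M : Model, ¬ M.HoldsAll n.A) :
    Sound n [n.withA (insert .bot n.A)] := by
  have := Link.union (SB := n.sigB) (B := n.B) (SA := n.sigA) {.bot}
    (fun ψ hψ M hM => (h M hM).elim) (by simp [constsOf, Form.consts])
  rw [← insert_eq] at this
  exact .of_link (n := n) (c := n.withA (insert Form.bot n.A)) this

theorem Node.Good.erase (hn : n.Good) (L : Form) : (n.withA (n.A.erase L)).Good :=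
  hn.withA ((constsOf_mono (erase_subset _ _)).trans hn.subA)
    fun φ hφ => hn.okA φ (mem_of_mem_erase hφ)

theorem GuessA.sound (hn : n.Good) (h : GuessA n cs) :
    Sound n cs ∧ ∀ c ∈ cs, c.Closed ∨ c.Good := by
  cases h with
  | refl i hL =>
    refine ⟨.of_link (Link.replace (fun M => ?_) hn.subA (hn.erase _).subA), ?_⟩
    · change M.HoldsAll n.A ↔ M.HoldsAll (n.A.erase _)
      conv_lhs => rw [← insert_erase hL]
      rw [Model.holds_insert]
      exact and_iff_right rfl
    · simpa using .inr (hn.erase _)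
  | merge L big small hL hform hlt =>
    have hc := (subset_constsOf hL).trans hn.subA
    have hb : (.index, big) ∈ n.sigA ∧ (.index, small) ∈ n.sigA := by
      rcases hform with rfl | rfl <;> simp only [Form.consts, Term.consts] at hc <;> grind
    obtain ⟨h1, h2⟩ := (hn.erase L).link_identify_prec hb.2 hb.1 hlt
    refine ⟨.of_link (.trans (Link.replace (fun M => ?_) hn.subA ?_) h1), ?_⟩
    · change M.HoldsAll n.A ↔ M.HoldsAll (insert _ (n.A.erase _))
      conv_lhs => rw [← insert_erase hL]
      rw [Model.holds_insert, Model.holds_insert]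
      refine and_congr_left fun _ => ?_
      rcases hform with rfl | rfl
      exacts [Iff.rfl, eq_comm]
    · have : constsOf (n.A.erase L) ⊆ n.sigA := (hn.erase L).subA
      change constsOf (insert _ (n.A.erase L)) ⊆ n.sigA
      rw [constsOf_insert]
      simp only [Form.consts, Term.consts]
      grind
    · simpa using .inr h2
  | guess big small hbig hsmall hlt h1 h2 =>
    have hb := hn.localA_subset hbig
    have hs := hn.localA_subset hsmall
    obtain ⟨hl, hg⟩ := hn.link_identify_prec hs hb hlt
    have hcn : (Form.neg (.eq (idx big) (idx small))).consts ⊆ n.sigA := by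
      simp only [Form.consts, Term.consts]
      grind
    have hce : (Form.eq (idx big) (idx small)).consts ⊆ n.sigA := hcn
    have hA' : constsOf (insert (Form.neg (.eq (idx big) (idx small))) n.A) ⊆ n.sigA := by
      rw [constsOf_insert]
      exact union_subset hcn hn.subA
    have hl' : Link ⟨n.sigA, n.sigB, insert (.neg (.eq (idx big) (idx small))) n.A, n.B⟩
        ⟨n.sigA, n.sigB, insert (.neg (.eq (idx big) (idx small))) n.A,
          if (.index, big) ∈ n.common ∧ (.index, small) ∈ n.common then
              insert (.neg (.eq (idx big) (idx small))) n.B else n.B⟩ := by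
      split_ifs with hc
      · refine .propagate _ (fun M hM => hM _ (mem_insert_self _ _)) ?_
        obtain ⟨hc1, hc2⟩ := hc
        simp only [Form.consts, Term.consts, Node.common] at hc1 hc2 ⊢
        grind
      · exact .refl _
    refine ⟨⟨fun H hd => ?_, fun c hc hs => ?_⟩, fun c hc => ?_⟩
    · refine Dv.cases [.neg (.eq (idx big) (idx small)), .eq (idx big) (idx small)] ?_ ?_ ?_
      · simpa using ⟨hcn, hce⟩
      · intro M _
        rw [holds_bigOr]
        by_cases hM : M.Holds (.eq (idx big) (idx small))
        · exact ⟨_, by simp, hM⟩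
        · exact ⟨.neg _, by simp, hM⟩
      · simp only [List.forall_mem_cons]
        exact ⟨hl'.der H (hd _ List.mem_cons_self),
          hl.der H (hd _ (List.mem_cons_of_mem _ List.mem_cons_self)), by simp⟩
    · simp only [List.mem_cons, List.not_mem_nil, or_false] at hc
      rcases hc with rfl | rfl
      · obtain ⟨M, hM, hM'⟩ := hl'.sat hs
        exact ⟨M, hM.mono (subset_insert _ _), hM'⟩
      · obtain ⟨M, hM, hM'⟩ := hl.sat hs
        exact ⟨M, hM.mono (subset_insert _ _), hM'⟩
    · simp only [List.mem_cons, List.not_mem_nil, or_false] at hc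
      rcases hc with rfl | rfl
      · have hok := okForm_ne n.phase (s := .index) (by simp) big small
        refine .inr ⟨hA', ?_, hn.adm, ?_, ?_⟩
        · dsimp only
          have := hn.subB
          split_ifs with hc
          · obtain ⟨hc1, hc2⟩ := hc
            rw [constsOf_insert]
            simp only [Form.consts, Term.consts, Node.common] at hc1 hc2 ⊢
            grind
          · exact this
        · intro φ hφ
          rcases mem_insert.1 hφ with rfl | hφ
          exacts [hok, hn.okA φ hφ]
        · dsimp only
          intro φ hφ
          split_ifs at hφ
          · rcases mem_insert.1 hφ with rfl | hφ
            exacts [hok, hn.okB φ hφ]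
          · exact hn.okB φ hφ
      · exact .inr hg
  | clash i hL =>
    exact ⟨.of_not_holdsAll fun M hM => hM _ hL rfl, by simp [Node.Closed.of_bot]⟩

theorem CopyA.sound (hn : n.Good) (h : CopyA n cs) :
    Sound n cs ∧ ∀ c ∈ cs, c.Good := by
  obtain ⟨L, hA, hB, hL⟩ := h
  refine ⟨.of_link (Link.propagate L (fun M hM => hM L hA) hL), ?_⟩
  simp only [List.mem_singleton, forall_eq]
  refine ⟨hn.subA, ?_, hn.adm, hn.okA, ?_⟩
  · dsimp only
    rw [constsOf_insert]
    exact union_subset (hL.trans inter_subset_right) hn.subB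
  · intro φ hφ
    rcases mem_insert.1 hφ with rfl | hφ
    exacts [hn.okA _ hA, hn.okB φ hφ]

/-! # Soundness of the replacement of array inequalities -/

section

variable {SA SB : Finset Const} {A A' B B' : Finset Form}

/-- The literals `diff(a, b) = i`, `rd(b, i) = e`, `rd(a, i) = d`. -/
abbrev diffDefs (a b i e d : ℕ) : Finset Form :=
  {.eq (.diff (arr a) (arr b)) (idx i), .eq (.rd (arr b) (idx i)) (el e),
    .eq (.rd (arr a) (idx i)) (el d)}

theorem constsOf_diffDefs (a b i e d : ℕ) : constsOf (diffDefs a b i e d) =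
    {(.array, a), (.array, b), (.index, i), (.elem, e), (.elem, d)} := by
  simp only [diffDefs, constsOf_insert, constsOf_singleton, Form.consts, Term.consts]
  ext c
  simp only [mem_union, mem_insert, mem_singleton]
  tauto

theorem flat_diffDefs {a b i e d : ℕ} : ∀ φ ∈ diffDefs a b i e d, Flat φ ∧ IsEq φ := by
  intro φ hφ
  simp only [mem_insert, mem_singleton] at hφ
  rcases hφ with rfl | rfl | rfl
  exacts [⟨.diff _ _ _, _, _, _, rfl⟩, ⟨.rd _ _ _, _, _, _, rfl⟩, ⟨.rd _ _ _, _, _, _, rfl⟩]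

theorem Link.define_diff (sh : Bool) {a b i e d : ℕ} (hed : e ≠ d)
    (hX : Disjoint {(.index, i), (.elem, e), (.elem, d)} (SA ∪ SB)) (ha : (.array, a) ∈ SA)
    (hb : (.array, b) ∈ SA) (hsh : sh = true → (.array, a) ∈ SB ∧ (.array, b) ∈ SB)
    (hA : constsOf A ⊆ SA) (hB : constsOf B ⊆ SB) :
    Link ⟨SA, SB, A, B⟩ ⟨SA ∪ {(.index, i), (.elem, e), (.elem, d)},
      if sh then SB ∪ {(.index, i), (.elem, e), (.elem, d)} else SB, A ∪ diffDefs a b i e d,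
      if sh then B ∪ diffDefs a b i e d else B⟩ := by
  simp only [disjoint_insert_left, disjoint_singleton_left] at hX
  obtain ⟨hi, he, hd⟩ := hX
  obtain ⟨hD1, hc1, -⟩ := (DefLit.diff i a b).spec
  obtain ⟨hD2, hc2, -⟩ := (DefLit.rd e b i).spec
  obtain ⟨hD3, hc3, -⟩ := (DefLit.rd d a i).spec
  have hA1 : constsOf (insert (.eq (.diff (arr a) (arr b)) (idx i)) A) ⊆
      insert (.index, i) SA := by
    rw [constsOf_insert, hc1]
    simp only [Term.consts]
    grind
  have hA2 : constsOf (insert (.eq (.rd (arr b) (idx i)) (el e))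
      (insert (.eq (.diff (arr a) (arr b)) (idx i)) A)) ⊆
      insert (.elem, e) (insert (.index, i) SA) := by
    rw [constsOf_insert, hc2]
    simp only [Term.consts]
    grind
  cases sh with
  | false =>
    have h1 := Link.define (SB := SB) (B := B) false .index i _ _ hi
      (by simp only [Term.consts]; grind) (by simp) hD1 hc1.subset hA hB
    have h2 := Link.define (SB := SB) (B := B) false .elem e _ _ (by grind)
      (by simp only [Term.consts]; grind) (by simp) hD2 hc2.subset hA1 hB
    have h3 := Link.define (SB := SB) (B := B) false .elem d _ _ (by grind)
      (by simp only [Term.consts]; grind) (by simp) hD3 hc3.subset hA2 hB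
    have := (h1.trans h2).trans h3
    simp only [Bool.false_eq_true, if_false] at this ⊢
    convert this using 2 <;>
    · ext c
      simp only [mem_union, mem_insert, mem_singleton]
      tauto
  | true =>
    obtain ⟨ha', hb'⟩ := hsh rfl
    have hB1 : constsOf (insert (.eq (.diff (arr a) (arr b)) (idx i)) B) ⊆
        insert (.index, i) SB := by
      rw [constsOf_insert, hc1]
      simp only [Term.consts]
      grind
    have hB2 : constsOf (insert (.eq (.rd (arr b) (idx i)) (el e))
        (insert (.eq (.diff (arr a) (arr b)) (idx i)) B)) ⊆
        insert (.elem, e) (insert (.index, i) SB) := by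
      rw [constsOf_insert, hc2]
      simp only [Term.consts]
      grind
    have h1 := Link.define true .index i _ _ hi
      (by simp only [Term.consts]; grind) (fun _ => by simp only [Term.consts]; grind) hD1
      hc1.subset hA hB
    have h2 := Link.define true .elem e _ _ (by grind)
      (by simp only [Term.consts]; grind) (fun _ => by simp only [Term.consts]; grind) hD2
      hc2.subset hA1 hB1
    have h3 := Link.define true .elem d _ _ (by grind)
      (by simp only [Term.consts]; grind) (fun _ => by simp only [Term.consts]; grind) hD3
      hc3.subset hA2 hB2
    have := (h1.trans h2).trans h3
    convert this using 2 <;>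
    · ext c
      simp only [if_true, mem_union, mem_insert, mem_singleton]
      tauto

theorem Model.ne_iff_of_diffDefs {a b i e d : ℕ} (h : M.HoldsAll (diffDefs a b i e d)) :
    M.const .array a ≠ M.const .array b ↔ M.const .elem d ≠ M.const .elem e := by
  simp only [diffDefs, holds_insert, holds_singleton, Holds, eval] at h
  obtain ⟨h1, h2, h3⟩ := h
  constructor
  · intro hne
    rw [← h2, ← h3, ← h1]
    exact M.rd_diff _ _ hne
  · intro hne he
    rw [← h2, ← h3, he] at hne
    exact hne rfl

theorem ArrayNeA.sound (hn : n.Good) (h : ArrayNeA n cs) :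
    Sound n cs ∧ ∀ c ∈ cs, c.Good := by
  obtain ⟨sh, a, b, i, e, d, ord', hL, hed, hext⟩ := h
  have hc := (subset_constsOf hL).trans hn.subA
  simp only [Form.consts, Term.consts] at hc
  have ha : (.array, a) ∈ n.sigA := hc (by simp)
  have hb : (.array, b) ∈ n.sigA := hc (by simp)
  have hA' : constsOf (insert (.neg (.eq (el d) (el e)))
      (n.A.erase (.neg (.eq (arr a) (arr b))))) ⊆
      n.sigA ∪ {(.index, i), (.elem, e), (.elem, d)} := by
    have h1 := hn.subA
    have h2 := constsOf_mono (erase_subset (.neg (.eq (arr a) (arr b))) n.A)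
    rw [constsOf_insert]
    simp only [Form.consts, Term.consts]
    grind
  have hD := constsOf_diffDefs a b i e d
  have hsh : sh = true → (.array, a) ∈ n.sigB ∧ (.array, b) ∈ n.sigB := fun h => by
    have h1 := hext.2.2.2 h
    rw [show constsOf _ = _ from hD] at h1
    have hd := hext.1
    have h2 := @h1 (.array, a) (by simp)
    have h3 := @h1 (.array, b) (by simp)
    simp only [Node.common, mem_union, mem_inter, mem_insert,
      mem_singleton, Prod.mk.injEq, reduceCtorEq, false_and, or_false] at h2 h3
    exact ⟨h2.2, h3.2⟩
  refine ⟨.of_link (.trans (Link.define_diff sh hed hext.1 ha hb hsh hn.subA hn.subB)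
    (Link.replace (A' := insert (.neg (.eq (el d) (el e)))
      (n.A.erase (.neg (.eq (arr a) (arr b)))) ∪ diffDefs a b i e d) (fun M => ?_) ?_ ?_)), ?_⟩
  · rw [Model.holds_union, Model.holds_union]
    refine and_congr_left fun hM => ?_
    conv_lhs => rw [← insert_erase hL]
    rw [Model.holds_insert, Model.holds_insert]
    exact and_congr_left fun _ => Model.ne_iff_of_diffDefs hM
  · rw [constsOf_union, hD]
    have := hn.subA
    grind
  · rw [constsOf_union, hD]
    grind
  · simp only [List.mem_singleton, forall_eq]
    refine hn.extend hext hA' (fun _ => ?_) ?_ ?_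
    · rw [show constsOf {_, _, _} = _ from hD]
      grind
    · intro φ hφ
      rcases mem_insert.1 hφ with rfl | hφ
      exacts [okForm_ne _ (by simp) _ _, hn.okA φ (mem_of_mem_erase hφ)]
    · exact fun φ hφ => okForm_of_flat_isEq _ (flat_diffDefs φ hφ).1 (flat_diffDefs φ hφ).2

end

/-! # Soundness of Term Sharing -/

theorem Node.CanExtend.congr {sh : Bool} {D D' : Finset Form} (h : n.CanExtend sh X ord' D)
    (hD : constsOf D' ⊆ constsOf D) :
    n.CanExtend sh X ord' D' :=
  ⟨h.1, h.2.1, h.2.2.1, fun hs => hD.trans (h.2.2.2 hs)⟩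

theorem Node.Good.share (hn : n.Good) {old new : ℕ} (hL : L ∈ n.A)
    (hLD : ∀ M : Model, M.Holds L ↔ M.Holds (.eq (.const s old) t))
    (hLc : L.consts = insert (s, old) t.consts) (ht : t.consts ⊆ n.common)
    (hold : (s, old) ∉ n.common) (hok : Flat L) (hok' : IsEq L)
    (hext : n.CanExtend true {(s, new)} ord' {L.rename s old new}) :
    Link n.toM (n.share s old new ord' L).toM ∧ (n.share s old new ord' L).Good := by
  have hLs := (subset_constsOf hL).trans hn.subA
  have hnew : (s, new) ∉ n.sigA ∪ n.sigB := disjoint_singleton_left.1 hext.1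
  have holdA : (s, old) ∈ n.sigA := hLs (by simp [hLc])
  have holdB : (s, old) ∉ n.sigB := fun h => hold (mem_inter.2 ⟨holdA, h⟩)
  have hne : old ≠ new := by
    rintro rfl
    exact hnew (mem_union_left _ holdA)
  have htold : (s, old) ∉ t.consts := fun h => hold (ht h)
  have hDc : (L.rename s old new).consts ⊆ insert (s, new) t.consts := by
    have := consts_rename_subset s old new L
    rw [hLc] at this
    grind
  have hD : ∀ M : Model, M.Holds (L.rename s old new) ↔ M.Holds (.eq (.const s new) t) := by
    intro M
    rw [Form.rename, ← M.holds_update_subst, hLD]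
    simp only [Model.Holds]
    rw [M.eval_update_self, M.eval_update_of_notMem _ _ _ _ htold]
  have hDold : (s, old) ∉ (L.rename s old new).consts := fun h => by
    have := hDc h
    simp only [mem_insert, Prod.mk.injEq, true_and] at this
    exact this.elim hne htold
  have hA' : constsOf (n.A.image (Form.rename s old new)) ⊆ n.sigA ∪ {(s, new)} := by
    have h1 := constsOf_image_rename_subset s old new n.A
    have h2 := hn.subA
    grind
  refine ⟨?_, hn.extend hext hA' (by simp) ?_ ?_⟩
  · have h1 := Link.define true s new t _ hnew (ht.trans inter_subset_left)
      (fun _ => ht.trans inter_subset_right) hD hDc hn.subA hn.subB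
    simp only [if_true] at h1
    have htA := ht.trans inter_subset_left
    have htB := ht.trans inter_subset_right
    have h2 := Link.identify (A := insert (L.rename s old new) n.A)
      (B := insert (L.rename s old new) n.B) (SA := insert (s, new) n.sigA)
      (SB := insert (s, new) n.sigB) hne
      (by have := hn.subA; rw [constsOf_insert]; grind)
      (by have := hn.subB; rw [constsOf_insert]; grind)
      (mem_insert_of_mem holdA) (mem_insert_self _ _)
      (fun _ => mem_insert_self _ _) (fun M hM => by
        have e1 := (hD M).1 (hM _ (mem_insert_self _ _))
        have e2 := (hLD M).1 (hM _ (mem_insert_of_mem hL))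
        exact e2.trans e1.symm)
    rw [if_neg (by simp [hne, holdB]), image_insert,
      Form.rename_of_notMem hDold] at h2
    have := h1.trans h2
    simpa only [Node.toM, Node.share, Node.extend, union_singleton_eq_insert, if_true] using this
  · intro φ hφ
    obtain ⟨ψ, hψ, rfl⟩ := mem_image.1 hφ
    exact (hn.okA ψ hψ).rename _ _ _
  · intro φ hφ
    rw [mem_singleton] at hφ
    subst hφ
    obtain ⟨s', t', u', rfl⟩ := hok'
    exact okForm_of_flat_isEq _ (hok.rename _ _ _) ⟨_, _, _, rfl⟩

/-! # Distinctness of index constants -/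

/-- All pairs of different index constants from `S` are declared to be different in `A`. -/
def NeAll (A : Finset Form) (S : Finset Const) : Prop :=
  ∀ i j, (.index, i) ∈ S → (.index, j) ∈ S → i ≠ j →
    Form.neg (.eq (idx i) (idx j)) ∈ A ∨ Form.neg (.eq (idx j) (idx i)) ∈ A

theorem NeAll.inj (h : NeAll A S) (hM : M.HoldsAll A) : M.Inj S := fun i j hi hj e => by
  by_contra hij
  rcases h i j hi hj hij with h | h
  exacts [hM _ h e, hM _ h e.symm]

theorem neAll_of_exhausted (hn : n.Good) (h : ∀ cs, ¬ GuessA n cs) :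
    NeAll n.A n.localA := by
  intro i j hi hj hij
  have key : ∀ {i j : ℕ}, (.index, i) ∈ n.localA → (.index, j) ∈ n.localA →
      Prec n.ord .index i j → Form.neg (.eq (idx i) (idx j)) ∈ n.A ∨
      Form.neg (.eq (idx j) (idx i)) ∈ n.A := by
    intro i j hi hj hlt
    by_contra hc
    push Not at hc
    exact h _ (.guess j i hj hi hlt hc.2 hc.1)
  have hord : ∀ {c}, c ∈ n.localA → c ∈ n.ord := fun hc =>
    hn.mem_ord (mem_union_left _ (hn.localA_subset hc))
  rcases prec_total hn.adm.1 (hord hi) (hord hj) hij with hlt | hlt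
  · exact key hi hj hlt
  · exact (key hj hi hlt).symm

theorem Exhausted.left {P : Node → List Node → Prop} (h : Exhausted (Sym P) n) (cs : List Node) : ¬ P n cs := fun hc => h cs (.inl hc)

theorem Exhausted.swap {P : Node → List Node → Prop} (h : Exhausted (Sym P) n) :
    Exhausted (Sym P) n.swap := by
  rintro cs (hc | ⟨ds, hc, rfl⟩)
  · exact h _ (.inr ⟨cs, hc, rfl⟩)
  · exact h _ (.inl hc)

/-! # Soundness of Splitting -/

theorem wrs_filter_append (hM : M.Inj S) (x : Term .array) (hW : ∀ p ∈ W, (.index, p.1) ∈ S)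
    (hn : (W.map Prod.fst).Nodup) (q : ℕ × ℕ → Prop) [DecidablePred q] :
    M.eval (wrs x W) = M.eval (wrs (wrs x (W.filter fun p => q p)) (W.filter fun p => ¬ q p)) := by
  rw [← wrs_append]
  refine M.array_ext fun k => ?_
  have hn' : ((W.filter (fun p => q p) ++ W.filter fun p => ¬ q p).map Prod.fst).Nodup := by
    refine List.Perm.nodup ((List.Perm.map _ ?_).symm) hn
    have := List.filter_append_perm (fun p => decide (q p)) W
    simpa using this
  have hmem : ∀ p, p ∈ W.filter (fun p => q p) ++ W.filter (fun p => ¬ q p) ↔ p ∈ W := by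
    intro p
    simp only [List.mem_append, List.mem_filter, decide_eq_true_eq]
    tauto
  rcases M.exists_write_or W k with ⟨p, hp, rfl⟩ | h
  · rw [hM.rd_wrs_of_mem x hW hn hp,
      hM.rd_wrs_of_mem x (fun p hp => hW p ((hmem p).1 hp)) hn' ((hmem p).2 hp)]
  · rw [M.rd_wrs_of_ne x h, M.rd_wrs_of_ne x fun p hp => h p ((hmem p).1 hp)]

theorem eval_wrs_append_eq_iff (hM : M.Inj S) (x : Term .array) {W1 W2 : List (ℕ × ℕ)}
    (hW : ∀ p ∈ W1 ++ W2, (.index, p.1) ∈ S) (hn : ((W1 ++ W2).map Prod.fst).Nodup) :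
    M.eval (wrs (wrs x W1) W2) = M.eval (wrs x W1) ↔
      ∀ p ∈ W2, M.rd (M.eval x) (M.const .index p.1) = M.const .elem p.2 := by
  have hne : ∀ p ∈ W2, ∀ q ∈ W1, M.const .index q.1 ≠ M.const .index p.1 := by
    intro p hp q hq e
    have := hM _ _ (hW q (List.mem_append_left _ hq)) (hW p (List.mem_append_right _ hp)) e
    rw [List.map_append, List.nodup_append] at hn
    exact hn.2.2 _ (List.mem_map_of_mem hq) _ (List.mem_map_of_mem hp) this
  have hn2 : (W2.map Prod.fst).Nodup := by
    rw [List.map_append] at hn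
    exact hn.of_append_right
  have hW2 : ∀ p ∈ W2, (.index, p.1) ∈ S := fun p hp => hW p (List.mem_append_right _ hp)
  constructor
  · intro h p hp
    rw [← M.rd_wrs_of_ne x (hne p hp), ← h, hM.rd_wrs_of_mem _ hW2 hn2 hp]
  · intro h
    refine M.array_ext fun k => ?_
    rcases M.exists_write_or W2 k with ⟨p, hp, rfl⟩ | h'
    · rw [hM.rd_wrs_of_mem _ hW2 hn2 hp, M.rd_wrs_of_ne x (hne p hp), h p hp]
    · rw [M.rd_wrs_of_ne _ h']

theorem Node.Good.sound_cases {n m : Node} (hm : m.Good) (hnm : Link n.toM m.toM) {i d : ℕ}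
    (hi : (.index, i) ∈ m.common) (hd : (.elem, d) ∈ m.common)
    (hW : ∀ p ∈ W, (.index, p.1) ∈ m.sigA ∧ (.elem, p.2) ∈ m.sigA ∧ p.1 ≠ i ∧ p.2 ≠ d)
    (hent : ∀ M : Model, M.HoldsAll m.A →
      ∃ p ∈ W, M.const .index p.1 = M.const .index i ∧ M.const .elem p.2 = M.const .elem d) :
    Sound n (W.map fun p => (m.identify .index p.1 i).identify .elem p.2 d) ∧
      ∀ c ∈ W.map fun p => (m.identify .index p.1 i).identify .elem p.2 d, c.Good := by
  have hi' := mem_inter.1 hi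
  have hd' := mem_inter.1 hd
  have key : ∀ p ∈ W, Link ⟨m.sigA, m.sigB,
      insert (.and (.eq (idx p.1) (idx i)) (.eq (el p.2) (el d))) m.A, m.B⟩
      ((m.identify .index p.1 i).identify .elem p.2 d).toM ∧
      ((m.identify .index p.1 i).identify .elem p.2 d).Good := by
    intro p hp
    obtain ⟨h1, h2, h3, h4⟩ := hW p hp
    have hA₀ := hm.subA
    have hA1 : constsOf (insert (Form.eq (el p.2) (el d)) m.A) ⊆ m.sigA := by
      rw [constsOf_insert]
      simp only [Form.consts, Term.consts]
      grind
    have hA2 : constsOf (insert (Form.eq (idx p.1) (idx i)) (insert (Form.eq (el p.2) (el d)) m.A)) ⊆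
        m.sigA := by
      rw [constsOf_insert]
      simp only [Form.consts, Term.consts]
      grind
    have hA3 : constsOf (insert (.and (.eq (idx p.1) (idx i)) (.eq (el p.2) (el d))) m.A) ⊆
        m.sigA := by
      rw [constsOf_insert]
      simp only [Form.consts, Term.consts]
      grind
    have hg := hm.identify (s := .index) (old := p.1) hi'.1 fun _ => hi'.2
    obtain ⟨l2, g2⟩ := hg.link_identify (s := .elem) (old := p.2) (new := d) h4 hd'.1 h2
      fun _ => hd'.2
    have l₀ := Link.replace (SB := m.sigB) (B := m.B) (fun M => by
      simp only [Model.holds_insert, Model.Holds, and_assoc]) hA3 hA2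
    have l1 := Link.identify_insert (SA := m.sigA) (SB := m.sigB) h3 hA1 hm.subB h1 hi'.1
      fun _ => hi'.2
    have e : (insert (Form.eq (el p.2) (el d)) m.A).image (Form.rename .index p.1 i) =
        insert (Form.eq (el p.2) (el d)) (m.A.image (Form.rename .index p.1 i)) := by
      rw [image_insert, Form.rename_of_notMem]
      simp [Form.consts, Term.consts]
    rw [e] at l1
    exact ⟨l₀.trans (l1.trans l2), g2⟩
  have hcons : ∀ p ∈ W, (Form.and (.eq (idx p.1) (idx i)) (.eq (el p.2) (el d))).consts ⊆
      m.sigA := by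
    intro p hp
    obtain ⟨h1, h2, -⟩ := hW p hp
    simp only [Form.consts, Term.consts]
    grind
  refine ⟨⟨fun H hc => hnm.der H ?_, fun c hc hs => ?_⟩, fun c hc => ?_⟩
  · refine Dv.cases (W.map fun p => .and (.eq (idx p.1) (idx i)) (.eq (el p.2) (el d))) ?_ ?_ ?_
    · intro ψ hψ
      obtain ⟨p, hp, rfl⟩ := List.mem_map.1 hψ
      exact hcons p hp
    · intro M hM
      obtain ⟨p, hp, h1, h2⟩ := hent M hM
      exact holds_bigOr.2 ⟨_, List.mem_map_of_mem hp, h1, h2⟩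
    · intro ψ hψ
      obtain ⟨p, hp, rfl⟩ := List.mem_map.1 hψ
      exact (key p hp).1.der H (hc _ (List.mem_map_of_mem hp))
  · obtain ⟨p, hp, rfl⟩ := List.mem_map.1 hc
    obtain ⟨M, h1, h2⟩ := (key p hp).1.sat hs
    exact hnm.sat ⟨M, h1.mono (subset_insert _ _), h2⟩
  · obtain ⟨p, hp, rfl⟩ := List.mem_map.1 hc
    exact (key p hp).2

theorem Sound.cons {n c : Node} {ψ : Form} (hψ : ψ.consts ⊆ n.sigA)
    (h1 : Link (⟨n.sigA, n.sigB, insert ψ n.A, n.B⟩ : MNode) c.toM)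
    (h2 : Sound (n.withA (insert (.neg ψ) n.A)) cs) : Sound n (c :: cs) := by
  refine ⟨fun H hd => ?_, fun c' hc' hs => ?_⟩
  · have d1 := h1.der H (hd _ List.mem_cons_self)
    have d2 := h2.der H fun c' hc' => hd c' (List.mem_cons_of_mem _ hc')
    refine Dv.cases [ψ, .neg ψ] (by simpa [Form.consts] using hψ) (fun M _ => ?_) ?_
    · rw [holds_bigOr]
      by_cases hM : M.Holds ψ
      · exact ⟨_, by simp, hM⟩
      · exact ⟨.neg _, by simp, hM⟩
    · intro φ hφ
      simp only [List.mem_cons, List.not_mem_nil, or_false] at hφ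
      rcases hφ with rfl | rfl
      exacts [d1, d2]
  · rcases List.mem_cons.1 hc' with rfl | hc'
    · obtain ⟨M, hM, hM'⟩ := h1.sat hs
      exact ⟨M, hM.mono (subset_insert _ _), hM'⟩
    · obtain ⟨M, hM, hM'⟩ := h2.sat c' hc' hs
      exact ⟨M, hM.mono (subset_insert _ _), hM'⟩

theorem NeAll.erase (h : NeAll A S) (hL : IsEq L) :
    NeAll (A.erase L) S := by
  obtain ⟨s, t, u, rfl⟩ := hL
  intro i j hi hj hij
  exact (h i j hi hj hij).imp (fun h => mem_erase.2 ⟨nofun, h⟩)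
    fun h => mem_erase.2 ⟨nofun, h⟩

theorem litRule_prec {a b : ℕ} (h : LitRule ord L (arr a) (wrs (arr b) V)) : Prec ord .array b a := by
  obtain ⟨b', V', h1, h2, -⟩ := litRule_arr.1 h
  obtain ⟨rfl, -⟩ := wrs_inj.1 h1
  exact h2

section

variable {SA SB : Finset Const} {A A' B B' : Finset Form}

/-- The fresh constants `X` and definitions `D` introduced by splitting. -/
def IsSplit (X : Finset Const) (D : Finset Form) (c c' c2 i d d2 : ℕ) (W1 : List (ℕ × ℕ)) :
    Prop :=
  (X = {(.array, c2), (.index, i), (.elem, d), (.elem, d2)} ∧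
      D = {.eq (arr c2) (wrs (arr c') W1), .eq (.diff (arr c) (arr c2)) (idx i),
        .eq (.rd (arr c) (idx i)) (el d), .eq (.rd (arr c2) (idx i)) (el d2)}) ∨
    (W1 = [] ∧ c2 = c' ∧ X = {(.index, i), (.elem, d), (.elem, d2)} ∧
      D = {.eq (.diff (arr c) (arr c2)) (idx i),
        .eq (.rd (arr c) (idx i)) (el d), .eq (.rd (arr c2) (idx i)) (el d2)})

theorem Link.define_split {c c' c2 i d d2 : ℕ} {W1 : List (ℕ × ℕ)} (hA : constsOf A ⊆ SA)
    (hB : constsOf B ⊆ SB) (hc : (.array, c) ∈ SA ∩ SB)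
    (hW1 : (wrs (arr c') W1).consts ⊆ SA ∩ SB) (hdd : d ≠ d2) (hX : Disjoint X (SA ∪ SB))
    (hc2 : IsSplit X D c c' c2 i d d2 W1) :
    Link ⟨SA, SB, A, B⟩ ⟨SA ∪ X, SB ∪ X, A ∪ D, B ∪ D⟩ ∧
      (∀ N : Model, N.HoldsAll D ↔ N.const .array c2 = N.eval (wrs (arr c') W1) ∧
        N.HoldsAll (diffDefs c c2 i d2 d)) ∧ (∀ φ ∈ D, Flat φ ∧ IsEq φ) ∧
      ((.index, i) ∈ X ∧ (.elem, d) ∈ X ∧ (.elem, d2) ∈ X) ∧ (.array, c2) ∈ SA ∪ X := by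
  have hfresh : ∀ c ∈ X, c ∉ SA ∪ SB := fun c hc h => disjoint_left.1 hX hc h
  obtain ⟨hcA, hcB⟩ := mem_inter.1 hc
  have hW₁A := hW1.trans inter_subset_left
  have hW₁B := hW1.trans inter_subset_right
  have hc'A : (.array, c') ∈ SA := (consts_wrs_subset.1 hW₁A).1 (mem_consts_arr c')
  have hc'B : (.array, c') ∈ SB := (consts_wrs_subset.1 hW₁B).1 (mem_consts_arr c')
  have hcomm : ∀ S : Finset Const, S ∪ {(.index, i), (.elem, d2), (.elem, d)} =
      S ∪ {(.index, i), (.elem, d), (.elem, d2)} := fun S => by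
    rw [pair_comm (Srt.elem, d2)]
  have hcomm' : ∀ S : Finset Form, S ∪ diffDefs c c2 i d2 d =
      S ∪ {.eq (.diff (arr c) (arr c2)) (idx i),
        .eq (.rd (arr c) (idx i)) (el d), .eq (.rd (arr c2) (idx i)) (el d2)} := fun S => by
    rw [diffDefs, pair_comm (Form.eq (.rd (arr c2) (idx i)) (el d2))]
  rcases hc2 with ⟨rfl, rfl⟩ | ⟨rfl, rfl, rfl, rfl⟩
  · have hf2 := hfresh (.array, c2) (by simp)
    have hdisj : Disjoint {(.index, i), (.elem, d2), (.elem, d)}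
        (insert (.array, c2) SA ∪ insert (.array, c2) SB) := by
      have h1 := hfresh (.index, i) (by simp)
      have h2 := hfresh (.elem, d) (by simp)
      have h3 := hfresh (.elem, d2) (by simp)
      simp only [disjoint_insert_left, disjoint_singleton_left]
      grind
    have l1 := Link.define true .array c2 (wrs (arr c') W1)
      (.eq (arr c2) (wrs (arr c') W1)) hf2 hW₁A (fun _ => hW₁B) (fun _ => Iff.rfl)
      (Finset.Subset.refl _) hA hB
    have key : ∀ {S : Finset Const} {C : Finset Form}, constsOf C ⊆ S →
        (wrs (arr c') W1).consts ⊆ S →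
        constsOf (insert (.eq (arr c2) (wrs (arr c') W1)) C) ⊆ insert (.array, c2) S := by
      intro S C hC hS
      rw [constsOf_insert, Form.consts]
      simp only [Term.consts]
      grind
    have l2 := Link.define_diff (SA := insert (.array, c2) SA)
      (SB := insert (.array, c2) SB) true (a := c) (b := c2) (i := i) (e := d2) (d := d)
      hdd.symm hdisj (mem_insert_of_mem hcA) (mem_insert_self _ _)
      (fun _ => ⟨mem_insert_of_mem hcB, mem_insert_self _ _⟩) (key hA hW₁A)
      (key hB hW₁B)
    refine ⟨?_, fun N => ?_, ?_, by simp, by simp⟩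
    · have := l1.trans l2
      simpa only [if_true, hcomm, hcomm', insert_union_comm] using this
    · simp only [diffDefs, Model.holds_insert, Model.holds_singleton, Model.Holds, Model.eval]
      tauto
    · intro φ hφ
      simp only [mem_insert, mem_singleton] at hφ
      rcases hφ with rfl | rfl | rfl | rfl
      exacts [⟨.wr _ _ _, _, _, _, rfl⟩, ⟨.diff _ _ _, _, _, _, rfl⟩, ⟨.rd _ _ _, _, _, _, rfl⟩,
        ⟨.rd _ _ _, _, _, _, rfl⟩]
  · have hdisj : Disjoint {(.index, i), (.elem, d2), (.elem, d)} (SA ∪ SB) := by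
      have h1 := hfresh (.index, i) (by simp)
      have h2 := hfresh (.elem, d) (by simp)
      have h3 := hfresh (.elem, d2) (by simp)
      simp only [disjoint_insert_left, disjoint_singleton_left]
      exact ⟨h1, h3, h2⟩
    have l2 := Link.define_diff true (a := c) (b := c2) (i := i) (e := d2) (d := d)
      hdd.symm hdisj hcA hc'A (fun _ => ⟨hcB, hc'B⟩) hA hB
    refine ⟨?_, fun N => ?_, ?_, by simp, mem_union_left _ hc'A⟩
    · simpa only [if_true, hcomm, hcomm'] using l2
    · simp only [diffDefs, Model.holds_insert, Model.holds_singleton, Model.Holds, Model.eval]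
      rw [show N.eval (wrs (arr c2) []) = N.const .array c2 from rfl]
      tauto
    · intro φ hφ
      simp only [mem_insert, mem_singleton] at hφ
      rcases hφ with rfl | rfl | rfl
      exacts [⟨.diff _ _ _, _, _, _, rfl⟩, ⟨.rd _ _ _, _, _, _, rfl⟩, ⟨.rd _ _ _, _, _, _, rfl⟩]

end

theorem split_facts (hn : n.Good) {c c' : ℕ} {V W W1 W2 : List (ℕ × ℕ)} (hL : L ∈ n.A)
    (hr : LitRule n.ord L (arr c) (wrs (arr c') V))
    (hW : NF n.ord ∅ (wrs (arr c') V) (wrs (arr c') W)) (q : ℕ × ℕ → Prop) [DecidablePred q]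
    (hW1 : W1 = W.filter fun p => q p) (hW2 : W2 = W.filter fun p => ¬ q p) :
    (∀ p ∈ W1 ++ W2, (.index, p.1) ∈ constsOf n.A ∧ (.elem, p.2) ∈ constsOf n.A) ∧
      ((W1 ++ W2).map Prod.fst).Nodup ∧ ∀ N : Model, N.Inj (constsOf n.A) →
        (N.Holds L ↔ N.const .array c = N.eval (wrs (wrs (arr c') W1) W2)) := by
  have hVc : (wrs (arr c') V).consts ⊆ constsOf n.A :=
    hr.consts_subset.2.1.trans (subset_constsOf hL)
  obtain ⟨-, hWi, hWn, hWe⟩ := hW.sound_wrs hn.adm.1 hVc hn.constsOf_mem_ord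
  refine ⟨fun p hp => (consts_wrs_subset.1 (hW.empty_subset hVc)).2 p ?_, ?_, fun N hN => ?_⟩
  · rcases List.mem_append.1 hp with hp | hp
    · exact (List.mem_filter.1 (hW1 ▸ hp)).1
    · exact (List.mem_filter.1 (hW2 ▸ hp)).1
  · refine List.Perm.nodup ((List.Perm.map _ ?_).symm) hWn
    have := List.filter_append_perm (fun p => decide (q p)) W
    rw [hW1, hW2]
    simpa using this
  · rw [hr.holds_iff, hWe N hN, wrs_filter_append hN (arr c') hWi hWn q, ← hW1, ← hW2]
    rfl

theorem split_sound (hn : n.Good) (hinv : NeAll n.A (constsOf n.A)) {c c' c2 i d d2 : ℕ}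
    {V W W1 W2 : List (ℕ × ℕ)} {M : Node} (hL : L ∈ n.A)
    (hr : LitRule n.ord L (arr c) (wrs (arr c') V)) (hc : (.array, c) ∈ n.common)
    (hW : NF n.ord ∅ (wrs (arr c') V) (wrs (arr c') W))
    (hW1 : W1 = W.filter fun p => (.index, p.1) ∈ n.common ∧ (.elem, p.2) ∈ n.common)
    (hW2 : W2 = W.filter fun p => ¬ ((.index, p.1) ∈ n.common ∧ (.elem, p.2) ∈ n.common))
    (hdd : d ≠ d2) (hc2 : IsSplit X D c c' c2 i d d2 W1)
    (hext : n.CanExtend true X ord' D) (hM : M = n.extend true X ord'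
      (insert (.neg (.eq (el d) (el d2)))
        (insert (.eq (arr c) (wrs (arr c2) W2)) (n.A.erase L))) D) :
    Sound n (n.withA (insert (.eq (arr c) (wrs (arr c') W1)) (n.A.erase L) ∪ reads c' W2) ::
        W2.map fun p => (M.identify .index p.1 i).identify .elem p.2 d) ∧
      ∀ m ∈ n.withA (insert (.eq (arr c) (wrs (arr c') W1)) (n.A.erase L) ∪ reads c' W2) ::
        W2.map fun p => (M.identify .index p.1 i).identify .elem p.2 d, m.Good := by
  obtain ⟨hWA, hnod, hE⟩ := split_facts hn hL hr hW
    (fun p => (.index, p.1) ∈ n.common ∧ (.elem, p.2) ∈ n.common) hW1 hW2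
  have hmem := fun p hp => (hWA p hp).1
  have hWA2 := fun p hp => hWA p (List.mem_append_right _ hp)
  have hnod₂ : (W2.map Prod.fst).Nodup := by
    rw [List.map_append] at hnod
    exact hnod.of_append_right
  have hc' : (.array, c') ∈ n.common := hn.prec_common (litRule_prec hr) hc
  have hinv' := hinv.erase hr.isEq
  have hAe := constsOf_mono (erase_subset L n.A)
  have hsub := hn.subA
  have hcS := (mem_inter.1 hc).1
  have hc'S := (mem_inter.1 hc').1
  have hWψ : (wrs (arr c') W1).consts ⊆ n.common := by
    refine consts_wrs_subset.2 ⟨by simpa [Term.consts] using hc', fun p hp => ?_⟩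
    rw [hW1, List.mem_filter, decide_eq_true_eq] at hp
    exact hp.2
  have hψS : (Form.eq (arr c) (wrs (arr c') W1)).consts ⊆ n.sigA := by
    rw [Form.consts]
    exact union_subset (by simpa [Term.consts] using hcS)
      (hWψ.trans inter_subset_left)
  have hrS : constsOf (reads c' W2) ⊆ n.sigA :=
    constsOf_reads_subset hc'S fun p hp => ⟨hsub (hWA2 p hp).1, hsub (hWA2 p hp).2⟩
  have hc₁S : constsOf (insert (.eq (arr c) (wrs (arr c') W1)) (n.A.erase L) ∪ reads c' W2) ⊆
      n.sigA := by
    rw [constsOf_union, constsOf_insert]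
    exact union_subset (union_subset hψS (hAe.trans hsub)) hrS
  have hg1 : (n.withA (insert (.eq (arr c) (wrs (arr c') W1)) (n.A.erase L) ∪ reads c' W2)).Good := by
    refine hn.withA hc₁S fun φ hφ => ?_
    simp only [mem_union, mem_insert] at hφ
    rcases hφ with (rfl | hφ) | hφ
    · exact okForm_of_flat_isEq _ (.wr _ _ _) ⟨_, _, _, rfl⟩
    · exact hn.okA φ (mem_of_mem_erase hφ)
    · exact okForm_of_flat_isEq _ (flat_of_mem_reads hφ).1 (flat_of_mem_reads hφ).2
  have hl1 : Link ⟨n.sigA, n.sigB, insert (.eq (arr c) (wrs (arr c') W1)) n.A, n.B⟩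
      (n.withA (insert (.eq (arr c) (wrs (arr c') W1)) (n.A.erase L) ∪ reads c' W2)).toM := by
    refine Link.replace (fun N => ?_) ?_ hc₁S
    · change _ ↔ N.HoldsAll (insert (.eq (arr c) (wrs (arr c') W1)) (n.A.erase L) ∪ reads c' W2)
      conv_lhs => rw [← insert_erase hL]
      simp only [Model.holds_insert, Model.holds_union]
      rw [and_assoc, and_comm (a := N.HoldsAll (n.A.erase L))]
      refine and_congr_right fun hψ => and_congr_left fun hN => ?_
      have hNi := hinv'.inj hN
      rw [hE N hNi, holdsAll_reads]
      change N.const .array c = N.eval (wrs (arr c') W1) at hψ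
      rw [hψ, eq_comm, eval_wrs_append_eq_iff hNi (arr c') hmem hnod]
      rfl
    · rw [constsOf_insert]
      exact union_subset hψS hsub
  have hA₀ : constsOf (insert (.neg (.eq (arr c) (wrs (arr c') W1))) n.A) ⊆ n.sigA := by
    rw [constsOf_insert]
    exact union_subset hψS hsub
  obtain ⟨hDl, hDh, hDf, ⟨hiX, hdX, hd₂X⟩, hc₂X⟩ :=
    Link.define_split hA₀ hn.subB hc hWψ hdd hext.1 hc2
  have hDc := hext.2.2.2 rfl
  have hfresh : ∀ c ∈ X, c ∉ n.sigA := fun c hc h =>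
    disjoint_left.1 hext.1 hc (mem_union_left _ h)
  have hMA : constsOf (insert (.neg (.eq (el d) (el d2)))
      (insert (.eq (arr c) (wrs (arr c2) W2)) (n.A.erase L))) ⊆ n.sigA ∪ X := by
    have h : (wrs (arr c2) W2).consts ⊆ n.sigA ∪ X := consts_wrs_subset.2
      ⟨by simpa [Term.consts] using hc₂X, fun p hp =>
        ⟨mem_union_left _ (hsub (hWA2 p hp).1),
          mem_union_left _ (hsub (hWA2 p hp).2)⟩⟩
    rw [constsOf_insert, constsOf_insert, Form.consts, Form.consts, Form.consts]
    simp only [Term.consts] at h ⊢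
    grind
  have hMg : M.Good := by
    rw [hM]
    refine hn.extend hext hMA (by simp) ?_ ?_
    · intro φ hφ
      simp only [mem_insert] at hφ
      rcases hφ with rfl | rfl | hφ
      · exact okForm_ne _ (by simp) _ _
      · exact okForm_of_flat_isEq _ (.wr _ _ _) ⟨_, _, _, rfl⟩
      · exact hn.okA φ (mem_of_mem_erase hφ)
    · exact fun φ hφ => okForm_of_flat_isEq _ (hDf φ hφ).1 (hDf φ hφ).2
  have hMA' : ∀ N : Model, N.HoldsAll M.A ↔ ((N.const .elem d ≠ N.const .elem d2) ∧
      (N.const .array c = N.eval (wrs (arr c2) W2)) ∧ N.HoldsAll (n.A.erase L)) ∧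
      N.HoldsAll D := fun N => by
    rw [hM]
    change N.HoldsAll (insert (.neg (.eq (el d) (el d2)))
        (insert (.eq (arr c) (wrs (arr c2) W2)) (n.A.erase L)) ∪ D) ↔ _
    rw [Model.holds_union, Model.holds_insert, Model.holds_insert]
    rfl
  have hMl : Link (n.withA (insert (.neg (.eq (arr c) (wrs (arr c') W1))) n.A)).toM M.toM := by
    refine hDl.trans ?_
    have hMs := hMg.subA
    rw [hM] at hMs
    have : Link ⟨n.sigA ∪ X, n.sigB ∪ X, insert (.neg (.eq (arr c) (wrs (arr c') W1))) n.A ∪ D,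
        n.B ∪ D⟩ ⟨n.sigA ∪ X, n.sigB ∪ X, M.A, n.B ∪ D⟩ := by
      refine Link.replace (fun N => ?_) ?_ (by rw [hM]; exact hMs)
      · rw [hMA', Model.holds_union]
        refine and_congr_left fun hD => ?_
        conv_lhs => rw [← insert_erase hL]
        rw [Model.holds_insert, Model.holds_insert]
        obtain ⟨e1, e2⟩ := (hDh N).1 hD
        have e3 := Model.ne_iff_of_diffDefs e2
        refine and_congr ?_ (and_congr_left fun hN => ?_)
        · rw [← e3, e1]
          rfl
        · rw [hE N (hinv'.inj hN), N.eval_wrs_congr (y := arr c2) e1.symm W2]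
      · rw [constsOf_union]
        simp only [Node.common] at hDc
        grind
    rw [hM] at this ⊢
    exact this
  have hMc : ∀ z ∈ X, z ∈ M.common := fun z hz => by
    rw [hM]
    exact mem_inter.2 ⟨mem_union_right _ hz, mem_union_right _ hz⟩
  have hMsig : M.sigA = n.sigA ∪ X := by rw [hM]; rfl
  obtain ⟨hs, hgs⟩ := hMg.sound_cases (W := W2) hMl (hMc _ hiX) (hMc _ hdX) (fun p hp => by
      rw [hMsig]
      refine ⟨mem_union_left _ (hsub (hWA2 p hp).1),
        mem_union_left _ (hsub (hWA2 p hp).2), ?_, ?_⟩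
      · rintro rfl
        exact hfresh _ hiX (hsub (hWA2 p hp).1)
      · rintro rfl
        exact hfresh _ hdX (hsub (hWA2 p hp).2)) (fun N hN => by
      obtain ⟨⟨h1, h2, h3⟩, hD⟩ := (hMA' N).1 hN
      obtain ⟨-, e2⟩ := (hDh N).1 hD
      simp only [diffDefs, Model.holds_insert, Model.holds_singleton, Model.Holds,
        Model.eval] at e2
      obtain ⟨-, e3, e4⟩ := e2
      rcases N.exists_write_or W2 (N.const .index i) with ⟨p, hp, e⟩ | h
      · refine ⟨p, hp, e, ?_⟩
        rw [← (hinv'.inj h3).rd_wrs_of_mem (arr c2) (fun p hp => (hWA2 p hp).1) hnod₂ hp, ← h2, e, e4]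
      · have := N.rd_wrs_of_ne (arr c2) h
        rw [← h2, e4] at this
        exact (h1 (this.trans e3)).elim)
  refine ⟨.cons hψS hl1 hs, fun m hm => ?_⟩
  rcases List.mem_cons.1 hm with rfl | hm
  exacts [hg1, hgs m hm]

/-! # Soundness of the completion instructions -/

theorem UndesiredA.sound (hn : n.Good) (hinv : NeAll n.A (constsOf n.A)) (h : UndesiredA n cs) : Sound n cs ∧ ∀ c ∈ cs, c.Good := by
  cases h with
  | shareRead c i d m ord' hL hc hi hd hext =>
    have e : (Form.eq (.rd (arr c) (idx i)) (el d)).rename .elem d m =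
        .eq (.rd (arr c) (idx i)) (el m) := by
      simp [Form.rename, Form.subst, Term.subst]
    obtain ⟨h1, h2⟩ := hn.share (s := .elem) (old := d) (new := m) (t := .rd (arr c) (idx i)) hL
      (DefLit.rd d c i).spec.1 (DefLit.rd d c i).spec.2.1
      (by simp only [Term.consts]; grind) hd (.rd _ _ _) ⟨_, _, _, rfl⟩ (by rwa [e])
    exact ⟨.of_link h1, by simpa using h2⟩
  | shareArray L a c m W ord' hL hr hW ha hext hm =>
    have hLc : L.consts = insert (.array, a) (wrs (arr c) W).consts := by
      have := hr.consts_subset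
      simp only [Term.consts] at this
      ext z
      grind
    have hflat : Flat L := by
      obtain ⟨b', V', h1, h2, rfl | ⟨-, rfl⟩⟩ := litRule_arr.1 hr
      exacts [.wr _ _ _, .wr _ _ []]
    obtain ⟨h1, h2⟩ := hn.share (s := .array) (old := a) (new := m) (t := wrs (arr c) W) hL
      (fun M => hr.holds_iff M) hLc hW ha hflat hr.isEq (hext.congr (by
        rw [constsOf_singleton, constsOf_singleton]
        refine (consts_rename_subset .array a m L).trans ?_
        rw [hLc]
        simp only [Form.consts, Term.consts]
        grind))
    exact ⟨.of_link h1, by simpa using h2⟩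
  | shareDiff a b k m ord' hL ha hb hk hext =>
    have e : (Form.eq (.diff (arr a) (arr b)) (idx k)).rename .index k m =
        .eq (.diff (arr a) (arr b)) (idx m) := by
      simp [Form.rename, Form.subst, Term.subst]
    obtain ⟨h1, h2⟩ := hn.share (s := .index) (old := k) (new := m) (t := .diff (arr a) (arr b)) hL
      (DefLit.diff k a b).spec.1 (DefLit.diff k a b).spec.2.1
      (by simp only [Term.consts]; grind) hk (.diff _ _ _) ⟨_, _, _, rfl⟩ (by rwa [e])
    exact ⟨.of_link h1, by simpa using h2⟩
  | split L c c' c2 i d d2 V W W1 W2 ord' X D M hL hr hc hrhs hW hW1 hW2 hdd hc2 hext hM =>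
    exact split_sound hn hinv hL hr hc hW hW1 hW2 hdd (hc2.imp (fun h => ⟨h.1, h.2.1⟩) id) hext hM

theorem Node.Good.compl (hn : n.Good) {del add : Finset Form} (h : Compl n.ord n.A del add) :
    constsOf (n.A \ del ∪ add) ⊆ n.sigA ∧ ∀ φ ∈ n.A \ del ∪ add, OKForm n.phase φ := by
  refine ⟨?_, fun φ hφ => ?_⟩
  · rw [constsOf_union]
    exact (union_subset (constsOf_mono sdiff_subset) h.consts_add_subset).trans hn.subA
  · rcases mem_union.1 hφ with hφ | hφ
    · exact hn.okA φ (mem_sdiff.1 hφ).1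
    · exact okForm_of_flat_isEq _ (h.flat_add φ hφ).1 (h.flat_add φ hφ).2

theorem NeAll.sdiff (h : NeAll A S) {del : Finset Form} (hdel : ∀ φ ∈ del, IsEq φ) : NeAll (A \ del) S := by
  have key : ∀ {t u : Term .index}, Form.neg (.eq t u) ∉ del := fun h => by
    obtain ⟨s, t, u, e⟩ := hdel _ h
    cases e
  intro i j hi hj hij
  exact (h i j hi hj hij).imp (fun h => mem_sdiff.2 ⟨h, key⟩)
    fun h => mem_sdiff.2 ⟨h, key⟩

theorem Node.Good.compl_iff (hn : n.Good) (hinv : NeAll n.A (constsOf n.A))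
    {del add : Finset Form} (h : Compl n.ord n.A del add) (M : Model) :
    M.HoldsAll n.A ↔ M.HoldsAll (n.A \ del ∪ add) := by
  have hinv' := hinv.sdiff h.isEq_del
  constructor
  · intro hM
    exact (h.holdsAll_iff hn.adm.1 hn.constsOf_mem_ord (hinv.inj hM)).1 hM
  · intro hM
    exact (h.holdsAll_iff hn.adm.1 hn.constsOf_mem_ord
      (hinv'.inj (hM.mono subset_union_left))).2 hM

theorem ComplA.sound (hn : n.Good) (hinv : NeAll n.A (constsOf n.A))
    (hinv' : NeAll n.B (constsOf n.B)) (h : ComplA n cs) :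
    Sound n cs ∧ ∀ c ∈ cs, c.Closed ∨ c.Good := by
  cases h with
  | single del add h hdel =>
    obtain ⟨h1, h2⟩ := hn.compl h
    exact ⟨.of_link (Link.replace (hn.compl_iff hinv h) hn.subA h1),
      by simpa using .inr (hn.withA h1 h2)⟩
  | both del add hA hB hdel =>
    obtain ⟨h1, h2⟩ := hn.compl hA
    obtain ⟨h3, h4⟩ := hn.swap.compl hB
    refine ⟨.of_link ((Link.replace (hn.compl_iff hinv hA) hn.subA h1).trans
      (Link.replace₂ (hn.swap.compl_iff hinv' hB) hn.subB h3)), ?_⟩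
    simpa using .inr ⟨h1, h3, hn.adm, h2, h4⟩
  | fail h =>
    exact ⟨.of_not_holdsAll fun M hM => h.not_holdsAll hn.adm.1 (hinv.inj hM) hM,
      by simp [Node.Closed.of_bot]⟩

theorem Sym.sound {P : Node → List Node → Prop} (h : Sym P n cs)
    (hP : ∀ {m ds}, m = n ∨ m = n.swap → P m ds → Sound m ds ∧ ∀ c ∈ ds, c.Closed ∨ c.Good) :
    Sound n cs ∧ ∀ c ∈ cs, c.Closed ∨ c.Good := by
  rcases h with h | ⟨ds, h, rfl⟩
  · exact hP (.inl rfl) h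
  · obtain ⟨h1, h2⟩ := hP (.inr rfl) h
    refine ⟨h1.swap, fun c hc => ?_⟩
    obtain ⟨d, hd, rfl⟩ := List.mem_map.1 hc
    exact (h2 d hd).imp .swap .swap

theorem CompletionStep.sound (hn : n.Good) (h : CompletionStep n cs) : Sound n cs ∧ ∀ c ∈ cs, c.Closed ∨ c.Good := by
  rcases h with h | ⟨hI, h⟩
  · refine h.sound fun {m ds} hm hP => ?_
    have hg : m.Good := by
      rcases hm with rfl | rfl
      exacts [hn, hn.swap]
    rcases hP with hP | hP
    · exact hP.sound hg
    · exact ⟨(hP.sound hg).1, fun c hc => .inr ((hP.sound hg).2 c hc)⟩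
  · have hA : NeAll n.A (constsOf n.A) := fun i j hi hj =>
      neAll_of_exhausted hn (fun cs hc => hI cs (.inl (.inl hc))) i j
        (mem_union_left _ hi) (mem_union_left _ hj)
    have hB : NeAll n.B (constsOf n.B) := fun i j hi hj =>
      neAll_of_exhausted hn.swap (fun cs hc => hI.swap cs (.inl (.inl hc))) i j
        (mem_union_left _ hi) (mem_union_left _ hj)
    rcases h with h | ⟨-, h⟩
    · refine h.sound fun {m ds} hm hP => ?_
      have hg : m.Good ∧ NeAll m.A (constsOf m.A) := by
        rcases hm with rfl | rfl
        exacts [⟨hn, hA⟩, ⟨hn.swap, hB⟩]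
      rcases hP with hP | hP
      · exact ⟨(hP.sound hg.1).1, fun c hc => .inr ((hP.sound hg.1).2 c hc)⟩
      · have := hP.sound hg.1 hg.2
        exact ⟨this.1, fun c hc => .inr (this.2 c hc)⟩
    · refine h.sound fun {m ds} hm hP => ?_
      rcases hm with rfl | rfl
      exacts [hP.sound hn hA hB, hP.sound hn.swap hB hA]

/-! # Extensions of the precedence -/

theorem exists_fresh (S : Finset Const) (s : Srt) : ∃ m, (s, m) ∉ S := by
  by_contra h
  push Not at h
  have : (Set.range fun m : ℕ => (s, m)) ⊆ (S : Set Const) := by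
    rintro _ ⟨m, rfl⟩
    exact h m
  exact Set.infinite_range_of_injective (fun a b h => by simpa using h)
    (S.finite_toSet.subset this)

theorem Admissible.append {SA SB : Finset Const} (h : Admissible SA SB ord) {l : List Const}
    (hl : l.Nodup) (hX : Disjoint l.toFinset (SA ∪ SB)) :
    Admissible (SA ∪ l.toFinset) SB (ord ++ l) := by
  obtain ⟨h1, h2, h3⟩ := h
  have hd : ∀ c ∈ l, c ∉ SA ∪ SB := fun c hc h =>
    disjoint_left.1 hX (List.mem_toFinset.2 hc) h
  refine ⟨?_, ?_, ?_⟩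
  · rw [List.nodup_append]
    refine ⟨h1, hl, fun a ha b hb e => hd b hb ?_⟩
    exact (h2 b).1 (e ▸ ha)
  · intro c
    rw [List.mem_append, h2]
    simp only [mem_union, List.mem_toFinset]
    tauto
  · intro s x y hx hy
    have hx' : (s, x) ∈ SA ∩ SB := by
      simp only [mem_inter, mem_union, List.mem_toFinset] at hx ⊢
      refine ⟨hx.1.resolve_right fun h => hd _ h (mem_union_right _ hx.2), hx.2⟩
    by_cases hyl : (s, y) ∈ l
    · have h1 : List.Sublist [(s, x)] ord :=
        List.singleton_sublist.2 ((h2 _).2 (mem_union_left _ (mem_inter.1 hx').1))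
      exact h1.append (List.singleton_sublist.2 hyl)
    · refine (h3 s x y hx' ?_).mono (List.sublist_append_left _ _)
      simp only [mem_sdiff, mem_inter, mem_union, List.mem_toFinset] at hy ⊢
      tauto

/-- New common constants can be inserted anywhere between the common constants of the same sort. -/
theorem Admissible.insert {SA SB : Finset Const} {l l1 l2 : List Const}
    (h : Admissible SA SB (l1 ++ l2)) (hl : l.Nodup) (hX : Disjoint l.toFinset (SA ∪ SB))
    (hs : ∀ c ∈ l, ∀ c' ∈ l1, c.1 = c'.1 → c' ∈ SA ∩ SB) :
    Admissible (SA ∪ l.toFinset) (SB ∪ l.toFinset) (l1 ++ l ++ l2) ∧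
      (l1 ++ l2).Sublist (l1 ++ l ++ l2) := by
  obtain ⟨h1, h2, h3⟩ := h
  have hd : ∀ c ∈ l, c ∉ SA ∪ SB := fun c hc h =>
    disjoint_left.1 hX (List.mem_toFinset.2 hc) h
  have hsub : (l1 ++ l2).Sublist (l1 ++ l ++ l2) :=
    (List.sublist_append_left _ _).append (List.Sublist.refl _)
  have hmem : ∀ c, c ∈ l1 ++ l ++ l2 ↔ c ∈ l1 ++ l2 ∨ c ∈ l := fun c => by
    simp only [List.mem_append]
    tauto
  have hnod : (l1 ++ l ++ l2).Nodup := by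
    have hp : (l1 ++ l ++ l2).Perm ((l1 ++ l2) ++ l) := by
      rw [List.append_assoc, List.append_assoc]
      exact List.Perm.append_left _ List.perm_append_comm
    rw [hp.nodup_iff, List.nodup_append]
    exact ⟨h1, hl, fun a ha b hb e => hd b hb ((h2 b).1 (e ▸ ha))⟩
  refine ⟨⟨hnod, fun c => ?_, fun s x y hx hy => ?_⟩, hsub⟩
  · rw [hmem, h2]
    simp only [mem_union, List.mem_toFinset]
    tauto
  · simp only [mem_sdiff, mem_inter, mem_union, List.mem_toFinset] at hx hy
    have hyl : (s, y) ∉ l := by tauto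
    by_cases hxl : (s, x) ∈ l
    · have hy2 : (s, y) ∈ l2 := by
        have : (s, y) ∈ l1 ++ l2 := (h2 _).2 (by simp only [mem_union]; tauto)
        refine (List.mem_append.1 this).resolve_left fun h => ?_
        have := mem_inter.1 (hs _ hxl _ h rfl)
        tauto
      have h1 : List.Sublist [(s, x)] (l1 ++ l) :=
        List.singleton_sublist.2 (List.mem_append_right _ hxl)
      exact h1.append (List.singleton_sublist.2 hy2)
    · refine (h3 s x y ?_ ?_).mono hsub
      all_goals
        simp only [mem_sdiff, mem_inter, mem_union]
        tauto

theorem Admissible.insert_after {SA SB : Finset Const} (h : Admissible SA SB ord) {c m : ℕ}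
    (hc : (s, c) ∈ SA ∩ SB) (hm : (s, m) ∉ SA ∪ SB) : ∃ ord', Admissible (SA ∪ {(s, m)}) (SB ∪ {(s, m)}) ord' ∧
      ord.Sublist ord' ∧ Prec ord' s c m ∧ ∀ y, Prec ord s c y → Prec ord' s m y := by
  obtain ⟨l1, l2, rfl⟩ := List.append_of_mem ((h.2.1 _).2
    (mem_union_left _ (mem_inter.1 hc).1))
  have e : l1 ++ (s, c) :: l2 = (l1 ++ [(s, c)]) ++ l2 := by simp
  rw [e] at h ⊢
  have key := Admissible.insert (l := [(s, m)]) h (by simp) (by simpa using hm) (by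
    simp only [List.mem_singleton, forall_eq]
    rintro ⟨s', x⟩ hx rfl
    rcases List.mem_append.1 hx with hx | hx
    · by_contra hxc
      have hlt := h.2.2 s c x hc (mem_sdiff.2
        ⟨(h.2.1 _).1 (List.mem_append_left _ (List.mem_append_left _ hx)), hxc⟩)
      have hlt' : Prec (l1 ++ [(s, c)] ++ l2) s x c :=
        ((List.singleton_sublist.2 hx).append (List.Sublist.refl [(s, c)])).trans
          (List.sublist_append_left _ _)
      exact hlt.asymm h.1 hlt'
    · rw [List.mem_singleton] at hx
      rwa [hx])
  refine ⟨_, key.1, key.2, ?_, fun y hy => ?_⟩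
  · exact ((List.sublist_append_right l1 [(s, c)]).append (List.Sublist.refl [(s, m)])).trans
      (List.sublist_append_left _ _)
  · have hy2 : (s, y) ∈ l2 := by
      rcases List.mem_append.1 hy.mem_right with hx | hx
      · exfalso
        rcases List.mem_append.1 hx with hx | hx
        · have hlt' : Prec (l1 ++ [(s, c)] ++ l2) s y c :=
            ((List.singleton_sublist.2 hx).append (List.Sublist.refl [(s, c)])).trans
              (List.sublist_append_left _ _)
          exact hy.asymm h.1 hlt'
        · simp only [List.mem_singleton, Prod.mk.injEq, true_and] at hx
          subst hx
          exact hy.irrefl h.1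
      · exact hx
    exact (List.sublist_append_right _ [(s, m)]).append (List.singleton_sublist.2 hy2)

theorem Node.Good.canExtend_append (hn : n.Good) {l : List Const} (hl : l.Nodup)
    (hX : Disjoint l.toFinset (n.sigA ∪ n.sigB)) (D : Finset Form) :
    n.CanExtend false l.toFinset (n.ord ++ l) D :=
  ⟨hX, List.sublist_append_left _ _, by simpa using hn.adm.append hl hX, by simp⟩

theorem Node.Good.canExtend_front (hn : n.Good) {l : List Const} (hl : l.Nodup)
    (hX : Disjoint l.toFinset (n.sigA ∪ n.sigB)) (hD : constsOf D ⊆ n.common ∪ l.toFinset) : n.CanExtend true l.toFinset (l ++ n.ord) D :=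
  ⟨hX, List.sublist_append_right _ _,
    by simpa using (Admissible.insert (l1 := []) hn.adm hl hX (by simp)).1, fun _ => hD⟩

/-! # Applicability of the instructions -/

/-- A term that is not a constant contains a subterm that can be named by a constant. -/
theorem Term.exists_flatten : ∀ {s' : Srt} (t : Term s'), (∃ n, t = .const s' n) ∨
    ∃ (s : Srt) (u : Term s), ∀ α, (s, α) ∉ t.consts → (∃ D, DefLit s α u D) ∧
      ∃ t' : Term s', Term.subst s α u t' = t ∧ (s, α) ∈ t'.consts
  | _, .const s n => .inl ⟨n, rfl⟩
  | _, .rd x i => by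
    right
    rcases x.exists_flatten with ⟨a, rfl⟩ | ⟨s, u, h⟩
    · rcases i.exists_flatten with ⟨i, rfl⟩ | ⟨s, u, h⟩
      · exact ⟨.elem, .rd (arr a) (idx i), fun α _ => ⟨⟨_, .rd _ _ _⟩, el α, by simp [Term.subst],
          by simp [Term.consts]⟩⟩
      · refine ⟨s, u, fun α hα => ?_⟩
        simp only [Term.consts, mem_union, not_or] at hα
        obtain ⟨hD, t', h1, h2⟩ := h α hα.2
        exact ⟨hD, .rd (arr a) t', by
          rw [Term.subst, h1, Term.subst_of_notMem _ _ _ _ (by simpa [Term.consts] using hα.1)],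
          by simp [Term.consts, h2]⟩
    · refine ⟨s, u, fun α hα => ?_⟩
      simp only [Term.consts, mem_union, not_or] at hα
      obtain ⟨hD, t', h1, h2⟩ := h α hα.1
      exact ⟨hD, .rd t' i, by rw [Term.subst, h1, Term.subst_of_notMem _ _ _ _ hα.2],
        by simp [Term.consts, h2]⟩
  | _, .wr x i e => by
    right
    rcases x.exists_flatten with ⟨a, rfl⟩ | ⟨s, u, h⟩
    · rcases i.exists_flatten with ⟨i, rfl⟩ | ⟨s, u, h⟩
      · rcases e.exists_flatten with ⟨e, rfl⟩ | ⟨s, u, h⟩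
        · exact ⟨.array, wrs (arr a) [(i, e)], fun α _ => ⟨⟨_, .wr _ _ _ (by simp)⟩, arr α,
            by simp [Term.subst, wrs], by simp [Term.consts]⟩⟩
        · refine ⟨s, u, fun α hα => ?_⟩
          simp only [Term.consts, mem_union, not_or] at hα
          obtain ⟨hD, t', h1, h2⟩ := h α hα.2
          exact ⟨hD, .wr (arr a) (idx i) t', by
            rw [Term.subst, h1, Term.subst_of_notMem _ _ _ _ (by simpa [Term.consts] using hα.1.1),
              Term.subst_of_notMem _ _ _ _ (by simpa [Term.consts] using hα.1.2)],
            by simp [Term.consts, h2]⟩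
      · refine ⟨s, u, fun α hα => ?_⟩
        simp only [Term.consts, mem_union, not_or] at hα
        obtain ⟨hD, t', h1, h2⟩ := h α hα.1.2
        exact ⟨hD, .wr (arr a) t' e, by
          rw [Term.subst, h1, Term.subst_of_notMem _ _ _ _ (by simpa [Term.consts] using hα.1.1),
            Term.subst_of_notMem _ _ _ _ hα.2], by simp [Term.consts, h2]⟩
    · refine ⟨s, u, fun α hα => ?_⟩
      simp only [Term.consts, mem_union, not_or] at hα
      obtain ⟨hD, t', h1, h2⟩ := h α hα.1.1
      exact ⟨hD, .wr t' i e, by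
        rw [Term.subst, h1, Term.subst_of_notMem _ _ _ _ hα.1.2,
          Term.subst_of_notMem _ _ _ _ hα.2], by simp [Term.consts, h2]⟩
  | _, .diff x y => by
    right
    rcases x.exists_flatten with ⟨a, rfl⟩ | ⟨s, u, h⟩
    · rcases y.exists_flatten with ⟨b, rfl⟩ | ⟨s, u, h⟩
      · exact ⟨.index, .diff (arr a) (arr b), fun α _ => ⟨⟨_, .diff _ _ _⟩, idx α,
          by simp [Term.subst], by simp [Term.consts]⟩⟩
      · refine ⟨s, u, fun α hα => ?_⟩
        simp only [Term.consts, mem_union, not_or] at hα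
        obtain ⟨hD, t', h1, h2⟩ := h α hα.2
        exact ⟨hD, .diff (arr a) t', by
          rw [Term.subst, h1, Term.subst_of_notMem _ _ _ _ (by simpa [Term.consts] using hα.1)],
          by simp [Term.consts, h2]⟩
    · refine ⟨s, u, fun α hα => ?_⟩
      simp only [Term.consts, mem_union, not_or] at hα
      obtain ⟨hD, t', h1, h2⟩ := h α hα.1
      exact ⟨hD, .diff t' y, by rw [Term.subst, h1, Term.subst_of_notMem _ _ _ _ hα.2],
        by simp [Term.consts, h2]⟩

theorem flat_of_consts (s : Srt) (m n : ℕ) : Flat (.eq (.const s m) (.const s n)) := by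
  cases s
  exacts [.wr _ _ [], .idxEq _ _, .elemEq _ _]

theorem IsLit.exists_flatten (h : IsLit L) (hL : ¬ Flat L) :
    ∃ (s : Srt) (u : Term s), ∀ α, (s, α) ∉ L.consts → (∃ D, DefLit s α u D) ∧
      ∃ L' : Form, L'.subst s α u = L ∧ (s, α) ∈ L'.consts := by
  have key : ∀ {s' : Srt} (t v : Term s'), (∃ m n, t = .const s' m ∧ v = .const s' n) ∨
      ∃ (s : Srt) (u : Term s), ∀ α, (s, α) ∉ (Form.eq t v).consts → (∃ D, DefLit s α u D) ∧
        ∃ t' v' : Term s', Term.subst s α u t' = t ∧ Term.subst s α u v' = v ∧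
          (s, α) ∈ (Form.eq t' v').consts := by
    intro s' t v
    rcases t.exists_flatten with ⟨m, rfl⟩ | ⟨s, u, h⟩
    · rcases v.exists_flatten with ⟨n, rfl⟩ | ⟨s, u, h⟩
      · exact .inl ⟨m, n, rfl, rfl⟩
      · refine .inr ⟨s, u, fun α hα => ?_⟩
        simp only [Form.consts, mem_union, not_or] at hα
        obtain ⟨hD, t', h1, h2⟩ := h α hα.2
        exact ⟨hD, _, t', Term.subst_of_notMem _ _ _ _ hα.1, h1, by simp [Form.consts, h2]⟩
    · refine .inr ⟨s, u, fun α hα => ?_⟩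
      simp only [Form.consts, mem_union, not_or] at hα
      obtain ⟨hD, t', h1, h2⟩ := h α hα.1
      exact ⟨hD, t', _, h1, Term.subst_of_notMem _ _ _ _ hα.2, by simp [Form.consts, h2]⟩
  cases h with
  | pos t v =>
    rcases key t v with ⟨m, n, rfl, rfl⟩ | ⟨s, u, h⟩
    · exact (hL (flat_of_consts _ _ _)).elim
    · refine ⟨s, u, fun α hα => ?_⟩
      obtain ⟨hD, t', v', h1, h2, h3⟩ := h α hα
      exact ⟨hD, .eq t' v', by rw [Form.subst, h1, h2], h3⟩
  | neg t v =>
    rcases key t v with ⟨m, n, rfl, rfl⟩ | ⟨s, u, h⟩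
    · exact (hL (.ne _ _ _)).elim
    · refine ⟨s, u, fun α hα => ?_⟩
      obtain ⟨hD, t', v', h1, h2, h3⟩ := h α hα
      exact ⟨hD, .neg (.eq t' v'), by rw [Form.subst, Form.subst, h1, h2], h3⟩

theorem Node.Good.exists_flatten (hn : n.Good) (hL : L ∈ n.A) (hlit : IsLit L) (hflat : ¬ Flat L) : ∃ cs, FlattenA n cs := by
  obtain ⟨s, u, h⟩ := hlit.exists_flatten hflat
  obtain ⟨α, hα⟩ := exists_fresh (n.sigA ∪ n.sigB) s
  obtain ⟨⟨D, hD⟩, L', h1, h2⟩ := h α fun hc =>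
    hα (mem_union_left _ (hn.subA (subset_constsOf hL hc)))
  exact ⟨_, .mk false L L' s α u D _ hL hflat hD h1 h2
    (by simpa using hn.canExtend_append (l := [(s, α)]) (by simp) (by simpa using hα) {D})⟩

theorem exists_fresh₂ (S : Finset Const) (s : Srt) : ∃ m k, (s, m) ∉ S ∧ (s, k) ∉ S ∧ m ≠ k := by
  obtain ⟨m, hm⟩ := exists_fresh S s
  obtain ⟨k, hk⟩ := exists_fresh (insert (s, m) S) s
  simp only [mem_insert, Prod.mk.injEq, true_and, not_or] at hk
  exact ⟨m, k, hm, hk.2, fun e => hk.1 e.symm⟩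

theorem disjoint_toFinset {l : List Const} (h : ∀ c ∈ l, c ∉ S) :
    Disjoint l.toFinset S :=
  disjoint_left.2 fun c hc => h c (List.mem_toFinset.1 hc)

theorem Node.Good.exists_arrayNe (hn : n.Good) {a b : ℕ}
    (hL : Form.neg (.eq (arr a) (arr b)) ∈ n.A) : ∃ cs, ArrayNeA n cs := by
  obtain ⟨i, hi⟩ := exists_fresh (n.sigA ∪ n.sigB) .index
  obtain ⟨e, d, he, hd, hed⟩ := exists_fresh₂ (n.sigA ∪ n.sigB) .elem
  have := hn.canExtend_append (l := [(.index, i), (.elem, e), (.elem, d)]) (by simp [hed])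
    (disjoint_toFinset (by simp only [List.forall_mem_cons]; exact ⟨hi, he, hd, by simp⟩))
    (diffDefs a b i e d)
  simp only [List.toFinset_cons, List.toFinset_nil, insert_empty_eq] at this
  exact ⟨_, .mk false a b i e d _ hL hed this⟩

theorem Node.Good.exists_repair (hn : n.Good) {a i : ℕ} (ha : (.array, a) ∈ n.localA)
    (hi : (.index, i) ∈ n.localA) (hmiss : ∀ e', ¬ Rews n.ord n.A (.rd (arr a) (idx i)) (el e')) : ∃ cs, RepairA n cs := by
  obtain ⟨e, he⟩ := exists_fresh (n.sigA ∪ n.sigB) .elem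
  exact ⟨_, .mk false a i e _ ha hi hmiss
    (by simpa using hn.canExtend_append (l := [(.elem, e)]) (by simp) (by simpa using he) _)⟩

/-! # States to which the instructions of higher priority do not apply -/

/-- The invariants restored with the highest priority. -/
structure Inv (ord : List Const) (A : Finset Form) (S : Finset Const) : Prop where
  ne : NeAll A S
  noEq : ∀ i j, Form.eq (idx i) (idx j) ∉ A
  noClash : ∀ i, Form.neg (.eq (idx i) (idx i)) ∉ A
  reach : ∀ a i, (.array, a) ∈ S → (.index, i) ∈ S → Reach ord A a i

theorem Node.Good.inv (hn : n.Good) (h : Exhausted (Sym InvA) n) :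
    Inv n.ord n.A n.localA := by
  have hg : ∀ cs, ¬ GuessA n cs := fun cs hc => h cs (.inl (.inl hc))
  refine ⟨neAll_of_exhausted hn hg, fun i j hL => ?_, fun i hL => hg _ (.clash i hL),
    fun a i ha hi => ?_⟩
  · by_cases hij : i = j
    · subst hij
      exact hg _ (.refl i hL)
    · have hc := (subset_constsOf hL).trans hn.subA
      simp only [Form.consts, Term.consts] at hc
      rcases prec_total hn.adm.1 (s := .index) (x := i) (y := j)
        (hn.mem_ord (mem_union_left _ (hc (by simp))))
        (hn.mem_ord (mem_union_left _ (hc (by simp)))) hij with hlt | hlt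
      · exact hg _ (.merge _ j i hL (.inr rfl) hlt)
      · exact hg _ (.merge _ i j hL (.inl rfl) hlt)
  · by_contra hr
    obtain ⟨cs, hc⟩ := hn.exists_repair ha hi fun e he => hr (reach_iff.2 ⟨e, he⟩)
    exact h cs (.inl (.inr hc))

theorem exists_NF_wrs (hn : ord.Nodup) (b : ℕ) (V : List (ℕ × ℕ)) :
    ∃ W, NF ord ∅ (wrs (arr b) V) (wrs (arr b) W) := by
  obtain ⟨u, hu, hu'⟩ := exists_NF hn ∅ (wrs (arr b) V)
  suffices h : ∃ W, u = wrs (arr b) W by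
    obtain ⟨W, rfl⟩ := h
    exact ⟨W, hu, hu'⟩
  clear hu'
  induction hu with
  | refl => exact ⟨V, rfl⟩
  | tail _ h ih =>
    obtain ⟨W, rfl⟩ := ih
    obtain ⟨b', W', rfl, ⟨L, hL, -⟩ | ⟨rfl, -⟩⟩ := h.wrs_shape
    · simp at hL
    · exact ⟨W', rfl⟩

/-- There are no common literals to be copied and no undesired literals. -/
structure Shared (n : Node) : Prop where
  copy : ∀ L ∈ n.A, L.consts ⊆ n.common → L ∈ n.B
  rule : ∀ L ∈ n.A, ∀ {s : Srt} (l r : Term s), s ≠ .elem ∨ (∃ a i, l ≍ Term.rd (arr a) (idx i)) →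
    LitRule n.ord L l r → l.consts ⊆ n.common → L.consts ⊆ n.common
  array : ∀ L ∈ n.A, ∀ (a : ℕ) (r : Term .array), LitRule n.ord L (arr a) r →
    r.consts ⊆ n.common → (.array, a) ∈ n.common
  diff : ∀ a b i, Form.eq (.diff (arr a) (arr b)) (idx i) ∈ n.A → (.array, a) ∈ n.common →
    (.array, b) ∈ n.common → (.index, i) ∈ n.common

theorem LitRule.consts_eq (h : LitRule ord L l r) : L.consts = l.consts ∪ r.consts := by
  have := h.consts_subset
  exact Finset.Subset.antisymm this.2.2 (union_subset this.1 this.2.1)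

theorem Node.Good.exists_split (hn : n.Good) {c c' : ℕ} (hL : L ∈ n.A)
    (hr : LitRule n.ord L (arr c) (wrs (arr c') V)) (hc : (.array, c) ∈ n.common)
    (hrhs : ¬ (wrs (arr c') V).consts ⊆ n.common) :
    ∃ cs, UndesiredA n cs := by
  obtain ⟨W, hW⟩ := exists_NF_wrs hn.adm.1 c' V
  have hlt := litRule_prec hr
  have hc' := hn.prec_common hlt hc
  obtain ⟨i, hi⟩ := exists_fresh (n.sigA ∪ n.sigB) .index
  obtain ⟨d, d2, hd, hd2, hdd⟩ := exists_fresh₂ (n.sigA ∪ n.sigB) .elem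
  obtain ⟨c2, hc2⟩ := exists_fresh (n.sigA ∪ n.sigB) .array
  obtain ⟨h1, h2⟩ := Admissible.insert (l1 := []) (l := [(.index, i), (.elem, d), (.elem, d2)])
    hn.adm (by simp [hdd])
    (disjoint_toFinset (by simp only [List.forall_mem_cons]; exact ⟨hi, hd, hd2, by simp⟩))
    (by simp)
  obtain ⟨ord', h3, h4, h5, h6⟩ := h1.insert_after (s := .array) (c := c') (m := c2)
    (by simp only [Node.common] at hc'; grind) (by simp at hc2 ⊢; tauto)
  have e : ∀ S : Finset Const, S ∪ {(.array, c2), (.index, i), (.elem, d), (.elem, d2)} =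
      S ∪ [(Srt.index, i), (.elem, d), (.elem, d2)].toFinset ∪ {(.array, c2)} := fun S => by
    ext z
    simp only [mem_union, mem_insert, mem_singleton, List.mem_toFinset,
      List.mem_cons, List.not_mem_nil]
    tauto
  refine ⟨_, .split L c c' c2 i d d2 V W _ _ ord'
    {(.array, c2), (.index, i), (.elem, d), (.elem, d2)} _ _ hL hr hc hrhs hW rfl rfl hdd
    (.inl ⟨rfl, rfl, h5, h6 _ (hlt.mono h2)⟩) ⟨?_, h2.trans h4, ?_, fun _ => ?_⟩ rfl⟩
  · simp only [disjoint_insert_left, disjoint_singleton_left]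
    exact ⟨hc2, hi, hd, hd2⟩
  · simp only [if_true]
    rw [e, e]
    exact h3
  · have hw : (wrs (arr c') (W.filter fun p => (.index, p.1) ∈ n.common ∧
        (.elem, p.2) ∈ n.common)).consts ⊆ n.common := consts_wrs_subset.2
      ⟨by simpa [Term.consts] using hc', fun p hp => by
        simpa using (List.mem_filter.1 hp).2⟩
    simp only [constsOf_insert, constsOf_singleton, Form.consts]
    simp only [Term.consts] at hw ⊢
    grind

theorem Node.Good.shared (hn : n.Good) (h : Exhausted (Sym CopyOrUndesiredA) n) :
    Shared n := by
  have hu : ∀ cs, ¬ UndesiredA n cs := fun cs hc => h cs (.inl (.inr hc))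
  refine ⟨fun L hL hLc => ?_, fun L hL s l r hs hr hl => ?_, fun L hL a r hr hc => ?_,
    fun a b k hL ha hb => ?_⟩
  · by_contra hB
    exact h _ (.inl (.inl (.mk L hL hB hLc)))
  · rw [hr.consts_eq]
    refine union_subset hl ?_
    rcases litRule_lhs_cases hr with ⟨a, b, W, rfl, h1, h2⟩ | ⟨a, i, e, rfl, h1, h2⟩ |
      ⟨e, d, rfl, h1, h2⟩
    · cases h1
      cases h2
      by_contra hrc
      obtain ⟨cs, hc⟩ := hn.exists_split hL hr (by simpa [Term.consts] using hl) hrc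
      exact hu cs hc
    · cases h1
      cases h2
      by_contra hd
      obtain ⟨m, hm⟩ := exists_fresh (n.sigA ∪ n.sigB) .elem
      obtain ⟨e', h1, rfl⟩ := litRule_rd.1 hr
      cases h1
      simp only [Term.consts] at hl hd
      refine hu _ (.shareRead a i e m ([(.elem, m)] ++ n.ord) hL (hl (by simp)) (hl (by simp))
        (fun h => hd (by simpa using h)) ?_)
      simpa using hn.canExtend_front (l := [(.elem, m)]) (by simp) (by simpa using hm)
        (D := {.eq (.rd (arr a) (idx i)) (el m)}) (by
          simp only [constsOf_singleton, Form.consts, Term.consts, List.toFinset_cons]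
          grind)
    · rcases hs with hs | ⟨a, i, hs⟩
      · exact (hs rfl).elim
      · cases h1.symm.trans hs
  · by_contra ha
    obtain ⟨c, W, rfl, hlt, -⟩ := litRule_arr.1 hr
    obtain ⟨m, hm⟩ := exists_fresh (n.sigA ∪ n.sigB) .array
    have hcc : (.array, c) ∈ n.common := (consts_wrs_subset.1 hc).1 (mem_consts_arr c)
    obtain ⟨ord', h1, h2, h3, -⟩ := hn.adm.insert_after (s := .array) (c := c) (m := m) hcc hm
    refine hu _ (.shareArray L a c m W ord' hL hr hc ha ⟨by simpa using hm, h2, h1, fun _ => ?_⟩ h3)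
    simp only [constsOf_singleton, Form.consts]
    simp only [Term.consts] at hc ⊢
    grind
  · by_contra hk
    obtain ⟨m, hm⟩ := exists_fresh (n.sigA ∪ n.sigB) .index
    refine hu _ (.shareDiff a b k m ([(.index, m)] ++ n.ord) hL ha hb hk ?_)
    simpa using hn.canExtend_front (l := [(.index, m)]) (by simp) (by simpa using hm)
      (D := {.eq (.diff (arr a) (arr b)) (idx m)}) (by
        simp only [constsOf_singleton, Form.consts, Term.consts, List.toFinset_cons]
        grind)

/-! # Soundness of the solver -/

theorem Node.Good.phaseStep (hn : n.Good) {P : Node → List Node → Prop} {next : Phase}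
    (h : PhaseStep P next n cs)
    (hP : ∀ {m ds}, m = n ∨ m = n.swap → P m ds → Sound m ds ∧ ∀ c ∈ ds, c.Closed ∨ c.Good)
    (hA : Exhausted (Sym P) n → ∀ φ ∈ n.A, OKForm next φ)
    (hB : Exhausted (Sym P) n → ∀ φ ∈ n.B, OKForm next φ) :
    Sound n cs ∧ ∀ c ∈ cs, c.Closed ∨ c.Good := by
  rcases h with h | ⟨he, rfl⟩
  · exact h.sound hP
  · refine ⟨.of_link (.refl _), fun c hc => .inr ?_⟩
    obtain rfl := List.mem_singleton.1 hc
    exact ⟨hn.subA, hn.subB, hn.adm, hA he, hB he⟩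

theorem Node.Good.step (hn : n.Good) (h : Step n cs) :
    Sound n cs ∧ ∀ c ∈ cs, c.Closed ∨ c.Good := by
  obtain ⟨-, h⟩ := h
  have hg : ∀ {m}, m = n ∨ m = n.swap → m.Good := by
    rintro m (rfl | rfl)
    exacts [hn, hn.swap]
  have hph : ∀ {m}, m = n ∨ m = n.swap → m.phase = n.phase := by
    rintro m (rfl | rfl) <;> rfl
  have hflat : ∀ {m : Node}, m.Good → m.phase = .flatten → Exhausted (Sym FlattenA) m →
      ∀ φ ∈ m.A, Flat φ := by
    intro m hm hp he φ hφ
    by_contra hf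
    have := hm.okA φ hφ
    rw [hp] at this
    obtain ⟨cs, hc⟩ := hm.exists_flatten hφ this hf
    exact he.left cs hc
  have hne : ∀ {m : Node}, m.Good → m.phase = .arrayNe → Exhausted (Sym ArrayNeA) m →
      ∀ φ ∈ m.A, OKForm .guess φ := by
    intro m hm hp he φ hφ
    have := hm.okA φ hφ
    rw [hp] at this
    refine ⟨this, fun a b e => ?_⟩
    subst e
    obtain ⟨cs, hc⟩ := hm.exists_arrayNe hφ
    exact he.left cs hc
  have hA := hn.okA
  have hB := hn.okB
  cases hp : n.phase <;> rw [hp] at h hA hB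
  · refine hn.phaseStep h (fun hm hP => ?_) (hflat hn hp) fun he => hflat hn.swap hp he.swap
    have := hP.sound (hg hm) ((hph hm).trans hp)
    exact ⟨this.1, fun c hc => .inr (this.2 c hc)⟩
  · refine hn.phaseStep h (fun hm hP => ?_) (hne hn hp) fun he => hne hn.swap hp he.swap
    have := hP.sound (hg hm)
    exact ⟨this.1, fun c hc => .inr (this.2 c hc)⟩
  · exact hn.phaseStep h (fun hm hP => hP.sound (hg hm)) (fun _ => hA) fun _ => hB
  · refine hn.phaseStep h (fun hm hP => ?_) (fun _ => hA) fun _ => hB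
    have := hP.sound (hg hm)
    exact ⟨this.1, fun c hc => .inr (this.2 c hc)⟩
  · exact CompletionStep.sound hn h

theorem root_good (hA : IsConstraint A) (hB : IsConstraint B)
    (h : Admissible (constsOf A) (constsOf B) ord) : (root A B ord).Good :=
  ⟨Finset.Subset.refl _, Finset.Subset.refl _, h, hA, hB⟩

/-! # Lexicographic descent -/

/-- Lexicographic descent of lists of natural numbers. -/
def LexLt : List ℕ → List ℕ → Prop
  | x :: l, y :: l' => x < y ∨ x ≤ y ∧ LexLt l l'
  | _, _ => False

theorem acc_lexLt (k : ℕ) : ∀ l : List ℕ, l.length = k →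
    Acc (fun a b : List ℕ => a.length = b.length ∧ LexLt a b) l := by
  induction k with
  | zero =>
    intro l hl
    obtain rfl := List.length_eq_zero_iff.1 hl
    exact ⟨_, fun y hy => by cases y <;> exact hy.2.elim⟩
  | succ k ih =>
    have key : ∀ (x : ℕ) (t : List ℕ), t.length = k →
        Acc (fun a b : List ℕ => a.length = b.length ∧ LexLt a b) (x :: t) := by
      intro x
      induction x using Nat.strong_induction_on with
      | _ x ihx =>
        intro t ht
        induction ih t ht with
        | intro t _ iht =>
          refine ⟨_, fun y hy => ?_⟩
          obtain ⟨hlen, hy⟩ := hy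
          match y, hlen, hy with
          | x' :: t', hlen, hy =>
            have hlen' : t'.length = t.length := by simpa using hlen
            rcases hy with hlt | ⟨hle, hlt⟩
            · exact ihx x' hlt t' (hlen'.trans ht)
            · rcases hle.lt_or_eq with hx | rfl
              · exact ihx x' hx t' (hlen'.trans ht)
              · exact iht t' ⟨hlen', hlt⟩ (hlen'.trans ht)
    intro l hl
    match l, hl with
    | x :: t, hl => exact key x t (by simpa using hl)

theorem acc_of_lexLt {α : Type*} {r : α → α → Prop} (μ : α → List ℕ) (k : ℕ)
    (hk : ∀ a, (μ a).length = k) (P : α → Prop)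
    (h : ∀ a b, P b → r a b → Acc r a ∨ P a ∧ LexLt (μ a) (μ b)) : ∀ a, P a → Acc r a := by
  intro a
  generalize hl : μ a = l
  induction acc_lexLt k l (hl ▸ hk a) generalizing a with
  | intro l _ ih =>
    intro ha
    refine ⟨_, fun b hb => ?_⟩
    rcases h b a ha hb with h | ⟨hP, hlt⟩
    · exact h
    · exact ih (μ b) ⟨by rw [hk, ← hl, hk], hl ▸ hlt⟩ b rfl hP

/-! # Sums over constraints -/

theorem sum_sdiff_union_le (g : Form → ℕ) {U del : Finset Form} (add : Finset Form) (h : del ⊆ U) : ∑ φ ∈ U \ del ∪ add, g φ + ∑ φ ∈ del, g φ ≤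
      ∑ φ ∈ U, g φ + ∑ φ ∈ add, g φ := by
  have h1 := sum_union_inter (s₁ := U \ del) (s₂ := add) (f := g)
  have h2 := sum_sdiff (f := g) h
  omega

theorem sum_le_of_forall_mem_image {g g' : Form → ℕ} {U U' : Finset Form} (f : Form → Form)
    (hU : ∀ φ ∈ U', φ ∈ U.image f ∨ g' φ = 0) (hg : ∀ φ ∈ U, g' (f φ) ≤ g φ) :
    ∑ φ ∈ U', g' φ ≤ ∑ φ ∈ U, g φ := by
  classical
  calc ∑ φ ∈ U', g' φ = ∑ φ ∈ U'.filter (· ∈ U.image f), g' φ := by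
        rw [sum_filter_of_ne]
        exact fun φ hφ hne => (hU φ hφ).resolve_right hne
    _ ≤ ∑ φ ∈ U.image f, g' φ := sum_le_sum_of_subset fun φ hφ => (mem_filter.1 hφ).2
    _ ≤ ∑ φ ∈ U, g' (f φ) := sum_image_le_of_nonneg (fun _ _ => Nat.zero_le _)
    _ ≤ ∑ φ ∈ U, g φ := sum_le_sum hg

/-! # The termination measure -/

/-- The number of writes of an array term that do not have common index and element. -/
def Term.badW (C : Finset Const) : {s : Srt} → Term s → ℕ
  | _, .wr x i e => x.badW C + if i.consts ∪ e.consts ⊆ C then 0 else 1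
  | _, .const _ _ => 0
  | _, .rd _ _ => 0
  | _, .diff _ _ => 0

/-- The number of writes that are not common in an equality with common left-hand side. -/
def Form.badW (C : Finset Const) : Form → ℕ
  | .eq t u => if t.consts ⊆ C then u.badW C else 0
  | _ => 0

theorem badW_wrs (C : Finset Const) (b : ℕ) (V : List (ℕ × ℕ)) : (wrs (arr b) V).badW C =
    V.countP fun p => ¬ ((.index, p.1) ∈ C ∧ (.elem, p.2) ∈ C) := by
  induction V using List.reverseRecOn with
  | nil => rfl
  | append_singleton V p ih =>
    rw [wrs_snoc, Term.badW, ih, List.countP_append]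
    simp only [Term.consts, union_subset_iff, singleton_subset_iff, List.countP_cons,
      List.countP_nil]
    split_ifs with h1 h2 h2 <;> simp_all

/-- The array equality is not oriented by the precedence. -/
def Unoriented (ord : List Const) (φ : Form) : Prop :=
  ∃ a b V, φ = .eq (arr a) (wrs (arr b) V) ∧ V ≠ [] ∧ ¬ Prec ord .array b a

/-- A `diff`-literal with different arguments. -/
def IsDiffNe (φ : Form) : Prop := ∃ a b i, a ≠ b ∧ φ = .eq (.diff (arr a) (arr b)) (idx i)

/-- An equality between arrays. -/
def IsArrEq (φ : Form) : Prop := ∃ t u : Term .array, φ = .eq t u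

/-- An equality between index constants. -/
def IsIdxEq (φ : Form) : Prop := ∃ i j, φ = .eq (idx i) (idx j)

open Classical in
/-- The characteristic function of a property of formulas. -/
noncomputable def ind (P : Form → Prop) (φ : Form) : ℕ := if P φ then 1 else 0

theorem ind_le {P Q : Form → Prop} {φ ψ : Form} (h : P φ → Q ψ) : ind P φ ≤ ind Q ψ := by
  unfold ind
  split_ifs <;> simp_all

theorem ind_eq_zero {P : Form → Prop} : ind P φ = 0 ↔ ¬ P φ := by
  unfold ind
  split_ifs <;> simp_all

theorem ind_of {P : Form → Prop} (h : P φ) : ind P φ = 1 := if_pos h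

/-- Weights of equalities. -/
def Form.wtA (ord : List Const) : Form → ℕ
  | .eq t u => t.wtA ord + u.wtA ord
  | _ => 0

def Form.wtW : Form → ℕ
  | .eq t u => t.wtW + u.wtW
  | _ => 0

def Form.wtE (ord : List Const) : Form → ℕ
  | .eq t u => t.wtE ord + u.wtE ord
  | _ => 0

/-- The number of constants of the sort `s` in `S`. -/
def cardSort (S : Finset Const) (s : Srt) : ℕ := (S.filter fun c => c.1 = s).card

theorem cardSort_le (h : ∀ n, (s, n) ∈ S' → (s, n) ∈ S) :
    cardSort S' s ≤ cardSort S s := by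
  refine card_le_card fun c hc => ?_
  obtain ⟨s', n⟩ := c
  simp only [mem_filter] at hc ⊢
  obtain ⟨hc, rfl⟩ := hc
  exact ⟨h n hc, rfl⟩

theorem cardSort_lt (h : ∀ n, (s, n) ∈ S' → (s, n) ∈ S) (m : ℕ) (hm : (s, m) ∈ S)
    (hm' : (s, m) ∉ S') : cardSort S' s < cardSort S s := by
  refine card_lt_card ⟨fun c hc => ?_, fun hc => hm' ?_⟩
  · obtain ⟨s', n⟩ := c
    simp only [mem_filter] at hc ⊢
    obtain ⟨hc, rfl⟩ := hc
    exact ⟨h n hc, rfl⟩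
  · exact (mem_filter.1 (hc (mem_filter.2 ⟨hm, rfl⟩))).1

/-- Replacement of a constant does not increase the number of constants. -/
theorem cardSort_le_of_replace {old new : ℕ}
    (h : ∀ n, (s, n) ∈ S' → n = new ∨ (s, n) ∈ S ∧ n ≠ old) (hold : (s, old) ∈ S) :
    cardSort S' s ≤ cardSort S s := by
  have h1 : S'.filter (fun c => c.1 = s) ⊆
      insert (s, new) ((S.filter fun c => c.1 = s).erase (s, old)) := by
    rintro ⟨s', n⟩ hc
    simp only [mem_filter] at hc
    obtain ⟨hc, rfl⟩ := hc
    rcases h n hc with rfl | ⟨h1, h2⟩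
    · exact mem_insert_self _ _
    · simp [h1, h2]
  have h2 := card_le_card h1
  have h3 := card_insert_le (s, new) ((S.filter fun c => c.1 = s).erase (s, old))
  have h4 : (s, old) ∈ S.filter fun c => c.1 = s := mem_filter.2 ⟨hold, rfl⟩
  have h5 := card_erase_of_mem h4
  have h6 := card_pos.2 ⟨_, h4⟩
  unfold cardSort
  omega

open Classical in
/-- The number of irreducible array constants in `S`. -/
noncomputable def irr (ord : List Const) (A : Finset Form) (S : Finset Const) : ℕ :=
  (S.filter fun c => c.1 = .array ∧ ¬ Red ord A c.2).card

theorem irr_le (h : ∀ a, (.array, a) ∈ S' → ¬ Red ord' A' a → (.array, a) ∈ S ∧ ¬ Red ord A a) :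
    irr ord' A' S' ≤ irr ord A S := by
  refine card_le_card fun c hc => ?_
  obtain ⟨s', n⟩ := c
  simp only [mem_filter] at hc ⊢
  obtain ⟨h1, rfl, h2⟩ := hc
  exact ⟨(h n h1 h2).1, rfl, (h n h1 h2).2⟩

open Classical in
theorem irr_lt (h : ∀ a, (.array, a) ∈ S' → ¬ Red ord' A' a → (.array, a) ∈ S ∧ ¬ Red ord A a)
    (b : ℕ) (hb : (.array, b) ∈ S) (hbr : ¬ Red ord A b) (hbr' : Red ord' A' b) :
    irr ord' A' S' < irr ord A S := by
  simp only [irr]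
  refine card_lt_card ⟨fun c hc => ?_, fun hc => ?_⟩
  · obtain ⟨s', n⟩ := c
    simp only [mem_filter] at hc ⊢
    obtain ⟨h1, rfl, h2⟩ := hc
    exact ⟨(h n h1 h2).1, rfl, (h n h1 h2).2⟩
  · exact (mem_filter.1 (hc (mem_filter.2 ⟨hb, rfl, hbr⟩))).2.2 hbr'

open Classical in
/-- The number of violations of the invariants. -/
noncomputable def defect (ord : List Const) (A : Finset Form) (S : Finset Const) : ℕ :=
  ((S ×ˢ S).filter fun p => p.1.1 = .index ∧ p.2.1 = .index ∧ p.1.2 ≠ p.2.2 ∧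
    Form.neg (.eq (idx p.1.2) (idx p.2.2)) ∉ A ∧ Form.neg (.eq (idx p.2.2) (idx p.1.2)) ∉ A).card +
  ((S ×ˢ S).filter fun p => p.1.1 = .array ∧ p.2.1 = .index ∧ ¬ Reach ord A p.1.2 p.2.2).card +
  (A.filter IsIdxEq).card

theorem defect_le_aux (hS : ∀ s n, s ≠ .elem → (s, n) ∈ S' → (s, n) ∈ S)
    (hne : ∀ i j, Form.neg (.eq (idx i) (idx j)) ∈ A → Form.neg (.eq (idx i) (idx j)) ∈ A')
    (hr : ∀ a i, (.array, a) ∈ S' → (.index, i) ∈ S' → Reach ord A a i → Reach ord' A' a i)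
    (hi : ∀ i j, Form.eq (idx i) (idx j) ∈ A' → Form.eq (idx i) (idx j) ∈ A) :
    defect ord' A' S' ≤ defect ord A S ∧
    (((∃ i j, (.index, i) ∈ S ∧ (.index, j) ∈ S ∧ i ≠ j ∧ Form.neg (.eq (idx i) (idx j)) ∉ A ∧
        Form.neg (.eq (idx j) (idx i)) ∉ A ∧ Form.neg (.eq (idx i) (idx j)) ∈ A') ∨
      (∃ a i, (.array, a) ∈ S ∧ (.index, i) ∈ S ∧ ¬ Reach ord A a i ∧ Reach ord' A' a i) ∨
      (∃ i j, Form.eq (idx i) (idx j) ∈ A ∧ Form.eq (idx i) (idx j) ∉ A')) →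
      defect ord' A' S' < defect ord A S) := by
  classical
  unfold defect
  set P := (S ×ˢ S).filter fun p => p.1.1 = .index ∧ p.2.1 = .index ∧ p.1.2 ≠ p.2.2 ∧
    Form.neg (.eq (idx p.1.2) (idx p.2.2)) ∉ A ∧ Form.neg (.eq (idx p.2.2) (idx p.1.2)) ∉ A with hP
  set P' := (S' ×ˢ S').filter fun p => p.1.1 = .index ∧ p.2.1 = .index ∧ p.1.2 ≠ p.2.2 ∧
    Form.neg (.eq (idx p.1.2) (idx p.2.2)) ∉ A' ∧ Form.neg (.eq (idx p.2.2) (idx p.1.2)) ∉ A'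
    with hP'
  set Q := (S ×ˢ S).filter fun p => p.1.1 = .array ∧ p.2.1 = .index ∧ ¬ Reach ord A p.1.2 p.2.2
    with hQ
  set Q' := (S' ×ˢ S').filter fun p => p.1.1 = .array ∧ p.2.1 = .index ∧
    ¬ Reach ord' A' p.1.2 p.2.2 with hQ'
  have h1 : P' ⊆ P := by
    rintro ⟨⟨s, i⟩, ⟨s', j⟩⟩ hc
    simp only [hP, hP', mem_filter, mem_product] at hc ⊢
    obtain ⟨⟨c1, c2⟩, rfl, rfl, c3, c4, c5⟩ := hc
    exact ⟨⟨hS _ _ nofun c1, hS _ _ nofun c2⟩, rfl, rfl, c3, fun h => c4 (hne _ _ h),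
      fun h => c5 (hne _ _ h)⟩
  have h2 : Q' ⊆ Q := by
    rintro ⟨⟨s, i⟩, ⟨s', j⟩⟩ hc
    simp only [hQ, hQ', mem_filter, mem_product] at hc ⊢
    obtain ⟨⟨c1, c2⟩, rfl, rfl, c3⟩ := hc
    exact ⟨⟨hS _ _ nofun c1, hS _ _ nofun c2⟩, rfl, rfl, fun h => c3 (hr _ _ c1 c2 h)⟩
  have h3 : A'.filter IsIdxEq ⊆ A.filter IsIdxEq := by
    intro φ hφ
    simp only [mem_filter] at hφ ⊢
    obtain ⟨hφ, i, j, rfl⟩ := hφ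
    exact ⟨hi _ _ hφ, _, _, rfl⟩
  have c1 := card_le_card h1
  have c2 := card_le_card h2
  have c3 := card_le_card h3
  refine ⟨by omega, ?_⟩
  rintro (⟨i, j, hi, hj, hij, hn, hn', hm⟩ | ⟨a, i, ha, hi, hn, hm⟩ | ⟨i, j, hm, hn⟩)
  · have : P'.card < P.card := card_lt_card ⟨h1, fun h => by
      have := @h ((.index, i), (.index, j)) (by
        simp only [hP, mem_filter, mem_product]
        exact ⟨⟨hi, hj⟩, by trivial, by trivial, hij, hn, hn'⟩)
      exact (mem_filter.1 this).2.2.2.2.1 hm⟩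
    omega
  · have : Q'.card < Q.card := card_lt_card ⟨h2, fun h => by
      have := @h ((.array, a), (.index, i)) (by
        simp only [hQ, mem_filter, mem_product]
        exact ⟨⟨ha, hi⟩, by trivial, by trivial, hn⟩)
      exact (mem_filter.1 this).2.2.2 hm⟩
    omega
  · have : (A'.filter IsIdxEq).card < (A.filter IsIdxEq).card :=
      card_lt_card ⟨h3, fun h => by
        have := @h (.eq (idx i) (idx j)) (mem_filter.2 ⟨hm, _, _, rfl⟩)
        exact hn (mem_filter.1 this).1⟩
    omega

/-- The invariants measured by `defect`. -/
def NoDefect (ord : List Const) (A : Finset Form) (S : Finset Const) : Prop :=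
  NeAll A S ∧ (∀ i j, Form.eq (idx i) (idx j) ∉ A) ∧
    ∀ a i, (.array, a) ∈ S → (.index, i) ∈ S → Reach ord A a i

theorem NoDefect.eq_zero (h : NoDefect ord A S) : defect ord A S = 0 := by
  obtain ⟨h1, h2, h3⟩ := h
  classical
  simp only [defect, Nat.add_eq_zero_iff, card_eq_zero, filter_eq_empty_iff]
  refine ⟨⟨?_, ?_⟩, ?_⟩
  · rintro ⟨⟨s, i⟩, ⟨s', j⟩⟩ hc ⟨rfl, rfl, c3, c4, c5⟩
    obtain ⟨c1, c2⟩ := mem_product.1 hc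
    exact (h1 i j c1 c2 c3).elim c4 c5
  · rintro ⟨⟨s, i⟩, ⟨s', j⟩⟩ hc ⟨rfl, rfl, c3⟩
    obtain ⟨c1, c2⟩ := mem_product.1 hc
    exact c3 (h3 i j c1 c2)
  · rintro φ hφ ⟨i, j, rfl⟩
    exact h2 i j hφ

namespace Node

/-- The constants in use. -/
abbrev used (n : Node) : Finset Const := constsOf (n.A ∪ n.B)

open Classical in
/-- The termination measure of the completion phase. -/
noncomputable def measure (n : Node) : List ℕ :=
  [cardSort n.used .index,
    cardSort (n.used \ n.common) .index,
    cardSort (n.used \ n.common) .array,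
    irr n.ord n.A (n.used ∩ n.sigA) + irr n.ord n.B (n.used ∩ n.sigB),
    ∑ φ ∈ n.A ∪ n.B, ind (Unoriented n.ord) φ,
    ∑ φ ∈ n.A ∪ n.B, φ.badW n.common,
    ∑ φ ∈ n.A ∪ n.B, ind IsDiffNe φ,
    defect n.ord n.A (n.used ∩ n.sigA) + defect n.ord n.B (n.used ∩ n.sigB),
    cardSort (n.used \ n.common) .elem,
    ∑ φ ∈ n.A ∪ n.B, ind IsArrEq φ,
    ∑ φ ∈ n.A ∪ n.B, φ.wtA n.ord,
    ∑ φ ∈ n.A ∪ n.B, φ.wtW,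
    ∑ φ ∈ n.A ∪ n.B, φ.wtE n.ord,
    ((n.A ∪ n.B).filter fun φ => φ.consts ⊆ n.common ∧ φ ∉ n.A).card +
      ((n.A ∪ n.B).filter fun φ => φ.consts ⊆ n.common ∧ φ ∉ n.B).card]

theorem measure_swap (n : Node) : n.swap.measure = n.measure := by
  simp only [measure, swap, used, common, union_comm n.B n.A,
    inter_comm n.sigB n.sigA]
  congr 4
  · rw [add_comm]
  · congr 4
    · rw [add_comm]
    · congr 6
      rw [add_comm]
      congr!

theorem Good.used_inter_sigA (hn : n.Good) : n.used ∩ n.sigA = n.localA := by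
  have h1 := hn.subA
  have h2 := hn.subB
  ext c
  simp only [used, constsOf_union, localA, common, mem_inter, mem_union]
  have := @h1 c
  have := @h2 c
  tauto

end Node

/-! # Descent of the completion instructions -/

/-- A set of constants that contains the right-hand side of a rule if it contains the left-hand
side is closed under rewriting. -/
theorem Rew.subset_of_closed
    (hC : ∀ L ∈ A, ∀ {s : Srt} (l r : Term s), LitRule ord L l r → l.consts ⊆ C → r.consts ⊆ C)
    (h : Rew ord A t u) (ht : t.consts ⊆ C) : u.consts ⊆ C := by
  induction h with
  | ground L hL hr => exact hC L hL _ _ hr ht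
  | readOther | readSame | sort | overwrite =>
    simp only [Term.consts, union_subset_iff] at ht ⊢
    tauto
  | rd₁ _ _ ih | rd₂ _ _ ih | wr₁ _ _ _ ih | wr₂ _ _ _ ih | wr₃ _ _ _ ih | diff₁ _ _ ih
  | diff₂ _ _ ih =>
    simp only [Term.consts, union_subset_iff] at ht ⊢
    tauto

theorem Rews.subset_of_closed
    (hC : ∀ L ∈ A, ∀ {s : Srt} (l r : Term s), LitRule ord L l r → l.consts ⊆ C → r.consts ⊆ C)
    (h : Rews ord A t u) (ht : t.consts ⊆ C) : u.consts ⊆ C := by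
  induction h with
  | refl => exact ht
  | tail _ h ih => exact h.subset_of_closed hC ih

/-- The array constant of a reduct of the right-hand side of a rule is smaller than the left-hand
side. -/
theorem litRule_prec_of_rews (hn : ord.Nodup) (hS : ∀ c ∈ constsOf A, c ∈ ord) (hL : L ∈ A)
    {a b : ℕ} {r : Term .array} (hr : LitRule ord L (arr a) r) (h : Rews ord A r (wrs (arr b) W)) :
    Prec ord .array b a := by
  have hc : r.consts ⊆ constsOf A := hr.consts_subset.2.1.trans (subset_constsOf hL)
  have hb : (Srt.array, b) ∈ ord :=
    hS _ (h.subset_of_subset hc (mem_consts_wrs.2 (.inl (mem_consts_arr b))))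
  have ha : (Srt.array, a) ∈ ord :=
    hS _ (subset_constsOf hL (hr.consts_subset.1 (mem_consts_arr a)))
  refine (prec_iff hn).2 ⟨hb, ha, ?_⟩
  have h1 := (litRule_lt hn hr).2 rfl
  have h2 : (wrs (arr b) W).wtA ord ≤ r.wtA ord := by
    rcases h.eq_or_lt hn with h | h | h
    · rw [h]
    · exact h.le
    · exact h.1.le
  rw [wtA_wrs] at h2
  simp only [Term.wtA] at h1 h2
  omega

theorem NF.not_red {b : ℕ} {t : Term .array} (h : NF ord A t (wrs (arr b) W)) : ¬ Red ord A b := by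
  rintro ⟨L, hL, r, hr⟩
  exact h.2 _ ((Rew.ground L hL hr).wrs W)

theorem red_of_mem {a b : ℕ} (h : Form.eq (arr a) (wrs (arr b) W) ∈ A) (hp : Prec ord .array b a) : Red ord A a :=
  ⟨_, h, _, .arr a b W hp⟩

theorem eq_of_litRule_arr (hn : ord.Nodup) {a a' : ℕ} {r r' : Term .array}
    (h : LitRule ord L (arr a) r) (h' : LitRule ord L (arr a') r') :
    a = a' ∧ r = r' := by
  obtain ⟨_, h1, h2⟩ := h.lhs_unique hn h'
  exact ⟨by simpa using h1, eq_of_heq h2⟩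

theorem Compl.red (h : Compl ord A del add) (hn : ord.Nodup) (hS : ∀ c ∈ constsOf A, c ∈ ord)
    {x : ℕ} (hx : Red ord A x) :
    Red ord (A \ del ∪ add) x := by
  obtain ⟨L, hL, r, hr⟩ := hx
  by_cases hd : L ∈ del
  swap
  · exact ⟨L, mem_union_left _ (mem_sdiff.2 ⟨hL, hd⟩), r, hr⟩
  cases h with
  | orient a b V W F hL' hab hV hW hF =>
    obtain rfl := mem_singleton.1 hd
    obtain ⟨c, U, rfl, hp, h | ⟨rfl, h⟩⟩ := litRule_arr.1 hr
    · simp only [Form.eq.injEq, heq_eq_eq, true_and, Term.const.injEq, wrs_inj] at h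
      obtain ⟨rfl, rfl, rfl⟩ := h
      exact absurd hab (hp.asymm hn)
    · simp only [Form.eq.injEq, heq_eq_eq, true_and, Term.const.injEq, wrs_eq_arr] at h
      exact absurd h.2.2 hV
  | orientSelf a V W hL' hW =>
    obtain rfl := mem_singleton.1 hd
    obtain ⟨c, U, rfl, hp, h | ⟨rfl, h⟩⟩ := litRule_arr.1 hr
    · simp only [Form.eq.injEq, heq_eq_eq, true_and, Term.const.injEq, wrs_inj] at h
      obtain ⟨rfl, rfl, rfl⟩ := h
      exact absurd hp (Prec.irrefl hn)
    · simp only [Form.eq.injEq, heq_eq_eq, true_and, Term.const.injEq, wrs_eq_arr] at h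
      obtain ⟨rfl, rfl, rfl⟩ := h
      exact absurd hp (Prec.irrefl hn)
  | gaussSymmTrans L1 L2 a b1 b2 r1 r2 W1 W2 U F G hL1 hr1 hL2 hr2 hne hn1 hn2 hb hF hU hG =>
    have hxa : x = a := by
      rcases mem_insert.1 hd with rfl | hd
      · exact (eq_of_litRule_arr hn hr hr1).1
      · obtain rfl := mem_singleton.1 hd
        exact (eq_of_litRule_arr hn hr hr2).1
    subst hxa
    exact red_of_mem (b := b2) (W := W2) (mem_union_right _ (mem_union_left _
      (mem_insert_of_mem (mem_singleton_self _)))) (litRule_prec_of_rews hn hS hL2 hr2 hn2.1)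
  | gaussConfl L1 L2 a b r1 r2 W1 W2 hL1 hr1 hL2 hr2 hne hn1 hn2 =>
    have hxa : x = a := by
      rcases mem_insert.1 hd with rfl | hd
      · exact (eq_of_litRule_arr hn hr hr1).1
      · obtain rfl := mem_singleton.1 hd
        exact (eq_of_litRule_arr hn hr hr2).1
    subst hxa
    exact red_of_mem (mem_union_right _ (mem_insert_self _ _))
      (litRule_prec_of_rews hn hS hL2 hr2 hn2.1)
  | critReadWrite L1 L2 a i e' d e r hL1 hr1 hL2 hr2 hd' he =>
    obtain rfl := mem_singleton.1 hd
    cases (hr.lhs_unique hn hr1).1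
  | critRead L1 L2 a i e' d' e d hL1 hr1 hL2 hr2 hne he hd' =>
    obtain rfl := mem_singleton.1 hd
    cases (hr.lhs_unique hn hr1).1
  | critElem L1 L2 c e' d' e d hL1 hr1 hL2 hr2 hne he hd' =>
    obtain rfl := mem_singleton.1 hd
    cases (hr.lhs_unique hn hr1).1
  | @reduceRhs s L' l r1 r1' hL' hr1 hn1 hne =>
    obtain rfl := mem_singleton.1 hd
    obtain ⟨rfl, h1, h2⟩ := hr.lhs_unique hn hr1
    obtain rfl := eq_of_heq h1
    obtain rfl := eq_of_heq h2
    obtain ⟨c, U, rfl, hp, -⟩ := litRule_arr.1 hr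
    obtain ⟨b', W', rfl⟩ := hn1.1.wrs_shape
    exact red_of_mem (mem_union_right _ (mem_singleton_self _))
      (litRule_prec_of_rews hn hS hL hr hn1.1)
  | removeRefl t hL' =>
    obtain rfl := mem_singleton.1 hd
    have h1 := (litRule_lt hn hr).2 rfl
    rcases hr.eq_or with h | h <;>
    · injection h with h2 h3 h4
      cases h2
      have := (eq_of_heq h3).symm.trans (eq_of_heq h4)
      rw [this] at h1
      exact absurd h1 (lt_irrefl _)
  | redundantWrite L' a b V U U' p hL' hr' hn' hj =>
    obtain rfl := mem_singleton.1 hd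
    obtain ⟨rfl, -⟩ := eq_of_litRule_arr hn hr hr'
    exact red_of_mem (mem_union_right _ (mem_singleton_self _)) (litRule_prec hr')
  | diffJoin a b i hL' hj hab =>
    obtain rfl := mem_singleton.1 hd
    rcases hr.eq_or with h | h <;> cases h
  | diffJoinSymm a b i hL' hj hab =>
    obtain rfl := mem_singleton.1 hd
    rcases hr.eq_or with h | h <;> cases h

theorem Compl.exists_read (h : Compl ord A del add) (hn : ord.Nodup)
    (hS : ∀ c ∈ constsOf A, c ∈ ord) {a i e : ℕ} (hL : Form.eq (.rd (arr a) (idx i)) (el e) ∈ A)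
    (ha : ¬ Red ord (A \ del ∪ add) a) :
    ∃ e', Form.eq (.rd (arr a) (idx i)) (el e') ∈ A \ del ∪ add := by
  have hr : LitRule ord (.eq (.rd (arr a) (idx i)) (el e)) _ _ := .rd a i e
  by_cases hd : Form.eq (.rd (arr a) (idx i)) (el e) ∈ del
  swap
  · exact ⟨e, mem_union_left _ (mem_sdiff.2 ⟨hL, hd⟩)⟩
  have key : ∀ {L : Form} {x : ℕ} {r : Term .array}, LitRule ord L (arr x) r →
      Form.eq (.rd (arr a) (idx i)) (el e) ≠ L := by
    rintro L x r h rfl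
    cases (hr.lhs_unique hn h).1
  generalize hLe : Form.eq (.rd (arr a) (idx i)) (el e) = L at *
  have hred := fun {x : ℕ} => h.red hn hS (x := x)
  cases h with
  | orient | orientSelf | diffJoin | diffJoinSymm =>
    obtain rfl := mem_singleton.1 hd
    cases hLe
  | gaussSymmTrans L1 L2 a b1 b2 r1 r2 W1 W2 U F G hL1 hr1 hL2 hr2 hne hn1 hn2 hb hF hU hG =>
    rcases mem_insert.1 hd with h | hd
    · exact absurd h (key hr1)
    · exact absurd (mem_singleton.1 hd) (key hr2)
  | gaussConfl L1 L2 a b r1 r2 W1 W2 hL1 hr1 hL2 hr2 hne hn1 hn2 =>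
    rcases mem_insert.1 hd with h | hd
    · exact absurd h (key hr1)
    · exact absurd (mem_singleton.1 hd) (key hr2)
  | critReadWrite L1 L2 a' i' e' d e r hL1 hr1 hL2 hr2 hd' he =>
    obtain rfl := mem_singleton.1 hd
    obtain ⟨-, h1, -⟩ := hr.lhs_unique hn hr1
    simp only [heq_eq_eq, Term.rd.injEq, Term.const.injEq] at h1
    obtain ⟨rfl, rfl⟩ := h1
    exact absurd (hred ⟨_, hL2, _, hr2⟩) ha
  | critRead L1 L2 a' i' e' d' e d hL1 hr1 hL2 hr2 hne he hd' =>
    obtain rfl := mem_singleton.1 hd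
    obtain ⟨-, h1, h2⟩ := hr.lhs_unique hn hr1
    simp only [heq_eq_eq, Term.rd.injEq, Term.const.injEq] at h1 h2
    obtain ⟨rfl, rfl⟩ := h1
    obtain ⟨d'', h3, rfl⟩ := litRule_rd.1 hr2
    simp only [Term.const.injEq] at h3
    subst h3
    refine ⟨d', mem_union_left _ (mem_sdiff.2 ⟨hL2, fun h => ?_⟩)⟩
    rw [mem_singleton, ← hLe] at h
    simp only [Form.eq.injEq, heq_eq_eq, Term.const.injEq, true_and] at h
    omega
  | critElem L1 L2 c e' d' e d hL1 hr1 hL2 hr2 hne he hd' =>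
    obtain rfl := mem_singleton.1 hd
    obtain ⟨-, h1, -⟩ := hr.lhs_unique hn hr1
    cases eq_of_heq h1
  | @reduceRhs s L' l r1 r1' hL' hr1 hn1 hne =>
    obtain rfl := mem_singleton.1 hd
    obtain ⟨rfl, h1, h2⟩ := hr.lhs_unique hn hr1
    obtain rfl := eq_of_heq h1
    obtain rfl := eq_of_heq h2
    obtain ⟨d, rfl⟩ := hn1.1.el_shape
    exact ⟨d, mem_union_right _ (mem_singleton_self _)⟩
  | removeRefl t hL' =>
    have := mem_singleton.1 hd
    rw [← hLe] at this
    injection this with h2 h3 h4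
    cases h2
    cases (eq_of_heq h3).trans (eq_of_heq h4).symm
  | redundantWrite L' a b V U U' p hL' hr' hn' hj =>
    exact absurd (mem_singleton.1 hd) (key hr')

/-- The shape of the array, index and `diff`-literals that are added by a completion
instruction. -/
theorem Compl.add_cases (h : Compl ord A del add) (hn : ord.Nodup)
    (hS : ∀ c ∈ constsOf A, c ∈ ord) (hφ : φ ∈ add) :
    (∃ a b V, φ = .eq (arr a) (wrs (arr b) V) ∧ Prec ord .array b a) ∨
      (∃ a i, φ = .eq (.diff (arr a) (arr a)) (idx i)) ∨ ∃ t u : Term .elem, φ = .eq t u := by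
  have hreads : ∀ {a : ℕ} {W : List (ℕ × ℕ)} {φ : Form}, φ ∈ reads a W →
      ∃ t u : Term .elem, φ = .eq t u := by
    intro a W φ h
    obtain ⟨p, -, rfl⟩ := mem_reads.1 h
    exact ⟨_, _, rfl⟩
  have helem : ∀ {l : List (ℕ × ℕ)} {φ : Form}, φ ∈ elemEqs l →
      ∃ t u : Term .elem, φ = .eq t u := by
    intro l φ h
    obtain ⟨p, -, -, rfl⟩ := mem_elemEqs.1 h
    exact ⟨_, _, rfl⟩
  cases h with
  | orient a b V W F hL' hab hV hW hF =>
    rcases mem_insert.1 hφ with rfl | hφ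
    · exact .inl ⟨_, _, _, rfl, hab⟩
    · exact .inr (.inr (hreads hφ))
  | orientSelf a V W hL' hW => exact .inr (.inr (hreads hφ))
  | gaussSymmTrans L1 L2 a b1 b2 r1 r2 W1 W2 U F G hL1 hr1 hL2 hr2 hne hn1 hn2 hb hF hU hG =>
    rcases mem_union.1 hφ with hφ | hφ
    · rcases mem_insert.1 hφ with rfl | hφ
      · exact .inl ⟨_, _, _, rfl, hb⟩
      · obtain rfl := mem_singleton.1 hφ
        exact .inl ⟨_, _, _, rfl, litRule_prec_of_rews hn hS hL2 hr2 hn2.1⟩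
    · exact .inr (.inr (helem hφ))
  | gaussConfl L1 L2 a b r1 r2 W1 W2 hL1 hr1 hL2 hr2 hne hn1 hn2 =>
    rcases mem_insert.1 hφ with rfl | hφ
    · exact .inl ⟨_, _, _, rfl, litRule_prec_of_rews hn hS hL2 hr2 hn2.1⟩
    · rcases mem_union.1 hφ with hφ | hφ
      · rcases mem_union.1 hφ with hφ | hφ
        · exact .inr (.inr (helem hφ))
        · exact .inr (.inr (hreads hφ))
      · exact .inr (.inr (hreads hφ))
  | critReadWrite | critRead | critElem => exact .inr (.inr (helem hφ))
  | @reduceRhs s L' l r1 r1' hL' hr1 hn1 hne =>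
    obtain rfl := mem_singleton.1 hφ
    rcases litRule_lhs_cases hr1 with ⟨a, b, W, rfl, h1, h2⟩ | ⟨a, i, e, rfl, h1, h2⟩ |
      ⟨e, d, rfl, h1, h2⟩
    · obtain rfl := eq_of_heq h1
      obtain rfl := eq_of_heq h2
      obtain ⟨b', W', rfl⟩ := hn1.1.wrs_shape
      exact .inl ⟨_, _, _, rfl, litRule_prec_of_rews hn hS hL' hr1 hn1.1⟩
    · exact .inr (.inr ⟨_, _, rfl⟩)
    · exact .inr (.inr ⟨_, _, rfl⟩)
  | removeRefl t hL' => cases hφ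
  | redundantWrite L' a b V U U' p hL' hr' hn' hj =>
    obtain rfl := mem_singleton.1 hφ
    exact .inl ⟨_, _, _, rfl, litRule_prec hr'⟩
  | diffJoin a b i hL' hj hab | diffJoinSymm b a i hL' hj hab =>
    rcases mem_insert.1 hφ with rfl | hφ
    · exact .inl ⟨_, _, [], rfl, hab⟩
    · obtain rfl := mem_singleton.1 hφ
      exact .inr (.inl ⟨_, _, rfl⟩)

theorem Compl.not_unoriented (h : Compl ord A del add) (hn : ord.Nodup)
    (hS : ∀ c ∈ constsOf A, c ∈ ord) (hφ : φ ∈ add) : ¬ Unoriented ord φ := by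
  rintro ⟨a, b, V, rfl, hV, hp⟩
  rcases h.add_cases hn hS hφ with ⟨a', b', V', h, hp'⟩ | ⟨a', i, h⟩ | ⟨t, u, h⟩
  · simp only [Form.eq.injEq, heq_eq_eq, true_and, Term.const.injEq, wrs_inj] at h
    obtain ⟨rfl, rfl, rfl⟩ := h
    exact hp hp'
  all_goals cases h

theorem Compl.not_isDiffNe (h : Compl ord A del add) (hn : ord.Nodup)
    (hS : ∀ c ∈ constsOf A, c ∈ ord) (hφ : φ ∈ add) : ¬ IsDiffNe φ := by
  rintro ⟨a, b, i, hab, rfl⟩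
  rcases h.add_cases hn hS hφ with ⟨a', b', V', h, hp'⟩ | ⟨a', i, h⟩ | ⟨t, u, h⟩
  · cases h
  · cases h
    exact hab rfl
  · cases h

theorem Compl.not_idxEq (h : Compl ord A del add) (hn : ord.Nodup)
    (hS : ∀ c ∈ constsOf A, c ∈ ord) (i j : ℕ) :
    Form.eq (idx i) (idx j) ∉ add := by
  intro hφ
  rcases h.add_cases hn hS hφ with ⟨a', b', V', h, hp'⟩ | ⟨a', i, h⟩ | ⟨t, u, h⟩ <;> cases h

theorem badW_eq_zero {b : ℕ} (h : ∀ p ∈ V, (.index, p.1) ∈ C ∧ (.elem, p.2) ∈ C) : (wrs (arr b) V).badW C = 0 := by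
  rw [badW_wrs, List.countP_eq_zero]
  intro p hp
  simpa using h p hp

theorem badW_elem (t : Term .elem) : t.badW C = 0 := by cases t <;> rfl

theorem badW_idx (t : Term .index) : t.badW C = 0 := by cases t <;> rfl

theorem formBadW_elem (t u : Term .elem) : (Form.eq t u).badW C = 0 := by
  simp [Form.badW, badW_elem]

theorem badW_of_mem_reads {a : ℕ} (h : φ ∈ reads a W) : φ.badW C = 0 := by
  obtain ⟨p, -, rfl⟩ := mem_reads.1 h
  exact formBadW_elem _ _

theorem badW_of_mem_elemEqs {l : List (ℕ × ℕ)} (h : φ ∈ elemEqs l) : φ.badW C = 0 := by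
  obtain ⟨p, -, -, rfl⟩ := mem_elemEqs.1 h
  exact formBadW_elem _ _

theorem formBadW_eq_zero {a b : ℕ} (h : (.array, a) ∈ C → (wrs (arr b) V).consts ⊆ C) :
    (Form.eq (arr a) (wrs (arr b) V)).badW C = 0 := by
  simp only [Form.badW]
  split_ifs with ha
  · exact badW_eq_zero (consts_wrs_subset.1 (h (ha (mem_consts_arr a)))).2
  · rfl

/-- Apart from orientation and Gaussian completion, completion instructions do not add writes that
are not common to a literal with common left-hand side. -/
theorem Compl.badW_add (h : Compl ord A del add) (hn : ord.Nodup)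
    (hC : ∀ L ∈ A, ∀ {s : Srt} (l r : Term s), LitRule ord L l r → l.consts ⊆ C → r.consts ⊆ C) :
    (∃ L ∈ del, Unoriented ord L) ∨
      (∃ b, (.array, b) ∈ constsOf A ∧ ¬ Red ord A b ∧ Red ord (A \ del ∪ add) b) ∨
      ∀ φ ∈ add, φ.badW C = 0 := by
  have harr : ∀ {L : Form} {a : ℕ} {r t : Term .array}, L ∈ A → LitRule ord L (arr a) r →
      NF ord A r t → (Srt.array, a) ∈ C → t.consts ⊆ C := by
    intro L a r t hL hr hnf ha
    exact hnf.1.subset_of_closed hC (hC L hL _ _ hr (by simpa [Term.consts] using ha))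
  cases h with
  | orient a b V W F hL' hab hV hW hF =>
    exact .inl ⟨_, mem_singleton_self _, a, b, V, rfl, hV, hab.asymm hn⟩
  | orientSelf a V W hL' hW => exact .inr (.inr fun φ hφ => badW_of_mem_reads hφ)
  | gaussSymmTrans L1 L2 a b1 b2 r1 r2 W1 W2 U F G hL1 hr1 hL2 hr2 hne hn1 hn2 hb hF hU hG =>
    refine .inr (.inl ⟨b1, ?_, hn1.not_red, red_of_mem (W := U)
      (mem_union_right _ (mem_union_left _ (mem_insert_self _ _))) hb⟩)
    exact hn1.1.subset_of_subset (hr1.consts_subset.2.1.trans (subset_constsOf hL1))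
      (mem_consts_wrs.2 (.inl (mem_consts_arr b1)))
  | gaussConfl L1 L2 a b r1 r2 W1 W2 hL1 hr1 hL2 hr2 hne hn1 hn2 =>
    refine .inr (.inr fun φ hφ => ?_)
    rcases mem_insert.1 hφ with rfl | hφ
    · refine formBadW_eq_zero fun ha => consts_wrs_subset.2 ?_
      obtain ⟨h1, h2⟩ := consts_wrs_subset.1 (harr hL1 hr1 hn1 ha)
      exact ⟨h1, fun p hp => h2 p (List.mem_filter.1 hp).1⟩
    · rcases mem_union.1 hφ with hφ | hφ
      · rcases mem_union.1 hφ with hφ | hφ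
        · exact badW_of_mem_elemEqs hφ
        · exact badW_of_mem_reads hφ
      · exact badW_of_mem_reads hφ
  | critReadWrite | critRead | critElem =>
    exact .inr (.inr fun φ hφ => badW_of_mem_elemEqs hφ)
  | @reduceRhs s L' l r1 r1' hL' hr1 hn1 hne =>
    refine .inr (.inr fun φ hφ => ?_)
    obtain rfl := mem_singleton.1 hφ
    rcases litRule_lhs_cases hr1 with ⟨a, b, W, rfl, h1, h2⟩ | ⟨a, i, e, rfl, h1, h2⟩ |
      ⟨e, d, rfl, h1, h2⟩
    · obtain rfl := eq_of_heq h1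
      obtain rfl := eq_of_heq h2
      obtain ⟨b', W', rfl⟩ := hn1.1.wrs_shape
      exact formBadW_eq_zero (harr hL' hr1 hn1)
    · exact formBadW_elem _ _
    · exact formBadW_elem _ _
  | removeRefl t hL' => exact .inr (.inr nofun)
  | redundantWrite L' a b V U U' p hL' hr' hn' hj =>
    refine .inr (.inr fun φ hφ => ?_)
    obtain rfl := mem_singleton.1 hφ
    refine formBadW_eq_zero fun ha => ?_
    have h1 := hC L' hL' _ _ hr' (by simpa [Term.consts] using ha)
    obtain ⟨h2, h3⟩ := consts_wrs_subset.1 (hn'.empty_subset h1)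
    refine consts_wrs_subset.2 ⟨h2, fun q hq => h3 q ?_⟩
    simp only [List.mem_append, List.mem_cons] at hq ⊢
    tauto
  | diffJoin a b i hL' hj hab | diffJoinSymm b a i hL' hj hab =>
    refine .inr (.inr fun φ hφ => ?_)
    rcases mem_insert.1 hφ with rfl | hφ
    · simp [Form.badW, Term.badW]
    · obtain rfl := mem_singleton.1 hφ
      simp [Form.badW, Term.badW]

theorem sum_elemEqs_singleton_le (g : Form → ℕ) (e d : ℕ) :
    ∑ φ ∈ elemEqs [(e, d)], g φ ≤ g (.eq (el e) (el d)) := by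
  calc ∑ φ ∈ elemEqs [(e, d)], g φ ≤ ∑ φ ∈ {Form.eq (el e) (el d)}, g φ :=
        sum_le_sum_of_subset fun φ hφ => by
          obtain ⟨p, hp, -, rfl⟩ := mem_elemEqs.1 hφ
          obtain rfl := List.mem_singleton.1 hp
          exact mem_singleton_self _
    _ = _ := sum_singleton _ _

theorem sum_ind_isArrEq_elemEqs (l : List (ℕ × ℕ)) :
    ∑ φ ∈ elemEqs l, ind IsArrEq φ = 0 := by
  refine sum_eq_zero fun φ hφ => ind_eq_zero.2 ?_
  rintro ⟨t, u, rfl⟩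
  obtain ⟨p, -, -, h⟩ := mem_elemEqs.1 hφ
  cases h

theorem not_isArrEq_of_mem_reads {a : ℕ} (h : φ ∈ reads a W) :
    ¬ IsArrEq φ := by
  rintro ⟨t, u, rfl⟩
  obtain ⟨p, -, h⟩ := mem_reads.1 h
  cases h

theorem Form.wtA_eq (ord : List Const) (t u : Term s) :
    (Form.eq t u).wtA ord = t.wtA ord + u.wtA ord := rfl

theorem Form.wtW_eq (t u : Term s) : (Form.eq t u).wtW = t.wtW + u.wtW := rfl

theorem Form.wtE_eq (ord : List Const) (t u : Term s) :
    (Form.eq t u).wtE ord = t.wtE ord + u.wtE ord := rfl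

theorem LitRule.wt_eq (h : LitRule ord L l r) : L.wtA ord = l.wtA ord + r.wtA ord ∧ L.wtW = l.wtW + r.wtW ∧
      L.wtE ord = l.wtE ord + r.wtE ord := by
  rcases h.eq_or with rfl | rfl
  · exact ⟨rfl, rfl, rfl⟩
  · simp only [Form.wtA, Form.wtW, Form.wtE]
    omega

theorem rews_el_wtE (hn : ord.Nodup) {e d : ℕ} (h : Rews ord A (el e) (el d)) : (el d).wtE ord ≤ (el e).wtE ord := by
  rcases h.eq_or_lt hn with h | h | h
  · rw [h]
  · exact absurd h (by simp [Term.wtA])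
  · rcases h.2 with h | h
    · exact absurd h (by simp [Term.wtW])
    · exact h.2.le

theorem length_le_of_NF (hn : ord.Nodup) {b : ℕ} (h : NF ord ∅ (wrs (arr b) V) (wrs (arr b) W)) : W.length ≤ V.length := by
  have h1 := h.1.eq_or_lt hn
  simp only [wrs_inj, Term.Lt, wtA_wrs, wtW_wrs] at h1
  rcases h1 with ⟨-, rfl⟩ | h1 | ⟨-, h1 | h1⟩ <;> omega

/-- The weights of the added literals are smaller than those of the deleted ones. -/
def WtLt (ord : List Const) (add del : Finset Form) : Prop :=
  ∑ φ ∈ add, φ.wtA ord < ∑ φ ∈ del, φ.wtA ord ∨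
    ∑ φ ∈ add, φ.wtA ord ≤ ∑ φ ∈ del, φ.wtA ord ∧
      (∑ φ ∈ add, φ.wtW < ∑ φ ∈ del, φ.wtW ∨ ∑ φ ∈ add, φ.wtW ≤ ∑ φ ∈ del, φ.wtW ∧
        ∑ φ ∈ add, φ.wtE ord < ∑ φ ∈ del, φ.wtE ord)

/-- The quantity that a completion instruction decreases. -/
theorem Compl.descent (h : Compl ord A del add) (hn : ord.Nodup) (hflat : ∀ φ ∈ A, Flat φ) :
    (∃ L ∈ del, Unoriented ord L) ∨
      (∃ b, (.array, b) ∈ constsOf A ∧ ¬ Red ord A b ∧ Red ord (A \ del ∪ add) b) ∨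
      (∃ L ∈ del, IsDiffNe L) ∨
      ∑ φ ∈ add, ind IsArrEq φ < ∑ φ ∈ del, ind IsArrEq φ ∨
      ∑ φ ∈ add, ind IsArrEq φ ≤ ∑ φ ∈ del, ind IsArrEq φ ∧ WtLt ord add del := by
  have hread : ∀ {L : Form} {a i e' d e : ℕ}, LitRule ord L (.rd (arr a) (idx i)) (el e') →
      ∑ φ ∈ elemEqs [(d, e)], ind IsArrEq φ ≤ ∑ φ ∈ {L}, ind IsArrEq φ ∧
        WtLt ord (elemEqs [(d, e)]) {L} := by
    intro L a i e' d e hr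
    refine ⟨by simp [sum_ind_isArrEq_elemEqs], .inl ?_⟩
    refine (sum_elemEqs_singleton_le _ _ _).trans_lt ?_
    rw [sum_singleton, hr.wt_eq.1]
    simp [Form.wtA, Term.wtA]
  cases h with
  | orient a b V W F hL' hab hV hW hF =>
    exact .inl ⟨_, mem_singleton_self _, a, b, V, rfl, hV, hab.asymm hn⟩
  | orientSelf a V W hL' hW =>
    by_cases hV : V = []
    · subst hV
      have hW' := length_le_of_NF hn hW
      obtain rfl : W = [] := by simpa using hW'
      refine .inr (.inr (.inr (.inr ⟨by simp [reads], .inl ?_⟩)))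
      simp [reads, wrs, Form.wtA, Term.wtA]
    · exact .inl ⟨_, mem_singleton_self _, a, a, V, rfl, hV, Prec.irrefl hn⟩
  | gaussSymmTrans L1 L2 a b1 b2 r1 r2 W1 W2 U F G hL1 hr1 hL2 hr2 hne hn1 hn2 hb hF hU hG =>
    refine .inr (.inl ⟨b1, ?_, hn1.not_red, red_of_mem (W := U)
      (mem_union_right _ (mem_union_left _ (mem_insert_self _ _))) hb⟩)
    exact hn1.1.subset_of_subset (hr1.consts_subset.2.1.trans (subset_constsOf hL1))
      (mem_consts_wrs.2 (.inl (mem_consts_arr b1)))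
  | gaussConfl L1 L2 a b r1 r2 W1 W2 hL1 hr1 hL2 hr2 hne hn1 hn2 =>
    refine .inr (.inr (.inr (.inl ?_)))
    have harr : ∀ {L : Form} {r : Term .array}, LitRule ord L (arr a) r → IsArrEq L := by
      intro L r h
      rcases h.eq_or with rfl | rfl <;> exact ⟨_, _, rfl⟩
    have h1 : L1 ≠ L2 := by
      rintro rfl
      exact hne (eq_of_litRule_arr hn hr1 hr2).2
    rw [sum_pair h1, ind_of (harr hr1), ind_of (harr hr2), Nat.lt_succ_iff]
    have h2 := sum_union_inter (s₁ := {Form.eq (arr a)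
        (wrs (arr b) (W1.filter fun p => p.1 ∈ W2.map Prod.fst))})
      (s₂ := elemEqs (((W1.product W2).filter fun q => q.1.1 = q.2.1).map
        fun q => (q.1.2, q.2.2)) ∪ reads b (W1.filter fun p => p.1 ∉ W2.map Prod.fst) ∪
        reads b (W2.filter fun p => p.1 ∉ W1.map Prod.fst)) (f := ind IsArrEq)
    have h3 : ∑ φ ∈ elemEqs (((W1.product W2).filter fun q => q.1.1 = q.2.1).map
        fun q => (q.1.2, q.2.2)) ∪ reads b (W1.filter fun p => p.1 ∉ W2.map Prod.fst) ∪
        reads b (W2.filter fun p => p.1 ∉ W1.map Prod.fst), ind IsArrEq φ = 0 := by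
      refine sum_eq_zero fun φ hφ => ind_eq_zero.2 ?_
      rcases mem_union.1 hφ with hφ | hφ
      · rcases mem_union.1 hφ with hφ | hφ
        · rintro ⟨t, u, rfl⟩
          obtain ⟨p, -, -, h⟩ := mem_elemEqs.1 hφ
          cases h
        · exact not_isArrEq_of_mem_reads hφ
      · exact not_isArrEq_of_mem_reads hφ
    rw [h3, sum_singleton, ind_of ⟨_, _, rfl⟩] at h2
    rw [insert_eq]
    omega
  | critReadWrite L1 L2 a i e' d e r hL1 hr1 hL2 hr2 hd' he =>
    exact .inr (.inr (.inr (.inr (hread hr1))))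
  | critRead L1 L2 a i e' d' e d hL1 hr1 hL2 hr2 hne he hd' =>
    exact .inr (.inr (.inr (.inr (hread hr1))))
  | critElem L1 L2 c e' d' e d hL1 hr1 hL2 hr2 hne he hd' =>
    refine .inr (.inr (.inr (.inr ⟨by simp [sum_ind_isArrEq_elemEqs], .inr ⟨?_, .inr ⟨?_, ?_⟩⟩⟩)))
    · exact (sum_elemEqs_singleton_le _ _ _).trans (by simp [Form.wtA, Term.wtA])
    · exact (sum_elemEqs_singleton_le _ _ _).trans (by simp [Form.wtW, Term.wtW])
    · refine (sum_elemEqs_singleton_le _ _ _).trans_lt ?_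
      rw [sum_singleton, hr1.wt_eq.2.2]
      have h1 := rews_el_wtE hn he.1
      have h2 := rews_el_wtE hn hd'.1
      obtain ⟨k, hk, hp, -⟩ := litRule_elem.1 hr2
      simp only [Term.const.injEq] at hk
      subst hk
      have h3 := hp.lt hn
      simp only [Form.wtE, Term.wtE] at h1 h2 ⊢
      omega
  | @reduceRhs s L' l r1 r1' hL' hr1 hn1 hne =>
    refine .inr (.inr (.inr (.inr ⟨?_, ?_⟩)))
    · rw [sum_singleton, sum_singleton]
      refine ind_le ?_
      rintro ⟨t, u, h⟩
      rcases hr1.eq_or with rfl | rfl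
      all_goals
        cases h
        exact ⟨_, _, rfl⟩
    · obtain ⟨h1, h2, h3⟩ := hr1.wt_eq
      simp only [WtLt, sum_singleton, h1, h2, h3, Form.wtA_eq, Form.wtW_eq, Form.wtE_eq]
      rcases hn1.1.eq_or_lt hn with h | h | ⟨h, h' | h'⟩
      · exact absurd h.symm hne
      all_goals omega
  | @removeRefl s t hL' =>
    refine .inr (.inr (.inr (.inr ⟨by simp, ?_⟩)))
    simp only [WtLt, sum_singleton, sum_empty]
    have hf := hflat _ hL'
    cases s with
    | array =>
      have := wtA_pos ord t
      simp only [Form.wtA]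
      omega
    | index =>
      generalize h : Form.eq t t = φ at hf
      cases hf <;> cases h
      simp [Form.wtA, Form.wtW, Form.wtE, Term.wtA, Term.wtW, Term.wtE]
    | elem =>
      generalize h : Form.eq t t = φ at hf
      cases hf <;> cases h
      simp [Form.wtA, Form.wtW, Form.wtE, Term.wtA, Term.wtW, Term.wtE]
  | redundantWrite L' a b V U U' p hL' hr' hn' hj =>
    refine .inr (.inr (.inr (.inr ⟨?_, .inr ⟨?_, .inl ?_⟩⟩)))
    · rw [sum_singleton, sum_singleton]
      refine ind_le fun _ => ?_
      rcases hr'.eq_or with rfl | rfl <;> exact ⟨_, _, rfl⟩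
    · simp only [sum_singleton, hr'.wt_eq.1, Form.wtA_eq, wtA_wrs, le_refl]
    · have := length_le_of_NF hn hn'
      simp only [sum_singleton, hr'.wt_eq.2.1, Form.wtW_eq, wtW_wrs, List.length_append,
        List.length_cons] at this ⊢
      omega
  | diffJoin a b i hL' hj hab =>
    exact .inr (.inr (.inl ⟨_, mem_singleton_self _, a, b, i,
      fun h => Prec.irrefl hn (h ▸ hab), rfl⟩))
  | diffJoinSymm a b i hL' hj hab =>
    exact .inr (.inr (.inl ⟨_, mem_singleton_self _, a, b, i,
      fun h => Prec.irrefl hn (h ▸ hab), rfl⟩))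

/-- A completion instruction does not create violations of the invariants. -/
theorem Compl.noDefect (h : Compl ord A del add) (hn : ord.Nodup)
    (hS : ∀ c ∈ constsOf A, c ∈ ord) (hSA : constsOf A ⊆ S) (hI : NoDefect ord A S) :
    NoDefect ord (A \ del ∪ add) S := by
  obtain ⟨h1, h2, h3⟩ := hI
  refine ⟨?_, ?_, ?_⟩
  · intro i j hi hj hij
    have := h1.sdiff h.isEq_del i j hi hj hij
    exact this.imp (mem_union_left _) (mem_union_left _)
  · intro i j hm
    rcases mem_union.1 hm with hm | hm
    · exact h2 i j (mem_sdiff.1 hm).1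
    · exact h.not_idxEq hn hS i j hm
  · intro a i ha hi
    refine reach_of_irreducible hn (fun a => (Srt.array, a) ∈ S) ?_ ?_ a ha
    · intro a b V L _ hL hr
      have h4 : constsOf (A \ del ∪ add) ⊆ S := by
        rw [constsOf_union]
        exact union_subset ((constsOf_mono sdiff_subset).trans hSA)
          (h.consts_add_subset.trans hSA)
      exact h4 (subset_constsOf hL (hr.consts_subset.2.1
        (mem_consts_wrs.2 (.inl (mem_consts_arr b)))))
    · intro a ha hr
      obtain ⟨e, he⟩ := (h3 a i ha hi).lit_of_irreducible fun h' => hr (h.red hn hS h')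
      exact h.exists_read hn hS he hr

theorem NoDefect.mono (h : NoDefect ord A S) (hS : S' ⊆ S) : NoDefect ord A S' :=
  ⟨fun i j hi hj => h.1 i j (hS hi) (hS hj), h.2.1, fun a i ha hi => h.2.2 a i (hS ha) (hS hi)⟩

theorem Inv.noDefect (h : Inv ord A S) : NoDefect ord A S := ⟨h.ne, h.noEq, h.reach⟩

theorem Shared.closed (h : Shared n) (hn : n.Good) : ∀ L ∈ n.A,
    ∀ {s : Srt} (l r : Term s), LitRule n.ord L l r → l.consts ⊆ n.common →
      r.consts ⊆ n.common := by
  intro L hL s l r hr hl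
  rcases litRule_lhs_cases hr with ⟨a, b, W, rfl, h1, h2⟩ | ⟨a, i, e, rfl, h1, h2⟩ |
    ⟨e, d, rfl, h1, h2⟩
  · exact hr.consts_subset.2.1.trans (h.rule L hL l r (.inl nofun) hr hl)
  · exact hr.consts_subset.2.1.trans (h.rule L hL l r (.inr ⟨a, i, h1⟩) hr hl)
  · obtain rfl := eq_of_heq h1
    obtain rfl := eq_of_heq h2
    obtain ⟨k, hk, hp, -⟩ := litRule_elem.1 hr
    simp only [Term.const.injEq] at hk
    subst hk
    simp only [Term.consts, singleton_subset_iff] at hl ⊢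
    exact hn.prec_common hp hl

theorem Node.Good.used_inter_sigB (hn : n.Good) :
    n.used ∩ n.sigB = n.swap.localA := by
  have := hn.swap.used_inter_sigA
  rwa [show n.swap.used = n.used by simp only [Node.used, Node.swap, union_comm]] at this

theorem Node.Good.nodup (hn : n.Good) : n.ord.Nodup := hn.adm.1

theorem Node.Good.mem_ord_of_mem (hn : n.Good) : ∀ c ∈ constsOf n.A, c ∈ n.ord :=
  fun _ hc => hn.mem_ord (mem_union_left _ (hn.subA hc))

theorem Node.Good.flat (hn : n.Good) (hph : n.phase = .completion) :
    ∀ φ ∈ n.A, Flat φ := fun φ hφ => by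
  have := hn.okA φ hφ
  rw [hph] at this
  exact this.1

theorem Node.Good.mem_common (hn : n.Good) (hA : L ∈ n.A) (hB : L ∈ n.B) :
    L.consts ⊆ n.common :=
  subset_inter ((subset_constsOf hA).trans hn.subA)
    ((subset_constsOf hB).trans hn.subB)

/-- A completion instruction decreases the measure, whether performed on the first component or
on both. -/
theorem Compl.measure_lt (hn : n.Good) (hph : n.phase = .completion)
    (hIA : Inv n.ord n.A n.localA) (hIB : Inv n.ord n.B n.swap.localA) (hSh : Shared n)
    {del add B' : Finset Form} (h : Compl n.ord n.A del add)
    (hB : B' = n.B ∧ (∀ L ∈ del, L ∉ n.B) ∨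
      B' = n.B \ del ∪ add ∧ Compl n.ord n.B del add) :
    LexLt (Node.measure { n with A := n.A \ del ∪ add, B := B' }) n.measure := by
  have hU : n.A \ del ∪ add ∪ B' = (n.A ∪ n.B) \ del ∪ add := by
    rcases hB with ⟨rfl, hB⟩ | ⟨rfl, hB⟩
    · ext φ
      have := hB φ
      simp only [mem_union, mem_sdiff]
      tauto
    · ext φ
      simp only [mem_union, mem_sdiff]
      tauto
  have hdel : del ⊆ n.A ∪ n.B := h.del_subset.trans subset_union_left
  have hused : constsOf (n.A \ del ∪ add ∪ B') ⊆ constsOf (n.A ∪ n.B) := by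
    rw [hU, constsOf_union]
    refine union_subset (constsOf_mono sdiff_subset)
      (h.consts_add_subset.trans (constsOf_mono subset_union_left))
  have hredA : ∀ a, Red n.ord n.A a → Red n.ord (n.A \ del ∪ add) a :=
    fun a => h.red hn.nodup hn.mem_ord_of_mem
  have hredB : ∀ a, Red n.ord n.B a → Red n.ord B' a := by
    rcases hB with ⟨rfl, -⟩ | ⟨rfl, hB⟩
    · exact fun a h => h
    · exact fun a => hB.red hn.nodup hn.swap.mem_ord_of_mem
  have hirrA : irr n.ord (n.A \ del ∪ add) (constsOf (n.A \ del ∪ add ∪ B') ∩ n.sigA) ≤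
      irr n.ord n.A (n.used ∩ n.sigA) :=
    irr_le fun a ha hr => ⟨inter_subset_inter_right hused ha, fun h => hr (hredA a h)⟩
  have hirrB : irr n.ord B' (constsOf (n.A \ del ∪ add ∪ B') ∩ n.sigB) ≤
      irr n.ord n.B (n.used ∩ n.sigB) :=
    irr_le fun a ha hr => ⟨inter_subset_inter_right hused ha, fun h => hr (hredB a h)⟩
  have hdefA : defect n.ord (n.A \ del ∪ add) (constsOf (n.A \ del ∪ add ∪ B') ∩ n.sigA) = 0 := by
    refine NoDefect.eq_zero ?_
    refine (h.noDefect hn.nodup hn.mem_ord_of_mem ?_ hIA.noDefect).mono ?_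
    · exact subset_union_left
    · rw [← hn.used_inter_sigA]
      exact inter_subset_inter_right hused
  have hdefB : defect n.ord B' (constsOf (n.A \ del ∪ add ∪ B') ∩ n.sigB) = 0 := by
    refine NoDefect.eq_zero (NoDefect.mono (S := n.swap.localA) ?_ ?_)
    · rcases hB with ⟨rfl, -⟩ | ⟨rfl, hB⟩
      · exact hIB.noDefect
      · exact hB.noDefect hn.nodup hn.swap.mem_ord_of_mem subset_union_left hIB.noDefect
    · rw [← hn.used_inter_sigB]
      exact inter_subset_inter_right hused
  have hstrict : ∀ s, cardSort (constsOf (n.A \ del ∪ add ∪ B') \ n.common) s ≤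
      cardSort (n.used \ n.common) s := fun s =>
    cardSort_le fun k hk => sdiff_subset_sdiff hused subset_rfl hk
  have hsum := fun g => sum_sdiff_union_le g add hdel
  have hun : ∑ φ ∈ add, ind (Unoriented n.ord) φ = 0 := sum_eq_zero fun φ hφ =>
    ind_eq_zero.2 (h.not_unoriented hn.nodup hn.mem_ord_of_mem hφ)
  have hdn : ∑ φ ∈ add, ind IsDiffNe φ = 0 := sum_eq_zero fun φ hφ =>
    ind_eq_zero.2 (h.not_isDiffNe hn.nodup hn.mem_ord_of_mem hφ)
  have hpos : ∀ {P : Form → Prop}, (∃ L ∈ del, P L) → 0 < ∑ φ ∈ del, ind P φ := by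
    rintro P ⟨L, hL, hP⟩
    refine sum_pos' (fun _ _ => Nat.zero_le _) ⟨L, hL, ?_⟩
    rw [ind_of hP]
    exact Nat.one_pos
  refine .inr ⟨cardSort_le fun k hk => hused hk, .inr ⟨hstrict _, .inr ⟨hstrict _, ?_⟩⟩⟩
  have h5 := hsum (ind (Unoriented n.ord))
  have hlast := h.descent hn.nodup (hn.flat hph)
  have hbad := h.badW_add hn.nodup (hSh.closed hn)
  by_cases hgauss : ∃ b, (.array, b) ∈ constsOf n.A ∧ ¬ Red n.ord n.A b ∧
      Red n.ord (n.A \ del ∪ add) b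
  · obtain ⟨b, hb, hb1, hb2⟩ := hgauss
    refine .inl (add_lt_add_of_lt_of_le ?_ hirrB)
    refine irr_lt (fun a ha hr => ⟨inter_subset_inter_right hused ha,
      fun h => hr (hredA a h)⟩) b ?_ hb1 hb2
    exact mem_inter.2 ⟨constsOf_mono subset_union_left hb, hn.subA hb⟩
  replace hlast := hlast.imp_right fun h => h.resolve_left hgauss
  replace hbad := hbad.imp_right fun h => h.resolve_left hgauss
  refine .inr ⟨add_le_add hirrA hirrB, ?_⟩
  by_cases hor : ∃ L ∈ del, Unoriented n.ord L
  · left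
    have := hpos hor
    simp only [hU]
    omega
  replace hlast := hlast.resolve_left hor
  replace hbad := hbad.resolve_left hor
  have h6 := hsum (Form.badW n.common)
  rw [sum_eq_zero hbad] at h6
  have h7 := hsum (ind IsDiffNe)
  refine .inr ⟨by simp only [hU]; omega, .inr ⟨?_, ?_⟩⟩
  · simp only [hU, Node.common] at h6 ⊢
    omega
  by_cases hdiff : ∃ L ∈ del, IsDiffNe L
  · left
    have := hpos hdiff
    simp only [hU]
    omega
  replace hlast := hlast.resolve_left hdiff
  refine .inr ⟨by simp only [hU]; omega, .inr ⟨?_, .inr ⟨hstrict _, ?_⟩⟩⟩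
  · exact (Nat.add_eq_zero_iff.2 ⟨hdefA, hdefB⟩).le.trans (Nat.zero_le _)
  have h10 := hsum (ind IsArrEq)
  have h11 := hsum (Form.wtA n.ord)
  have h12 := hsum Form.wtW
  have h13 := hsum (Form.wtE n.ord)
  simp only [hU]
  rcases hlast with hlt | ⟨hle, hlt | ⟨hle', hlt | ⟨hle'', hlt⟩⟩⟩
  · left
    omega
  · exact .inr ⟨by omega, .inl (by omega)⟩
  · exact .inr ⟨by omega, .inr ⟨by omega, .inl (by omega)⟩⟩
  · exact .inr ⟨by omega, .inr ⟨by omega, .inr ⟨by omega, .inl (by omega)⟩⟩⟩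

theorem ComplA.measure_lt (hn : n.Good) (hph : n.phase = .completion)
    (hIA : Inv n.ord n.A n.localA) (hIB : Inv n.ord n.B n.swap.localA) (hSh : Shared n)
    (h : ComplA n cs) :
    ∀ c ∈ cs, c.Closed ∨ c.phase = n.phase ∧ LexLt c.measure n.measure := by
  cases h with
  | single del add h hdel =>
    intro c hc
    obtain rfl := List.mem_singleton.1 hc
    exact .inr ⟨rfl, h.measure_lt hn hph hIA hIB hSh
      (.inl ⟨rfl, fun L hL hB => hdel L hL (hn.mem_common (h.del_subset hL) hB)⟩)⟩
  | both del add hA hB hdel =>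
    intro c hc
    obtain rfl := List.mem_singleton.1 hc
    exact .inr ⟨rfl, hA.measure_lt hn hph hIA hIB hSh (.inr ⟨rfl, hB⟩)⟩
  | fail h =>
    intro c hc
    obtain rfl := List.mem_singleton.1 hc
    exact .inl .of_bot

/-! # Renaming of index and element constants -/

/-- Renaming of a constant in a pair of an index and an element. -/
abbrev renW (s : Srt) (o m : ℕ) (p : ℕ × ℕ) : ℕ × ℕ :=
  (if s = .index ∧ o = p.1 then m else p.1, if s = .elem ∧ o = p.2 then m else p.2)

theorem rename_arrEq (hs : s ≠ .array) (o m a b : ℕ) (V : List (ℕ × ℕ)) :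
    (Form.eq (arr a) (wrs (arr b) V)).rename s o m =
      .eq (arr a) (wrs (arr b) (V.map (renW s o m))) := by
  obtain ⟨W', h, rfl⟩ := subst_wrs s o m (arr b) V
  simp only [Form.rename, Form.subst, h, subst_const_const, hs, false_and, if_false]

theorem rename_rd (hs : s ≠ .array) (o m a i e : ℕ) :
    (Form.eq (.rd (arr a) (idx i)) (el e)).rename s o m =
      .eq (.rd (arr a) (idx (renW s o m (i, e)).1)) (el (renW s o m (i, e)).2) := by
  change Form.eq (.rd (Term.subst s o _ (arr a)) (Term.subst s o _ (idx i)))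
    (Term.subst s o _ (el e)) = _
  simp only [subst_const_const, hs, false_and, if_false]

theorem rename_diff (hs : s ≠ .array) (o m a b i : ℕ) :
    (Form.eq (.diff (arr a) (arr b)) (idx i)).rename s o m =
      .eq (.diff (arr a) (arr b)) (idx (if s = .index ∧ o = i then m else i)) := by
  change Form.eq (.diff (Term.subst s o _ (arr a)) (Term.subst s o _ (arr b)))
    (Term.subst s o _ (idx i)) = _
  simp only [subst_const_const, hs, false_and, if_false]

theorem rename_const_eq (o m : ℕ) (s' : Srt) (i j : ℕ) :
    (Form.eq (.const s' i) (.const s' j)).rename s o m =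
      .eq (.const s' (if s = s' ∧ o = i then m else i))
        (.const s' (if s = s' ∧ o = j then m else j)) := by
  simp only [Form.rename, Form.subst, subst_const_const]

theorem rename_const_ne (o m : ℕ) (s' : Srt) (i j : ℕ) :
    (Form.neg (.eq (.const s' i) (.const s' j))).rename s o m =
      .neg (.eq (.const s' (if s = s' ∧ o = i then m else i))
        (.const s' (if s = s' ∧ o = j then m else j))) := by
  simp only [Form.rename, Form.subst, subst_const_const]

theorem litRule_rename {a b : ℕ} (hs : s ≠ .array) (o m : ℕ)
    (h : LitRule ord L (arr a) (wrs (arr b) V)) :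
    LitRule ord (L.rename s o m) (arr a) (wrs (arr b) (V.map (renW s o m))) := by
  obtain ⟨b', V', h1, hp, rfl | ⟨rfl, rfl⟩⟩ := litRule_arr.1 h
  · rw [rename_arrEq hs]
    exact .arr _ _ _ (litRule_prec h)
  · obtain ⟨rfl, rfl⟩ := wrs_inj.1 h1
    simp only [rename_const_eq, hs, false_and, if_false]
    exact .arrSymm _ _ hp

theorem Red.rename {a : ℕ} (hs : s ≠ .array) (o m : ℕ) (h : Red ord A a) :
    Red ord (A.image (Form.rename s o m)) a := by
  obtain ⟨L, hL, r, hr⟩ := h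
  obtain ⟨b, V, rfl, -⟩ := litRule_arr.1 hr
  exact ⟨_, mem_image_of_mem _ hL, _, litRule_rename hs o m hr⟩

theorem Red.mono (ho : ord.Sublist ord') {a : ℕ} (hA : ∀ L ∈ A, ¬ IsIdxEq L → L ∈ A')
    (h : Red ord A a) : Red ord' A' a := by
  obtain ⟨L, hL, r, hr⟩ := h
  refine ⟨L, hA L hL ?_, r, hr.mono ho⟩
  rintro ⟨i, j, rfl⟩
  rcases hr.eq_or with h | h <;> cases h

theorem Reach.mono (ho : ord.Sublist ord') {a i : ℕ} (hA : ∀ L ∈ A, ¬ IsIdxEq L → L ∈ A')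
    (h : Reach ord A a i) : Reach ord' A' a i := by
  have key : ∀ {L : Form} {a : ℕ} {r : Term .array}, LitRule ord L (arr a) r → ¬ IsIdxEq L := by
    rintro L a r hr ⟨i, j, rfl⟩
    rcases hr.eq_or with h | h <;> cases h
  induction h with
  | lit h => exact .lit (hA _ h (by rintro ⟨i, j, h⟩; cases h))
  | write hL hr h => exact .write (hA _ hL (key hr)) (hr.mono ho) h
  | base hL hr _ ih => exact .base (hA _ hL (key hr)) (hr.mono ho) ih

theorem Reach.rename_elem {a i : ℕ} (o m : ℕ) (h : Reach ord A a i) : Reach ord (A.image (Form.rename .elem o m)) a i := by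
  induction h with
  | @lit a i e h =>
    have := mem_image_of_mem (Form.rename .elem o m) h
    rw [rename_rd (s := .elem) (by decide)] at this
    exact .lit (by simpa using this)
  | write hL hr h =>
    refine .write (mem_image_of_mem _ hL) (litRule_rename (s := .elem) (by decide) o m hr) ?_
    obtain ⟨p, hp, rfl⟩ := List.mem_map.1 h
    exact List.mem_map.2 ⟨_, List.mem_map_of_mem hp, by simp⟩
  | base hL hr _ ih => exact .base (mem_image_of_mem _ hL) (litRule_rename (s := .elem) (by decide) o m hr) ih

theorem Flat.not_unoriented_rename (hφ : Flat φ) (hs : s ≠ .array) (o m : ℕ)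
    (ho : ord.Sublist ord') (h : Unoriented ord' (φ.rename s o m)) :
    Unoriented ord φ := by
  obtain ⟨a, b, V, h, hV, hp⟩ := h
  cases hφ with
  | wr a' b' V' =>
    rw [rename_arrEq hs] at h
    simp only [Form.eq.injEq, heq_eq_eq, true_and, Term.const.injEq, wrs_inj] at h
    obtain ⟨rfl, rfl, rfl⟩ := h
    exact ⟨_, _, _, rfl, by simpa using hV, fun h => hp (h.mono ho)⟩
  | rd => rw [rename_rd hs] at h; cases h
  | diff => rw [rename_diff hs] at h; cases h
  | idxEq => rw [rename_const_eq] at h; cases h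
  | elemEq => rw [rename_const_eq] at h; cases h
  | ne => rw [rename_const_ne] at h; cases h

theorem Flat.badW_rename_le (hφ : Flat φ) (hs : s ≠ .array) {o m : ℕ} {C C' : Finset Const}
    (hC : C ⊆ C') (hm : (s, m) ∈ C')
    (hC' : ∀ a, (.array, a) ∈ φ.consts → (.array, a) ∈ C' → (.array, a) ∈ C) :
    (φ.rename s o m).badW C' ≤ φ.badW C := by
  cases hφ with
  | wr a b V =>
    rw [rename_arrEq hs]
    simp only [Form.badW, badW_wrs, List.countP_map]
    split_ifs with h1 h2 h2
    · refine List.countP_mono_left fun p _ => ?_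
      simp only [Function.comp_apply, decide_eq_true_eq, not_and_or]
      rintro (h | h)
      · refine .inl fun h' => h ?_
        split_ifs with hi
        · exact hi.1 ▸ hm
        · exact hC h'
      · refine .inr fun h' => h ?_
        split_ifs with hi
        · exact hi.1 ▸ hm
        · exact hC h'
    · exact absurd (by
        simp only [Term.consts, singleton_subset_iff] at h1 ⊢
        exact hC' a (by simp [Form.consts, Term.consts]) h1) h2
    · exact Nat.zero_le _
    · exact le_rfl
  | rd => rw [rename_rd hs, formBadW_elem]; exact Nat.zero_le _
  | diff => rw [rename_diff hs]; simp [Form.badW, badW_idx]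
  | idxEq => rw [rename_const_eq]; simp [Form.badW, badW_idx]
  | elemEq => rw [rename_const_eq, formBadW_elem]; exact Nat.zero_le _
  | ne => rw [rename_const_ne]; simp [Form.badW]

theorem Flat.isDiffNe_rename (hφ : Flat φ) (hs : s ≠ .array) {o m : ℕ}
    (h : IsDiffNe (φ.rename s o m)) : IsDiffNe φ := by
  obtain ⟨a, b, i, hab, h⟩ := h
  cases hφ with
  | wr a' b' V' => rw [rename_arrEq hs] at h; cases h
  | rd => rw [rename_rd hs] at h; cases h
  | diff => rw [rename_diff hs] at h; cases h; exact ⟨_, _, _, hab, rfl⟩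
  | idxEq => rw [rename_const_eq] at h; cases h
  | elemEq => rw [rename_const_eq] at h; cases h
  | ne => rw [rename_const_ne] at h; cases h

theorem Form.badW_le {C C' : Finset Const} (hC : C ⊆ C') (h : ∀ c ∈ φ.consts, c ∈ C' → c ∈ C) : φ.badW C' ≤ φ.badW C := by
  have key : ∀ {s : Srt} (t : Term s), t.badW C' ≤ t.badW C := by
    intro s t
    induction t with
    | const | rd | diff => simp [Term.badW]
    | wr x i e ih =>
      simp only [Term.badW]
      refine Nat.add_le_add ih ?_
      split_ifs with h1 h2
      · exact le_rfl
      · exact Nat.zero_le _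
      · exact absurd (by
          refine Finset.Subset.trans ?_ hC
          assumption) h1
      · exact le_rfl
  cases φ with
  | eq t u =>
    simp only [Form.badW]
    split_ifs with h1 h2
    · exact key u
    · exact absurd (fun c hc => h c (mem_union_left _ hc) (h1 hc)) h2
    · exact Nat.zero_le _
    · exact le_rfl
  | _ => exact le_rfl

namespace Node

theorem common_subset_extend {sh : Bool} {A' D : Finset Form} : n.common ⊆ (n.extend sh X ord' A' D).common := by
  intro c hc
  obtain ⟨h1, h2⟩ := mem_inter.1 hc
  refine mem_inter.2 ⟨mem_union_left _ h1, ?_⟩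
  cases sh
  · exact h2
  · exact mem_union_left _ h2

theorem mem_common_of_extend {sh : Bool} {A' D : Finset Form} {c : Const}
    (h : c ∈ (n.extend sh X ord' A' D).common) (hc : c ∉ X) :
    c ∈ n.common := by
  obtain ⟨h1, h2⟩ := mem_inter.1 h
  refine mem_inter.2 ⟨(mem_union.1 h1).resolve_right hc, ?_⟩
  cases sh
  · exact h2
  · exact (mem_union.1 h2).resolve_right hc

theorem used_extend {sh : Bool} {A' D : Finset Form} : (n.extend sh X ord' A' D).used ⊆
      constsOf A' ∪ constsOf n.B ∪ constsOf D := by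
  intro c hc
  simp only [used, extend, constsOf_union, mem_union] at hc ⊢
  cases sh
  · simp only [Bool.false_eq_true, if_false] at hc
    tauto
  · simp only [if_true, constsOf_union, mem_union] at hc
    tauto

theorem Good.used_subset (hn : n.Good) : n.used ⊆ n.sigA ∪ n.sigB := by
  rw [used, constsOf_union]
  exact union_subset_union hn.subA hn.subB

theorem Good.identify_eq (hn : n.Good) {o m : ℕ} (ho : (s, o) ∈ n.sigA) :
    n.identify s o m = { n with
      A := n.A.image (Form.rename s o m), B := n.B.image (Form.rename s o m) } := by
  simp only [Node.identify]
  split_ifs with h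
  · rfl
  · have h' : (s, o) ∉ constsOf n.B := fun h' => h (mem_inter.2 ⟨ho, hn.subB h'⟩)
    rw [image_rename_of_notMem h']

theorem used_identify (hn : n.Good) {o m : ℕ} (ho : (s, o) ∈ n.sigA) :
    (n.identify s o m).used ⊆ insert (s, m) (n.used.erase (s, o)) := by
  rw [hn.identify_eq ho]
  simp only [used, ← image_union]
  exact constsOf_image_rename_subset _ _ _ _

theorem strict_le {n c : Node} (hu : ∀ k, (s, k) ∈ c.used → (s, k) ∈ n.used ∨
      (s, k) ∈ c.common) (hc : ∀ k, (s, k) ∈ n.common → (s, k) ∈ c.common) :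
    cardSort (c.used \ c.common) s ≤ cardSort (n.used \ n.common) s := by
  refine cardSort_le fun k hk => ?_
  obtain ⟨h1, h2⟩ := mem_sdiff.1 hk
  exact mem_sdiff.2 ⟨(hu k h1).resolve_right h2, fun h => h2 (hc k h)⟩

theorem strict_lt {n c : Node} (hu : ∀ k, (s, k) ∈ c.used → (s, k) ∈ n.used ∨
      (s, k) ∈ c.common) (hc : ∀ k, (s, k) ∈ n.common → (s, k) ∈ c.common) (o : ℕ)
    (ho : (s, o) ∈ n.used) (ho' : (s, o) ∉ n.common) (ho'' : (s, o) ∉ c.used) :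
    cardSort (c.used \ c.common) s < cardSort (n.used \ n.common) s := by
  refine cardSort_lt (fun k hk => ?_) o (mem_sdiff.2 ⟨ho, ho'⟩)
    fun h => ho'' (mem_sdiff.1 h).1
  obtain ⟨h1, h2⟩ := mem_sdiff.1 hk
  exact mem_sdiff.2 ⟨(hu k h1).resolve_right h2, fun h => h2 (hc k h)⟩

end Node

namespace Node

/-- The invariants are partially restored. -/
theorem Good.measure_lt_of_defect {n c : Node} (hn : n.Good) (ho : n.ord.Sublist c.ord)
    (hu : ∀ s k, s ≠ .elem → (s, k) ∈ c.used → (s, k) ∈ n.used)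
    (hA : ∀ k ∈ n.used, k ∈ c.sigA ↔ k ∈ n.sigA) (hB : ∀ k ∈ n.used, k ∈ c.sigB ↔ k ∈ n.sigB)
    (hcom : n.common ⊆ c.common) (hnew : ∀ φ ∈ c.A ∪ c.B, φ ∈ n.A ∪ n.B ∨
      ¬ Unoriented c.ord φ ∧ φ.badW c.common = 0 ∧ ¬ IsDiffNe φ)
    (hAA : ∀ L ∈ n.A, ¬ IsIdxEq L → L ∈ c.A) (hBB : ∀ L ∈ n.B, ¬ IsIdxEq L → L ∈ c.B)
    (hiA : ∀ i j, Form.eq (idx i) (idx j) ∈ c.A → Form.eq (idx i) (idx j) ∈ n.A)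
    (hiB : ∀ i j, Form.eq (idx i) (idx j) ∈ c.B → Form.eq (idx i) (idx j) ∈ n.B)
    (hd : (∃ i j, (.index, i) ∈ n.localA ∧ (.index, j) ∈ n.localA ∧ i ≠ j ∧
        Form.neg (.eq (idx i) (idx j)) ∉ n.A ∧ Form.neg (.eq (idx j) (idx i)) ∉ n.A ∧
        Form.neg (.eq (idx i) (idx j)) ∈ c.A) ∨
      (∃ a i, (.array, a) ∈ n.localA ∧ (.index, i) ∈ n.localA ∧ ¬ Reach n.ord n.A a i ∧
        Reach c.ord c.A a i) ∨
      ∃ i j, Form.eq (idx i) (idx j) ∈ n.A ∧ Form.eq (idx i) (idx j) ∉ c.A) :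
    LexLt c.measure n.measure := by
  have hSA : ∀ s k, s ≠ .elem → (s, k) ∈ c.used ∩ c.sigA → (s, k) ∈ n.used ∩ n.sigA := by
    intro s k hs hk
    obtain ⟨h1, h2⟩ := mem_inter.1 hk
    exact mem_inter.2 ⟨hu s k hs h1, (hA _ (hu s k hs h1)).1 h2⟩
  have hSB : ∀ s k, s ≠ .elem → (s, k) ∈ c.used ∩ c.sigB → (s, k) ∈ n.used ∩ n.sigB := by
    intro s k hs hk
    obtain ⟨h1, h2⟩ := mem_inter.1 hk
    exact mem_inter.2 ⟨hu s k hs h1, (hB _ (hu s k hs h1)).1 h2⟩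
  have hsum : ∀ g g' : Form → ℕ, (∀ φ ∈ n.A ∪ n.B, g' φ ≤ g φ) →
      (∀ φ ∈ c.A ∪ c.B, φ ∈ n.A ∪ n.B ∨ g' φ = 0) →
      ∑ φ ∈ c.A ∪ c.B, g' φ ≤ ∑ φ ∈ n.A ∪ n.B, g φ := fun g g' h1 h2 =>
    sum_le_of_forall_mem_image id (by simpa using h2) h1
  have hne : ∀ {i j}, ¬ IsIdxEq (.neg (.eq (idx i) (idx j))) := by
    rintro i j ⟨_, _, h⟩
    cases h
  rw [← hn.used_inter_sigA] at hd
  refine .inr ⟨cardSort_le fun k hk => hu _ k nofun hk,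
    .inr ⟨strict_le (fun k hk => .inl (hu _ k nofun hk)) fun k hk => hcom hk,
    .inr ⟨strict_le (fun k hk => .inl (hu _ k nofun hk)) fun k hk => hcom hk,
    .inr ⟨Nat.add_le_add (irr_le fun a ha hr => ⟨hSA _ _ nofun ha, fun h => hr (h.mono ho hAA)⟩)
      (irr_le fun a ha hr => ⟨hSB _ _ nofun ha, fun h => hr (h.mono ho hBB)⟩),
    .inr ⟨?_, .inr ⟨?_, .inr ⟨?_, .inl ?_⟩⟩⟩⟩⟩⟩⟩
  · refine hsum _ _ (fun φ hφ => ind_le ?_) fun φ hφ => (hnew φ hφ).imp_right fun h =>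
      ind_eq_zero.2 h.1
    rintro ⟨a, b, V, rfl, hV, hp⟩
    exact ⟨a, b, V, rfl, hV, fun h => hp (h.mono ho)⟩
  · refine hsum _ _ (fun φ hφ => Form.badW_le hcom fun k hk hk' => ?_) fun φ hφ =>
      (hnew φ hφ).imp_right fun h => h.2.1
    have hk'' : k ∈ n.used := subset_constsOf hφ hk
    obtain ⟨h1, h2⟩ := mem_inter.1 hk'
    exact mem_inter.2 ⟨(hA k hk'').1 h1, (hB k hk'').1 h2⟩
  · exact hsum _ _ (fun φ hφ => le_rfl) fun φ hφ => (hnew φ hφ).imp_right fun h =>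
      ind_eq_zero.2 h.2.2
  · refine Nat.add_lt_add_of_lt_of_le ((defect_le_aux hSA (fun i j h => hAA _ h hne)
      (fun a i _ _ h => h.mono ho hAA) hiA).2 hd) ?_
    exact (defect_le_aux hSB (fun i j h => hBB _ h hne)
      (fun a i _ _ h => h.mono ho hBB) hiB).1

/-- Identification of index constants. -/
theorem Good.measure_lt_of_merge (hn : n.Good) {A' : Finset Form} (hA' : A' ⊆ n.A)
    {big small : ℕ} (hbig : (.index, big) ∈ n.localA) (hsmall : (.index, small) ∈ n.localA)
    (hlt : Prec n.ord .index small big) :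
    LexLt ((n.withA A').identify .index big small).measure n.measure := by
  have hg : (n.withA A').Good := hn.withA ((constsOf_mono hA').trans hn.subA)
    fun φ hφ => hn.okA φ (hA' hφ)
  have hne : small ≠ big := fun h => Prec.irrefl hn.nodup (h ▸ hlt)
  have hu : n.localA ⊆ n.used := hn.used_inter_sigA ▸ inter_subset_left
  have hu' : (n.withA A').used ⊆ n.used :=
    constsOf_mono (union_subset_union hA' subset_rfl)
  have h := used_identify hg (o := big) (m := small) (hn.localA_subset hbig)
  refine .inl (cardSort_lt (fun k hk => ?_) big (hu hbig) fun hk => ?_)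
  · rcases mem_insert.1 (h hk) with h | h
    · exact h ▸ hu hsmall
    · exact hu' (mem_of_mem_erase h)
  · rcases mem_insert.1 (h hk) with h | h
    · exact hne (by simpa using h.symm)
    · exact notMem_erase _ _ h

end Node

open Node

theorem GuessA.measure_lt (hn : n.Good) (h : GuessA n cs) :
    ∀ c ∈ cs, c.Closed ∨ c.phase = n.phase ∧ LexLt c.measure n.measure := by
  cases h with
  | refl i hL =>
    intro c hc
    obtain rfl := List.mem_singleton.1 hc
    refine .inr ⟨rfl, ?_⟩
    have hsub : n.A.erase (.eq (idx i) (idx i)) ∪ n.B ⊆ n.A ∪ n.B :=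
      union_subset_union (erase_subset _ _) subset_rfl
    refine hn.measure_lt_of_defect (List.Sublist.refl _) (fun s k _ hk => constsOf_mono hsub hk)
      (fun _ _ => Iff.rfl) (fun _ _ => Iff.rfl) subset_rfl (fun φ hφ => .inl (hsub hφ))
      (fun L hL h => mem_erase.2 ⟨fun h' => h ⟨_, _, h'⟩, hL⟩) (fun _ hL _ => hL)
      (fun _ _ h => mem_of_mem_erase h) (fun _ _ h => h)
      (.inr (.inr ⟨i, i, hL, notMem_erase _ _⟩))
  | merge L big small hL hform hlt =>
    intro c hc
    obtain rfl := List.mem_singleton.1 hc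
    refine .inr ⟨rfl, hn.measure_lt_of_merge (erase_subset _ _) ?_ ?_ hlt⟩
    all_goals
      refine mem_union_left _ (subset_constsOf hL ?_)
      rcases hform with rfl | rfl <;> simp [Form.consts, Term.consts]
  | guess big small hbig hsmall hlt h1 h2 =>
    intro c hc
    simp only [List.mem_cons, List.not_mem_nil, or_false] at hc
    rcases hc with rfl | rfl
    · refine .inr ⟨rfl, ?_⟩
      have hu : n.localA ⊆ n.used := hn.used_inter_sigA ▸ inter_subset_left
      have hne : small ≠ big := fun h => Prec.irrefl hn.nodup (h ▸ hlt)
      have hmem : ∀ φ, φ ∈ (if (.index, big) ∈ n.common ∧ (.index, small) ∈ n.common then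
          insert (.neg (.eq (idx big) (idx small))) n.B else n.B) →
          φ = .neg (.eq (idx big) (idx small)) ∨ φ ∈ n.B := by
        intro φ h
        split_ifs at h
        · exact mem_insert.1 h
        · exact .inr h
      have hmem' : ∀ φ ∈ insert (.neg (.eq (idx big) (idx small))) n.A ∪
          (if (.index, big) ∈ n.common ∧ (.index, small) ∈ n.common then
          insert (.neg (.eq (idx big) (idx small))) n.B else n.B),
          φ = .neg (.eq (idx big) (idx small)) ∨ φ ∈ n.A ∪ n.B := by
        intro φ h
        rcases mem_union.1 h with h | h
        · exact (mem_insert.1 h).imp_right (mem_union_left _)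
        · exact (hmem φ h).imp_right (mem_union_right _)
      refine hn.measure_lt_of_defect (List.Sublist.refl _) (fun s k _ hk => ?_)
        (fun _ _ => Iff.rfl) (fun _ _ => Iff.rfl) subset_rfl (fun φ hφ => ?_)
        (fun L hL h => mem_insert_of_mem hL) (fun _ hL _ => ?_)
        (fun _ _ h => (mem_insert.1 h).resolve_left nofun)
        (fun _ _ h => (hmem _ h).resolve_left nofun)
        (.inl ⟨big, small, hbig, hsmall, hne.symm, h1, h2, mem_insert_self _ _⟩)
      · obtain ⟨φ, hφ, hk⟩ := mem_constsOf.1 hk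
        rcases hmem' φ hφ with rfl | h
        · simp only [Form.consts, Term.consts, mem_union, mem_singleton] at hk
          rcases hk with h | h
          · exact h ▸ hu hbig
          · exact h ▸ hu hsmall
        · exact subset_constsOf h hk
      · refine (hmem' φ hφ).symm.imp_right ?_
        rintro rfl
        refine ⟨?_, rfl, ?_⟩
        · rintro ⟨a, b, V, h, -⟩
          cases h
        · rintro ⟨a, b, V, -, h⟩
          cases h
      · dsimp only
        split_ifs
        · exact mem_insert_of_mem hL
        · exact hL
    · exact .inr ⟨rfl, hn.measure_lt_of_merge subset_rfl hbig hsmall hlt⟩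
  | clash i hL =>
    intro c hc
    obtain rfl := List.mem_singleton.1 hc
    exact .inl .of_bot

theorem RepairA.measure_lt (hn : n.Good) (h : RepairA n cs) :
    ∀ c ∈ cs, c.Closed ∨ c.phase = n.phase ∧ LexLt c.measure n.measure := by
  cases h with
  | mk sh a i e ord' ha hi hmiss hext =>
    intro c hc
    obtain rfl := List.mem_singleton.1 hc
    refine .inr ⟨rfl, ?_⟩
    obtain ⟨hX, ho, -, -⟩ := hext
    have hu : n.localA ⊆ n.used := hn.used_inter_sigA ▸ inter_subset_left
    have hX' : ∀ k ∈ n.used, k ∉ ({(.elem, e)} : Finset Const) := fun k hk hk' =>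
      disjoint_left.1 hX hk' (hn.used_subset hk)
    have hmem : ∀ φ ∈ (n.extend sh {(.elem, e)} ord' n.A
        {.eq (.rd (arr a) (idx i)) (el e)}).B, φ ∈ n.B ∨
        φ = .eq (.rd (arr a) (idx i)) (el e) := by
      intro φ hφ
      simp only [extend] at hφ
      split_ifs at hφ
      · simpa [or_comm] using hφ
      · exact .inl hφ
    have hmemA : ∀ φ ∈ (n.extend sh {(.elem, e)} ord' n.A
        {.eq (.rd (arr a) (idx i)) (el e)}).A, φ ∈ n.A ∨
        φ = .eq (.rd (arr a) (idx i)) (el e) := by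
      intro φ hφ
      simpa [extend, or_comm] using hφ
    refine hn.measure_lt_of_defect ho (fun s k hs hk => ?_)
      (fun k hk => ?_) (fun k hk => ?_) common_subset_extend (fun φ hφ => ?_)
      (fun L hL h => mem_union_left _ hL) (fun L hL _ => ?_)
      (fun i j h => (hmemA _ h).resolve_right nofun)
      (fun i j h => (hmem _ h).resolve_right nofun)
      (.inr (.inl ⟨a, i, ha, hi, fun h => ?_, .lit (mem_union_right _
        (mem_singleton_self _))⟩))
    · have := used_extend hk
      simp only [constsOf_singleton, Form.consts, Term.consts, mem_union,
        mem_singleton] at this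
      rcases this with (h | h) | (h | h) | h
      · exact constsOf_mono subset_union_left h
      · exact constsOf_mono subset_union_right h
      · exact h ▸ hu ha
      · exact h ▸ hu hi
      · exact absurd (Prod.ext_iff.1 h).1 hs
    · simp only [extend, mem_union, hX' k hk, or_false]
    · simp only [extend]
      split_ifs
      · simp only [mem_union, hX' k hk, or_false]
      · rfl
    · rcases mem_union.1 hφ with h | h
      · refine (hmemA φ h).imp (mem_union_left _) ?_
        rintro rfl
        exact ⟨(by rintro ⟨_, _, _, h, -⟩; cases h), formBadW_elem _ _,
          (by rintro ⟨_, _, _, -, h⟩; cases h)⟩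
      · refine (hmem φ h).imp (mem_union_right _) ?_
        rintro rfl
        exact ⟨(by rintro ⟨_, _, _, h, -⟩; cases h), formBadW_elem _ _,
          (by rintro ⟨_, _, _, -, h⟩; cases h)⟩
    · simp only [extend]
      split_ifs
      · exact mem_union_left _ hL
      · exact hL
    · obtain ⟨e', he'⟩ := reach_iff.1 h
      exact hmiss e' he'

theorem CopyA.measure_lt (hI : Inv n.ord n.A n.localA) (h : CopyA n cs) :
    ∀ c ∈ cs, c.phase = n.phase ∧ LexLt c.measure n.measure := by
  cases h with
  | mk L hA hB hL =>
    intro c hc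
    obtain rfl := List.mem_singleton.1 hc
    refine ⟨rfl, ?_⟩
    have hU : n.A ∪ insert L n.B = n.A ∪ n.B := by
      ext φ
      simp only [mem_union, mem_insert]
      refine ⟨?_, by tauto⟩
      rintro (h | rfl | h) <;> tauto
    have hBB : ∀ M ∈ n.B, ¬ IsIdxEq M → M ∈ insert L n.B := fun M hM _ =>
      mem_insert_of_mem hM
    have hne : ∀ {i j}, ¬ IsIdxEq (.neg (.eq (idx i) (idx j))) := by
      rintro i j ⟨_, _, h⟩
      cases h
    refine .inr ⟨by simp only [used, hU, le_refl], .inr ⟨by simp only [used, hU, common, le_refl],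
      .inr ⟨by simp only [used, hU, common, le_refl], .inr ⟨Nat.add_le_add
        (by simp only [used, hU, le_refl])
        (irr_le fun a ha hr => ⟨by simpa only [used, hU] using ha,
          fun h => hr (h.mono (List.Sublist.refl _) hBB)⟩),
      .inr ⟨by simp only [hU, le_refl], .inr ⟨by simp only [hU, common, le_refl],
      .inr ⟨by simp only [hU, le_refl], .inr ⟨Nat.add_le_add
        (by simp only [used, hU, le_refl]) ?_,
      .inr ⟨by simp only [used, hU, common, le_refl], .inr ⟨by simp only [hU, le_refl],
      .inr ⟨by simp only [hU, le_refl], .inr ⟨by simp only [hU, le_refl],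
      .inr ⟨by simp only [hU, le_refl], .inl ?_⟩⟩⟩⟩⟩⟩⟩⟩⟩⟩⟩⟩⟩
    · refine (defect_le_aux (fun s k _ hk => by simpa only [used, hU] using hk)
        (fun i j h => hBB _ h hne)
        (fun a i _ _ h => h.mono (List.Sublist.refl _) hBB) fun i j h => ?_).1
      refine (mem_insert.1 h).resolve_left ?_
      rintro rfl
      exact hI.noEq i j hA
    · refine Nat.add_lt_add_of_le_of_lt
        (card_le_card fun φ hφ => mem_filter.2
          (by simpa only [hU, common] using mem_filter.1 hφ)) ?_
      refine card_lt_card ⟨fun φ hφ => ?_, fun h => ?_⟩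
      · simp only [hU, mem_filter, mem_insert, not_or] at hφ ⊢
        exact ⟨hφ.1, hφ.2.1, hφ.2.2.2⟩
      · have := @h L (mem_filter.2 ⟨mem_union_left _ hA, hL, hB⟩)
        exact (mem_filter.1 this).2.2 (mem_insert_self _ _)

namespace Node

theorem mem_common_share {o m : ℕ} :
    (s, m) ∈ (n.share s o m ord' L).common :=
  mem_inter.2 ⟨mem_union_right _ (mem_singleton_self _),
    mem_union_right _ (mem_singleton_self _)⟩

/-- Constants and literals after Term Sharing. -/
theorem Good.share_facts (hn : n.Good) {o m : ℕ} (hL : L ∈ n.A) (ho : (s, o) ∈ L.consts)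
    (ho' : (s, o) ∉ n.common) (hext : n.CanExtend true {(s, m)} ord' D) :
    (n.share s o m ord' L).A = n.A.image (Form.rename s o m) ∧
      (n.share s o m ord' L).A ∪ (n.share s o m ord' L).B =
        (n.A ∪ n.B).image (Form.rename s o m) ∧
      (n.share s o m ord' L).used ⊆ insert (s, m) (n.used.erase (s, o)) ∧
      (s, o) ∈ n.used ∧ (s, o) ∉ (n.share s o m ord' L).used ∧
      (∀ c ∈ (n.share s o m ord' L).used, c ∈ n.used ∨ c ∈ (n.share s o m ord' L).common) ∧
      n.common ⊆ (n.share s o m ord' L).common := by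
  have hoA : (s, o) ∈ n.sigA := hn.subA (subset_constsOf hL ho)
  have hoB : (s, o) ∉ constsOf n.B := fun h => ho' (mem_inter.2 ⟨hoA, hn.subB h⟩)
  have hmo : (s, m) ≠ (s, o) := fun h => disjoint_left.1 hext.1
    (mem_singleton_self (s, m)) (h ▸ mem_union_left _ hoA)
  have hA : (n.share s o m ord' L).A = n.A.image (Form.rename s o m) := by
    change n.A.image (Form.rename s o m) ∪ {L.rename s o m} = _
    exact union_eq_left.2 (singleton_subset_iff.2 (mem_image_of_mem _ hL))
  have hB : (n.share s o m ord' L).B = n.B ∪ {L.rename s o m} := rfl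
  have hU : (n.share s o m ord' L).A ∪ (n.share s o m ord' L).B =
      (n.A ∪ n.B).image (Form.rename s o m) := by
    rw [hA, hB, image_union, image_rename_of_notMem hoB, ← union_assoc]
    refine union_eq_left.2 (singleton_subset_iff.2 (mem_union_left _
      (mem_image_of_mem _ hL)))
  have hu : (n.share s o m ord' L).used ⊆ insert (s, m) (n.used.erase (s, o)) := by
    rw [used, hU]
    exact constsOf_image_rename_subset _ _ _ _
  refine ⟨hA, hU, hu, constsOf_mono subset_union_left (subset_constsOf hL ho), ?_,
    fun c hc => ?_, common_subset_extend⟩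
  · intro h
    rcases mem_insert.1 (hu h) with h | h
    · exact hmo h.symm
    · exact notMem_erase _ _ h
  · rcases mem_insert.1 (hu hc) with rfl | h
    · exact .inr mem_common_share
    · exact .inl (mem_of_mem_erase h)

theorem Good.share_cardSort_le (hn : n.Good) {o m : ℕ} (hL : L ∈ n.A) (ho : (s, o) ∈ L.consts)
    (ho' : (s, o) ∉ n.common) (hext : n.CanExtend true {(s, m)} ord' D) (s' : Srt) :
    cardSort (n.share s o m ord' L).used s' ≤ cardSort n.used s' := by
  obtain ⟨-, -, hu, hou, -, -, -⟩ := hn.share_facts hL ho ho' hext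
  by_cases hs : s' = s
  · subst hs
    refine cardSort_le_of_replace (new := m) (fun k hk => ?_) hou
    rcases mem_insert.1 (hu hk) with h | h
    · exact .inl (by simpa using h)
    · obtain ⟨h1, h2⟩ := mem_erase.1 h
      exact .inr ⟨h2, fun h => h1 (h ▸ rfl)⟩
  · refine cardSort_le fun k hk => ?_
    rcases mem_insert.1 (hu hk) with h | h
    · exact absurd (Prod.ext_iff.1 h).1 hs
    · exact mem_of_mem_erase h

/-- Sharing of an element constant. -/
theorem Good.measure_share_elem (hn : n.Good) (hn' : n.phase = .completion) {o m : ℕ}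
    (hL : L ∈ n.A) (ho : (.elem, o) ∈ L.consts) (ho' : (.elem, o) ∉ n.common) (hLi : ¬ IsIdxEq L)
    (hext : n.CanExtend true {(.elem, m)} ord' D) :
    LexLt (n.share .elem o m ord' L).measure n.measure := by
  obtain ⟨hA, hU, hu, hou, hou', huc, hcom⟩ := hn.share_facts hL ho ho' hext
  set c := n.share .elem o m ord' L with hc
  have hs : Srt.elem ≠ .array := by decide
  have hord : n.ord.Sublist ord' := hext.2.1
  have hflat : ∀ φ ∈ n.A ∪ n.B, Flat φ := fun φ hφ =>
    (mem_union.1 hφ).elim (hn.flat hn' φ) (hn.swap.flat hn' φ)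
  have hsum : ∀ g g' : Form → ℕ, (∀ φ ∈ n.A ∪ n.B, g' (φ.rename .elem o m) ≤ g φ) →
      ∑ φ ∈ c.A ∪ c.B, g' φ ≤ ∑ φ ∈ n.A ∪ n.B, g φ := fun g g' h1 =>
    sum_le_of_forall_mem_image (Form.rename .elem o m)
      (fun φ hφ => .inl (hU ▸ hφ)) h1
  have hu' : ∀ s k, s ≠ .elem → (s, k) ∈ c.used → (s, k) ∈ n.used := by
    intro s k hs hk
    rcases mem_insert.1 (hu hk) with h | h
    · exact absurd (Prod.ext_iff.1 h).1 hs
    · exact mem_of_mem_erase h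
  have hX : ∀ {s k}, s ≠ Srt.elem → (s, k) ∉ ({(.elem, m)} : Finset Const) := by
    intro s k hs h
    exact hs (Prod.ext_iff.1 (mem_singleton.1 h)).1
  have hSA : ∀ s k, s ≠ .elem → (s, k) ∈ c.used ∩ c.sigA → (s, k) ∈ n.used ∩ n.sigA := by
    intro s k hs hk
    obtain ⟨h1, h2⟩ := mem_inter.1 hk
    exact mem_inter.2 ⟨hu' s k hs h1, (mem_union.1 h2).resolve_right (hX hs)⟩
  have hSB : ∀ s k, s ≠ .elem → (s, k) ∈ c.used ∩ c.sigB → (s, k) ∈ n.used ∩ n.sigB := by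
    intro s k hs hk
    obtain ⟨h1, h2⟩ := mem_inter.1 hk
    exact mem_inter.2 ⟨hu' s k hs h1, (mem_union.1 h2).resolve_right (hX hs)⟩
  have hBB : ∀ M ∈ n.B, ¬ IsIdxEq M → M ∈ c.B := fun M hM _ => mem_union_left _ hM
  have hne : ∀ {i j}, ¬ IsIdxEq (.neg (.eq (idx i) (idx j))) := by
    rintro i j ⟨_, _, h⟩
    cases h
  have hidx : ∀ {φ : Form}, Flat φ → ∀ i j, φ.rename .elem o m = .eq (idx i) (idx j) →
      φ = .eq (idx i) (idx j) := by
    intro φ hφ i j h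
    cases hφ with
    | wr a' b' V' => rw [rename_arrEq hs] at h; cases h
    | rd => rw [rename_rd hs] at h; cases h
    | diff => rw [rename_diff hs] at h; cases h
    | idxEq => rw [rename_const_eq] at h; simpa using h
    | elemEq => rw [rename_const_eq] at h; cases h
    | ne => rw [rename_const_ne] at h; cases h
  refine .inr ⟨hn.share_cardSort_le hL ho ho' hext _, .inr ⟨strict_le (fun k hk => huc _ hk)
    fun k hk => hcom hk, .inr ⟨strict_le (fun k hk => huc _ hk) fun k hk => hcom hk,
    .inr ⟨Nat.add_le_add (irr_le fun a ha hr => ⟨hSA _ _ nofun ha, fun h => hr ?_⟩)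
      (irr_le fun a ha hr => ⟨hSB _ _ nofun ha, fun h => hr (h.mono hord hBB)⟩),
    .inr ⟨?_, .inr ⟨?_, .inr ⟨?_, .inr ⟨Nat.add_le_add ?_ ?_, .inl ?_⟩⟩⟩⟩⟩⟩⟩⟩
  · rw [hA]
    exact (h.rename hs o m).mono hord fun L hL _ => hL
  · exact hsum _ _ fun φ hφ => ind_le ((hflat φ hφ).not_unoriented_rename hs o m hord)
  · refine hsum _ _ fun φ hφ => (hflat φ hφ).badW_rename_le hs hcom ?_ fun a _ ha =>
      mem_common_of_extend ha (hX nofun)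
    exact mem_common_share
  · exact hsum _ _ fun φ hφ => ind_le ((hflat φ hφ).isDiffNe_rename hs)
  · refine (defect_le_aux hSA (fun i j h => ?_) (fun a i _ _ h => ?_) fun i j h => ?_).1
    · rw [hA]
      have := mem_image_of_mem (Form.rename .elem o m) h
      rw [rename_const_ne] at this
      simpa using this
    · rw [hA]
      exact (h.rename_elem o m).mono hord fun L hL _ => hL
    · rw [hA] at h
      obtain ⟨φ, hφ, h⟩ := mem_image.1 h
      exact hidx (hn.flat hn' φ hφ) i j h ▸ hφ
  · refine (defect_le_aux hSB (fun i j h => hBB _ h hne)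
      (fun a i _ _ h => h.mono hord hBB) fun i j h => ?_).1
    refine (mem_union.1 h).resolve_right fun h => hLi ⟨i, j, ?_⟩
    exact hidx (hn.flat hn' L hL) i j (mem_singleton.1 h).symm
  · exact strict_lt (fun k hk => huc _ hk) (fun k hk => hcom hk) o hou ho' hou'

end Node

theorem Rew.badW_le (C : Finset Const) (h : Rew ord ∅ t u) : u.badW C ≤ t.badW C := by
  induction h with
  | ground L hL => cases hL
  | sort x i j e d => simp only [Term.badW]; omega
  | overwrite x i e d => simp only [Term.badW]; omega
  | readOther | readSame | rd₁ | rd₂ | diff₁ | diff₂ => simp [Term.badW]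
  | wr₁ i e h ih => simp only [Term.badW]; omega
  | wr₂ x e h ih =>
    have := h.consts_subset
    simp only [Term.badW]
    refine Nat.add_le_add_left ?_ _
    split_ifs with h1 h2 h2
    · exact le_rfl
    · exact Nat.zero_le _
    · refine absurd (union_subset ?_ (union_subset_right h2)) h1
      refine this.trans (union_subset (union_subset_left h2) ?_)
      simp [constsOf]
    · exact le_rfl
  | wr₃ x i h ih =>
    have := h.consts_subset
    simp only [Term.badW]
    refine Nat.add_le_add_left ?_ _
    split_ifs with h1 h2 h2
    · exact le_rfl
    · exact Nat.zero_le _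
    · refine absurd (union_subset (union_subset_left h2) ?_) h1
      refine this.trans (union_subset (union_subset_right h2) ?_)
      simp [constsOf]
    · exact le_rfl

theorem NF.badW_le (C : Finset Const) (h : NF ord ∅ t u) : u.badW C ≤ t.badW C := by
  obtain ⟨h, -⟩ := h
  induction h with
  | refl => exact le_rfl
  | tail _ h ih => exact (h.badW_le C).trans ih

/-- The definitions introduced by the splitting of a literal with left-hand side `c`. -/
structure SplitDefs (ord : List Const) (S C : Finset Const) (c c2 i d : ℕ) (X : Finset Const)
    (D : Finset Form) : Prop where
  flat : ∀ φ ∈ D, Flat φ ∧ IsEq φ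
  oriented : ∀ φ ∈ D, ¬ Unoriented ord φ
  bad : ∀ φ ∈ D, φ.badW (C ∪ X) = 0
  index : ∀ k, (.index, k) ∈ X → k = i
  memI : (.index, i) ∈ X
  memD : (.elem, d) ∈ X
  red : ∀ a, (.array, a) ∈ X → Red ord D a
  consts : constsOf D ⊆ S ∪ X
  prec : Prec ord .array c2 c
  memC : (.array, c2) ∈ S ∪ X

theorem splitDefs {S C X : Finset Const} {c c' c2 i d d2 : ℕ} {W1 : List (ℕ × ℕ)}
    (hc : (.array, c) ∈ S) (hW : (wrs (arr c') W1).consts ⊆ S)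
    (hW1 : (wrs (arr c') W1).consts ⊆ C) (hp : Prec ord .array c' c)
    (hc2 : (X = {(.array, c2), (.index, i), (.elem, d), (.elem, d2)} ∧
          D = {.eq (arr c2) (wrs (arr c') W1), .eq (.diff (arr c) (arr c2)) (idx i),
            .eq (.rd (arr c) (idx i)) (el d), .eq (.rd (arr c2) (idx i)) (el d2)} ∧
          Prec ord .array c' c2 ∧ Prec ord .array c2 c) ∨
        (W1 = [] ∧ c2 = c' ∧ X = {(.index, i), (.elem, d), (.elem, d2)} ∧
          D = {.eq (.diff (arr c) (arr c2)) (idx i),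
            .eq (.rd (arr c) (idx i)) (el d), .eq (.rd (arr c2) (idx i)) (el d2)})) :
    SplitDefs ord S C c c2 i d X D := by
  have key : ∀ φ : Form, φ = .eq (.diff (arr c) (arr c2)) (idx i) ∨
      φ = .eq (.rd (arr c) (idx i)) (el d) ∨ φ = .eq (.rd (arr c2) (idx i)) (el d2) →
      (Flat φ ∧ IsEq φ) ∧ ¬ Unoriented ord φ ∧ φ.badW (C ∪ X) = 0 := by
    rintro φ (rfl | rfl | rfl)
    · exact ⟨⟨.diff _ _ _, _, _, _, rfl⟩, (by rintro ⟨_, _, _, h, -⟩; cases h), by simp [Form.badW, badW_idx]⟩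
    · exact ⟨⟨.rd _ _ _, _, _, _, rfl⟩, (by rintro ⟨_, _, _, h, -⟩; cases h), formBadW_elem _ _⟩
    · exact ⟨⟨.rd _ _ _, _, _, _, rfl⟩, (by rintro ⟨_, _, _, h, -⟩; cases h), formBadW_elem _ _⟩
  have hW' := hW (mem_consts_wrs.2 (.inl (mem_consts_arr c')))
  rcases hc2 with ⟨rfl, rfl, hp1, hp2⟩ | ⟨rfl, rfl, rfl, rfl⟩
  · have key' : ∀ φ ∈ ({.eq (arr c2) (wrs (arr c') W1), .eq (.diff (arr c) (arr c2)) (idx i),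
        .eq (.rd (arr c) (idx i)) (el d), .eq (.rd (arr c2) (idx i)) (el d2)} : Finset Form),
        (Flat φ ∧ IsEq φ) ∧ ¬ Unoriented ord φ ∧ φ.badW (C ∪ {(.array, c2), (.index, i), (.elem, d),
          (.elem, d2)}) = 0 := by
      intro φ hφ
      rcases mem_insert.1 hφ with rfl | hφ
      · refine ⟨⟨.wr _ _ _, _, _, _, rfl⟩, ?_, formBadW_eq_zero fun _ => hW1.trans subset_union_left⟩
        rintro ⟨a, b, V, h, hV, hp'⟩
        simp only [Form.eq.injEq, heq_eq_eq, true_and, Term.const.injEq, wrs_inj] at h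
        obtain ⟨rfl, rfl, rfl⟩ := h
        exact hp' hp1
      · exact key φ (by simpa using hφ)
    refine ⟨fun φ h => (key' φ h).1, fun φ h => (key' φ h).2.1, fun φ h => (key' φ h).2.2,
      by simp, by simp, by simp, ?_, ?_, hp2, by simp⟩
    · intro a ha
      obtain rfl : a = c2 := by simpa using ha
      exact red_of_mem (mem_insert_self _ _) hp1
    · simp only [constsOf_insert, constsOf_singleton, Form.consts]
      refine union_subset (union_subset (by simp [Term.consts])
        (hW.trans subset_union_left)) ?_
      clear key key' hp1 hp2 hp hW hW1
      simp only [Term.consts]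
      grind
  · refine ⟨fun φ h => (key φ (by simpa using h)).1, fun φ h => (key φ (by simpa using h)).2.1,
      fun φ h => (key φ (by simpa using h)).2.2, by simp, by simp, by simp, by simp, ?_, hp,
      mem_union_left _ hW'⟩
    simp only [constsOf_insert, constsOf_singleton, Form.consts, Term.consts]
    grind

namespace Node

/-- The alternative of splitting in which the literal is replaced by a common one. -/
theorem measure_split_common (hn : n.Good) {c c' : ℕ} {V W1 W2 : List (ℕ × ℕ)} (hL : L ∈ n.A)
    (hLB : L ∉ n.B) (hr : LitRule n.ord L (arr c) (wrs (arr c') V)) (hbad : 0 < L.badW n.common)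
    (hW1 : (wrs (arr c') W1).consts ⊆ n.common)
    (hW : ∀ p ∈ W1 ++ W2, (.index, p.1) ∈ constsOf n.A ∧ (.elem, p.2) ∈ constsOf n.A) :
    LexLt (n.withA (insert (.eq (arr c) (wrs (arr c') W1)) (n.A.erase L) ∪
      reads c' W2)).measure n.measure := by
  have hc := subset_constsOf hL (hr.consts_subset.1 (mem_consts_arr c))
  have hc' := subset_constsOf hL (hr.consts_subset.2.1
    (mem_consts_wrs.2 (.inl (mem_consts_arr c'))))
  set add : Finset Form := insert (.eq (arr c) (wrs (arr c') W1)) (reads c' W2) with hadd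
  have hA : insert (.eq (arr c) (wrs (arr c') W1)) (n.A.erase L) ∪ reads c' W2 =
      n.A \ {L} ∪ add := by
    rw [hadd, sdiff_singleton_eq_erase, insert_union, union_insert]
  rw [hA]
  have hU : n.A \ {L} ∪ add ∪ n.B = (n.A ∪ n.B) \ {L} ∪ add := by
    ext φ
    have : φ = L → φ ∉ n.B := fun h => h ▸ hLB
    simp only [mem_union, mem_sdiff, mem_singleton]
    tauto
  have haddc : constsOf add ⊆ constsOf n.A := by
    rw [hadd, constsOf_insert]
    refine union_subset (union_subset (singleton_subset_iff.2 hc)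
      (consts_wrs_subset.2 ⟨singleton_subset_iff.2 hc', fun p hp =>
        hW p (List.mem_append_left _ hp)⟩)) (constsOf_reads_subset hc' fun p hp =>
        hW p (List.mem_append_right _ hp))
  have hused : constsOf (n.A \ {L} ∪ add ∪ n.B) ⊆ constsOf (n.A ∪ n.B) := by
    rw [hU, constsOf_union]
    exact union_subset (constsOf_mono sdiff_subset)
      (haddc.trans (constsOf_mono subset_union_left))
  have hp := litRule_prec hr
  have hmem : Form.eq (arr c) (wrs (arr c') W1) ∈ n.A \ {L} ∪ add :=
    mem_union_right _ (mem_insert_self _ _)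
  have hsum := fun g => sum_sdiff_union_le g (U := n.A ∪ n.B) (del := {L}) add
    (singleton_subset_iff.2 (mem_union_left _ hL))
  have hredA : ∀ a, Red n.ord n.A a → Red n.ord (n.A \ {L} ∪ add) a := by
    rintro a ⟨L', hL', r, hr'⟩
    by_cases h : L' = L
    · subst h
      obtain ⟨rfl, -⟩ := eq_of_litRule_arr hn.nodup hr hr'
      exact red_of_mem hmem hp
    · exact ⟨L', mem_union_left _ (mem_sdiff.2 ⟨hL', by simpa using h⟩), r, hr'⟩
  refine .inr ⟨cardSort_le fun k hk => hused hk,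
    .inr ⟨strict_le (fun k hk => .inl (hused hk)) fun _ h => h,
    .inr ⟨strict_le (fun k hk => .inl (hused hk)) fun _ h => h,
    .inr ⟨Nat.add_le_add (irr_le fun a ha hr => ⟨inter_subset_inter_right hused ha,
        fun h => hr (hredA a h)⟩)
      (irr_le fun a ha hr => ⟨inter_subset_inter_right hused ha, hr⟩),
    .inr ⟨?_, .inl ?_⟩⟩⟩⟩⟩
  · have h := hsum (ind (Unoriented n.ord))
    rw [sum_eq_zero (s := add)] at h
    · simp only [withA, hU]
      omega
    · intro φ hφ
      refine ind_eq_zero.2 ?_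
      rintro ⟨a, b, U, rfl, hU, hp'⟩
      rcases mem_insert.1 hφ with h | h
      · simp only [Form.eq.injEq, heq_eq_eq, true_and, Term.const.injEq, wrs_inj] at h
        obtain ⟨rfl, rfl, rfl⟩ := h
        exact hp' hp
      · obtain ⟨p, -, h⟩ := mem_reads.1 h
        cases h
  · have h := hsum (Form.badW n.common)
    rw [sum_eq_zero (s := add), sum_singleton] at h
    · simp only [withA, hU, common] at h hbad ⊢
      omega
    · intro φ hφ
      rcases mem_insert.1 hφ with rfl | h
      · exact formBadW_eq_zero fun _ => hW1
      · exact badW_of_mem_reads h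

/-- The alternatives of splitting in which a pair of an index and an element is identified with a
common one. -/
theorem measure_split_identify (hn : n.Good) (hph : n.phase = .completion) {c c' c2 i d d2 : ℕ}
    {V W2 : List (ℕ × ℕ)} {M : Node} (hL : L ∈ n.A) (hLB : L ∉ n.B)
    (hr : LitRule n.ord L (arr c) (wrs (arr c') V)) (hbad : W2.length ≤ L.badW n.common)
    (hW : ∀ p ∈ W2, (.index, p.1) ∈ constsOf n.A ∧ (.elem, p.2) ∈ constsOf n.A)
    (hext : n.CanExtend true X ord' D) (hD : SplitDefs ord' (constsOf n.A) n.common c c2 i d X D)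
    (hd2 : (.elem, d2) ∈ X) (hM : M = n.extend true X ord'
      (insert (.neg (.eq (el d) (el d2)))
        (insert (.eq (arr c) (wrs (arr c2) W2)) (n.A.erase L))) D) {p : ℕ × ℕ} (hp : p ∈ W2) :
    LexLt ((M.identify .index p.1 i).identify .elem p.2 d).measure n.measure := by
  set A2 : Finset Form := insert (.neg (.eq (el d) (el d2)))
    (insert (.eq (arr c) (wrs (arr c2) W2)) (n.A.erase L)) with hA2
  have hord := hext.2.1
  have hX := hext.1
  have hc := subset_constsOf hL (hr.consts_subset.1 (mem_consts_arr c))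
  have hA₂c : constsOf A2 ⊆ constsOf n.A ∪ X := by
    have h : (wrs (arr c2) W2).consts ⊆ constsOf n.A ∪ X := consts_wrs_subset.2
      ⟨singleton_subset_iff.2 hD.memC, fun p hp =>
        ⟨mem_union_left _ (hW p hp).1, mem_union_left _ (hW p hp).2⟩⟩
    have h' := constsOf_mono (erase_subset L n.A)
    have h1 := hD.memD
    rw [hA2, constsOf_insert, constsOf_insert, Form.consts, Form.consts, Form.consts]
    simp only [Term.consts] at h ⊢
    grind
  have hMA : M.A = A2 ∪ D := by rw [hM]; rfl
  have hMB : M.B = n.B ∪ D := by rw [hM]; rfl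
  have hMsA : M.sigA = n.sigA ∪ X := by rw [hM]; rfl
  have hMsB : M.sigB = n.sigB ∪ X := by rw [hM]; rfl
  have hMo : M.ord = ord' := by rw [hM]; rfl
  have hMg : M.Good := by
    rw [hM]
    refine hn.extend hext (hA₂c.trans (union_subset_union_left hn.subA)) nofun ?_ ?_
    · intro φ hφ
      simp only [hA2, mem_insert] at hφ
      rcases hφ with rfl | rfl | hφ
      · exact okForm_ne _ (by simp) _ _
      · exact okForm_of_flat_isEq _ (.wr _ _ _) ⟨_, _, _, rfl⟩
      · exact hn.okA φ (mem_of_mem_erase hφ)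
    · exact fun φ hφ => okForm_of_flat_isEq _ (hD.flat φ hφ).1 (hD.flat φ hφ).2
  have hiX := hD.memI
  have hdX := hD.memD
  have hMc : M.common = (n.sigA ∪ X) ∩ (n.sigB ∪ X) := by rw [Node.common, hMsA, hMsB]
  have hXc : ∀ k ∈ X, k ∈ M.common := fun k hk => by
    rw [hMc]
    exact mem_inter.2 ⟨mem_union_right _ hk, mem_union_right _ hk⟩
  have hCM : n.common ∪ X ⊆ M.common := by
    refine union_subset ?_ hXc
    rw [hMc]
    exact inter_subset_inter subset_union_left subset_union_left
  have hfr : ∀ k ∈ n.used, k ∉ X := fun k hk hk' =>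
    disjoint_left.1 hX hk' (hn.used_subset hk)
  have hMcn : ∀ k ∈ n.used, k ∈ M.common → k ∈ n.common := fun k hk h => by
    rw [hMc] at h
    simpa [Node.common, hfr k hk] using h
  have hAu : constsOf n.A ⊆ n.used := constsOf_mono subset_union_left
  have hMu : M.used ⊆ n.used ∪ X := by
    rw [Node.used, hMA, hMB, constsOf_union (A2 ∪ D), constsOf_union A2, constsOf_union n.B]
    have h1 := union_subset_union_left (t := X) hAu
    refine union_subset (union_subset (hA₂c.trans h1) (hD.consts.trans h1))
      (union_subset ?_ (hD.consts.trans h1))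
    exact (constsOf_mono subset_union_right).trans subset_union_left
  have hp1 : (.index, p.1) ∈ M.sigA := by
    rw [hMsA]
    exact mem_union_left _ (hn.subA (hW p hp).1)
  have hp2 : (.elem, p.2) ∈ M.sigA := by
    rw [hMsA]
    exact mem_union_left _ (hn.subA (hW p hp).2)
  have hM1 : (M.identify .index p.1 i).Good :=
    hMg.identify (mem_inter.1 (hXc _ hiX)).1 fun _ => (mem_inter.1 (hXc _ hiX)).2
  have hu1 := used_identify hMg (m := i) hp1
  have hu2 := used_identify hM1 (s := .elem) (o := p.2) (m := d) hp2
  have e1 := hMg.identify_eq (m := i) hp1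
  have e2 := hM1.identify_eq (s := .elem) (o := p.2) (m := d) hp2
  set N := (M.identify .index p.1 i).identify .elem p.2 d with hN
  set f : Form → Form := fun φ => (φ.rename .index p.1 i).rename .elem p.2 d with hf
  have hNA : N.A = (A2 ∪ D).image f := by
    rw [e2, e1, hMA, image_image]
    rfl
  have hNB : N.B = (n.B ∪ D).image f := by
    rw [e2, e1]
    change (M.B.image _).image _ = _
    rw [hMB, image_image]
    rfl
  have hNo : N.ord = ord' := hMo
  have hNc : N.common = M.common := rfl
  have hNu : ∀ s k, (s, k) ∈ N.used → (s, k) ∈ n.used ∨ (s, k) ∈ X := by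
    intro s k hk
    rcases mem_insert.1 (hu2 hk) with h | h
    · exact .inr (h ▸ hdX)
    rcases mem_insert.1 (hu1 (mem_of_mem_erase h)) with h | h
    · exact .inr (h ▸ hiX)
    · exact mem_union.1 (hMu (mem_of_mem_erase h))
  have hsi : Srt.index ≠ .array := by decide
  have hse : Srt.elem ≠ .array := by decide
  have hredf : ∀ {U : Finset Form} {a : ℕ}, Red ord' U a → Red ord' (U.image f) a := by
    intro U a h
    have := (h.rename hsi p.1 i).rename hse p.2 d
    rwa [image_image] at this
  have hredA : ∀ a, Red n.ord n.A a → Red ord' N.A a := by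
    rintro a ⟨L', hL', r, hr'⟩
    rw [hNA]
    refine hredf ?_
    by_cases h : L' = L
    · subst h
      obtain ⟨rfl, -⟩ := eq_of_litRule_arr hn.nodup hr hr'
      exact red_of_mem (mem_union_left _ (mem_insert_of_mem
        (mem_insert_self _ _))) hD.prec
    · exact ⟨L', mem_union_left _ (mem_insert_of_mem (mem_insert_of_mem
        (mem_erase.2 ⟨h, hL'⟩))), r, hr'.mono hord⟩
  have hredB : ∀ a, Red n.ord n.B a → Red ord' N.B a := fun a h => by
    rw [hNB]
    exact hredf (h.mono hord fun L hL _ => mem_union_left _ hL)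
  have hNar : ∀ a, (.array, a) ∈ N.used → ¬ (Red ord' N.A a ∧ Red ord' N.B a) →
      (.array, a) ∈ n.used := by
    refine fun a ha h => (hNu _ _ ha).resolve_right fun h' => h ⟨?_, ?_⟩
    · rw [hNA]
      exact hredf ((hD.red a h').mono (List.Sublist.refl _) fun L hL _ =>
        mem_union_right _ hL)
    · rw [hNB]
      exact hredf ((hD.red a h').mono (List.Sublist.refl _) fun L hL _ =>
        mem_union_right _ hL)
  have hUflat : ∀ φ ∈ n.A ∪ n.B, Flat φ := fun φ hφ =>
    (mem_union.1 hφ).elim (hn.flat hph φ) (hn.swap.flat hph φ)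
  set κ : Form := .eq (arr c) (wrs (arr c2) W2) with hκ
  have hUN : ∀ φ ∈ N.A ∪ N.B, φ ∈ ((n.A ∪ n.B).erase L).image f ∨
      ∃ ψ, (ψ = .neg (.eq (el d) (el d2)) ∨ ψ = κ ∨ ψ ∈ D) ∧ φ = f ψ := by
    intro φ hφ
    rw [hNA, hNB, ← image_union] at hφ
    obtain ⟨ψ, hψ, rfl⟩ := mem_image.1 hφ
    have hB : ψ ∈ n.B → f ψ ∈ ((n.A ∪ n.B).erase L).image f := fun h =>
      mem_image_of_mem f (mem_erase.2 ⟨fun h' => hLB (h' ▸ h),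
        mem_union_right _ h⟩)
    have hA : ψ ∈ n.A.erase L → f ψ ∈ ((n.A ∪ n.B).erase L).image f := fun h =>
      mem_image_of_mem f (erase_subset_erase _ subset_union_left h)
    simp only [hA2, mem_union, mem_insert] at hψ
    rcases hψ with ((rfl | rfl | h) | h) | (h | h)
    · exact .inr ⟨_, .inl rfl, rfl⟩
    · exact .inr ⟨_, .inr (.inl rfl), rfl⟩
    · exact .inl (hA h)
    · exact .inr ⟨_, .inr (.inr h), rfl⟩
    · exact .inl (hB h)
    · exact .inr ⟨_, .inr (.inr h), rfl⟩
  have hfun : ∀ {φ : Form} {o : List Const}, Flat φ → o.Sublist ord' →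
      Unoriented ord' (f φ) → Unoriented o φ := fun hφ ho h =>
    hφ.not_unoriented_rename hsi p.1 i ho ((hφ.rename .index p.1 i).not_unoriented_rename hse p.2 d
      (List.Sublist.refl _) h)
  have hmI : (.index, i) ∈ M.common := hXc _ hiX
  have hmD : (.elem, d) ∈ M.common := hXc _ hdX
  have hfbad : ∀ {φ : Form} {C : Finset Const}, Flat φ → C ⊆ M.common →
      (∀ a, (.array, a) ∈ φ.consts → (.array, a) ∈ M.common → (.array, a) ∈ C) →
      (f φ).badW M.common ≤ φ.badW C := fun hφ hC h =>
    ((hφ.rename .index p.1 i).badW_rename_le hse subset_rfl hmD fun _ _ h => h).trans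
      (hφ.badW_rename_le hsi hC hmI h)
  have hκW : f κ = .eq (arr c) (wrs (arr c2)
      ((W2.map (renW .index p.1 i)).map (renW .elem p.2 d))) := by
    simp only [hf, hκ, rename_arrEq hsi, rename_arrEq hse]
  have hκlt : (f κ).badW M.common < L.badW n.common := by
    refine lt_of_lt_of_le ?_ hbad
    rw [hκW, Form.badW]
    split_ifs
    · rw [badW_wrs]
      refine (List.countP_lt_length_iff.2 ⟨_, List.mem_map_of_mem (List.mem_map_of_mem hp), ?_⟩).trans_eq
        (by simp)
      simpa using ⟨hmI, hmD⟩
    · exact List.length_pos_of_mem hp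
  refine .inr ⟨cardSort_le_of_replace (new := i) (old := p.1) (fun k hk => ?_) (hAu (hW p hp).1),
    .inr ⟨strict_le (fun k hk => (hNu _ _ hk).imp_right (hXc _))
      fun _ h => hCM (mem_union_left _ h),
    .inr ⟨strict_le (fun k hk => (hNu _ _ hk).imp_right (hXc _))
      fun _ h => hCM (mem_union_left _ h),
    .inr ⟨Nat.add_le_add (irr_le fun a ha hr => ?_) (irr_le fun a ha hr => ?_),
    .inr ⟨?_, .inl ?_⟩⟩⟩⟩⟩
  · rcases mem_insert.1 (hu2 hk) with h | h
    · cases h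
    rcases mem_insert.1 (hu1 (mem_of_mem_erase h)) with h | h
    · exact .inl (by simpa using h)
    · obtain ⟨h1, h2⟩ := mem_erase.1 h
      rcases mem_union.1 (hMu h2) with h | h
      · exact .inr ⟨h, fun h => h1 (h ▸ rfl)⟩
      · exact .inl (hD.index k h)
  · rw [hNo] at hr
    obtain ⟨h1, h2⟩ := mem_inter.1 ha
    have h3 := hNar a h1 fun h => hr h.1
    have h4 : (.array, a) ∈ n.sigA ∪ X := hMsA ▸ h2
    exact ⟨mem_inter.2 ⟨h3, (mem_union.1 h4).resolve_right (hfr _ h3)⟩,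
      fun h => hr (hredA a h)⟩
  · rw [hNo] at hr
    obtain ⟨h1, h2⟩ := mem_inter.1 ha
    have h3 := hNar a h1 fun h => hr h.2
    have h4 : (.array, a) ∈ n.sigB ∪ X := hMsB ▸ h2
    exact ⟨mem_inter.2 ⟨h3, (mem_union.1 h4).resolve_right (hfr _ h3)⟩,
      fun h => hr (hredB a h)⟩
  · rw [hNo]
    refine (sum_le_of_forall_mem_image f (U := (n.A ∪ n.B).erase L) (fun φ hφ => ?_)
      fun φ hφ => ind_le (hfun (hUflat φ (mem_of_mem_erase hφ)) hord)).trans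
      (sum_le_sum_of_subset (erase_subset _ _))
    refine (hUN φ hφ).imp_right ?_
    rintro ⟨ψ, hψ, rfl⟩
    refine ind_eq_zero.2 fun h => ?_
    rcases hψ with rfl | rfl | hψ
    · obtain ⟨_, _, _, h, -⟩ := h
      cases h
    · rw [hκW] at h
      obtain ⟨a, b, U, h, -, hp'⟩ := h
      simp only [Form.eq.injEq, heq_eq_eq, true_and, Term.const.injEq, wrs_inj] at h
      obtain ⟨rfl, rfl, -⟩ := h
      exact hp' hD.prec
    · exact hD.oriented ψ hψ (hfun (hD.flat ψ hψ).1 (List.Sublist.refl _) h)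
  · have h1 : ∑ φ ∈ (N.A ∪ N.B).erase (f κ), φ.badW M.common ≤
        ∑ φ ∈ (n.A ∪ n.B).erase L, φ.badW n.common := by
      refine sum_le_of_forall_mem_image f (fun φ hφ => ?_) fun φ hφ => ?_
      · obtain ⟨h1, h2⟩ := mem_erase.1 hφ
        refine (hUN φ h2).imp_right ?_
        rintro ⟨ψ, rfl | rfl | hψ, rfl⟩
        · simp only [hf, rename_const_ne]
          rfl
        · exact absurd rfl h1
        · refine Nat.eq_zero_of_le_zero ((hfbad (hD.flat ψ hψ).1 hCM ?_).trans
            (hD.bad ψ hψ).le)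
          intro a ha ha'
          rcases mem_union.1 (hD.consts (subset_constsOf hψ ha)) with h | h
          · exact mem_union_left _ (hMcn _ (hAu h) ha')
          · exact mem_union_right _ h
      · have hφ := mem_of_mem_erase hφ
        exact hfbad (hUflat φ hφ) (union_subset_left hCM) fun a ha =>
          hMcn _ (subset_constsOf hφ ha)
    have h2 : ∑ φ ∈ N.A ∪ N.B, φ.badW M.common ≤
        ∑ φ ∈ (N.A ∪ N.B).erase (f κ), φ.badW M.common + (f κ).badW M.common := by
      by_cases h : f κ ∈ N.A ∪ N.B
      · rw [sum_erase_add _ _ h]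
      · rw [erase_eq_of_notMem h]
        exact Nat.le_add_right _ _
    have h3 := sum_erase_add (n.A ∪ n.B) (Form.badW n.common)
      (mem_union_left _ hL)
    rw [hNc]
    omega

end Node

open Node

theorem UndesiredA.measure_lt (hn : n.Good) (hph : n.phase = .completion) (h : UndesiredA n cs) :
    ∀ c ∈ cs, c.phase = n.phase ∧ LexLt c.measure n.measure := by
  cases h with
  | shareRead c i d m ord' hL hc hi hd hext =>
    intro x hx
    obtain rfl := List.mem_singleton.1 hx
    refine ⟨rfl, hn.measure_share_elem hph hL (by simp [Form.consts, Term.consts]) hd ?_ hext⟩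
    rintro ⟨_, _, h⟩
    cases h
  | shareArray L a c m W ord' hL hr hW ha hext hm =>
    intro x hx
    obtain rfl := List.mem_singleton.1 hx
    have hLa := hr.consts_subset.1 (mem_consts_arr a)
    obtain ⟨-, -, -, hou, hou', huc, hcom⟩ := hn.share_facts hL hLa ha hext
    exact ⟨rfl, .inr ⟨hn.share_cardSort_le hL hLa ha hext _, .inr ⟨strict_le (fun k hk => huc _ hk)
      fun k hk => hcom hk, .inl (strict_lt (fun k hk => huc _ hk) (fun k hk => hcom hk) a hou ha
        hou')⟩⟩⟩
  | shareDiff a b k m ord' hL ha hb hk hext =>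
    intro x hx
    obtain rfl := List.mem_singleton.1 hx
    have hLa : (Srt.index, k) ∈ (Form.eq (.diff (arr a) (arr b)) (idx k)).consts := by
      simp [Form.consts, Term.consts]
    obtain ⟨-, -, -, hou, hou', huc, hcom⟩ := hn.share_facts hL hLa hk hext
    exact ⟨rfl, .inr ⟨hn.share_cardSort_le hL hLa hk hext _,
      .inl (strict_lt (fun k hk => huc _ hk) (fun k hk => hcom hk) k hou hk hou')⟩⟩
  | split L c c' c2 i d d2 V W W1 W2 ord' X D M hL hr hc hrhs hW hW1 hW2 hdd hc2 hext hM =>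
    obtain ⟨hWA, -, -⟩ := split_facts hn hL hr hW
      (fun p => (.index, p.1) ∈ n.common ∧ (.elem, p.2) ∈ n.common) hW1 hW2
    have hc' : (.array, c') ∈ n.common := hn.prec_common (litRule_prec hr) hc
    have hc'A := subset_constsOf hL (hr.consts_subset.2.1
      (mem_consts_wrs.2 (.inl (mem_consts_arr c'))))
    have hcA := subset_constsOf hL (hr.consts_subset.1 (mem_consts_arr c))
    have hW₁c : (wrs (arr c') W1).consts ⊆ n.common := by
      refine consts_wrs_subset.2 ⟨by simpa [Term.consts] using hc', fun p hp => ?_⟩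
      rw [hW1, List.mem_filter, decide_eq_true_eq] at hp
      exact hp.2
    have hLB : L ∉ n.B := fun h =>
      hrhs (hr.consts_subset.2.1.trans (hn.mem_common hL h))
    have hLbad : L.badW n.common = (wrs (arr c') V).badW n.common := by
      obtain ⟨b, U, h1, hp, rfl | ⟨rfl, rfl⟩⟩ := litRule_arr.1 hr
      · rw [Form.badW, if_pos (by simpa [Term.consts] using hc)]
      · obtain ⟨rfl, rfl⟩ := wrs_inj.1 h1
        exact absurd (by simpa [wrs, Term.consts] using hc') hrhs
    have hlen : W2.length ≤ L.badW n.common := by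
      rw [hLbad]
      refine le_trans ?_ (hW.badW_le _)
      rw [badW_wrs, List.countP_eq_length_filter, hW2]
    have hpos : 0 < L.badW n.common := by
      rw [hLbad, badW_wrs, List.countP_pos_iff]
      by_contra! h
      refine hrhs (consts_wrs_subset.2 ⟨by simpa [Term.consts] using hc', fun p hp => ?_⟩)
      simpa using h p hp
    have hD : SplitDefs ord' (constsOf n.A) n.common c c2 i d X D :=
      splitDefs hcA (consts_wrs_subset.2 ⟨by simpa [Term.consts] using hc'A,
        fun p hp => hWA p (List.mem_append_left _ hp)⟩) hW₁c ((litRule_prec hr).mono hext.2.1) hc2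
    have hd2 : (.elem, d2) ∈ X := by
      rcases hc2 with ⟨rfl, -⟩ | ⟨-, -, rfl, -⟩ <;> simp
    intro x hx
    rcases List.mem_cons.1 hx with rfl | hx
    · exact ⟨rfl, measure_split_common hn hL hLB hr hpos hW₁c hWA⟩
    · obtain ⟨p, hp, rfl⟩ := List.mem_map.1 hx
      refine ⟨by rw [hM]; rfl, measure_split_identify hn hph hL hLB hr hlen
        (fun p hp => hWA p (List.mem_append_right _ hp)) hext hD hd2 hM hp⟩

theorem Sym.measure_lt {P : Node → List Node → Prop} {μ : Node → List ℕ}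
    (hμ : ∀ m : Node, μ m.swap = μ m) (h : Sym P n cs)
    (hP : ∀ {m ds}, m = n ∨ m = n.swap → P m ds →
      ∀ c ∈ ds, c.Closed ∨ c.phase = m.phase ∧ LexLt (μ c) (μ m)) :
    ∀ c ∈ cs, c.Closed ∨ c.phase = n.phase ∧ LexLt (μ c) (μ n) := by
  rcases h with h | ⟨ds, h, rfl⟩
  · exact hP (.inl rfl) h
  · intro c hc
    obtain ⟨d, hd, rfl⟩ := List.mem_map.1 hc
    rw [hμ, ← hμ n]
    exact (hP (.inr rfl) h d hd).imp_left Node.Closed.swap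

theorem InvA.measure_lt (hn : n.Good) (h : InvA n cs) :
    ∀ c ∈ cs, c.Closed ∨ c.phase = n.phase ∧ LexLt c.measure n.measure := by
  rcases h with h | h
  · exact h.measure_lt hn
  · exact h.measure_lt hn

theorem CompletionStep.measure_lt (hn : n.Good) (hph : n.phase = .completion)
    (h : CompletionStep n cs) :
    ∀ c ∈ cs, c.Closed ∨ c.phase = n.phase ∧ LexLt c.measure n.measure := by
  have hg : ∀ {m : Node}, m = n ∨ m = n.swap → m.Good ∧ m.phase = .completion := by
    rintro m (rfl | rfl)
    · exact ⟨hn, hph⟩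
    · exact ⟨hn.swap, hph⟩
  rcases h with h | ⟨hI, h | ⟨hS, h⟩⟩
  · exact h.measure_lt measure_swap fun hm h => h.measure_lt (hg hm).1
  · refine h.measure_lt measure_swap fun hm h c hc => .inr ?_
    rcases h with h | h
    · refine h.measure_lt ?_ c hc
      rcases hm with rfl | rfl
      · exact hn.inv hI
      · exact hn.swap.inv hI.swap
    · exact h.measure_lt (hg hm).1 (hg hm).2 c hc
  · refine h.measure_lt measure_swap fun hm h' => ?_
    rcases hm with rfl | rfl
    · exact h'.measure_lt hn hph (hn.inv hI) (hn.swap.inv hI.swap) (hn.shared hS)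
    · refine h'.measure_lt hn.swap hph (hn.swap.inv hI.swap) ?_ (hn.swap.shared hS.swap)
      exact hn.inv hI

theorem Node.Closed.acc (h : n.Closed) : Acc Child n :=
  ⟨_, fun _ ⟨_, h', _⟩ => absurd h h'.1⟩

theorem acc_completion (hn : n.Good) (hph : n.phase = .completion) :
    Acc Child n := by
  refine acc_of_lexLt Node.measure 14 (fun _ => rfl) (fun n => n.Good ∧ n.phase = .completion)
    ?_ n ⟨hn, hph⟩
  rintro c n ⟨hn, hph⟩ ⟨cs, hs, hc⟩
  have hg := (hn.step hs).2 c hc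
  obtain ⟨-, h⟩ := hs
  rw [hph] at h
  rcases h.measure_lt hn hph c hc with h | ⟨h1, h2⟩
  · exact .inl h.acc
  · rcases hg with h | hg
    · exact .inl h.acc
    · exact .inr ⟨⟨hg, h1.trans hph⟩, h2⟩

/-- A pre-processing phase terminates if the next one does. -/
theorem acc_phase {P : Node → List Node → Prop} {ph next : Phase} (μ : Node → List ℕ) (k : ℕ)
    (hk : ∀ n, (μ n).length = k) (hμ : ∀ n : Node, μ n.swap = μ n)
    (hstep : ∀ {n : Node} {cs : List Node}, n.phase = ph → Step n cs → PhaseStep P next n cs)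
    (hP : ∀ {n : Node} {cs : List Node}, n.Good → n.phase = ph → P n cs → ∀ c ∈ cs,
      c.Closed ∨ c.phase = n.phase ∧ LexLt (μ c) (μ n))
    (hnext : ∀ {n : Node}, n.Good → n.phase = next → Acc Child n) (hn : n.Good)
    (hph : n.phase = ph) : Acc Child n := by
  refine acc_of_lexLt μ k hk (fun n => n.Good ∧ n.phase = ph) ?_ n ⟨hn, hph⟩
  rintro c n ⟨hn, hph⟩ ⟨cs, hs, hc⟩
  rcases (hn.step hs).2 c hc with h | hg
  · exact .inl h.acc
  rcases hstep hph hs with h | ⟨-, rfl⟩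
  · have := h.measure_lt hμ (n := n) (fun {m ds} hm h' => by
      rcases hm with rfl | rfl
      · exact hP hn hph h'
      · exact hP hn.swap hph h') c hc
    rcases this with h | ⟨h1, h2⟩
    · exact .inl h.acc
    · exact .inr ⟨⟨hg, h1.trans hph⟩, h2⟩
  · obtain rfl := List.mem_singleton.1 hc
    exact .inl (hnext hg rfl)

/-- The pairs of an array and an index without a read literal. -/
def MissingRead (A : Finset Form) (p : Const × Const) : Prop :=
  p.1.1 = .array ∧ p.2.1 = .index ∧
    ∀ e, Form.eq (.rd (arr p.1.2) (idx p.2.2)) (el e) ∉ A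

open Classical in
/-- The number of missing read literals. -/
noncomputable def readDefect (A : Finset Form) (S : Finset Const) : ℕ :=
  ((S ×ˢ S).filter (MissingRead A)).card

theorem readDefect_le (hA : A ⊆ A') (hS : ∀ s n, s ≠ .elem → (s, n) ∈ S' → (s, n) ∈ S) :
    readDefect A' S' ≤ readDefect A S ∧ ∀ a i e, (.array, a) ∈ S → (.index, i) ∈ S →
      (∀ e, Form.eq (.rd (arr a) (idx i)) (el e) ∉ A) →
      Form.eq (.rd (arr a) (idx i)) (el e) ∈ A' → readDefect A' S' < readDefect A S := by
  classical
  have h : (S' ×ˢ S').filter (MissingRead A') ⊆ (S ×ˢ S).filter (MissingRead A) := by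
    rintro ⟨⟨s, a⟩, ⟨s', i⟩⟩ h
    obtain ⟨h, rfl, rfl, h'⟩ := mem_filter.1 h
    obtain ⟨h1, h2⟩ := mem_product.1 h
    exact mem_filter.2 ⟨mem_product.2 ⟨hS _ _ nofun h1, hS _ _ nofun h2⟩, rfl, rfl,
      fun e he => h' e (hA he)⟩
  refine ⟨by unfold readDefect; convert card_le_card h, fun a i e ha hi hm he => ?_⟩
  have : ((S' ×ˢ S').filter (MissingRead A')).card < ((S ×ˢ S).filter (MissingRead A)).card :=
    card_lt_card ⟨h, fun h => (mem_filter.1 (@h ((.array, a), (.index, i))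
      (mem_filter.2 ⟨mem_product.2 ⟨ha, hi⟩, rfl, rfl, hm⟩))).2.2.2 e he⟩
  unfold readDefect
  convert this

theorem ReadA.measure_lt (hn : n.Good) (h : ReadA n cs) :
    ∀ c ∈ cs, c.phase = n.phase ∧
      readDefect c.A (c.used ∩ c.sigA) + readDefect c.B (c.used ∩ c.sigB) <
      readDefect n.A (n.used ∩ n.sigA) + readDefect n.B (n.used ∩ n.sigB) := by
  cases h with
  | mk sh a i e ord' ha hi hmiss hext =>
    intro c hc
    obtain rfl := List.mem_singleton.1 hc
    refine ⟨rfl, ?_⟩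
    have hX := hext.1
    have hu : n.localA ⊆ n.used := hn.used_inter_sigA ▸ inter_subset_left
    have hX' : ∀ k ∈ n.used, k ∉ ({(.elem, e)} : Finset Const) := fun k hk hk' =>
      disjoint_left.1 hX hk' (hn.used_subset hk)
    have hus : ∀ s k, s ≠ .elem → (s, k) ∈ (n.extend sh {(.elem, e)} ord' n.A
        {.eq (.rd (arr a) (idx i)) (el e)}).used → (s, k) ∈ n.used := by
      intro s k hs hk
      have := used_extend hk
      simp only [constsOf_singleton, Form.consts, Term.consts, mem_union,
        mem_singleton] at this
      rcases this with (h | h) | (h | h) | h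
      · exact constsOf_mono subset_union_left h
      · exact constsOf_mono subset_union_right h
      · exact h ▸ hu ha
      · exact h ▸ hu hi
      · exact absurd (Prod.ext_iff.1 h).1 hs
    rw [← hn.used_inter_sigA] at ha hi
    have hA : (n.extend sh {(.elem, e)} ord' n.A {.eq (.rd (arr a) (idx i)) (el e)}).A =
      n.A ∪ {.eq (.rd (arr a) (idx i)) (el e)} := rfl
    have hB : n.B ⊆ (n.extend sh {(.elem, e)} ord' n.A {.eq (.rd (arr a) (idx i)) (el e)}).B := by
      cases sh
      · exact subset_rfl
      · exact subset_union_left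
    have hsA : (n.extend sh {(.elem, e)} ord' n.A {.eq (.rd (arr a) (idx i)) (el e)}).sigA ⊆
      n.sigA ∪ {(.elem, e)} := subset_rfl
    have hsB : (n.extend sh {(.elem, e)} ord' n.A {.eq (.rd (arr a) (idx i)) (el e)}).sigB ⊆
        n.sigB ∪ {(.elem, e)} := by
      cases sh
      · exact subset_union_left
      · exact subset_rfl
    generalize n.extend sh {(.elem, e)} ord' n.A {.eq (.rd (arr a) (idx i)) (el e)} = c at *
    have h1 := readDefect_le (S := n.used ∩ n.sigA) (S' := c.used ∩ c.sigA)
      (A := n.A) (A' := c.A) (hA ▸ subset_union_left) (fun s k hs hk => by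
        obtain ⟨h1, h2⟩ := mem_inter.1 hk
        have h3 := hus s k hs h1
        exact mem_inter.2 ⟨h3, (mem_union.1 (hsA h2)).resolve_right (hX' _ h3)⟩)
    have h2 := readDefect_le (S := n.used ∩ n.sigB) (S' := c.used ∩ c.sigB) hB
      (fun s k hs hk => by
        obtain ⟨h1, h2⟩ := mem_inter.1 hk
        have h3 := hus s k hs h1
        exact mem_inter.2 ⟨h3, (mem_union.1 (hsB h2)).resolve_right (hX' _ h3)⟩)
    exact Nat.add_lt_add_of_lt_of_le (h1.2 a i e ha hi hmiss
      (hA ▸ mem_union_right _ (mem_singleton_self _))) h2.1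

/-- An inequality between array constants. -/
def IsArrNe (φ : Form) : Prop := ∃ a b, φ = .neg (.eq (arr a) (arr b))

theorem sum_union_le_of_eq_zero (g : Form → ℕ) {A D : Finset Form} (hD : ∀ φ ∈ D, g φ = 0) :
    ∑ φ ∈ A ∪ D, g φ ≤ ∑ φ ∈ A, g φ := by
  have h := sum_union_inter (s₁ := A) (s₂ := D) (f := g)
  rw [sum_eq_zero hD] at h
  omega

theorem sum_extend_lt (g : Form → ℕ) {sh : Bool} {L L' : Form} (hL : L ∈ n.A) (hlt : g L' < g L)
    (hD : ∀ φ ∈ D, g φ = 0) :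
    ∑ φ ∈ (n.extend sh X ord' (insert L' (n.A.erase L)) D).A, g φ +
      ∑ φ ∈ (n.extend sh X ord' (insert L' (n.A.erase L)) D).B, g φ <
      ∑ φ ∈ n.A, g φ + ∑ φ ∈ n.B, g φ := by
  refine Nat.add_lt_add_of_lt_of_le ?_ ?_
  · refine (sum_union_le_of_eq_zero g hD).trans_lt ?_
    have h1 := sum_erase_add n.A g hL
    have h2 : ∑ φ ∈ insert L' (n.A.erase L), g φ ≤ g L' + ∑ φ ∈ n.A.erase L, g φ := by
      by_cases h : L' ∈ n.A.erase L
      · rw [insert_eq_of_mem h]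
        exact Nat.le_add_left _ _
      · rw [sum_insert h]
    omega
  · cases sh
    · exact le_rfl
    · exact sum_union_le_of_eq_zero g hD

theorem ArrayNeA.measure_lt (h : ArrayNeA n cs) :
    ∀ c ∈ cs, c.phase = n.phase ∧ ∑ φ ∈ c.A, ind IsArrNe φ + ∑ φ ∈ c.B, ind IsArrNe φ <
      ∑ φ ∈ n.A, ind IsArrNe φ + ∑ φ ∈ n.B, ind IsArrNe φ := by
  cases h with
  | mk sh a b i e d ord' hL hed hext =>
    intro c hc
    obtain rfl := List.mem_singleton.1 hc
    refine ⟨rfl, sum_extend_lt _ hL ?_ fun φ hφ => ind_eq_zero.2 ?_⟩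
    · rw [ind_of (P := IsArrNe) (φ := .neg (.eq (arr a) (arr b))) ⟨a, b, rfl⟩, ind_eq_zero.2]
      · exact Nat.one_pos
      · rintro ⟨_, _, h⟩
        cases h
    · rintro ⟨_, _, rfl⟩
      simp at hφ

/-- The number of function symbols. -/
def Term.size : {s : Srt} → Term s → ℕ
  | _, .const _ _ => 0
  | _, .rd x i => x.size + i.size + 1
  | _, .wr x i e => x.size + i.size + e.size + 1
  | _, .diff x y => x.size + y.size + 1

def Form.size : Form → ℕ
  | .eq t u => t.size + u.size
  | .neg φ => φ.size
  | .bot => 0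
  | .top => 0
  | .and φ ψ => φ.size + ψ.size
  | .or φ ψ => φ.size + ψ.size
  | .imp φ ψ => φ.size + ψ.size

theorem Term.size_subst (s : Srt) (n : ℕ) (u : Term s) : ∀ {s' : Srt} (t : Term s'),
    t.size ≤ (Term.subst s n u t).size ∧
      ((s, n) ∈ t.consts → t.size + u.size ≤ (Term.subst s n u t).size)
  | _, .const s' m => by
    refine ⟨Nat.zero_le _, fun h => ?_⟩
    simp only [Term.consts, mem_singleton, Prod.mk.injEq] at h
    obtain ⟨rfl, rfl⟩ := h
    simp [Term.subst, Term.size]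
  | _, .rd x i => by
    have h1 := Term.size_subst s n u x
    have h2 := Term.size_subst s n u i
    simp only [Term.size, Term.subst, Term.consts, mem_union]
    refine ⟨by omega, ?_⟩
    rintro (h | h)
    · have := h1.2 h; omega
    · have := h2.2 h; omega
  | _, .wr x i e => by
    have h1 := Term.size_subst s n u x
    have h2 := Term.size_subst s n u i
    have h3 := Term.size_subst s n u e
    simp only [Term.size, Term.subst, Term.consts, mem_union]
    refine ⟨by omega, ?_⟩
    rintro ((h | h) | h)
    · have := h1.2 h; omega
    · have := h2.2 h; omega
    · have := h3.2 h; omega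
  | _, .diff x y => by
    have h1 := Term.size_subst s n u x
    have h2 := Term.size_subst s n u y
    simp only [Term.size, Term.subst, Term.consts, mem_union]
    refine ⟨by omega, ?_⟩
    rintro (h | h)
    · have := h1.2 h; omega
    · have := h2.2 h; omega

theorem Form.size_subst (s : Srt) (n : ℕ) (u : Term s) (φ : Form) :
    φ.size ≤ (φ.subst s n u).size ∧
      ((s, n) ∈ φ.consts → φ.size + u.size ≤ (φ.subst s n u).size) := by
  induction φ with
  | eq t v =>
    have h1 := Term.size_subst s n u t
    have h2 := Term.size_subst s n u v
    simp only [Form.size, Form.subst, Form.consts, mem_union]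
    refine ⟨by omega, ?_⟩
    rintro (h | h)
    · have := h1.2 h; omega
    · have := h2.2 h; omega
  | bot | top => simp [Form.size, Form.subst, Form.consts]
  | neg φ ih => exact ih
  | and φ ψ h1 h2 | or φ ψ h1 h2 | imp φ ψ h1 h2 =>
    simp only [Form.size, Form.subst, Form.consts, mem_union]
    refine ⟨by omega, ?_⟩
    rintro (h | h)
    · have := h1.2 h; omega
    · have := h2.2 h; omega

theorem DefLit.size_pos {α : ℕ} {D : Form} (h : DefLit s α t D) :
    0 < t.size := by
  cases h with
  | wr _ b W hW =>
    obtain ⟨V, p, rfl⟩ : ∃ V p, W = V ++ [p] := ⟨_, _, (List.dropLast_append_getLast hW).symm⟩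
    rw [wrs_snoc]
    exact Nat.succ_pos _
  | rd | diff => exact Nat.succ_pos _

open Classical in
/-- The size of a formula that is not flat. -/
noncomputable def flatDefect (φ : Form) : ℕ := if Flat φ then 0 else φ.size

theorem FlattenA.measure_lt (h : FlattenA n cs) :
    ∀ c ∈ cs, c.phase = n.phase ∧ ∑ φ ∈ c.A, flatDefect φ + ∑ φ ∈ c.B, flatDefect φ <
      ∑ φ ∈ n.A, flatDefect φ + ∑ φ ∈ n.B, flatDefect φ := by
  cases h with
  | mk sh L L' s α t D ord' hL hflat hD hL' hocc hext =>
    intro c hc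
    obtain rfl := List.mem_singleton.1 hc
    refine ⟨rfl, sum_extend_lt _ hL ?_ fun φ hφ => ?_⟩
    · have h1 := (Form.size_subst s α t L').2 hocc
      have h2 := hD.size_pos
      rw [hL'] at h1
      unfold flatDefect
      rw [if_neg hflat]
      split_ifs <;> omega
    · obtain rfl := mem_singleton.1 hφ
      exact if_pos hD.spec.2.2.1

/-- There is no infinite branch above a well-formed node. -/
theorem Node.Good.acc (hn : n.Good) : Acc Child n := by
  have hlt : ∀ {x y : ℕ}, x < y → LexLt [x] [y] := fun h => .inl h
  have h4 : ∀ {n : Node}, n.Good → n.phase = .reads → Acc Child n :=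
    acc_phase (P := ReadA) (fun n => [readDefect n.A (n.used ∩ n.sigA) +
      readDefect n.B (n.used ∩ n.sigB)]) 1 (fun _ => rfl)
      (fun n => by simp only [Node.used, Node.swap, union_comm n.B, add_comm])
      (fun hph h => by
        obtain ⟨-, h⟩ := h
        rwa [hph] at h)
      (fun hn _ h c hc => .inr ((h.measure_lt hn c hc).imp_right hlt)) acc_completion
  have h3 : ∀ {n : Node}, n.Good → n.phase = .guess → Acc Child n :=
    acc_phase (P := GuessA) Node.measure 14 (fun _ => rfl) measure_swap
      (fun hph h => by
        obtain ⟨-, h⟩ := h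
        rwa [hph] at h)
      (fun hn _ h => h.measure_lt hn) h4
  have h2 : ∀ {n : Node}, n.Good → n.phase = .arrayNe → Acc Child n :=
    acc_phase (P := ArrayNeA) (fun n => [∑ φ ∈ n.A, ind IsArrNe φ + ∑ φ ∈ n.B, ind IsArrNe φ]) 1
      (fun _ => rfl) (fun n => by simp only [Node.swap, add_comm])
      (fun hph h => by
        obtain ⟨-, h⟩ := h
        rwa [hph] at h)
      (fun hn _ h c hc => .inr ((h.measure_lt c hc).imp_right hlt)) h3
  have h1 : ∀ {n : Node}, n.Good → n.phase = .flatten → Acc Child n :=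
    acc_phase (P := FlattenA) (fun n => [∑ φ ∈ n.A, flatDefect φ + ∑ φ ∈ n.B, flatDefect φ]) 1
      (fun _ => rfl) (fun n => by simp only [Node.swap, add_comm])
      (fun hph h => by
        obtain ⟨-, h⟩ := h
        rwa [hph] at h)
      (fun hn _ h c hc => .inr ((h.measure_lt c hc).imp_right hlt)) h2
  cases hph : n.phase with
  | flatten => exact h1 hn hph
  | arrayNe => exact h2 hn hph
  | guess => exact h3 hn hph
  | reads => exact h4 hn hph
  | completion => exact acc_completion hn hph

/-! # Completion instructions on common literals -/

section Transfer

variable {ord : List Const} {A B : Finset Form} {C : Finset Const}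

/-- The rules of `A` and `B` with left-hand side over `C` agree. -/
structure SameRules (ord : List Const) (A B : Finset Form) (C : Finset Const) : Prop where
  closed : ∀ L ∈ A, ∀ {s : Srt} (l r : Term s), LitRule ord L l r → l.consts ⊆ C → r.consts ⊆ C
  left : ∀ L ∈ A, ∀ {s : Srt} (l r : Term s), LitRule ord L l r → l.consts ⊆ C → L ∈ B
  right : ∀ L ∈ B, ∀ {s : Srt} (l r : Term s), LitRule ord L l r → l.consts ⊆ C → L ∈ A
  copy : ∀ L ∈ A, L.consts ⊆ C → L ∈ B

theorem Rew.transfer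
    (hAB : ∀ L ∈ A, ∀ {s : Srt} (l r : Term s), LitRule ord L l r → l.consts ⊆ C → L ∈ B)
    (h : Rew ord A t u) (ht : t.consts ⊆ C) : Rew ord B t u := by
  induction h with
  | ground L hL hr => exact .ground L (hAB L hL _ _ hr ht) hr
  | readOther x i j e h => exact .readOther x i j e h
  | readSame x i e => exact .readSame x i e
  | sort x i j e d h => exact .sort x i j e d h
  | overwrite x i e d => exact .overwrite x i e d
  | rd₁ i _ ih => exact .rd₁ i (ih (union_subset_left ht))
  | rd₂ x _ ih => exact .rd₂ x (ih (union_subset_right ht))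
  | wr₁ i e _ ih =>
    exact .wr₁ i e (ih (union_subset_left (union_subset_left ht)))
  | wr₂ x e _ ih =>
    exact .wr₂ x e (ih (union_subset_right (union_subset_left ht)))
  | wr₃ x i _ ih => exact .wr₃ x i (ih (union_subset_right ht))
  | diff₁ y _ ih => exact .diff₁ y (ih (union_subset_left ht))
  | diff₂ x _ ih => exact .diff₂ x (ih (union_subset_right ht))

namespace SameRules

variable (H : SameRules ord A B C)
include H

theorem rews (h : Rews ord A t u) (ht : t.consts ⊆ C) :
    Rews ord B t u ∧ u.consts ⊆ C := by
  induction h with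
  | refl => exact ⟨.refl, ht⟩
  | tail _ h ih => exact ⟨ih.1.tail (h.transfer H.left ih.2), h.subset_of_closed H.closed ih.2⟩

theorem nf (h : NF ord A t u) (ht : t.consts ⊆ C) :
    NF ord B t u ∧ u.consts ⊆ C := by
  obtain ⟨h1, h2⟩ := H.rews h.1 ht
  exact ⟨⟨h1, fun v hv => h.2 v (hv.transfer H.right h2)⟩, h2⟩

theorem joinable (h : Joinable ord A t u) (ht : t.consts ⊆ C) (hu : u.consts ⊆ C) : Joinable ord B t u := by
  obtain ⟨v, h1, h2⟩ := h
  exact ⟨v, (H.rews h1 ht).1, (H.rews h2 hu).1⟩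

theorem compl {del add : Finset Form} (h : Compl ord A del add) (hdel : ∀ L ∈ del, L.consts ⊆ C) : Compl ord B del add := by
  have hrd : ∀ {x : Term .array} {i : ℕ}, x.consts ⊆ C → (.index, i) ∈ C →
      (Term.rd x (idx i)).consts ⊆ C := fun hx hi =>
    union_subset hx (singleton_subset_iff.2 hi)
  have hF : ∀ {P : ℕ × ℕ → ℕ → Prop} {Q : ℕ × ℕ → ℕ → Prop} {W : List (ℕ × ℕ)} {F : List ℕ},
      List.Forall₂ P W F → (∀ p ∈ W, ∀ f, P p f → Q p f) → List.Forall₂ Q W F := by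
    intro P Q W F h hPQ
    induction h with
    | nil => exact .nil
    | cons h _ ih =>
      exact .cons (hPQ _ List.mem_cons_self _ h) (ih fun p hp => hPQ p (List.mem_cons_of_mem _ hp))
  cases h with
  | orient a b V W F hL hab hV hW hF' =>
    have hL' := hdel _ (mem_singleton_self _)
    have hbV : (wrs (arr b) V).consts ⊆ C := union_subset_right hL'
    obtain ⟨h1, h2⟩ := consts_wrs_subset.1 (hW.empty_subset hbV)
    exact .orient a b V W F (H.copy _ hL hL') hab hV hW (hF hF' fun p hp f hf =>
      (H.rews hf (hrd h1 (h2 p hp).1)).1)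
  | orientSelf a V W hL hW =>
    exact .orientSelf a V W (H.copy _ hL (hdel _ (mem_singleton_self _))) hW
  | gaussSymmTrans L1 L2 a b1 b2 r1 r2 W1 W2 U F G hL1 hr1 hL2 hr2 hne hn1 hn2 hb hF' hU hG =>
    have h1 := hdel L1 (by simp)
    have h2 := hdel L2 (by simp)
    obtain ⟨e1, c1⟩ := H.nf hn1 (hr1.consts_subset.2.1.trans h1)
    obtain ⟨e2, c2⟩ := H.nf hn2 (hr2.consts_subset.2.1.trans h2)
    have c1' := consts_wrs_subset.1 c1
    exact .gaussSymmTrans L1 L2 a b1 b2 r1 r2 W1 W2 U F G (H.copy _ hL1 h1) hr1 (H.copy _ hL2 h2)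
      hr2 hne e1 e2 hb (hF hF' fun p hp f hf => (H.rews hf (hrd c1'.1 (c1'.2 p hp).1)).1) hU
      (hF hG fun p hp f hf => (H.nf hf (hrd c2 (c1'.2 p hp).1)).1)
  | gaussConfl L1 L2 a b r1 r2 W1 W2 hL1 hr1 hL2 hr2 hne hn1 hn2 =>
    have h1 := hdel L1 (by simp)
    have h2 := hdel L2 (by simp)
    exact .gaussConfl L1 L2 a b r1 r2 W1 W2 (H.copy _ hL1 h1) hr1 (H.copy _ hL2 h2) hr2 hne
      (H.nf hn1 (hr1.consts_subset.2.1.trans h1)).1 (H.nf hn2 (hr2.consts_subset.2.1.trans h2)).1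
  | critReadWrite L1 L2 a i e' d e r hL1 hr1 hL2 hr2 hd he =>
    have h1 := hdel L1 (mem_singleton_self _)
    have c1 := hr1.consts_subset.1.trans h1
    have ha : (arr a).consts ⊆ C := union_subset_left c1
    have hi : (.index, i) ∈ C := singleton_subset_iff.1 (union_subset_right c1)
    exact .critReadWrite L1 L2 a i e' d e r (H.copy _ hL1 h1) hr1 (H.left _ hL2 _ _ hr2 ha) hr2
      (H.nf hd (hrd (H.closed _ hL2 _ _ hr2 ha) hi)).1
      (H.nf he (hr1.consts_subset.2.1.trans h1)).1
  | critRead L1 L2 a i e' d' e d hL1 hr1 hL2 hr2 hne he hd =>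
    have h1 := hdel L1 (mem_singleton_self _)
    have c1 := hr1.consts_subset.1.trans h1
    exact .critRead L1 L2 a i e' d' e d (H.copy _ hL1 h1) hr1 (H.left _ hL2 _ _ hr2 c1) hr2 hne
      (H.nf he (hr1.consts_subset.2.1.trans h1)).1 (H.nf hd (H.closed _ hL2 _ _ hr2 c1)).1
  | critElem L1 L2 c e' d' e d hL1 hr1 hL2 hr2 hne he hd =>
    have h1 := hdel L1 (mem_singleton_self _)
    have c1 := hr1.consts_subset.1.trans h1
    exact .critElem L1 L2 c e' d' e d (H.copy _ hL1 h1) hr1 (H.left _ hL2 _ _ hr2 c1) hr2 hne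
      (H.nf he (hr1.consts_subset.2.1.trans h1)).1 (H.nf hd (H.closed _ hL2 _ _ hr2 c1)).1
  | reduceRhs L l r r' hL hr hn hne =>
    have h1 := hdel L (mem_singleton_self _)
    exact .reduceRhs L l r r' (H.copy _ hL h1) hr (H.nf hn (hr.consts_subset.2.1.trans h1)).1 hne
  | removeRefl t hL => exact .removeRefl t (H.copy _ hL (hdel _ (mem_singleton_self _)))
  | redundantWrite L a b V U U' p hL hr hn hj =>
    have h1 := hdel L (mem_singleton_self _)
    obtain ⟨c1, c2⟩ := consts_wrs_subset.1 (hn.empty_subset (hr.consts_subset.2.1.trans h1))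
    obtain ⟨c3, c4⟩ := c2 p (by simp)
    exact .redundantWrite L a b V U U' p (H.copy _ hL h1) hr hn
      (H.joinable hj (hrd c1 c3) (singleton_subset_iff.2 c4))
  | diffJoin a b i hL hj hab =>
    have h1 := hdel _ (mem_singleton_self _)
    have hi : (.index, i) ∈ C := singleton_subset_iff.1 (union_subset_right h1)
    exact .diffJoin a b i (H.copy _ hL h1) (H.joinable hj
      (hrd (union_subset_left (union_subset_left h1)) hi)
      (hrd (union_subset_right (union_subset_left h1)) hi)) hab
  | diffJoinSymm a b i hL hj hab =>
    have h1 := hdel _ (mem_singleton_self _)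
    have hi : (.index, i) ∈ C := singleton_subset_iff.1 (union_subset_right h1)
    exact .diffJoinSymm a b i (H.copy _ hL h1) (H.joinable hj
      (hrd (union_subset_left (union_subset_left h1)) hi)
      (hrd (union_subset_right (union_subset_left h1)) hi)) hab

end SameRules

end Transfer

theorem Shared.consts_subset (h : Shared n) (hn : n.Good) (hL : L ∈ n.A)
    (hr : LitRule n.ord L l r) (hl : l.consts ⊆ n.common) :
    L.consts ⊆ n.common :=
  hr.consts_subset.2.2.trans (union_subset hl (h.closed hn L hL l r hr hl))

theorem common_swap (n : Node) : n.swap.common = n.common := inter_comm _ _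

theorem Shared.sameRules (h : Shared n) (h' : Shared n.swap) (hn : n.Good) :
    SameRules n.ord n.A n.B n.common where
  closed := h.closed hn
  left L hL _ _ _ hr hl := h.copy L hL (h.consts_subset hn hL hr hl)
  right L hL _ l r hr hl := by
    rw [← common_swap] at hl
    exact h'.copy L hL (h'.consts_subset hn.swap hL hr hl)
  copy := h.copy

/-- No completion instruction that deletes only common literals, or only literals that are not
common, applies to the first component. -/
theorem Exhausted.not_compl (hn : n.Good) (h : Exhausted (Sym ComplA) n) (hS : Shared n)
    (hS' : Shared n.swap) {del add : Finset Form} (hc : Compl n.ord n.A del add)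
    (hdel : (∀ L ∈ del, L.consts ⊆ n.common) ∨ ∀ L ∈ del, ¬ L.consts ⊆ n.common) : False := by
  rcases hdel with hdel | hdel
  · exact h.left _ (.both del add hc ((hS.sameRules hS' hn).compl hc hdel) hdel)
  · exact h.left _ (.single del add hc hdel)

/-- Facts about one component of an exhausted pair. -/
structure Leaf (n : Node) : Prop where
  inv : Inv n.ord n.A n.localA
  shared : Shared n
  oriented : ∀ a b V, Form.eq (arr a) (wrs (arr b) V) ∈ n.A →
    ∃ x r, LitRule n.ord (.eq (arr a) (wrs (arr b) V)) (arr x) r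
  orientedEl : ∀ e d, Form.eq (el e) (el d) ∈ n.A →
    ∃ x y, LitRule n.ord (.eq (el e) (el d)) (el x) (el y)
  array : ∀ L1 ∈ n.A, ∀ L2 ∈ n.A, ∀ a r1 r2, LitRule n.ord L1 (arr a) r1 →
    LitRule n.ord L2 (arr a) r2 → r1 = r2
  readWrite : ∀ a i e, Form.eq (.rd (arr a) (idx i)) (el e) ∈ n.A → ¬ Red n.ord n.A a
  read : ∀ a i e d, Form.eq (.rd (arr a) (idx i)) (el e) ∈ n.A →
    Form.eq (.rd (arr a) (idx i)) (el d) ∈ n.A → e = d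
  elem : ∀ L1 ∈ n.A, ∀ L2 ∈ n.A, ∀ c e d, LitRule n.ord L1 (el c) (el e) →
    LitRule n.ord L2 (el c) (el d) → e = d
  irr : ∀ L ∈ n.A, ∀ {s : Srt} (l r : Term s), LitRule n.ord L l r → ∀ u, ¬ Rew n.ord n.A r u
  write : ∀ L ∈ n.A, ∀ a b V, LitRule n.ord L (arr a) (wrs (arr b) V) → ∀ p ∈ V,
    ¬ Joinable n.ord n.A (.rd (arr b) (idx p.1)) (el p.2)
  diffJoin : ∀ a b i, Form.eq (.diff (arr a) (arr b)) (idx i) ∈ n.A → a ≠ b →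
    ¬ Joinable n.ord n.A (.rd (arr a) (idx i)) (.rd (arr b) (idx i))
  failure : ¬ Failure n.ord n.A

theorem exists_forall₂ {P : ℕ × ℕ → ℕ → Prop} (h : ∀ p ∈ W, ∃ f, P p f) :
    ∃ F, List.Forall₂ P W F := by
  induction W with
  | nil => exact ⟨[], .nil⟩
  | cons p W ih =>
    obtain ⟨f, hf⟩ := h p List.mem_cons_self
    obtain ⟨F, hF⟩ := ih fun p hp => h p (List.mem_cons_of_mem _ hp)
    exact ⟨f :: F, .cons hf hF⟩

theorem Node.Good.leaf (hn : n.Good) (hI : Exhausted (Sym InvA) n)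
    (hS : Exhausted (Sym CopyOrUndesiredA) n) (h : Exhausted (Sym ComplA) n) : Leaf n := by
  have inv := hn.inv hI
  have shared := hn.shared hS
  have shared' := hn.swap.shared hS.swap
  have hnd := hn.nodup
  have hmo := hn.mem_ord_of_mem
  have hloc : constsOf n.A ⊆ n.localA := subset_union_left
  have hone : ∀ {L add}, Compl n.ord n.A {L} add → False := by
    intro L add hc
    refine h.not_compl hn shared shared' hc ?_
    simp only [mem_singleton, forall_eq]
    exact em _
  have hLc : ∀ {L : Form} {s : Srt} {l r : Term s}, L ∈ n.A → LitRule n.ord L l r →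
      l.consts ⊆ constsOf n.A ∧ r.consts ⊆ constsOf n.A := fun hL hr =>
    ⟨hr.consts_subset.1.trans (subset_constsOf hL),
      hr.consts_subset.2.1.trans (subset_constsOf hL)⟩
  have hrews : ∀ {b i}, (Srt.array, b) ∈ constsOf n.A → (Srt.index, i) ∈ constsOf n.A →
      ∃ e, Rews n.ord n.A (.rd (arr b) (idx i)) (el e) := fun hb hi =>
    reach_iff.1 (inv.reach _ _ (hloc hb) (hloc hi))
  have hnfrd : ∀ {b i W}, (Srt.array, b) ∈ constsOf n.A → (Srt.index, i) ∈ constsOf n.A →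
      ∃ e, NF n.ord n.A (.rd (wrs (arr b) W) (idx i)) (el e) := fun hb hi =>
    exists_NF_rd hnd (fun a ha => inv.reach _ _ (hloc ha) (hloc hi))
      (inv.reach _ _ (hloc hb) (hloc hi))
  have hnfel : ∀ e, ∃ d, NF n.ord n.A (el e) (el d) := by
    intro e
    obtain ⟨u, hu⟩ := exists_NF hnd n.A (el e)
    obtain ⟨d, rfl⟩ := hu.1.el_shape
    exact ⟨d, hu⟩
  have irr : ∀ L ∈ n.A, ∀ {s : Srt} (l r : Term s), LitRule n.ord L l r →
      ∀ u, ¬ Rew n.ord n.A r u := by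
    intro L hL s l r hr u hu
    obtain ⟨r', hr'⟩ := exists_NF hnd n.A r
    refine hone (.reduceRhs L l r r' hL hr hr' ?_)
    rintro rfl
    exact hr'.2 u hu
  refine ⟨inv, shared, ?_, ?_, ?_, ?_, ?_, ?_, irr, ?_, ?_, fun hf => h.left _ (.fail hf)⟩
  · intro a b V hL
    have hc := subset_constsOf hL
    simp only [Form.consts] at hc
    have ha := union_subset_left hc (mem_consts_arr a)
    have hb := union_subset_right hc (mem_consts_wrs.2 (.inl (mem_consts_arr b)))
    obtain ⟨W, hW⟩ := exists_NF_wrs hnd b V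
    by_cases hab : a = b
    · subst hab
      exact (hone (.orientSelf a V W hL hW)).elim
    rcases prec_total hnd (hmo _ ha) (hmo _ hb) hab with hp | hp
    · by_cases hV : V = []
      · subst hV
        exact ⟨b, arr a, .arrSymm b a hp⟩
      · have hWc := consts_wrs_subset.1 (hW.empty_subset (union_subset_right hc))
        obtain ⟨F, hF⟩ := exists_forall₂ (P := fun p f =>
          Rews n.ord n.A (.rd (arr b) (idx p.1)) (el f)) fun p hp => hrews hb (hWc.2 p hp).1
        exact (hone (.orient a b V W F hL hp hV hW hF)).elim
    · exact ⟨a, _, .arr a b V hp⟩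
  · intro e d hL
    have hc := subset_constsOf hL
    simp only [Form.consts] at hc
    have he := union_subset_left hc (mem_consts_el e)
    have hd := union_subset_right hc (mem_consts_el d)
    by_cases hed : e = d
    · subst hed
      exact (hone (.removeRefl _ hL)).elim
    rcases prec_total hnd (hmo _ he) (hmo _ hd) hed with hp | hp
    · exact ⟨d, e, .elemSymm d e hp⟩
    · exact ⟨e, d, .elem e d hp⟩
  · have key : ∀ L1 ∈ n.A, ∀ L2 ∈ n.A, ∀ a r1 r2 b1 b2 W1 W2, LitRule n.ord L1 (arr a) r1 →
        LitRule n.ord L2 (arr a) r2 → r1 ≠ r2 → NF n.ord n.A r1 (wrs (arr b1) W1) →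
        NF n.ord n.A r2 (wrs (arr b2) W2) → ¬ Prec n.ord .array b2 b1 ∧ b1 ≠ b2 := by
      intro L1 hL1 L2 hL2 a r1 r2 b1 b2 W1 W2 hr1 hr2 hne hn1 hn2
      have htwo : ∀ {add}, Compl n.ord n.A {L1, L2} add → False := by
        intro add hc
        refine h.not_compl hn shared shared' hc ?_
        by_cases ha : (arr a).consts ⊆ n.common
        · refine .inl ?_
          simp only [mem_insert, mem_singleton, forall_eq_or_imp, forall_eq]
          exact ⟨shared.consts_subset hn hL1 hr1 ha, shared.consts_subset hn hL2 hr2 ha⟩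
        · refine .inr ?_
          simp only [mem_insert, mem_singleton, forall_eq_or_imp, forall_eq]
          exact ⟨fun h => ha (hr1.consts_subset.1.trans h),
            fun h => ha (hr2.consts_subset.1.trans h)⟩
      have c1 := consts_wrs_subset.1 (hn1.1.subset_of_subset (hLc hL1 hr1).2)
      have c2 := consts_wrs_subset.1 (hn2.1.subset_of_subset (hLc hL2 hr2).2)
      have hb1 := c1.1 (mem_consts_arr b1)
      have hb2 := c2.1 (mem_consts_arr b2)
      refine ⟨fun hb => ?_, ?_⟩
      · obtain ⟨F, hF⟩ := exists_forall₂ (P := fun p f =>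
          Rews n.ord n.A (.rd (arr b1) (idx p.1)) (el f)) fun p hp => hrews hb1 (c1.2 p hp).1
        obtain ⟨U, hU⟩ := exists_NF_wrs hnd b2 (W2 ++ (W1.map Prod.fst).zip F)
        obtain ⟨G, hG⟩ := exists_forall₂ (P := fun p g =>
          NF n.ord n.A (.rd (wrs (arr b2) W2) (idx p.1)) (el g)) fun p hp => hnfrd hb2 (c1.2 p hp).1
        exact htwo (.gaussSymmTrans L1 L2 a b1 b2 r1 r2 W1 W2 U F G hL1 hr1 hL2 hr2 hne hn1 hn2 hb
          hF hU hG)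
      · rintro rfl
        exact htwo (.gaussConfl L1 L2 a b1 r1 r2 W1 W2 hL1 hr1 hL2 hr2 hne hn1 hn2)
    intro L1 hL1 L2 hL2 a r1 r2 hr1 hr2
    by_contra hne
    obtain ⟨u1, hn1⟩ := exists_NF hnd n.A r1
    obtain ⟨u2, hn2⟩ := exists_NF hnd n.A r2
    obtain ⟨b, V, rfl, -⟩ := litRule_arr.1 hr1
    obtain ⟨b', V', rfl, -⟩ := litRule_arr.1 hr2
    obtain ⟨b1, W1, rfl⟩ := hn1.1.wrs_shape
    obtain ⟨b2, W2, rfl⟩ := hn2.1.wrs_shape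
    obtain ⟨k1, k2⟩ := key _ hL1 _ hL2 _ _ _ _ _ _ _ hr1 hr2 hne hn1 hn2
    obtain ⟨k3, -⟩ := key _ hL2 _ hL1 _ _ _ _ _ _ _ hr2 hr1 (Ne.symm hne) hn2 hn1
    have hb1 := (consts_wrs_subset.1 (hn1.1.subset_of_subset (hLc hL1 hr1).2)).1 (mem_consts_arr b1)
    have hb2 := (consts_wrs_subset.1 (hn2.1.subset_of_subset (hLc hL2 hr2).2)).1 (mem_consts_arr b2)
    exact (prec_total hnd (hmo _ hb1) (hmo _ hb2) k2).elim k3 k1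
  · rintro a i e hL ⟨L2, hL2, r, hr⟩
    have hi : (Srt.index, i) ∈ constsOf n.A := subset_constsOf hL (by
      simp [Form.consts, Term.consts])
    obtain ⟨b, V, rfl, -⟩ := litRule_arr.1 hr
    obtain ⟨d, hd⟩ := hnfrd (W := V) ((consts_wrs_subset.1 (hLc hL2 hr).2).1 (mem_consts_arr b)) hi
    obtain ⟨e', he'⟩ := hnfel e
    exact hone (.critReadWrite _ L2 a i e d e' _ hL (.rd a i e) hL2 hr hd he')
  · intro a i e d hL hL'
    by_contra hed
    obtain ⟨e', he'⟩ := hnfel e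
    obtain ⟨d', hd'⟩ := hnfel d
    exact hone (.critRead _ _ a i e d e' d' hL (.rd a i e) hL' (.rd a i d) hed he' hd')
  · intro L1 hL1 L2 hL2 c e d hr1 hr2
    by_contra hed
    obtain ⟨e', he'⟩ := hnfel e
    obtain ⟨d', hd'⟩ := hnfel d
    exact hone (.critElem _ _ c e d e' d' hL1 hr1 hL2 hr2 hed he' hd')
  · intro L hL a b V hr p hp hj
    obtain ⟨U, U', rfl⟩ := List.append_of_mem hp
    refine hone (.redundantWrite L a b _ U U' p hL hr ⟨.refl, fun v hv => ?_⟩ hj)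
    exact irr L hL _ _ hr v (hv.mono (List.Sublist.refl _) (empty_subset _))
  · intro a b i hL hab hj
    have hc := subset_constsOf hL
    simp only [Form.consts, Term.consts, union_subset_iff, singleton_subset_iff] at hc
    rcases prec_total hnd (hmo _ hc.1.1) (hmo _ hc.1.2) hab with hp | hp
    · exact hone (.diffJoinSymm a b i hL hj hp)
    · exact hone (.diffJoin a b i hL hj hp)

/-! # The model of a saturated set of flat literals -/

/-- The literals in `A` are saturated with respect to rewriting with `U`. -/
structure Saturated (ord : List Const) (A U : Finset Form) : Prop where
  flat : ∀ L ∈ A, Flat L ∧ ∀ a b, L ≠ .neg (.eq (arr a) (arr b))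
  noEq : ∀ i j, Form.eq (idx i) (idx j) ∉ A
  noClash : ∀ i, Form.neg (.eq (idx i) (idx i)) ∉ A
  neElem : ∀ e d, Form.neg (.eq (el e) (el d)) ∈ A → ¬ Joinable ord U (el e) (el d)
  oriented : ∀ a b V, Form.eq (arr a) (wrs (arr b) V) ∈ A →
    ∃ x r, LitRule ord (.eq (arr a) (wrs (arr b) V)) (arr x) r
  orientedEl : ∀ e d, Form.eq (el e) (el d) ∈ A →
    ∃ x y, LitRule ord (.eq (el e) (el d)) (el x) (el y)
  array : ∀ L1 ∈ A, ∀ L2 ∈ U, ∀ a r1 r2, LitRule ord L1 (arr a) r1 →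
    LitRule ord L2 (arr a) r2 → r1 = r2
  readWrite : ∀ a i e, Form.eq (.rd (arr a) (idx i)) (el e) ∈ A → ¬ Red ord U a
  read : ∀ a i e d, Form.eq (.rd (arr a) (idx i)) (el e) ∈ A →
    Form.eq (.rd (arr a) (idx i)) (el d) ∈ U → e = d
  elem : ∀ L1 ∈ A, ∀ L2 ∈ U, ∀ c e d, LitRule ord L1 (el c) (el e) →
    LitRule ord L2 (el c) (el d) → e = d
  irr : ∀ L ∈ A, ∀ {s : Srt} (l r : Term s), LitRule ord L l r → ∀ u, ¬ Rew ord U r u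
  write : ∀ L ∈ A, ∀ a b V, LitRule ord L (arr a) (wrs (arr b) V) → ∀ p ∈ V,
    ¬ Joinable ord U (.rd (arr b) (idx p.1)) (el p.2) ∧
      ∃ e, Rews ord U (.rd (arr b) (idx p.1)) (el e)
  diffJoin : ∀ a b i, Form.eq (.diff (arr a) (arr b)) (idx i) ∈ A → a ≠ b →
    ¬ Joinable ord U (.rd (arr a) (idx i)) (.rd (arr b) (idx i))
  diffReach : ∀ a b i, Form.eq (.diff (arr a) (arr b)) (idx i) ∈ A →
    (∃ e, Rews ord U (.rd (arr a) (idx i)) (el e)) ∧ ∃ e, Rews ord U (.rd (arr b) (idx i)) (el e)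
  diffFun : ∀ a b i a' b' i', Form.eq (.diff (arr a) (arr b)) (idx i) ∈ A →
    Form.eq (.diff (arr a') (arr b')) (idx i') ∈ U → Joinable ord U (arr a) (arr a') →
    Joinable ord U (arr b) (arr b') → i = i'

theorem foldl_update_of_notMem {α β γ : Type*} [DecidableEq α] (k : γ → α) (v : γ → β) (x : α)
    (V : List γ) (f : α → β) (h : ∀ p ∈ V, k p ≠ x) :
    V.foldl (fun f p => Function.update f (k p) (v p)) f x = f x := by
  induction V generalizing f with
  | nil => rfl
  | cons p V ih =>
    rw [List.foldl_cons, ih _ fun q hq => h q (List.mem_cons_of_mem _ hq),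
      Function.update_of_ne (h p List.mem_cons_self).symm]

theorem foldl_update_of_mem {α β γ : Type*} [DecidableEq α] (k : γ → α) (v : γ → β) (V : List γ)
    (f : α → β) (hV : (V.map k).Nodup) {p : γ} (hp : p ∈ V) :
    V.foldl (fun f p => Function.update f (k p) (v p)) f (k p) = v p := by
  induction V generalizing f with
  | nil => simp at hp
  | cons q V ih =>
    rw [List.map_cons, List.nodup_cons] at hV
    rw [List.foldl_cons]
    rcases List.mem_cons.1 hp with rfl | hp
    · rw [foldl_update_of_notMem, Function.update_self]
      exact fun r hr e => hV.1 (e ▸ List.mem_map_of_mem hr)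
    · exact ih _ hV.2 hp

section Model

variable (ord : List Const) (U : Finset Form)

open Classical in
noncomputable def elVal (e : ℕ) : ℕ :=
  if h : ∃ d, Rew ord U (el e) (el d) then h.choose else e

open Classical in
noncomputable def arrNf (a : ℕ) : ℕ × List (ℕ × ℕ) :=
  if h : ∃ q : ℕ × List (ℕ × ℕ), Rew ord U (arr a) (wrs (arr q.1) q.2) then h.choose else (a, [])

open Classical in
/-- The value of an irreducible array constant. The values `inr b` keep different irreducible
constants apart. -/
noncomputable def baseVal (b : ℕ) : Option ℕ → ℕ ⊕ ℕ
  | none => .inr b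
  | some i => if h : ∃ e, Form.eq (.rd (arr b) (idx i)) (el e) ∈ U then
      .inl (elVal ord U h.choose) else .inr b

noncomputable def updVal (V : List (ℕ × ℕ)) (f : Option ℕ → ℕ ⊕ ℕ) : Option ℕ → ℕ ⊕ ℕ :=
  V.foldl (fun f p => Function.update f (some p.1) (.inl (elVal ord U p.2))) f

noncomputable def arrVal (a : ℕ) : Option ℕ → ℕ ⊕ ℕ :=
  updVal ord U (arrNf ord U a).2 (baseVal ord U (arrNf ord U a).1)

/-- `i` is the value of a literal for `diff(x, y)` that does not contradict the axiom on `diff`. -/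
def DiffVal (x y : Option ℕ → ℕ ⊕ ℕ) (i : Option ℕ) : Prop :=
  (x ≠ y → x i ≠ y i) ∧ ∃ a b j, i = some j ∧ Form.eq (.diff (arr a) (arr b)) (idx j) ∈ U ∧
    x = arrVal ord U a ∧ y = arrVal ord U b

open Classical in
noncomputable def diffVal (x y : Option ℕ → ℕ ⊕ ℕ) : Option ℕ :=
  if h : ∃ i, DiffVal ord U x y i then h.choose
  else if h : ∃ i, x i ≠ y i then h.choose else none

noncomputable def satModel : Model where
  carrier
    | .array => Option ℕ → ℕ ⊕ ℕ
    | .index => Option ℕ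
    | .elem => ℕ ⊕ ℕ
  rd f i := f i
  wr f i e := Function.update f i e
  diff := diffVal ord U
  const
    | .array => arrVal ord U
    | .index => some
    | .elem => fun e => .inl (elVal ord U e)
  rd_wr_same _ _ _ := Function.update_self ..
  rd_wr_other _ _ _ _ h := Function.update_of_ne h.symm ..
  rd_diff x y h := by
    unfold diffVal
    split_ifs with h1 h2
    · exact h1.choose_spec.1 h
    · exact h2.choose_spec
    · exact (h (funext fun i => not_not.1 fun hi => h2 ⟨i, hi⟩)).elim

variable {ord U}

theorem updVal_snoc (V : List (ℕ × ℕ)) (p : ℕ × ℕ) (f : Option ℕ → ℕ ⊕ ℕ) :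
    updVal ord U (V ++ [p]) f =
      Function.update (updVal ord U V f) (some p.1) (.inl (elVal ord U p.2)) := by
  simp [updVal]

theorem eval_wrs_satModel (x : Term .array) (V : List (ℕ × ℕ)) :
    (satModel ord U).eval (wrs x V) = updVal ord U V ((satModel ord U).eval x) := by
  induction V using List.reverseRecOn with
  | nil => rfl
  | append_singleton V p ih =>
    rw [wrs_snoc]
    change Function.update ((satModel ord U).eval (wrs x V)) _ _ = _
    rw [ih]
    exact (updVal_snoc V p _).symm

theorem satModel_inj (S : Finset Const) : (satModel ord U).Inj S :=
  fun _ _ _ _ h => Option.some.inj h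

theorem irreducible_of_wrs {b : ℕ} (h : ∀ u, ¬ Rew ord A (wrs (arr b) V) u) :
    ¬ Red ord A b ∧ ∀ p ∈ V, ∀ u, ¬ Rew ord A (el p.2) u := by
  refine ⟨fun ⟨L, hL, r, hr⟩ => h _ ((Rew.ground L hL hr).wrs V), fun p hp u hu => ?_⟩
  obtain ⟨V1, V2, rfl⟩ := List.append_of_mem hp
  rw [wrs_append] at h
  exact h _ ((Rew.wr₃ (wrs (arr b) V1) (idx p.1) hu).wrs V2)

theorem elVal_of_irreducible {e : ℕ} (h : ∀ u, ¬ Rew ord U (el e) u) : elVal ord U e = e :=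
  dif_neg fun ⟨_, hd⟩ => h _ hd

theorem arrNf_of_irreducible {a : ℕ} (h : ¬ Red ord U a) : arrNf ord U a = (a, []) := by
  refine dif_neg fun ⟨_, hq⟩ => h ?_
  obtain ⟨L, hL, hr⟩ := rew_arr.1 hq
  exact ⟨L, hL, _, hr⟩

theorem arrVal_of_irreducible {a : ℕ} (h : ¬ Red ord U a) : arrVal ord U a = baseVal ord U a := by
  rw [arrVal, arrNf_of_irreducible h]
  rfl

namespace Saturated

variable (h : Saturated ord U U)
include h

theorem elVal_of_rule (hL : L ∈ U) {e d : ℕ} (hr : LitRule ord L (el e) (el d)) :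
    elVal ord U e = d ∧ elVal ord U d = d := by
  have hx : ∃ d, Rew ord U (el e) (el d) := ⟨d, .ground L hL hr⟩
  refine ⟨?_, elVal_of_irreducible (h.irr L hL _ _ hr)⟩
  obtain ⟨L', hL', hr'⟩ := rew_el.1 hx.choose_spec
  rw [elVal, dif_pos hx]
  exact h.elem _ hL' _ hL _ _ _ hr' hr

theorem rews_elVal (e : ℕ) :
    Rews ord U (el e) (el (elVal ord U e)) ∧ ∀ u, ¬ Rew ord U (el (elVal ord U e)) u := by
  by_cases he : ∃ u, Rew ord U (el e) u
  · obtain ⟨u, hu⟩ := he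
    obtain ⟨L, hL, hr⟩ := rew_el.1 hu
    obtain ⟨d, rfl, -⟩ := litRule_elem.1 hr
    rw [(h.elVal_of_rule hL hr).1]
    exact ⟨.single hu, h.irr L hL _ _ hr⟩
  · rw [not_exists] at he
    rw [elVal_of_irreducible he]
    exact ⟨.refl, he⟩

theorem arrNf_of_rule (hL : L ∈ U) {a b : ℕ} (hr : LitRule ord L (arr a) (wrs (arr b) V)) : arrNf ord U a = (b, V) := by
  have hx : ∃ q : ℕ × List (ℕ × ℕ), Rew ord U (arr a) (wrs (arr q.1) q.2) :=
    ⟨(b, V), .ground L hL hr⟩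
  obtain ⟨L', hL', hr'⟩ := rew_arr.1 hx.choose_spec
  rw [arrNf, dif_pos hx]
  exact Prod.ext_iff.2 (wrs_inj.1 (h.array _ hL' _ hL _ _ _ hr' hr))

theorem baseVal_of_mem {a i e : ℕ} (hL : Form.eq (.rd (arr a) (idx i)) (el e) ∈ U) :
    baseVal ord U a (some i) = .inl (elVal ord U e) := by
  have hx : ∃ e, Form.eq (.rd (arr a) (idx i)) (el e) ∈ U := ⟨e, hL⟩
  rw [baseVal, dif_pos hx, h.read _ _ _ _ hx.choose_spec hL]

theorem holds_of_litRule (hL : L ∈ U) (hr : LitRule ord L l r) : (satModel ord U).Holds L := by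
  rw [hr.holds_iff]
  have key : ∀ a b V, LitRule ord L (arr a) (wrs (arr b) V) →
      (satModel ord U).eval (arr a) = (satModel ord U).eval (wrs (arr b) V) := by
    intro a b V hr
    rw [eval_wrs_satModel]
    change arrVal ord U a = updVal ord U V (arrVal ord U b)
    rw [arrVal, h.arrNf_of_rule hL hr,
      arrVal_of_irreducible (irreducible_of_wrs (h.irr L hL _ _ hr)).1]
  have key' : ∀ e d, LitRule ord L (el e) (el d) →
      (satModel ord U).eval (el e) = (satModel ord U).eval (el d) := by
    intro e d hr
    obtain ⟨h1, h2⟩ := h.elVal_of_rule hL hr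
    exact congrArg Sum.inl (h1.trans h2.symm)
  cases hr with
  | arr a b W hp => exact key a b W (.arr a b W hp)
  | arrSymm a b hp => exact key a b [] (.arrSymm a b hp)
  | rd a i e =>
    change arrVal ord U a (some i) = _
    rw [arrVal_of_irreducible (h.readWrite _ _ _ hL), h.baseVal_of_mem hL]
    rfl
  | elem e d hp => exact key' e d (.elem e d hp)
  | elemSymm e d hp => exact key' e d (.elemSymm e d hp)

variable (hn : ord.Nodup)
include hn

theorem eval_eq_of_rews (hr : Rews ord U t u) :
    (satModel ord U).eval t = (satModel ord U).eval u :=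
  hr.sound hn (satModel_inj (t.consts ∪ constsOf U)) subset_union_left
    subset_union_right fun _ hL _ _ _ hr _ => h.holds_of_litRule hL hr

/-- Reads that reduce to constants and have the same value are joinable. -/
theorem joinable_of_eval_eq {t u : Term .elem} {e d : ℕ} (ht : Rews ord U t (el e))
    (hu : Rews ord U u (el d)) (he : (satModel ord U).eval t = (satModel ord U).eval u) :
    Joinable ord U t u := by
  rw [h.eval_eq_of_rews hn ht, h.eval_eq_of_rews hn hu] at he
  have : elVal ord U e = elVal ord U d := Sum.inl.inj he
  exact ⟨_, ht.trans (h.rews_elVal e).1, this ▸ hu.trans (h.rews_elVal d).1⟩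

variable (hS : ∀ c ∈ constsOf U, c ∈ ord)
include hS

theorem arrNf_spec (a : ℕ) :
    Rews ord U (arr a) (wrs (arr (arrNf ord U a).1) (arrNf ord U a).2) ∧
      ((arrNf ord U a).2.map Prod.fst).Pairwise (Prec ord .index) ∧
      ∀ p ∈ (arrNf ord U a).2, elVal ord U p.2 = p.2 ∧
        baseVal ord U (arrNf ord U a).1 (some p.1) ≠ .inl p.2 := by
  by_cases ha : Red ord U a
  · obtain ⟨L, hL, r, hr⟩ := ha
    obtain ⟨b, V, rfl, -⟩ := litRule_arr.1 hr
    rw [h.arrNf_of_rule hL hr]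
    have hi := h.irr L hL _ _ hr
    have hi' := irreducible_of_wrs hi
    refine ⟨.single (.ground L hL hr), sorted_of_irreducible hn (fun p hp => hS _ ?_) hi,
      fun p hp => ⟨elVal_of_irreducible (hi'.2 p hp), fun he => ?_⟩⟩
    · exact ((consts_wrs_subset.1 hr.consts_subset.2.1).2 p hp).1 |> subset_constsOf hL
    · obtain ⟨hj, e, hre⟩ := h.write L hL a b V hr p hp
      refine hj (h.joinable_of_eval_eq hn hre .refl ?_)
      change arrVal ord U b (some p.1) = .inl (elVal ord U p.2)
      rw [arrVal_of_irreducible hi'.1, he, elVal_of_irreducible (hi'.2 p hp)]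
  · rw [arrNf_of_irreducible ha]
    exact ⟨.refl, .nil, by simp⟩

theorem arrNf_eq_of_arrVal_eq {a a' : ℕ} (he : arrVal ord U a = arrVal ord U a') :
    arrNf ord U a = arrNf ord U a' := by
  have hsub : ∀ {b V V'}, (V.map Prod.fst).Nodup → (V'.map Prod.fst).Nodup →
      (∀ p ∈ V, elVal ord U p.2 = p.2 ∧ baseVal ord U b (some p.1) ≠ .inl p.2) →
      (∀ p ∈ V', elVal ord U p.2 = p.2 ∧ baseVal ord U b (some p.1) ≠ .inl p.2) →
      updVal ord U V (baseVal ord U b) = updVal ord U V' (baseVal ord U b) → V ⊆ V' := by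
    intro b V V' hV hV' h1 h2 he p hp
    have hnd : ∀ {V : List (ℕ × ℕ)}, (V.map Prod.fst).Nodup →
        (V.map fun p => some p.1).Nodup := fun hV => by
      have := hV.map (Option.some_injective _)
      rwa [List.map_map] at this
    have e1 : updVal ord U V' (baseVal ord U b) (some p.1) = .inl p.2 := by
      rw [← he, updVal, foldl_update_of_mem (fun p : ℕ × ℕ => some p.1) _ V _ (hnd hV) hp,
        (h1 p hp).1]
    by_cases hk : ∃ q ∈ V', some q.1 = some p.1
    · obtain ⟨q, hq, hqp⟩ := hk
      rw [← hqp, updVal, foldl_update_of_mem (fun p : ℕ × ℕ => some p.1) _ V' _ (hnd hV') hq,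
        (h2 q hq).1] at e1
      rwa [← Prod.ext (Option.some.inj hqp) (Sum.inl.inj e1)]
    · rw [updVal, foldl_update_of_notMem (fun p : ℕ × ℕ => some p.1) _ _ V' _
        fun q hq hqp => hk ⟨q, hq, hqp⟩] at e1
      exact ((h1 p hp).2 e1).elim
  obtain ⟨-, s1, q1⟩ := h.arrNf_spec hn hS a
  obtain ⟨-, s2, q2⟩ := h.arrNf_spec hn hS a'
  unfold arrVal at he
  generalize arrNf ord U a = x at *
  generalize arrNf ord U a' = y at *
  obtain ⟨b, V⟩ := x
  obtain ⟨b', V'⟩ := y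
  dsimp only at *
  have hb : b = b' := by
    have := congrFun he none
    rw [updVal, updVal, foldl_update_of_notMem (fun p : ℕ × ℕ => some p.1) _ _ V _ (by simp),
      foldl_update_of_notMem (fun p : ℕ × ℕ => some p.1) _ _ V' _ (by simp)] at this
    exact Sum.inr.inj this
  subst hb
  have n1 := nodup_of_pairwise_prec hn s1
  have n2 := nodup_of_pairwise_prec hn s2
  have hperm : V.Perm V' := (List.perm_ext_iff_of_nodup n1.of_map n2.of_map).2 fun p =>
    ⟨fun hp => hsub n1 n2 q1 q2 he hp, fun hp => hsub n2 n1 q2 q1 he.symm hp⟩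
  rw [List.pairwise_map] at s1 s2
  rw [hperm.eq_of_pairwise (fun p q _ _ h1 h2 => (h1.asymm hn h2).elim) s1 s2]

theorem joinable_of_arrVal_eq {a a' : ℕ} (he : arrVal ord U a = arrVal ord U a') :
    Joinable ord U (arr a) (arr a') := by
  refine ⟨_, (h.arrNf_spec hn hS a).1, ?_⟩
  rw [h.arrNf_eq_of_arrVal_eq hn hS he]
  exact (h.arrNf_spec hn hS a').1

theorem sat : Sat U := by
  refine ⟨satModel ord U, fun L hL => ?_⟩
  obtain ⟨hf, hne⟩ := h.flat L hL
  cases hf with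
  | wr a b V =>
    obtain ⟨x, r, hr⟩ := h.oriented a b V hL
    exact h.holds_of_litRule hL hr
  | rd a i e => exact h.holds_of_litRule hL (.rd a i e)
  | diff a b i =>
    have hD : DiffVal ord U (arrVal ord U a) (arrVal ord U b) (some i) := by
      refine ⟨fun hab he => ?_, a, b, i, rfl, hL, rfl, rfl⟩
      obtain ⟨⟨e, h1⟩, d, h2⟩ := h.diffReach a b i hL
      exact h.diffJoin a b i hL (fun e => hab (e ▸ rfl)) (h.joinable_of_eval_eq hn h1 h2 he)
    have hx : ∃ i, DiffVal ord U (arrVal ord U a) (arrVal ord U b) i := ⟨_, hD⟩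
    change diffVal ord U (arrVal ord U a) (arrVal ord U b) = some i
    rw [diffVal, dif_pos hx]
    obtain ⟨-, a', b', j, hj, hL', ha, hb⟩ := hx.choose_spec
    rw [hj, h.diffFun a b i a' b' j hL hL' (h.joinable_of_arrVal_eq hn hS ha)
      (h.joinable_of_arrVal_eq hn hS hb)]
  | idxEq i j => exact (h.noEq i j hL).elim
  | elemEq e d =>
    obtain ⟨x, y, hr⟩ := h.orientedEl e d hL
    exact h.holds_of_litRule hL hr
  | ne s m n =>
    intro he
    cases s with
    | array => exact hne m n rfl
    | index =>
      obtain rfl : m = n := Option.some.inj he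
      exact h.noClash m hL
    | elem => exact h.neElem m n hL (h.joinable_of_eval_eq hn .refl .refl he)

end Saturated

end Model

/-! # Satisfiability of open leaves -/

/-- Rewriting with both components agrees with rewriting with the first component on terms over
the signature of the first component. -/
theorem Leaf.sameRules (hn : n.Good) (h : Leaf n) (h' : Leaf n.swap) :
    SameRules n.ord (n.A ∪ n.B) n.A n.sigA := by
  have hS := h'.shared.sameRules h.shared hn.swap
  rw [common_swap] at hS
  have hcopy : ∀ L ∈ n.A ∪ n.B, L.consts ⊆ n.sigA → L ∈ n.A := fun L hL hc => by
    rcases mem_union.1 hL with hL | hL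
    · exact hL
    · exact hS.copy L hL (subset_inter hc ((subset_constsOf hL).trans hn.subB))
  have hleft : ∀ L ∈ n.A ∪ n.B, ∀ {s : Srt} (l r : Term s), LitRule n.ord L l r →
      l.consts ⊆ n.sigA → L ∈ n.A := fun L hL s l r hr hl => by
    rcases mem_union.1 hL with hL | hL
    · exact hL
    · exact hS.left L hL l r hr (subset_inter hl
        (hr.consts_subset.1.trans ((subset_constsOf hL).trans hn.subB)))
  exact ⟨fun L hL _ l r hr hl => hr.consts_subset.2.1.trans
    ((subset_constsOf (hleft L hL l r hr hl)).trans hn.subA), hleft,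
    fun L hL _ _ _ _ _ => mem_union_left _ hL, hcopy⟩

theorem Leaf.common_of_NF (h : Leaf n) {a : ℕ} {t : Term .array} (ht : NF n.ord n.A (arr a) t)
    (hc : t.consts ⊆ n.common) : (Srt.array, a) ∈ n.common := by
  rcases Relation.ReflTransGen.cases_head ht.1 with rfl | ⟨u, hu, hr⟩
  · exact hc (mem_consts_arr a)
  · obtain ⟨L, hL, hr'⟩ := rew_arr.1 hu
    rcases Relation.ReflTransGen.cases_head hr with rfl | ⟨v, hv, -⟩
    · exact h.shared.array L hL a u hr' hc
    · exact (h.irr L hL _ _ hr' v hv).elim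

theorem Leaf.saturated (hn : n.Good) (hph : n.phase = .completion) (h : Leaf n)
    (h' : Leaf n.swap) : Saturated n.ord n.A (n.A ∪ n.B) := by
  have H := h.sameRules hn h'
  have H' := h'.sameRules hn.swap h
  rw [show n.swap.A ∪ n.swap.B = n.A ∪ n.B from union_comm _ _] at H'
  have hc : ∀ {L}, L ∈ n.A → L.consts ⊆ n.sigA := fun hL =>
    (subset_constsOf hL).trans hn.subA
  have hcl : ∀ {L : Form} {s : Srt} {l r : Term s}, L ∈ n.A → LitRule n.ord L l r →
      l.consts ⊆ n.sigA ∧ r.consts ⊆ n.sigA := fun hL hr =>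
    ⟨hr.consts_subset.1.trans (hc hL), hr.consts_subset.2.1.trans (hc hL)⟩
  have hmono : ∀ {s : Srt} {t u : Term s}, Rews n.ord n.A t u → Rews n.ord (n.A ∪ n.B) t u :=
    fun h => h.mono (List.Sublist.refl _) subset_union_left
  have hloc : constsOf n.A ⊆ n.localA := subset_union_left
  have hreach : ∀ {a i}, (Srt.array, a) ∈ constsOf n.A → (Srt.index, i) ∈ constsOf n.A →
      ∃ e, Rews n.ord (n.A ∪ n.B) (.rd (arr a) (idx i)) (el e) := fun ha hi => by
    obtain ⟨e, he⟩ := reach_iff.1 (h.inv.reach _ _ (hloc ha) (hloc hi))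
    exact ⟨e, hmono he⟩
  have hok : ∀ L ∈ n.A, Flat L ∧ ∀ a b, L ≠ .neg (.eq (arr a) (arr b)) := fun L hL => by
    have := hn.okA L hL
    rwa [hph] at this
  have hrd : ∀ {a i}, (Srt.array, a) ∈ n.sigA → (Srt.index, i) ∈ n.sigA →
      (Term.rd (arr a) (idx i)).consts ⊆ n.sigA := fun ha hi =>
    union_subset (singleton_subset_iff.2 ha) (singleton_subset_iff.2 hi)
  have hdiff : ∀ {a b i}, Form.eq (.diff (arr a) (arr b)) (idx i) ∈ n.A →
      ((Srt.array, a) ∈ constsOf n.A ∧ (Srt.array, b) ∈ constsOf n.A) ∧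
        (Srt.index, i) ∈ constsOf n.A := fun hL => by
    have := subset_constsOf hL
    simpa only [Form.consts, Term.consts, union_subset_iff,
      singleton_subset_iff] using this
  refine ⟨hok, h.inv.noEq, h.inv.noClash, ?_, h.oriented, h.orientedEl, ?_, ?_, ?_, ?_, ?_, ?_, ?_,
    ?_, ?_⟩
  · intro e d hL hj
    have := hc hL
    exact h.failure (.elem e d hL (H.joinable hj (union_subset_left this)
      (union_subset_right this)))
  · intro L1 hL1 L2 hL2 a r1 r2 hr1 hr2
    exact h.array L1 hL1 L2 (H.left L2 hL2 _ _ hr2 (hcl hL1 hr1).1) a r1 r2 hr1 hr2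
  · rintro a i e hL ⟨L2, hL2, r, hr⟩
    exact h.readWrite a i e hL ⟨L2, H.left L2 hL2 _ _ hr (union_subset_left
      (union_subset_left (hc hL))), r, hr⟩
  · intro a i e d hL hL'
    exact h.read a i e d hL (H.left _ hL' _ _ (.rd a i d) (union_subset_left (hc hL)))
  · intro L1 hL1 L2 hL2 c e d hr1 hr2
    exact h.elem L1 hL1 L2 (H.left L2 hL2 _ _ hr2 (hcl hL1 hr1).1) c e d hr1 hr2
  · intro L hL s l r hr u hu
    exact h.irr L hL l r hr u (hu.transfer H.left (hcl hL hr).2)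
  · intro L hL a b V hr p hp
    have hV := consts_wrs_subset.1 (hr.consts_subset.2.1.trans (subset_constsOf hL))
    have hb := hV.1 (mem_consts_arr b)
    obtain ⟨hi, he⟩ := hV.2 p hp
    exact ⟨fun hj => h.write L hL a b V hr p hp (H.joinable hj (hrd (hn.subA hb) (hn.subA hi))
      (singleton_subset_iff.2 (hn.subA he))), hreach hb hi⟩
  · intro a b i hL hab hj
    obtain ⟨⟨ha, hb⟩, hi⟩ := hdiff hL
    exact h.diffJoin a b i hL hab (H.joinable hj (hrd (hn.subA ha) (hn.subA hi))
      (hrd (hn.subA hb) (hn.subA hi)))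
  · intro a b i hL
    obtain ⟨⟨ha, hb⟩, hi⟩ := hdiff hL
    exact ⟨hreach ha hi, hreach hb hi⟩
  · intro a b i a' b' i' hL hL' hja hjb
    by_contra hii
    obtain ⟨⟨ha, hb⟩, hi⟩ := hdiff hL
    have hs : ∀ {x}, (Srt.array, x) ∈ n.sigA → (arr x).consts ⊆ n.sigA := fun hx =>
      singleton_subset_iff.2 hx
    have hs' : ∀ {x}, (Srt.array, x) ∈ n.sigB → (arr x).consts ⊆ n.sigB := fun hx =>
      singleton_subset_iff.2 hx
    by_cases hA : Form.eq (.diff (arr a') (arr b')) (idx i') ∈ n.A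
    · obtain ⟨⟨ha', hb'⟩, -⟩ := hdiff hA
      exact h.failure (.diff a b a' b' i i' hL hA
        (H.joinable hja (hs (hn.subA ha)) (hs (hn.subA ha')))
        (H.joinable hjb (hs (hn.subA hb)) (hs (hn.subA hb'))) hii)
    have hB := (mem_union.1 hL').resolve_left hA
    have hcB := (subset_constsOf hB).trans hn.subB
    simp only [Form.consts, Term.consts, union_subset_iff,
      singleton_subset_iff] at hcB
    have hcom : ∀ {x y}, Joinable n.ord (n.A ∪ n.B) (arr x) (arr y) → (Srt.array, x) ∈ n.sigA →
        (Srt.array, y) ∈ n.sigB → (Srt.array, x) ∈ n.common := by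
      rintro x y ⟨u, h1, h2⟩ hx hy
      obtain ⟨v, hv⟩ := exists_NF hn.nodup (n.A ∪ n.B) u
      obtain ⟨k1, k2⟩ := H.nf ⟨h1.trans hv.1, hv.2⟩ (hs hx)
      exact h.common_of_NF k1 (subset_inter k2 (H'.rews (h2.trans hv.1) (hs' hy)).2)
    have hca := hcom hja (hn.subA ha) hcB.1.1
    have hcb := hcom hjb (hn.subA hb) hcB.1.2
    have hci := h.shared.diff a b i hL hca hcb
    have hLB := h.shared.copy _ hL (by
      simpa only [Form.consts, Term.consts, union_subset_iff,
        singleton_subset_iff] using ⟨⟨hca, hcb⟩, hci⟩)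
    have hI := inter_subset_right (s₁ := n.sigA) (s₂ := n.sigB)
    exact h'.failure (.diff a b a' b' i i' hLB hB
      (H'.joinable hja (hs' (hI hca)) (hs' hcB.1.1))
      (H'.joinable hjb (hs' (hI hcb)) (hs' hcB.1.2)) hii)

theorem Saturated.union {A B U : Finset Form} (hA : Saturated ord A U) (hB : Saturated ord B U) : Saturated ord (A ∪ B) U := by
  have key : ∀ {P : Form → Prop}, (∀ L ∈ A, P L) → (∀ L ∈ B, P L) → ∀ L ∈ A ∪ B, P L :=
    fun h1 h2 L hL => (mem_union.1 hL).elim (h1 L) (h2 L)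
  exact
    { flat := key hA.flat hB.flat
      noEq i j hL := (mem_union.1 hL).elim (hA.noEq i j) (hB.noEq i j)
      noClash i hL := (mem_union.1 hL).elim (hA.noClash i) (hB.noClash i)
      neElem e d hL := (mem_union.1 hL).elim (hA.neElem e d) (hB.neElem e d)
      oriented a b V hL := (mem_union.1 hL).elim (hA.oriented a b V) (hB.oriented a b V)
      orientedEl e d hL := (mem_union.1 hL).elim (hA.orientedEl e d) (hB.orientedEl e d)
      array := key hA.array hB.array
      readWrite a i e hL := (mem_union.1 hL).elim (hA.readWrite a i e) (hB.readWrite a i e)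
      read a i e d hL := (mem_union.1 hL).elim (hA.read a i e d) (hB.read a i e d)
      elem := key hA.elem hB.elem
      irr L hL _ l r := (mem_union.1 hL).elim (hA.irr L · l r) (hB.irr L · l r)
      write := key hA.write hB.write
      diffJoin a b i hL := (mem_union.1 hL).elim (hA.diffJoin a b i) (hB.diffJoin a b i)
      diffReach a b i hL := (mem_union.1 hL).elim (hA.diffReach a b i) (hB.diffReach a b i)
      diffFun a b i a' b' i' hL := (mem_union.1 hL).elim (hA.diffFun a b i a' b' i')
        (hB.diffFun a b i a' b' i') }

theorem Exhausted.phase_eq (h : Exhausted Step n) (hc : ¬ n.Closed) :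
    n.phase = .completion := by
  have key : ∀ P next, ¬ ∀ cs, PhaseStep P next n cs → Step n cs := fun P next hP =>
    h _ (hP _ (.inr ⟨fun cs hcs => h cs (hP cs (.inl hcs)), rfl⟩))
  cases hph : n.phase with
  | flatten => exact (key FlattenA .arrayNe fun cs hcs => ⟨hc, by rw [hph]; exact hcs⟩).elim
  | arrayNe => exact (key ArrayNeA .guess fun cs hcs => ⟨hc, by rw [hph]; exact hcs⟩).elim
  | guess => exact (key GuessA .reads fun cs hcs => ⟨hc, by rw [hph]; exact hcs⟩).elim
  | reads => exact (key ReadA .completion fun cs hcs => ⟨hc, by rw [hph]; exact hcs⟩).elim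
  | completion => rfl

/-- An open node to which no instruction applies is satisfiable. -/
theorem Node.Good.satP (hn : n.Good) (h : Exhausted Step n) (hc : ¬ n.Closed) :
    SatP n.toM := by
  have hph := h.phase_eq hc
  have hC : ∀ cs, ¬ CompletionStep n cs := fun cs hcs => h cs ⟨hc, by rw [hph]; exact hcs⟩
  have hI : Exhausted (Sym InvA) n := fun cs hcs => hC cs (.inl hcs)
  have hS : Exhausted (Sym CopyOrUndesiredA) n := fun cs hcs => hC cs (.inr ⟨hI, .inl hcs⟩)
  have hA : Exhausted (Sym ComplA) n := fun cs hcs => hC cs (.inr ⟨hI, .inr ⟨hS, hcs⟩⟩)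
  have hl := hn.leaf hI hS hA
  have hl' := hn.swap.leaf hI.swap hS.swap hA.swap
  have hs' := hl'.saturated hn.swap hph hl
  rw [show n.swap.A ∪ n.swap.B = n.A ∪ n.B from union_comm _ _] at hs'
  obtain ⟨M, hM⟩ := ((hl.saturated hn hph hl').union hs').sat hn.nodup fun c hc => by
    rw [constsOf_union] at hc
    exact (mem_union.1 hc).elim (hn.mem_ord_of_mem c) (hn.swap.mem_ord_of_mem c)
  exact ⟨M, Model.holds_union.1 hM⟩

/-! # Nodes of interpolating trees -/

theorem Step.ne_nil (h : Step n cs) : cs ≠ [] := by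
  have hs : ∀ {P : Node → List Node → Prop}, (∀ {n cs}, P n cs → cs ≠ []) → Sym P n cs →
      cs ≠ [] := by
    rintro P hP (h' | ⟨ds, h', rfl⟩)
    · exact hP h'
    · exact fun e => hP h' (List.map_eq_nil_iff.1 e)
  have hp : ∀ {P next}, (∀ {n cs}, P n cs → cs ≠ []) → PhaseStep P next n cs → cs ≠ [] := by
    rintro P next hP (h | ⟨-, rfl⟩)
    · exact hs hP h
    · exact List.cons_ne_nil _ _
  have hg : ∀ {n cs}, GuessA n cs → cs ≠ [] := fun h => by cases h <;> exact List.cons_ne_nil _ _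
  obtain ⟨-, h⟩ := h
  cases hph : n.phase <;> rw [hph] at h
  · exact hp (fun h => by cases h; exact List.cons_ne_nil _ _) h
  · exact hp (fun h => by cases h; exact List.cons_ne_nil _ _) h
  · exact hp hg h
  · exact hp (fun h => by cases h; exact List.cons_ne_nil _ _) h
  · rcases h with h | ⟨-, h | ⟨-, h⟩⟩
    · refine hs ?_ h
      rintro n cs (h | h)
      · exact hg h
      · cases h; exact List.cons_ne_nil _ _
    · refine hs ?_ h
      rintro n cs (h | h) <;> cases h <;> exact List.cons_ne_nil _ _
    · exact hs (fun h => by cases h <;> exact List.cons_ne_nil _ _) h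

/-- Every node of an interpolating tree is closed or satisfies the invariants, and models of a node
give models of the root. -/
theorem IsInterpolatingTree.closed_or_good {n₀ : Node} {T : Tree} (hT : IsInterpolatingTree n₀ T)
    (h₀ : n₀.Good) (p : List ℕ) : ∀ n, T p = some n →
      (n.Closed ∨ n.Good) ∧ (SatP n.toM → SatP n₀.toM) := by
  induction p using List.reverseRecOn with
  | nil =>
    intro n hn
    rw [hT.1] at hn
    cases hn
    exact ⟨.inr h₀, id⟩
  | append_singleton p k ih =>
    intro c hc
    cases hm : T p with
    | none => simp [hT.2.1 p k hm] at hc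
    | some m =>
      obtain ⟨hm1, hm2⟩ := ih m hm
      rcases hT.2.2 p m hm with ⟨cs, hs, hk⟩ | ⟨-, hk⟩
      · rw [hk k] at hc
        have hc := List.mem_of_getElem? hc
        obtain ⟨h1, h2⟩ := (hm1.resolve_left hs.1).step hs
        exact ⟨h2 c hc, fun h => hm2 (h1.sat c hc h)⟩
      · simp [hk k] at hc

theorem IsInterpolatingTree.isRefutation {n₀ : Node} {T : Tree} (hT : IsInterpolatingTree n₀ T)
    (h₀ : n₀.Good) (hf : T.Finite) (h : ¬ SatP n₀.toM) : IsRefutation T := by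
  refine ⟨hf, fun p n hp hs => ?_, fun p n cs hp hs hcs => ?_⟩
  · by_contra hc
    obtain ⟨h1, h2⟩ := hT.closed_or_good h₀ p n hp
    have hn := h1.resolve_left hc
    rcases hT.2.2 p n hp with ⟨cs, hcs, hs'⟩ | ⟨hex, -⟩
    · obtain rfl := hs'.unique hs
      exact (hcs.ne_nil rfl).elim
    · exact h (h2 (hn.satP hex hc))
  · rcases hT.2.2 p n hp with ⟨ds, hds, hs'⟩ | ⟨-, hs'⟩
    · obtain rfl := hs.unique hs'
      exact (((hT.closed_or_good h₀ p n hp).1.resolve_left hds.1).step hds).1.nonempty_deriv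
    · exact (hcs (hs.unique hs')).elim

end AXdiff

theorem theorem6p1 (A B : Finset AXdiff.Form)
    (hA : AXdiff.IsConstraint A) (hB : AXdiff.IsConstraint B)
    (ord : List AXdiff.Const)
    (hord : AXdiff.Admissible (AXdiff.constsOf A) (AXdiff.constsOf B) ord) :
    (∃ T, AXdiff.IsInterpolatingTree (AXdiff.root A B ord) T) ∧
    ∀ T, AXdiff.IsInterpolatingTree (AXdiff.root A B ord) T →
      T.Finite ∧
      (AXdiff.IsRefutation T ↔ ¬ AXdiff.Sat (A ∪ B)) ∧
      (AXdiff.IsRefutation T →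
        ∃ R, AXdiff.Expansion T [] (AXdiff.root A B ord).toM R) ∧
      ∀ R, AXdiff.Expansion T [] (AXdiff.root A B ord).toM R →
        AXdiff.IsInterpolant A B R.interpolant := by
  have h₀ := AXdiff.root_good hA hB hord
  refine ⟨AXdiff.exists_isInterpolatingTree _, fun T hT => ?_⟩
  have hacc := h₀.acc
  have hfin : T.Finite := AXdiff.finite_above_of_acc hT hacc [] hT.1
  have hexp : AXdiff.IsRefutation T →
      ∃ R, AXdiff.Expansion T [] (AXdiff.root A B ord).toM R := fun hR =>
    AXdiff.exists_expansion hT hR hacc [] hT.1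
  refine ⟨hfin, ⟨fun hR => ?_, fun hsat => ?_⟩, hexp, fun R _ =>
    AXdiff.isInterpolant_of_refutation R⟩
  · rintro ⟨M, hM⟩
    obtain ⟨R, -⟩ := hexp hR
    obtain ⟨-, h1, h2⟩ := AXdiff.isInterpolant_of_refutation R
    obtain ⟨hMA, hMB⟩ := AXdiff.Model.holds_union.1 hM
    exact h2 ⟨M, AXdiff.Model.holds_insert.2 ⟨h1 M hMA, hMB⟩⟩
  · refine hT.isRefutation h₀ hfin fun ⟨M, hMA, hMB⟩ => hsat ⟨M, ?_⟩
    exact AXdiff.Model.holds_union.2 ⟨hMA, hMB⟩
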